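/- **Definitions.** A *logical circuit* on a set $X$ of $n$ variables is a finite directed acyclic graph with a root from which every gate is reachable; its leaves are literals $x$ or $\neg x$ ($x\in X$), its other gates are $\oplus$-gates (disjunctions) and $\otimes$-gates (conjunctions); an $\oplus$-gate without children is false, a $\otimes$-gate without children is true. Its *size* is its number of edges. For a gate $p$, $vars_p$ is the set of variables that appear at or below $p$. A circuit is *decomposable* if distinct children of a $\otimes$-gate have disjoint sets $vars$; *smooth* if all children of an $\oplus$-gate have the same set $vars$; *deterministic* if under every input at most one child of each $\oplus$-gate evaluates to true. Two circuits on $X$ are *equivalent* if they evaluate to the same output on every input. A *vtree* on $X$ is a full binary tree whose leaves are in one-to-one correspondence with $X$. A circuit *respects* a vtree $V$ if each $\otimes$-gate has $0$ or $2$ children and there is a map $\rho$ from the gates to the nodes of $V$ such that: a literal of $x$ is mapped to the leaf of $x$; if $c$ is a child of an $\oplus$-gate $p$, then $\rho(c)$ is $\rho(p)$ or a descendant of it; and the children of a $\otimes$-gate $p$ with two children can be named $c_1,c_2$ so that $\rho(p)$ is an internal node with left and right children $v_l,v_r$, $\rho(c_1)$ is $v_l$ or a descendant of $v_l$, and $\rho(c_2)$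 is $v_r$ or a descendant of $v_r$. A circuit is *structured decomposable* if it respects some vtree. The inverse Ackermann function is Tarjan's: $A(0,x)=2x$, and for $i\ge 1$, $A(i,0)=0$, $A(i,1)=2$, $A(i,x)=A(i-1,A(i,x-1))$ for $x\ge 2$; $\alpha(m,n)=\min\{i\ge 1 : A(i,4\lceil m/n\rceil)>\log_2 n\}$. **Theorem 2.** There is an algorithm that, given a structured decomposable circuit $g$ of size $m$ on $n\le m$ variables together with a vtree that $g$ respects (the map $\rho$ is not given), outputs a smooth and decomposable circuit that is equivalent to $g$, and that is moreover deterministic if $g$ is deterministic. It runs in time $O(m\cdot\alpha(m,n))$ on a word RAM (unit-cost arithmetic and indirect addressing on words of $O(\log m)$ bits); circuits are given and returned as adjacency lists of their gates, and vtrees are given by child pointers. -/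

import Mathlib

/-! ### Logical circuits -/

/-- A gate of a circuit on the variables `Fin n` whose gates are numbered by `Fin N`: a literal
(`lit x true` is `x`, `lit x false` is its negation), an `⊕`-gate or a `⊗`-gate with its children. -/
inductive Gate (n N : ℕ) where
  | lit (x : Fin n) (b : Bool)
  | or (cs : List (Fin N))
  | and (cs : List (Fin N))

/-- The children of a gate. -/
def Gate.children {n N : ℕ} : Gate n N → List (Fin N)
  | .lit _ _ => []
  | .or cs => cs
  | .and cs => cs

/-- A logical circuit on the `n` variables `Fin n`: a finite directed acyclic graph, its gates
numbered in an arbitrary order, all of them reachable from the root. -/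
structure Circuit (n : ℕ) where
  /-- the number of gates -/
  N : ℕ
  gate : Fin N → Gate n N
  root : Fin N
  nodup : ∀ i, (gate i).children.Nodup
  /-- There is no directed cycle (the set of gates is finite). -/
  acyclic : WellFounded fun c p : Fin N => c ∈ (gate p).children
  rooted : ∀ i, Relation.ReflTransGen (fun p c : Fin N => c ∈ (gate p).children) root i

namespace Circuit

variable {n : ℕ}

/-- The size of a circuit is its number of edges. -/
def size (C : Circuit n) : ℕ := ∑ i, (C.gate i).children.length

/-- `C.Below p q`: the gate `q` is at or below the gate `p`. -/
def Below (C : Circuit n) (p q : Fin C.N) : Prop :=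
  Relation.ReflTransGen (fun p c : Fin C.N => c ∈ (C.gate p).children) p q

/-- The variables that appear at or below a gate. -/
def vars (C : Circuit n) (p : Fin C.N) : Set (Fin n) :=
  {x | ∃ q b, C.Below p q ∧ C.gate q = .lit x b}

/-- `C.Sat a p`: the gate `p` evaluates to true on the input `a`. An empty disjunction is false, an
empty conjunction is true. -/
inductive Sat (C : Circuit n) (a : Fin n → Bool) : Fin C.N → Prop where
  | lit (p : Fin C.N) (x : Fin n) (b : Bool) (h : C.gate p = .lit x b) (hx : a x = b) : Sat C a p
  | or (p : Fin C.N) (cs : List (Fin C.N)) (h : C.gate p = .or cs) (c : Fin C.N) (hc : c ∈ cs)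
      (hs : Sat C a c) : Sat C a p
  | and (p : Fin C.N) (cs : List (Fin C.N)) (h : C.gate p = .and cs)
      (hs : ∀ c ∈ cs, Sat C a c) : Sat C a p

/-- Two circuits are equivalent if they evaluate to the same output on every input. -/
def Equivalent (C D : Circuit n) : Prop :=
  ∀ a : Fin n → Bool, C.Sat a C.root ↔ D.Sat a D.root

/-- Distinct children of a `⊗`-gate have disjoint sets of variables. -/
def Decomposable (C : Circuit n) : Prop :=
  ∀ p cs, C.gate p = .and cs → ∀ c ∈ cs, ∀ d ∈ cs, c ≠ d → Disjoint (C.vars c) (C.vars d)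

/-- All children of an `⊕`-gate have the same set of variables. -/
def Smooth (C : Circuit n) : Prop :=
  ∀ p cs, C.gate p = .or cs → ∀ c ∈ cs, ∀ d ∈ cs, C.vars c = C.vars d

/-- On every input at most one child of each `⊕`-gate evaluates to true. -/
def Deterministic (C : Circuit n) : Prop :=
  ∀ (a : Fin n → Bool) p cs, C.gate p = .or cs →
    ∀ c ∈ cs, ∀ d ∈ cs, C.Sat a c → C.Sat a d → c = d

end Circuit

/-! ### Vtrees and structuredness -/

/-- Full binary trees with leaves labelled by variables. -/
inductive VTree (n : ℕ) where
  | leaf (x : Fin n)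
  | node (l r : VTree n)

namespace VTree

variable {n : ℕ}

/-- The leaf labels from left to right. -/
def leaves : VTree n → List (Fin n)
  | .leaf x => [x]
  | .node l r => l.leaves ++ r.leaves

/-- The leaves are in one-to-one correspondence with the variables. -/
def IsVTree (T : VTree n) : Prop := T.leaves.Nodup ∧ ∀ x, x ∈ T.leaves

/-- `Desc s t`: `s` is the subtree at the root or at a descendant of the root of `t`. In a vtree
the leaf labels are distinct, so that its nodes are identified with the subtrees at them. -/
inductive Desc : VTree n → VTree n → Prop where
  | refl (t : VTree n) : Desc t t
  | left {s l : VTree n} (r : VTree n) (h : Desc s l) : Desc s (.node l r)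
  | right {s r : VTree n} (l : VTree n) (h : Desc s r) : Desc s (.node l r)

end VTree

/-- The circuit `C` respects the vtree `T`, through a map `ρ` from its gates to the nodes of `T`.
The two children of a `⊗`-gate may be listed in either order. -/
def Circuit.Respects {n : ℕ} (C : Circuit n) (T : VTree n) : Prop :=
  ∃ ρ : Fin C.N → VTree n,
    (∀ p, VTree.Desc (ρ p) T) ∧
    (∀ p x b, C.gate p = .lit x b → ρ p = .leaf x) ∧
    (∀ p cs, C.gate p = .or cs → ∀ c ∈ cs, VTree.Desc (ρ c) (ρ p)) ∧
    (∀ p cs, C.gate p = .and cs → cs = [] ∨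
      ∃ c₁ c₂ vl vr, cs.Perm [c₁, c₂] ∧ ρ p = .node vl vr ∧
        VTree.Desc (ρ c₁) vl ∧ VTree.Desc (ρ c₂) vr)

/-! ### The inverse Ackermann function, as defined by Tarjan -/

/-- `A(0,x) = 2x`, and for `i ≥ 1`: `A(i,0) = 0`, `A(i,1) = 2`, and
`A(i,x) = A(i-1, A(i,x-1))` for `x ≥ 2`. -/
def tarjanA : ℕ → ℕ → ℕ
  | 0, x => 2 * x
  | _ + 1, 0 => 0
  | _ + 1, 1 => 2
  | i + 1, x + 2 => tarjanA i (tarjanA (i + 1) (x + 1))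
termination_by i x => (i, x)

/-- `α(m,n) = min {i ≥ 1 | A(i, 4⌈m/n⌉) > log₂ n}`, the inequality written as `n < 2 ^ A(…)`. -/
noncomputable def invAckermann (m n : ℕ) : ℕ :=
  sInf {i | 1 ≤ i ∧ n < 2 ^ tarjanA i (4 * ((m + n - 1) / n))}

/-! ### A word RAM with structured control flow

The machine has registers and random-access memory banks (arrays), of which a program mentions
finitely many. Every register and every cell holds a natural number. Each operation on words,
memory access, assignment and test costs one unit of time, and a run must keep all
values that it computes below a bound `W` (words of `log₂ W` bits). -/

/-- The contents of the registers and of the memory banks. -/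
structure RamState where
  reg : ℕ → ℕ
  mem : ℕ → ℕ → ℕ

/-- The state after writing `v` to register `x`. -/
def RamState.setReg (s : RamState) (x v : ℕ) : RamState :=
  ⟨Function.update s.reg x v, s.mem⟩

/-- The state after writing `v` to cell `i` of bank `b`. -/
def RamState.setMem (s : RamState) (b i v : ℕ) : RamState :=
  ⟨s.reg, Function.update s.mem b (Function.update (s.mem b) i v)⟩

/-- The operations on words; `sub` is truncated at zero, `div` rounds down (and `x / 0 = 0`). -/
inductive WordOp where
  | add | sub | mul | div | lt | eq

/-- The result of an operation on words; a test returns `1` for true and `0` for false. -/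
def WordOp.apply : WordOp → ℕ → ℕ → ℕ
  | .add, x, y => x + y
  | .sub, x, y => x - y
  | .mul, x, y => x * y
  | .div, x, y => x / y
  | .lt, x, y => if x < y then 1 else 0
  | .eq, x, y => if x = y then 1 else 0

/-- Expressions: constants, registers, the cell of bank `b` with a computed address, operations. -/
inductive RamExp where
  | const (k : ℕ)
  | reg (x : ℕ)
  | load (b : ℕ) (addr : RamExp)
  | op (o : WordOp) (e₁ e₂ : RamExp)

namespace RamExp

/-- The value of an expression. -/
def eval (s : RamState) : RamExp → ℕ
  | .const k => k
  | .reg x => s.reg x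
  | .load b a => s.mem b (a.eval s)
  | .op o e₁ e₂ => o.apply (e₁.eval s) (e₂.eval s)

/-- The time to evaluate an expression: one unit for each of its nodes. -/
def cost : RamExp → ℕ
  | .const _ => 1
  | .reg _ => 1
  | .load _ a => a.cost + 1
  | .op _ e₁ e₂ => e₁.cost + e₂.cost + 1

/-- All values that occur in the evaluation of an expression are less than `W`. -/
def Fits (W : ℕ) (s : RamState) : RamExp → Prop
  | .const k => k < W
  | .reg x => s.reg x < W
  | .load b a => a.Fits W s ∧ s.mem b (a.eval s) < W
  | .op o e₁ e₂ => e₁.Fits W s ∧ e₂.Fits W s ∧ o.apply (e₁.eval s) (e₂.eval s) < W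

end RamExp

/-- Programs. A test is true if the value of the expression is not zero. -/
inductive RamProg where
  | skip
  | assign (x : ℕ) (e : RamExp)
  | store (b : ℕ) (addr e : RamExp)
  | seq (p q : RamProg)
  | ite (e : RamExp) (p q : RamProg)
  | while (e : RamExp) (p : RamProg)

/-- `RamRun W p s t s'`: started in the state `s` the program `p` halts in the state `s'` after `t`
units of time, all computed values being less than `W`. -/
inductive RamRun (W : ℕ) : RamProg → RamState → ℕ → RamState → Prop where
  | skip (s : RamState) : RamRun W .skip s 1 s
  | assign (s : RamState) (x : ℕ) (e : RamExp) (h : e.Fits W s) :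
      RamRun W (.assign x e) s (e.cost + 1) (s.setReg x (e.eval s))
  | store (s : RamState) (b : ℕ) (a e : RamExp) (ha : a.Fits W s) (he : e.Fits W s) :
      RamRun W (.store b a e) s (a.cost + e.cost + 1)
        (s.setMem b (a.eval s) (e.eval s))
  | seq {p q : RamProg} {s s₁ s₂ : RamState} {t₁ t₂ : ℕ}
      (h₁ : RamRun W p s t₁ s₁) (h₂ : RamRun W q s₁ t₂ s₂) : RamRun W (.seq p q) s (t₁ + t₂) s₂
  | iteTrue {e : RamExp} {p : RamProg} {s s₁ : RamState} {t : ℕ} (q : RamProg)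
      (hf : e.Fits W s) (he : e.eval s ≠ 0) (h : RamRun W p s t s₁) :
      RamRun W (.ite e p q) s (e.cost + 1 + t) s₁
  | iteFalse {e : RamExp} {q : RamProg} {s s₁ : RamState} {t : ℕ} (p : RamProg)
      (hf : e.Fits W s) (he : e.eval s = 0) (h : RamRun W q s t s₁) :
      RamRun W (.ite e p q) s (e.cost + 1 + t) s₁
  | whileTrue {e : RamExp} {p : RamProg} {s s₁ s₂ : RamState} {t₁ t₂ : ℕ}
      (hf : e.Fits W s) (he : e.eval s ≠ 0) (h₁ : RamRun W p s t₁ s₁)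
      (h₂ : RamRun W (.while e p) s₁ t₂ s₂) : RamRun W (.while e p) s (e.cost + 1 + t₁ + t₂) s₂
  | whileFalse {e : RamExp} {s : RamState} (p : RamProg)
      (hf : e.Fits W s) (he : e.eval s = 0) : RamRun W (.while e p) s (e.cost + 1) s

/-! ### Representation of circuits and vtrees in memory -/

/-- The code of the type of a gate. -/
def Gate.code {n N : ℕ} : Gate n N → ℕ
  | .lit _ false => 0
  | .lit _ true => 1
  | .or _ => 2
  | .and _ => 3

/-- The state `s` holds the circuit `C`: register 0 is the number of gates and register 1 the root;
bank 0 holds the types of the gates, bank 1 the variables of the literals, bank 3 the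
concatenation of the lists of children of all gates, and bank 2 the position in bank 3 at
which the list of each gate starts (followed by the number of edges). -/
def Circuit.StoredIn {n : ℕ} (C : Circuit n) (s : RamState) : Prop :=
  s.reg 0 = C.N ∧ s.reg 1 = C.root ∧
  (∀ i : Fin C.N, s.mem 0 i = (C.gate i).code) ∧
  (∀ (i : Fin C.N) x b, C.gate i = .lit x b → s.mem 1 i = x) ∧
  s.mem 2 0 = 0 ∧
  (∀ i : Fin C.N, s.mem 2 (i + 1) = s.mem 2 i + (C.gate i).children.length) ∧
  (∀ (i : Fin C.N) (k : ℕ) (hk : k < (C.gate i).children.length),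
    s.mem 3 (s.mem 2 i + k) = (C.gate i).children[k])

/-- The state `s` holds the tree `T` on `n` variables with its root at node number `v`, by pointers,
the nodes being numbered below `2n - 1` in an arbitrary order: bank 4 says whether a node is a
leaf (0) or internal (1), bank 5 holds the variable of a leaf or the left child, and bank 6 the
right child. -/
def VTree.StoredAt {n : ℕ} (s : RamState) : VTree n → ℕ → Prop
  | .leaf x, v => v < 2 * n - 1 ∧ s.mem 4 v = 0 ∧ s.mem 5 v = x
  | .node l r, v => v < 2 * n - 1 ∧ s.mem 4 v = 1 ∧
      VTree.StoredAt s l (s.mem 5 v) ∧ VTree.StoredAt s r (s.mem 6 v)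

/-- The initial states with input `C` and `T`: register 2 is the number of variables and register 3
the number of the root of `T`; all other registers and banks are zero. -/
def IsInputState {n : ℕ} (C : Circuit n) (T : VTree n) (s : RamState) : Prop :=
  C.StoredIn s ∧ s.reg 2 = n ∧ T.StoredAt s (s.reg 3) ∧
  (∀ x, 4 ≤ x → s.reg x = 0) ∧ (∀ b, 7 ≤ b → ∀ i, s.mem b i = 0)

/-! Give the variables the positions 1, …, n in the order of the leaves of the vtree. The leaves
below a node of the vtree occupy an interval of positions, so the variables of one child of a binary
⊗-gate all precede those of the other (`Circuit.Respects.separated`). This is all that is used of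
the map ρ. For every gate p let [lo p, hi p] be the hull of the positions of its variables. The new
circuit has a copy of p whose set of variables consists of everything in this range, whether or not
it occurs below p (`Circuit.IsCopy`). An edge from an ⊕-gate to a child then lacks at most two gaps
of positions, and a ⊗-gate at most the gap between its children (`Circuit.EdgeGaps`). A gap is
filled by conjoining the gates x ∨ ¬x of its variables. These are tautologies, so neither the
function nor determinism is affected, while smoothness and decomposability hold because the ranges
and gaps partition the range of the parent.

What remains is to construct conjunctions over 2m given intervals in time O(m α(m,n)). Put the
positions at the leaves of a complete binary tree of height h with O(n) leaves, stored as a heap. If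
the ends a < b of a gap have their lowest common ancestor at height i+1, then the gap consists of
what is right of a below the ancestor of a at height i, and what is left of b below the ancestor of
b at height i (`meetHeight_split`). Every node carries a pointer to some proper ancestor together
with the products of what lies to its right and to its left below that ancestor (`ForestInv`). A
query compresses the path from a leaf to the required ancestor and combines the products on the way.
Queries are treated by increasing meeting height, so that no pointer jumps over the ancestor in
question (`ForestInv.exists_path`). The heights come from a table for pairs of half-words, and the
queries are sorted into buckets by height.

The cost of the compressions is amortised. Let a = α(m,n)+1 and q = 4⌈m/n⌉, so that h < A(a,q). A
node of height at most z, with z ≥ q, whose parent has height p has a level, the least i with p <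
A(i,z), which is at most a. On a compressed path every node except the topmost one of its level
loses potential (`nodePot_lt`), so a path of length l costs l ≤ a + 1 plus the drop of potential
(`PathTo.forestPot_compress`). The initial potential is O(a · n · q) = O(a · m), since the heights
in a complete binary tree have a linear sum (`forestPot_le`).

The new gates are appended to a list in which children precede their parents, and `PGate.Valid`
records the intended variables and function of each gate. Finally the gates reachable from the new
root are marked and renumbered, and the list is read as a circuit (`exists_ofList`).

On the machine side, programs are verified in a semantics `Exec` that ignores the word size. A
syntactic condition `RamProg.Safe` says that stored values grow by a bounded amount per step, so a
time bound also bounds the values (`Exec.ramRun`). -/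

/-! ### Runs without an explicit bound on the word size -/

namespace RamExp

/-- Every cell of one of the input banks that is read by the expression holds at most `V`. -/
def LowBdd (V : ℕ) (s : RamState) : RamExp → Prop
  | .const _ => True
  | .reg _ => True
  | .load b a => a.LowBdd V s ∧ (b < 7 → s.mem b (a.eval s) ≤ V)
  | .op _ e f => e.LowBdd V s ∧ f.LowBdd V s

/-- The value of the expression is at most the largest value in the state. -/
def Flat : RamExp → Bool
  | .const _ => false
  | .reg _ => true
  | .load _ _ => true
  | .op .sub e _ => e.Flat
  | .op .div e _ => e.Flat
  | .op _ _ _ => false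

/-- The value of the expression exceeds the largest value in the state by at most `κ`. -/
def Incr (κ : ℕ) : RamExp → Bool
  | .const k => k ≤ κ
  | .op .add e (.const k) => e.Flat && k ≤ κ
  | e => e.Flat

/-- All constants in the expression are at most `κ`. -/
def ConstLe (κ : ℕ) : RamExp → Bool
  | .const k => k ≤ κ
  | .reg _ => true
  | .load _ a => a.ConstLe κ
  | .op _ e f => e.ConstLe κ && f.ConstLe κ

end RamExp

/-- All registers and all cells of the work banks hold at most `V`. -/
def RamState.Bdd (V : ℕ) (s : RamState) : Prop :=
  (∀ x, s.reg x ≤ V) ∧ ∀ b, 7 ≤ b → ∀ i, s.mem b i ≤ V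

theorem RamState.Bdd.mono {V V' : ℕ} {s : RamState} (h : s.Bdd V) (hV : V ≤ V') : s.Bdd V' :=
  ⟨fun x => (h.1 x).trans hV, fun b hb i => (h.2 b hb i).trans hV⟩

theorem RamState.Bdd.setReg {V : ℕ} {s : RamState} (h : s.Bdd V) (x : ℕ) {v : ℕ} (hv : v ≤ V) :
    (s.setReg x v).Bdd V := by
  refine ⟨fun y => ?_, h.2⟩
  simp only [RamState.setReg, Function.update_apply]
  split_ifs
  exacts [hv, h.1 y]

theorem RamState.Bdd.setMem {V : ℕ} {s : RamState} (h : s.Bdd V) (b i : ℕ) {v : ℕ} (hv : v ≤ V) :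
    (s.setMem b i v).Bdd V := by
  refine ⟨h.1, fun b' hb' j => ?_⟩
  simp only [RamState.setMem, Function.update_apply]
  split_ifs with h1
  · subst h1
    simp only [Function.update_apply]
    split_ifs
    exacts [hv, h.2 _ hb' j]
  · exact h.2 b' hb' j

namespace RamExp

theorem load_le {V V₀ : ℕ} (hV : V₀ ≤ V) {s : RamState} (hs : s.Bdd V) {b : ℕ} {a : RamExp}
    (h : (RamExp.load b a).LowBdd V₀ s) : s.mem b (a.eval s) ≤ V := by
  by_cases hb : b < 7
  · exact (h.2 hb).trans hV
  · exact hs.2 b (not_lt.1 hb) _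

theorem Flat.eval_le {V V₀ : ℕ} (hV : V₀ ≤ V) {s : RamState} (hs : s.Bdd V) {e : RamExp}
    (hF : e.Flat) (h : e.LowBdd V₀ s) : e.eval s ≤ V := by
  induction e with
  | const k => simp [Flat] at hF
  | reg x => exact hs.1 x
  | load b a _ => exact load_le hV hs h
  | op o e f ih _ =>
    cases o <;> simp only [Flat, Bool.false_eq_true] at hF
    · exact (Nat.sub_le _ _).trans (ih hF h.1)
    · exact (Nat.div_le_self _ _).trans (ih hF h.1)

theorem Incr.eval_le {V V₀ κ : ℕ} (hV : V₀ ≤ V) {s : RamState} (hs : s.Bdd V) {e : RamExp}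
    (hF : e.Incr κ) (h : e.LowBdd V₀ s) : e.eval s ≤ V + κ := by
  unfold Incr at hF
  split at hF
  · simp at hF
    simp only [eval]
    omega
  · simp at hF
    have := Flat.eval_le hV hs hF.1 h.1
    simp only [eval, WordOp.apply]
    omega
  · exact (Flat.eval_le hV hs hF h).trans (Nat.le_add_right _ _)

/-- In `U ^ cost` every operation has a factor `U ≥ 2` of its own, which pays for a sum by x + y ≤
2xy. The other operations do not exceed the product of the bounds on their operands. -/
theorem fits_of_lowBdd {V V₀ κ U : ℕ} (hV : V₀ ≤ V) (hU : V + κ + 2 ≤ U) {s : RamState}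
    (hs : s.Bdd V) {e : RamExp} (hF : e.ConstLe κ) (h : e.LowBdd V₀ s) :
    ∀ W, U ^ e.cost < W → e.eval s ≤ U ^ e.cost ∧ e.Fits W s := by
  have hU1 : 2 ≤ U := by omega
  induction e with
  | const k =>
    intro W hW
    simp [ConstLe] at hF
    simp only [cost, pow_one, eval, Fits] at hW ⊢
    omega
  | reg x =>
    intro W hW
    have := hs.1 x
    simp only [cost, pow_one, eval, Fits] at hW ⊢
    omega
  | load b a ih =>
    intro W hW
    have h1 := load_le hV hs h
    simp only [cost, eval, Fits] at hW ⊢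
    have h2 : U ^ a.cost ≤ U ^ (a.cost + 1) := Nat.pow_le_pow_right (by omega) (by omega)
    have h3 : U ≤ U ^ (a.cost + 1) := Nat.le_self_pow (by omega) _
    have := ih hF h.1 W (by omega)
    exact ⟨by omega, this.2, by omega⟩
  | op o e f ihe ihf =>
    intro W hW
    simp only [ConstLe, Bool.and_eq_true] at hF
    simp only [cost, eval, Fits] at hW ⊢
    have h1 : U ^ e.cost ≤ U ^ (e.cost + f.cost + 1) :=
      Nat.pow_le_pow_right (by omega) (by omega)
    have h2 : U ^ f.cost ≤ U ^ (e.cost + f.cost + 1) :=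
      Nat.pow_le_pow_right (by omega) (by omega)
    obtain ⟨he, he'⟩ := ihe hF.1 h.1 W (by omega)
    obtain ⟨hf, hf'⟩ := ihf hF.2 h.2 W (by omega)
    have hmul : U ^ e.cost * U ^ f.cost * U = U ^ (e.cost + f.cost + 1) := by ring
    have hpe : 1 ≤ U ^ e.cost := Nat.one_le_pow _ _ (by omega)
    have hpf : 1 ≤ U ^ f.cost := Nat.one_le_pow _ _ (by omega)
    have key : o.apply (e.eval s) (f.eval s) ≤ U ^ (e.cost + f.cost + 1) := by
      rw [← hmul] at h1 h2 ⊢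
      cases o <;> simp only [WordOp.apply]
      · have : U ^ e.cost + U ^ f.cost ≤ U ^ e.cost * U ^ f.cost * U := by
          have := Nat.le_mul_of_pos_right (U ^ e.cost) hpf
          have := Nat.le_mul_of_pos_left (U ^ f.cost) hpe
          have := Nat.mul_le_mul_left (U ^ e.cost * U ^ f.cost) hU1
          omega
        omega
      · omega
      · calc _ ≤ U ^ e.cost * U ^ f.cost := Nat.mul_le_mul he hf
          _ ≤ _ := Nat.le_mul_of_pos_right _ (by omega)
      · exact (Nat.div_le_self _ _).trans (he.trans h1)
      · split_ifs <;> nlinarith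
      · split_ifs <;> nlinarith
    exact ⟨key, he', hf', by omega⟩

end RamExp

/-- Runs as in `RamRun`, where instead of the word size only the values that are read from the
input banks are bounded. -/
inductive Exec (V : ℕ) : RamProg → RamState → ℕ → RamState → Prop where
  | skip (s : RamState) : Exec V .skip s 1 s
  | assign (s : RamState) (x : ℕ) (e : RamExp) (h : e.LowBdd V s) :
      Exec V (.assign x e) s (e.cost + 1) (s.setReg x (e.eval s))
  | store (s : RamState) (b : ℕ) (a e : RamExp) (ha : a.LowBdd V s) (he : e.LowBdd V s) :
      Exec V (.store b a e) s (a.cost + e.cost + 1) (s.setMem b (a.eval s) (e.eval s))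
  | seq {p q : RamProg} {s s₁ s₂ : RamState} {t₁ t₂ : ℕ}
      (h₁ : Exec V p s t₁ s₁) (h₂ : Exec V q s₁ t₂ s₂) : Exec V (.seq p q) s (t₁ + t₂) s₂
  | iteTrue {e : RamExp} {p : RamProg} {s s₁ : RamState} {t : ℕ} (q : RamProg)
      (hf : e.LowBdd V s) (he : e.eval s ≠ 0) (h : Exec V p s t s₁) :
      Exec V (.ite e p q) s (e.cost + 1 + t) s₁
  | iteFalse {e : RamExp} {q : RamProg} {s s₁ : RamState} {t : ℕ} (p : RamProg)
      (hf : e.LowBdd V s) (he : e.eval s = 0) (h : Exec V q s t s₁) :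
      Exec V (.ite e p q) s (e.cost + 1 + t) s₁
  | whileTrue {e : RamExp} {p : RamProg} {s s₁ s₂ : RamState} {t₁ t₂ : ℕ}
      (hf : e.LowBdd V s) (he : e.eval s ≠ 0) (h₁ : Exec V p s t₁ s₁)
      (h₂ : Exec V (.while e p) s₁ t₂ s₂) : Exec V (.while e p) s (e.cost + 1 + t₁ + t₂) s₂
  | whileFalse {e : RamExp} {s : RamState} (p : RamProg)
      (hf : e.LowBdd V s) (he : e.eval s = 0) : Exec V (.while e p) s (e.cost + 1) s

namespace RamProg

/-- All stored values exceed the largest value in the state by at most `κ`, and all expressions have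
cost at most `c`. -/
def Safe (κ c : ℕ) : RamProg → Bool
  | .skip => true
  | .assign _ e => e.Incr κ && e.ConstLe κ && e.cost ≤ c
  | .store _ a e => a.ConstLe κ && a.cost ≤ c && e.Incr κ && e.ConstLe κ && e.cost ≤ c
  | .seq p q => p.Safe κ c && q.Safe κ c
  | .ite e p q => e.ConstLe κ && e.cost ≤ c && p.Safe κ c && q.Safe κ c
  | .while e p => e.ConstLe κ && e.cost ≤ c && p.Safe κ c

/-- The registers that the program may change. -/
def regs : RamProg → List ℕ
  | .skip => []
  | .assign x _ => [x]
  | .store _ _ _ => []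
  | .seq p q => p.regs ++ q.regs
  | .ite _ p q => p.regs ++ q.regs
  | .while _ p => p.regs

/-- The banks that the program may change. -/
def banks : RamProg → List ℕ
  | .skip => []
  | .assign _ _ => []
  | .store b _ _ => [b]
  | .seq p q => p.banks ++ q.banks
  | .ite _ p q => p.banks ++ q.banks
  | .while _ p => p.banks

end RamProg

/-- The largest value in the state grows additively, by at most `κ` per unit of time. Within one
expression of cost at most `c` it can only be raised to the power `c`. Thus the word size follows
from the running time, without following any values through the algorithm. -/
theorem Exec.ramRun {V₀ κ c W : ℕ} {p : RamProg} {s s' : RamState} {t : ℕ} (h : Exec V₀ p s t s') :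
    p.Safe κ c → ∀ V, V₀ ≤ V → s.Bdd V → (V + κ * t + κ + 2) ^ c < W →
      RamRun W p s t s' ∧ s'.Bdd (V + κ * t) := by
  have fits : ∀ {e : RamExp} {s : RamState} {V t : ℕ}, V₀ ≤ V → s.Bdd V →
      (V + κ * t + κ + 2) ^ c < W → e.ConstLe κ → e.cost ≤ c → e.LowBdd V₀ s → e.Fits W s := by
    intro e s V t hV hs hW h1 h2 h3
    refine (RamExp.fits_of_lowBdd (U := V + κ * t + κ + 2) hV (by omega) hs h1 h3 W ?_).2
    exact lt_of_le_of_lt (Nat.pow_le_pow_right (by omega) h2) hW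
  have shrink : ∀ {V t t' : ℕ}, (V + κ * t + κ + 2) ^ c < W → t' ≤ t →
      (V + κ * t' + κ + 2) ^ c < W := by
    intro V t t' hW ht
    refine lt_of_le_of_lt (Nat.pow_le_pow_left ?_ c) hW
    have := Nat.mul_le_mul_left κ ht
    omega
  induction h with
  | skip s => exact fun _ V _ hs _ => ⟨.skip s, hs.mono (by omega)⟩
  | assign s x e h =>
    intro hS V hV hs hW
    simp only [RamProg.Safe, Bool.and_eq_true, decide_eq_true_eq] at hS
    refine ⟨.assign s x e (fits hV hs hW hS.1.2 hS.2 h), ?_⟩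
    have h1 := RamExp.Incr.eval_le hV hs hS.1.1 h
    have h2 : κ ≤ κ * (e.cost + 1) := Nat.le_mul_of_pos_right _ (by omega)
    exact (hs.mono (by omega)).setReg x (by omega)
  | store s b a e ha he =>
    intro hS V hV hs hW
    simp only [RamProg.Safe, Bool.and_eq_true, decide_eq_true_eq] at hS
    obtain ⟨⟨⟨⟨h1, h2⟩, h3⟩, h4⟩, h5⟩ := hS
    refine ⟨.store s b a e (fits hV hs hW h1 h2 ha) (fits hV hs hW h4 h5 he), ?_⟩
    have h1 := RamExp.Incr.eval_le hV hs h3 he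
    have h2 : κ ≤ κ * (a.cost + e.cost + 1) := Nat.le_mul_of_pos_right _ (by omega)
    exact (hs.mono (by omega)).setMem b _ (by omega)
  | @seq p q s s₁ s₂ t₁ t₂ _ _ ih₁ ih₂ =>
    intro hS V hV hs hW
    simp only [RamProg.Safe, Bool.and_eq_true] at hS
    obtain ⟨r1, b1⟩ := ih₁ hS.1 V hV hs (shrink hW (by omega))
    have hm : V + κ * (t₁ + t₂) = V + κ * t₁ + κ * t₂ := by ring
    rw [hm] at hW ⊢
    obtain ⟨r2, b2⟩ := ih₂ hS.2 _ (by omega) b1 hW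
    exact ⟨.seq r1 r2, b2⟩
  | @iteTrue e p s s₁ t q hf he _ ih =>
    intro hS V hV hs hW
    simp only [RamProg.Safe, Bool.and_eq_true, decide_eq_true_eq] at hS
    obtain ⟨r, b⟩ := ih hS.1.2 V hV hs (shrink hW (by omega))
    exact ⟨.iteTrue q (fits hV hs hW hS.1.1.1 hS.1.1.2 hf) he r,
      b.mono (Nat.add_le_add_left (Nat.mul_le_mul_left κ (by omega)) V)⟩
  | @iteFalse e q s s₁ t p hf he _ ih =>
    intro hS V hV hs hW
    simp only [RamProg.Safe, Bool.and_eq_true, decide_eq_true_eq] at hS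
    obtain ⟨r, b⟩ := ih hS.2 V hV hs (shrink hW (by omega))
    exact ⟨.iteFalse p (fits hV hs hW hS.1.1.1 hS.1.1.2 hf) he r,
      b.mono (Nat.add_le_add_left (Nat.mul_le_mul_left κ (by omega)) V)⟩
  | @whileTrue e p s s₁ s₂ t₁ t₂ hf he _ _ ih₁ ih₂ =>
    intro hS V hV hs hW
    have hS' := hS
    simp only [RamProg.Safe, Bool.and_eq_true, decide_eq_true_eq] at hS
    obtain ⟨r1, b1⟩ := ih₁ hS.2 V hV hs (shrink hW (by omega))
    have hm : V + κ * (t₁ + t₂) = V + κ * t₁ + κ * t₂ := by ring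
    have hW2 := shrink (t' := t₁ + t₂) hW (by omega)
    rw [hm] at hW2
    obtain ⟨r2, b2⟩ := ih₂ hS' _ (by omega) b1 hW2
    refine ⟨.whileTrue (fits hV hs hW hS.1.1 hS.1.2 hf) he r1 r2, b2.mono ?_⟩
    rw [← hm]
    exact Nat.add_le_add_left (Nat.mul_le_mul_left κ (by omega)) V
  | @whileFalse e s p hf he =>
    intro hS V hV hs hW
    simp only [RamProg.Safe, Bool.and_eq_true, decide_eq_true_eq] at hS
    exact ⟨.whileFalse p (fits hV hs hW hS.1.1 hS.1.2 hf) he, hs.mono (by omega)⟩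

/-- `s'` differs from `s` only in the registers and banks that `p` may change. -/
def RamProg.Agree (p : RamProg) (s s' : RamState) : Prop :=
  (∀ x, x ∉ p.regs → s'.reg x = s.reg x) ∧ ∀ b, b ∉ p.banks → s'.mem b = s.mem b

theorem RamProg.Agree.refl (p : RamProg) (s : RamState) : p.Agree s s :=
  ⟨fun _ _ => rfl, fun _ _ => rfl⟩

theorem RamProg.Agree.trans {p : RamProg} {s s₁ s₂ : RamState} (h₁ : p.Agree s s₁)
    (h₂ : p.Agree s₁ s₂) : p.Agree s s₂ :=
  ⟨fun x hx => (h₂.1 x hx).trans (h₁.1 x hx), fun b hb => (h₂.2 b hb).trans (h₁.2 b hb)⟩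

theorem RamProg.Agree.of_subset {p q : RamProg} {s s' : RamState} (h : p.Agree s s')
    (hr : p.regs ⊆ q.regs) (hb : p.banks ⊆ q.banks) : q.Agree s s' :=
  ⟨fun x hx => h.1 x fun h' => hx (hr h'), fun b hb' => h.2 b fun h' => hb' (hb h')⟩

/-- This is the frame rule. The registers and banks that may change are read off the program text,
so that the preservation of everything else is later settled by `decide`. -/
theorem Exec.agree {V : ℕ} {p : RamProg} {s s' : RamState} {t : ℕ} (h : Exec V p s t s') :
    p.Agree s s' := by
  induction h with
  | skip s => exact .refl _ _
  | assign s x e h =>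
    refine ⟨fun y hy => ?_, fun _ _ => rfl⟩
    simp only [RamProg.regs, List.mem_singleton] at hy
    simp [RamState.setReg, hy]
  | store s b a e ha he =>
    refine ⟨fun _ _ => rfl, fun b' hb' => ?_⟩
    simp only [RamProg.banks, List.mem_singleton] at hb'
    simp [RamState.setMem, hb']
  | seq _ _ ih₁ ih₂ =>
    exact (ih₁.of_subset (by simp [RamProg.regs]) (by simp [RamProg.banks])).trans
      (ih₂.of_subset (by simp [RamProg.regs]) (by simp [RamProg.banks]))
  | iteTrue _ _ _ _ ih => exact ih.of_subset (by simp [RamProg.regs]) (by simp [RamProg.banks])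
  | iteFalse _ _ _ _ ih => exact ih.of_subset (by simp [RamProg.regs]) (by simp [RamProg.banks])
  | whileTrue _ _ _ _ ih₁ ih₂ =>
    exact (ih₁.of_subset (by simp [RamProg.regs]) (by simp [RamProg.banks])).trans ih₂
  | whileFalse => exact .refl _ _

/-- Started in `s`, the program halts within `T` units of time in a state that satisfies `Q`. -/
def Runs (V : ℕ) (p : RamProg) (s : RamState) (T : ℕ) (Q : RamState → Prop) : Prop :=
  ∃ t s', Exec V p s t s' ∧ t ≤ T ∧ Q s'

namespace Runs

variable {V : ℕ} {p q : RamProg} {s : RamState} {T T' : ℕ} {Q R : RamState → Prop}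

theorem mono (h : Runs V p s T Q) (hT : T ≤ T') (hQ : ∀ s', p.Agree s s' → Q s' → R s') :
    Runs V p s T' R := by
  obtain ⟨t, s', h1, h2, h3⟩ := h
  exact ⟨t, s', h1, h2.trans hT, hQ s' h1.agree h3⟩

theorem seq (h₁ : Runs V p s T Q) (h₂ : ∀ s', p.Agree s s' → Q s' → Runs V q s' T' R) :
    Runs V (.seq p q) s (T + T') R := by
  obtain ⟨t, s', h1, h2, h3⟩ := h₁
  obtain ⟨t', s'', h1', h2', h3'⟩ := h₂ s' h1.agree h3
  exact ⟨t + t', s'', .seq h1 h1', Nat.add_le_add h2 h2', h3'⟩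

theorem ite {e : RamExp} (he : e.LowBdd V s) (h₁ : e.eval s ≠ 0 → Runs V p s T Q)
    (h₂ : e.eval s = 0 → Runs V q s T Q) : Runs V (.ite e p q) s (e.cost + 1 + T) Q := by
  by_cases h : e.eval s = 0
  · obtain ⟨t, s', h1, h2, h3⟩ := h₂ h
    exact ⟨_, s', .iteFalse p he h h1, by omega, h3⟩
  · obtain ⟨t, s', h1, h2, h3⟩ := h₁ h
    exact ⟨_, s', .iteTrue q he h h1, by omega, h3⟩

/-- A loop with an invariant that involves the time that is left. -/
theorem loop {e : RamExp} (I : ℕ → RamState → Prop) (hI : I T s)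
    (hstep : ∀ c s', p.Agree s s' → I c s' → e.LowBdd V s' ∧
      (e.eval s' ≠ 0 → ∃ d, Runs V p s' d fun s'' => ∃ c', c' + d + (e.cost + 1) ≤ c ∧ I c' s'') ∧
      (e.eval s' = 0 → e.cost + 1 ≤ c ∧ Q s')) :
    Runs V (.while e p) s T Q := by
  suffices H : ∀ c s', p.Agree s s' → I c s' → Runs V (.while e p) s' c Q from H T s (.refl _ _) hI
  intro c
  -- The budget `c` serves as the termination measure, since every round spends at least the cost of
  -- the test and one unit more.
  induction c using Nat.strong_induction_on with
  | _ c ih =>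
    intro s' ha hI'
    obtain ⟨h0, h1, h2⟩ := hstep c s' ha hI'
    by_cases h : e.eval s' = 0
    · exact ⟨_, s', .whileFalse p h0 h, (h2 h).1, (h2 h).2⟩
    · obtain ⟨d, t, s'', hx, ht, c', hc, hI''⟩ := h1 h
      obtain ⟨t', s₃, hx', ht', hQ⟩ := ih c' (by omega) s'' (ha.trans hx.agree) hI''
      exact ⟨_, s₃, .whileTrue h0 h hx hx', by omega, hQ⟩

/-- A loop that is executed `k` times. -/
theorem count {e : RamExp} (D : ℕ) (I : ℕ → RamState → Prop) (k : ℕ) (hI : I k s)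
    (hok : ∀ k s', p.Agree s s' → I k s' → e.LowBdd V s')
    (hstep : ∀ k s', p.Agree s s' → I (k + 1) s' → e.eval s' ≠ 0 ∧ Runs V p s' D (I k))
    (hdone : ∀ s', p.Agree s s' → I 0 s' → e.eval s' = 0 ∧ Q s') :
    Runs V (.while e p) s ((k + 1) * (D + e.cost + 1)) Q := by
  refine loop (fun c s' => ∃ k, (k + 1) * (D + e.cost + 1) ≤ c ∧ I k s') ⟨k, le_rfl, hI⟩ ?_
  rintro c s' ha ⟨k, hk, hI'⟩
  refine ⟨hok k s' ha hI', fun he => ?_, fun he => ?_⟩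
  · cases k with
    | zero => exact absurd (hdone s' ha hI').1 he
    | succ k =>
      refine ⟨D, (hstep k s' ha hI').2.mono le_rfl fun s'' _ h => ⟨(k + 1) * (D + e.cost + 1), ?_, k,
        le_rfl, h⟩⟩
      calc _ = (k + 1 + 1) * (D + e.cost + 1) := by ring
        _ ≤ c := hk
  · cases k with
    | zero => exact ⟨by omega, (hdone s' ha hI').2⟩
    | succ k => exact absurd he (hstep k s' ha hI').1

/-- A loop that is executed `k` times, in times that depend on the number of executions left. -/
theorem count_sum {e : RamExp} (D : ℕ → ℕ) (I : ℕ → RamState → Prop) (k : ℕ) (hI : I k s)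
    (hok : ∀ k s', p.Agree s s' → I k s' → e.LowBdd V s')
    (hstep : ∀ k s', p.Agree s s' → I (k + 1) s' → e.eval s' ≠ 0 ∧ Runs V p s' (D k) (I k))
    (hdone : ∀ s', p.Agree s s' → I 0 s' → e.eval s' = 0 ∧ Q s') :
    Runs V (.while e p) s (∑ i ∈ Finset.range k, (D i + e.cost + 1) + e.cost + 1) Q := by
  refine loop (fun c s' => ∃ k, ∑ i ∈ Finset.range k, (D i + e.cost + 1) + e.cost + 1 ≤ c ∧ I k s')
    ⟨k, le_rfl, hI⟩ ?_
  rintro c s' ha ⟨k, hk, hI'⟩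
  refine ⟨hok k s' ha hI', fun he => ?_, fun he => ?_⟩
  · cases k with
    | zero => exact absurd (hdone s' ha hI').1 he
    | succ k =>
      rw [Finset.sum_range_succ] at hk
      refine ⟨D k, (hstep k s' ha hI').2.mono le_rfl fun s'' _ h => ⟨_, ?_, k, le_rfl, h⟩⟩
      omega
  · cases k with
    | zero => exact ⟨by omega, (hdone s' ha hI').2⟩
    | succ k => exact absurd he (hstep k s' ha hI').1

/-- A loop with a measure that decreases. -/
theorem while_lt {e : RamExp} (D : ℕ) (I : ℕ → RamState → Prop) (k : ℕ) (hI : I k s)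
    (hok : ∀ k s', p.Agree s s' → I k s' → e.LowBdd V s')
    (hstep : ∀ k s', p.Agree s s' → I k s' → e.eval s' ≠ 0 →
      Runs V p s' D fun s'' => ∃ k' < k, I k' s'')
    (hdone : ∀ k s', p.Agree s s' → I k s' → e.eval s' = 0 → Q s') :
    Runs V (.while e p) s ((k + 1) * (D + e.cost + 1)) Q := by
  refine loop (fun c s' => ∃ k, (k + 1) * (D + e.cost + 1) ≤ c ∧ I k s') ⟨k, le_rfl, hI⟩ ?_
  rintro c s' ha ⟨k, hk, hI'⟩
  refine ⟨hok k s' ha hI', fun he => ⟨D, (hstep k s' ha hI' he).mono le_rfl ?_⟩,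
    fun he => ⟨?_, hdone k s' ha hI' he⟩⟩
  · rintro s'' _ ⟨k', hk', h⟩
    refine ⟨(k' + 1) * (D + e.cost + 1), ?_, k', le_rfl, h⟩
    calc _ = (k' + 1 + 1) * (D + e.cost + 1) := by ring
      _ ≤ (k + 1) * (D + e.cost + 1) := Nat.mul_le_mul_right _ (by omega)
      _ ≤ c := hk
  · have : 1 * (D + e.cost + 1) ≤ (k + 1) * (D + e.cost + 1) := Nat.mul_le_mul_right _ (by omega)
    omega

end Runs

/-! ### Programs without loops -/

namespace RamProg

def loopFree : RamProg → Bool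
  | .skip => true
  | .assign _ _ => true
  | .store _ _ _ => true
  | .seq p q => p.loopFree && q.loopFree
  | .ite _ p q => p.loopFree && q.loopFree
  | .while _ _ => false

/-- The state in which a program without loops halts. -/
def step : RamProg → RamState → RamState
  | .skip, s => s
  | .assign x e, s => s.setReg x (e.eval s)
  | .store b a e, s => s.setMem b (a.eval s) (e.eval s)
  | .seq p q, s => q.step (p.step s)
  | .ite e p q, s => if e.eval s = 0 then q.step s else p.step s
  | .while _ _, s => s

/-- An upper bound on the running time of a program without loops. -/
def time : RamProg → ℕ
  | .skip => 1
  | .assign _ e => e.cost + 1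
  | .store _ a e => a.cost + e.cost + 1
  | .seq p q => p.time + q.time
  | .ite e p q => e.cost + 1 + max p.time q.time
  | .while _ _ => 0

/-- The values that a program without loops reads from the input banks are at most `V`. -/
def LowBdd (V : ℕ) : RamProg → RamState → Prop
  | .skip, _ => True
  | .assign _ e, s => e.LowBdd V s
  | .store _ a e, s => a.LowBdd V s ∧ e.LowBdd V s
  | .seq p q, s => p.LowBdd V s ∧ q.LowBdd V (p.step s)
  | .ite e p q, s => e.LowBdd V s ∧ (e.eval s ≠ 0 → p.LowBdd V s) ∧ (e.eval s = 0 → q.LowBdd V s)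
  | .while _ _, _ => True

end RamProg

/-- Code without loops halts in a state that can be computed symbolically. Its time bound is then
mostly a matter of `decide`, and its effect a matter of `simp` on `RamProg.step`. -/
theorem Runs.of_loopFree {V : ℕ} {p : RamProg} {s : RamState} {T : ℕ} {Q : RamState → Prop}
    (hp : p.loopFree) (hT : p.time ≤ T) (hl : p.LowBdd V s) (hQ : Q (p.step s)) :
    Runs V p s T Q := by
  suffices H : Runs V p s p.time (· = p.step s) by
    exact H.mono hT fun s' _ h => h ▸ hQ
  clear hQ hT
  induction p generalizing s with
  | skip => exact ⟨_, _, .skip s, le_rfl, rfl⟩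
  | assign x e => exact ⟨_, _, .assign s x e hl, le_rfl, rfl⟩
  | store b a e => exact ⟨_, _, .store s b a e hl.1 hl.2, le_rfl, rfl⟩
  | seq p q ihp ihq =>
    simp only [RamProg.loopFree, Bool.and_eq_true] at hp
    refine (ihp hp.1 hl.1).seq fun s' _ h => ?_
    subst h
    exact ihq hp.2 hl.2
  | ite e p q ihp ihq =>
    simp only [RamProg.loopFree, Bool.and_eq_true] at hp
    refine Runs.ite hl.1 (fun h => ?_) fun h => ?_
    · exact (ihp hp.1 (hl.2.1 h)).mono (le_max_left _ _) fun s' _ h' => by simp [RamProg.step, h, h']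
    · exact (ihq hp.2 (hl.2.2 h)).mono (le_max_right _ _) fun s' _ h' => by simp [RamProg.step, h, h']
  | _ => simp [RamProg.loopFree] at hp

/-! ### Rules for the symbolic execution of programs -/

namespace RamState

theorem reg_setReg (s : RamState) (x v y : ℕ) :
    (s.setReg x v).reg y = if y = x then v else s.reg y := by
  simp [setReg, Function.update_apply]

theorem mem_setReg (s : RamState) (x v : ℕ) : (s.setReg x v).mem = s.mem := rfl

theorem reg_setMem (s : RamState) (b i v : ℕ) : (s.setMem b i v).reg = s.reg := rfl

theorem mem_setMem (s : RamState) (b i v b' : ℕ) :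
    (s.setMem b i v).mem b' = if b' = b then Function.update (s.mem b) i v else s.mem b' := by
  simp [setMem, Function.update_apply]

end RamState

infixr:60 " ;; " => RamProg.seq

attribute [simp] RamProg.step RamProg.LowBdd RamExp.LowBdd RamExp.eval WordOp.apply
  RamState.reg_setReg RamState.mem_setReg RamState.reg_setMem RamState.mem_setMem

theorem Runs.step_seq {V : ℕ} {p q : RamProg} {s : RamState} {T T' : ℕ} {Q : RamState → Prop}
    (hp : p.loopFree) (hT : p.time ≤ T) (hl : p.LowBdd V s) (h : Runs V q (p.step s) T' Q) :
    Runs V (p ;; q) s (T + T') Q :=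
  (Runs.of_loopFree (Q := (· = p.step s)) hp hT hl rfl).seq fun _ _ h' => h' ▸ h

/-! ### Growth of the functions of Tarjan and the inverse Ackermann function -/

theorem tarjanA_zero (x : ℕ) : tarjanA 0 x = 2 * x := by simp [tarjanA]

theorem tarjanA_succ_zero (i : ℕ) : tarjanA (i + 1) 0 = 0 := by simp [tarjanA]

theorem tarjanA_one (i : ℕ) : tarjanA i 1 = 2 := by cases i <;> simp [tarjanA]

theorem tarjanA_succ_succ (i : ℕ) {x : ℕ} (hx : 1 ≤ x) :
    tarjanA (i + 1) (x + 1) = tarjanA i (tarjanA (i + 1) x) := by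
  obtain ⟨x, rfl⟩ := Nat.exists_eq_add_of_le' hx
  rw [tarjanA]

theorem two_mul_le_tarjanA (i x : ℕ) : 2 * x ≤ tarjanA i x := by
  induction i generalizing x with
  | zero => simp [tarjanA]
  | succ i ih =>
    induction x with
    | zero => simp
    | succ x ihx =>
      rcases Nat.eq_zero_or_pos x with rfl | hx
      · simp [tarjanA]
      · rw [tarjanA_succ_succ i hx]
        have := ih (tarjanA (i + 1) x)
        omega

theorem tarjanA_strictMono (i : ℕ) : StrictMono (tarjanA i) := by
  refine strictMono_nat_of_lt_succ fun x => ?_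
  cases i with
  | zero => simp [tarjanA]
  | succ i =>
    rcases Nat.eq_zero_or_pos x with rfl | hx
    · simp [tarjanA]
    · rw [tarjanA_succ_succ i hx]
      have := two_mul_le_tarjanA i (tarjanA (i + 1) x)
      have := two_mul_le_tarjanA (i + 1) x
      omega

/-- A(i+1,x) is A(i, ·) at an argument of at least 2(x-1), which is at least x+2 for x ≥ 4. Strict
monotonicity gains one for each of the two additional steps. -/
theorem tarjanA_add_two_le (i : ℕ) {x : ℕ} (hx : 4 ≤ x) : tarjanA i x + 2 ≤ tarjanA (i + 1) x := by
  obtain ⟨y, rfl⟩ := Nat.exists_eq_add_of_le' hx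
  rw [show y + 4 = y + 3 + 1 from rfl, tarjanA_succ_succ i (by omega)]
  have h1 := two_mul_le_tarjanA (i + 1) (y + 3)
  have h2 := (tarjanA_strictMono i).monotone (show y + 3 + 1 + 2 ≤ tarjanA (i + 1) (y + 3) by omega)
  have h3 := tarjanA_strictMono i (show y + 3 + 1 < y + 3 + 1 + 1 by omega)
  have h4 := tarjanA_strictMono i (show y + 3 + 1 + 1 < y + 3 + 1 + 2 by omega)
  omega

theorem le_tarjanA_left (i : ℕ) {x : ℕ} (hx : 4 ≤ x) : i ≤ tarjanA i x := by
  induction i with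
  | zero => exact Nat.zero_le _
  | succ i ih =>
    have := tarjanA_add_two_le i hx
    omega

theorem four_le_quotient {m n : ℕ} (hn : 1 ≤ n) (hm : n ≤ m) : 4 ≤ 4 * ((m + n - 1) / n) := by
  have : 1 ≤ (m + n - 1) / n := (Nat.one_le_div_iff (by omega)).2 (by omega)
  omega

/-- The infimum is attained because A(n,x) ≥ n for x ≥ 4, so that i = n is admissible. The crude
bound by n is needed only to see that the running time is polynomial, for the word size. -/
theorem invAckermann_spec {m n : ℕ} (hn : 1 ≤ n) (hm : n ≤ m) :
    1 ≤ invAckermann m n ∧ n < 2 ^ tarjanA (invAckermann m n) (4 * ((m + n - 1) / n)) ∧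
      invAckermann m n ≤ n := by
  have hmem : n ∈ {i | 1 ≤ i ∧ n < 2 ^ tarjanA i (4 * ((m + n - 1) / n))} :=
    ⟨hn, Nat.lt_two_pow_self.trans_le
      (Nat.pow_le_pow_right (by norm_num) (le_tarjanA_left n (four_le_quotient hn hm)))⟩
  have h := Nat.sInf_mem ⟨n, hmem⟩
  exact ⟨h.1, h.2, Nat.sInf_le hmem⟩

/-- The height of the tree may exceed log₂ n by up to two. Going from level α to level α+1 adds at
least two to the value of A, which absorbs this. -/
theorem lt_tarjanA_invAckermann {m n h : ℕ} (hn : 1 ≤ n) (hm : n ≤ m) (hh : 2 ^ h ≤ 4 * n) :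
    h < tarjanA (invAckermann m n + 1) (4 * ((m + n - 1) / n)) := by
  have h1 := (invAckermann_spec hn hm).2.1
  have h2 := tarjanA_add_two_le (invAckermann m n) (four_le_quotient hn hm)
  by_contra hc
  have h3 := Nat.pow_le_pow_right (n := 2) (by norm_num) (h2.trans (not_lt.1 hc))
  rw [pow_add] at h3
  omega

/-! ### The potential of a node in a forest under path compression -/

/-- The least `y` with `p < A(i, y)`. -/
noncomputable def ackIndex (i p : ℕ) : ℕ := sInf {y | p < tarjanA i y}

theorem lt_tarjanA_ackIndex (i p : ℕ) : p < tarjanA i (ackIndex i p) :=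
  Nat.sInf_mem (s := {y | p < tarjanA i y})
    ⟨p + 1, show p < _ by have := two_mul_le_tarjanA i (p + 1); omega⟩

theorem ackIndex_le {i p y : ℕ} (h : p < tarjanA i y) : ackIndex i p ≤ y := Nat.sInf_le h

theorem lt_ackIndex {i p y : ℕ} (h : tarjanA i y ≤ p) : y < ackIndex i p := by
  by_contra hc
  have := (tarjanA_strictMono i).monotone (not_lt.1 hc)
  have := lt_tarjanA_ackIndex i p
  omega

theorem ackIndex_mono (i : ℕ) {p p' : ℕ} (h : p ≤ p') : ackIndex i p ≤ ackIndex i p' :=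
  ackIndex_le (h.trans_lt (lt_tarjanA_ackIndex i p'))

/-- The potential of a node with parameter `z` whose parent has height `p`. -/
noncomputable def nodePot (a z p : ℕ) : ℕ :=
  (2 * z - p) + ∑ i ∈ Finset.Icc 1 a, (z + 1 - ackIndex i p)

theorem nodePot_le (a z p : ℕ) : nodePot a z p ≤ (a + 2) * (z + 1) := by
  have : ∑ i ∈ Finset.Icc 1 a, (z + 1 - ackIndex i p) ≤ ∑ i ∈ Finset.Icc 1 a, (z + 1) :=
    Finset.sum_le_sum fun i _ => Nat.sub_le _ _
  simp only [Finset.sum_const, Nat.card_Icc, smul_eq_mul, add_tsub_cancel_right] at this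
  rw [nodePot, add_mul]
  omega

theorem nodePot_anti (a z : ℕ) {p p' : ℕ} (h : p ≤ p') : nodePot a z p' ≤ nodePot a z p := by
  refine Nat.add_le_add (by omega) (Finset.sum_le_sum fun i _ => ?_)
  have := ackIndex_mono i h
  omega

/-- The least `i` with `p < A(i, z)`. -/
noncomputable def ackLevel (z p : ℕ) : ℕ := sInf {i | p < tarjanA i z}

theorem ackLevel_spec {a z p : ℕ} (h : p < tarjanA a z) :
    p < tarjanA (ackLevel z p) z ∧ ackLevel z p ≤ a ∧
      ∀ i, i < ackLevel z p → tarjanA i z ≤ p :=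
  ⟨Nat.sInf_mem (s := {i | p < tarjanA i z}) ⟨a, h⟩, Nat.sInf_le h,
    fun _ hi => not_lt.1 fun h' =>
      (Nat.sInf_le (s := {i | p < tarjanA i z}) h').not_gt hi⟩

/-- Two nodes on a path have parameters z, z' and parents of heights p, p', the second node being
the higher one, and both have level i. At level 0 the term 2z - p is positive and drops. At level i
= k+1 the jump from p to the new height P is at least an application of A(k, ·), which raises the
index with respect to A(k+1, ·). That index was at most z, so the truncated difference z + 1 - index
is positive and really drops. -/
theorem nodePot_lt {a z z' p p' P : ℕ} (hz : 4 ≤ z) (hp : p < tarjanA a z) (hp' : p' < tarjanA a z')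
    (h1 : p ≤ z') (h2 : p < p') (h3 : p' ≤ P) (hl : ackLevel z p = ackLevel z' p') :
    nodePot a z P + 1 ≤ nodePot a z p := by
  obtain ⟨u1, u2, u3⟩ := ackLevel_spec hp
  obtain ⟨v1, v2, v3⟩ := ackLevel_spec hp'
  rw [← hl] at v1 v2 v3
  set i := ackLevel z p
  have hmono : ∀ j ∈ Finset.Icc 1 a, z + 1 - ackIndex j P ≤ z + 1 - ackIndex j p := fun j _ => by
    have := ackIndex_mono j (h2.le.trans h3)
    omega
  rcases Nat.eq_zero_or_pos i with hi | hi
  · have := Finset.sum_le_sum hmono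
    rw [hi, tarjanA_zero] at u1
    simp only [nodePot]
    omega
  · obtain ⟨k, hk⟩ : ∃ k, i = k + 1 := ⟨i - 1, by omega⟩
    rw [hk] at u1 u2 u3 v3
    -- The higher node does not have level k, so A(k,z') ≤ p', and p ≤ z' because the parent of the
    -- lower node is not above the higher node.
    have hA : tarjanA k p ≤ P :=
      ((tarjanA_strictMono k).monotone h1).trans ((v3 k (by omega)).trans h3)
    have hidx : ackIndex (k + 1) p < ackIndex (k + 1) P := by
      apply lt_ackIndex
      have hpos : ackIndex (k + 1) p ≠ 0 := fun h0 => by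
        have := lt_tarjanA_ackIndex (k + 1) p
        rw [h0, tarjanA_succ_zero] at this
        omega
      obtain ⟨y, hy⟩ := Nat.exists_eq_succ_of_ne_zero hpos
      have hyp : tarjanA (k + 1) y ≤ p := by
        by_contra hc
        have := ackIndex_le (not_le.1 hc)
        omega
      rw [hy]
      rcases Nat.eq_zero_or_pos y with rfl | hy0
      -- Index 1 would mean p < 2, but level k+1 forces p ≥ A(k,z) ≥ 2z. This is where z ≥ 4 keeps
      -- away the irregular initial values of A.
      · have h4 := lt_tarjanA_ackIndex (k + 1) p
        rw [hy, tarjanA_one] at h4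
        have h5 := u3 k (by omega)
        have h6 := two_mul_le_tarjanA k z
        omega
      · rw [Nat.succ_eq_add_one, tarjanA_succ_succ k hy0]
        exact ((tarjanA_strictMono k).monotone hyp).trans hA
    have hz' := ackIndex_le u1
    have := Finset.sum_lt_sum hmono ⟨k + 1, Finset.mem_Icc.2 ⟨by omega, u2⟩, by omega⟩
    simp only [nodePot]
    omega

/-! ### Path compression -/

/-- `l` lists the nodes from `x` up to the node `u`, without `u`, that parent pointers lead through. -/
inductive PathTo (par : ℕ → ℕ) (u : ℕ) : ℕ → List ℕ → Prop where
  | nil : PathTo par u u []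
  | cons {x : ℕ} {l : List ℕ} (hx : x ≠ u) (h : PathTo par u (par x) l) : PathTo par u x (x :: l)

theorem PathTo.height_le {par ht : ℕ → ℕ} {u x : ℕ} {l : List ℕ} (h : PathTo par u x l)
    (hl : ∀ y ∈ l, ht y < ht (par y)) :
    ht x ≤ ht u ∧ ∀ y ∈ l, ht x ≤ ht y ∧ ht (par y) ≤ ht u := by
  induction h with
  | nil => simp
  | @cons x l hx h ih =>
    simp only [List.mem_cons, forall_eq_or_imp] at hl ⊢
    obtain ⟨h1, h2⟩ := ih hl.2
    refine ⟨hl.1.le.trans h1, ⟨le_rfl, h1⟩, fun y hy => ⟨hl.1.le.trans (h2 y hy).1, (h2 y hy).2⟩⟩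

theorem PathTo.nodup {par ht : ℕ → ℕ} {u x : ℕ} {l : List ℕ} (h : PathTo par u x l)
    (hl : ∀ y ∈ l, ht y < ht (par y)) : l.Nodup := by
  induction h with
  | nil => simp
  | @cons x l hx h ih =>
    simp only [List.mem_cons, forall_eq_or_imp] at hl
    refine List.nodup_cons.2 ⟨fun hm => ?_, ih hl.2⟩
    have := (h.height_le hl.2).2 x hm
    omega

/-- Induction from the top of the path downwards, where `s` collects the levels met so far. A node
whose level is already in `s` has a node of the same level above it and pays for itself by
`nodePot_lt`. Otherwise its level is new and the unit is charged to `s`. Since all heights are below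
A(a,q), only the levels 0, …, a occur. -/
theorem PathTo.potential {par ht : ℕ → ℕ} {u x a q : ℕ} {l : List ℕ} (h : PathTo par u x l)
    (hq : 4 ≤ q) (hl : ∀ y ∈ l, ht y < ht (par y)) (hu : ht u < tarjanA a q) :
    ∃ s ⊆ Finset.range (a + 1),
      (∀ i ∈ s, ∃ y ∈ l, ackLevel (max (ht y) q) (ht (par y)) = i) ∧
      l.length + (l.map fun y => nodePot a (max (ht y) q) (ht u)).sum ≤
        (l.map fun y => nodePot a (max (ht y) q) (ht (par y))).sum + s.card := by
  induction h with
  | nil => exact ⟨∅, by simp⟩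
  | @cons x l hx h ih =>
    have hl' := hl
    simp only [List.mem_cons, forall_eq_or_imp] at hl'
    obtain ⟨s, hs, hs1, hs2⟩ := ih hl'.2
    have hh := h.height_le hl'.2
    have hA : ∀ y, ht u < tarjanA a (max (ht y) q) := fun y =>
      hu.trans_le ((tarjanA_strictMono a).monotone (le_max_right _ _))
    simp only [List.length_cons, List.map_cons, List.sum_cons, List.mem_cons]
    set i := ackLevel (max (ht x) q) (ht (par x)) with hi
    by_cases his : i ∈ s
    · obtain ⟨y, hy, hyi⟩ := hs1 i his
      have h4 := hh.2 y hy
      have := nodePot_lt (a := a) (z := max (ht x) q) (z' := max (ht y) q) (p := ht (par x))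
        (p' := ht (par y)) (P := ht u) (by omega) (hh.1.trans_lt (hA x)) (h4.2.trans_lt (hA y))
        (by omega) (by have := hl'.2 y hy; omega) h4.2 (by rw [hyi])
      exact ⟨s, hs, fun j hj => (hs1 j hj).imp fun y hy => ⟨.inr hy.1, hy.2⟩, by omega⟩
    · refine ⟨insert i s, ?_, ?_, ?_⟩
      · refine Finset.insert_subset (Finset.mem_range.2 ?_) hs
        have := (ackLevel_spec (hh.1.trans_lt (hA x))).2.1
        omega
      · intro j hj
        rcases Finset.mem_insert.1 hj with rfl | hj
        · exact ⟨x, .inl rfl, rfl⟩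
        · exact (hs1 j hj).imp fun y hy => ⟨.inr hy.1, hy.2⟩
      · rw [Finset.card_insert_of_notMem his]
        have := nodePot_anti a (max (ht x) q) hh.1
        omega

/-- The potential of a forest on the set `D` of nodes. -/
noncomputable def forestPot (a q : ℕ) (ht : ℕ → ℕ) (D : Finset ℕ) (par : ℕ → ℕ) : ℕ :=
  ∑ v ∈ D, nodePot a (max (ht v) q) (ht (par v))

/-- The parent pointers after the compression of the path `l` to the node `u`. -/
def compress (par : ℕ → ℕ) (u : ℕ) (l : List ℕ) (v : ℕ) : ℕ := if v ∈ l then u else par v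

/-- The amortised cost of a compression is a + 1, the number of possible levels. Nodes off the path
keep their parent and hence their potential. -/
theorem PathTo.forestPot_compress {par ht : ℕ → ℕ} {u x a q : ℕ} {l : List ℕ} {D : Finset ℕ}
    (h : PathTo par u x l) (hq : 4 ≤ q) (hl : ∀ y ∈ l, ht y < ht (par y) ∧ y ∈ D)
    (hu : ht u < tarjanA a q) :
    l.length + forestPot a q ht D (compress par u l) ≤ forestPot a q ht D par + (a + 1) := by
  have hl1 : ∀ y ∈ l, ht y < ht (par y) := fun y hy => (hl y hy).1
  obtain ⟨s, hs, -, hs2⟩ := h.potential hq hl1 hu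
  have hc := Finset.card_le_card hs
  rw [Finset.card_range] at hc
  have hnd := h.nodup hl1
  have hsub : l.toFinset ⊆ D := fun y hy => (hl y (List.mem_toFinset.1 hy)).2
  rw [← List.sum_toFinset _ hnd, ← List.sum_toFinset _ hnd] at hs2
  simp only [forestPot]
  rw [← Finset.sum_sdiff hsub, ← Finset.sum_sdiff hsub (f := fun v => nodePot a _ (ht (par v)))]
  have e1 : ∑ v ∈ D \ l.toFinset, nodePot a (max (ht v) q) (ht (compress par u l v)) =
      ∑ v ∈ D \ l.toFinset, nodePot a (max (ht v) q) (ht (par v)) :=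
    Finset.sum_congr rfl fun v hv => by
      simp only [Finset.mem_sdiff, List.mem_toFinset] at hv
      simp [compress, hv.2]
  have e2 : ∑ v ∈ l.toFinset, nodePot a (max (ht v) q) (ht (compress par u l v)) =
      ∑ v ∈ l.toFinset, nodePot a (max (ht v) q) (ht u) :=
    Finset.sum_congr rfl fun v hv => by
      simp only [List.mem_toFinset] at hv
      simp [compress, hv]
  rw [e1, e2]
  omega

/-! ### Heights in a complete binary tree in heap order -/

/-- The height of the node `v` of the complete binary tree of height `h` with root `1`, in which the
children of `v` are `2v` and `2v+1`. -/
def heapHeight (h v : ℕ) : ℕ := h - Nat.log 2 v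

theorem heapHeight_div {h v : ℕ} (k : ℕ) (hv : 2 ^ k ≤ v) (hv' : v < 2 ^ (h + 1)) :
    heapHeight h (v / 2 ^ k) = heapHeight h v + k := by
  have h0 : 0 < 2 ^ k := by positivity
  have h1 : Nat.log 2 v < h + 1 := Nat.log_lt_of_lt_pow (by omega) hv'
  have h2 : k ≤ Nat.log 2 v := Nat.le_log_of_pow_le (by norm_num) hv
  have h3 : Nat.log 2 (v / 2 ^ k) = Nat.log 2 v - k := Nat.log_div_base_pow 2 v k
  simp only [heapHeight, h3]
  omega

/-- A further layer of leaves raises the height of each of the 2^(h+1) - 1 old nodes by one and adds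
only nodes of height zero. -/
theorem sum_heapHeight (h : ℕ) : ∑ v ∈ Finset.Ico 1 (2 ^ (h + 1)), heapHeight h v + h + 2 = 2 ^ (h + 1) := by
  induction h with
  | zero => simp [heapHeight]
  | succ h ih =>
    have h1 : 1 ≤ 2 ^ (h + 1) := Nat.one_le_two_pow
    have h2 : 2 ^ (h + 1) ≤ 2 ^ (h + 1 + 1) := Nat.pow_le_pow_right (by norm_num) (by omega)
    rw [← Finset.sum_Ico_consecutive _ h1 h2]
    have e1 : ∑ v ∈ Finset.Ico (2 ^ (h + 1)) (2 ^ (h + 1 + 1)), heapHeight (h + 1) v = 0 := by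
      refine Finset.sum_eq_zero fun v hv => ?_
      rw [Finset.mem_Ico] at hv
      have : h + 1 ≤ Nat.log 2 v := Nat.le_log_of_pow_le (by norm_num) hv.1
      simp only [heapHeight]
      omega
    have e2 : ∑ v ∈ Finset.Ico 1 (2 ^ (h + 1)), heapHeight (h + 1) v =
        ∑ v ∈ Finset.Ico 1 (2 ^ (h + 1)), (heapHeight h v + 1) := by
      refine Finset.sum_congr rfl fun v hv => ?_
      rw [Finset.mem_Ico] at hv
      have : Nat.log 2 v < h + 1 := Nat.log_lt_of_lt_pow (by omega) hv.2
      simp only [heapHeight]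
      omega
    rw [e1, e2, Finset.sum_add_distrib, Finset.sum_const, Nat.card_Ico, smul_eq_mul, mul_one]
    have : 2 ^ (h + 1 + 1) = 2 * 2 ^ (h + 1) := by ring
    omega

/-- The bound holds for arbitrary parent pointers. The part of max(height, q) that comes from the
heights contributes linearly by `sum_heapHeight`, so the total is of order a · 2^h · q. -/
theorem forestPot_le (a q h : ℕ) (par : ℕ → ℕ) :
    forestPot a q (heapHeight h) (Finset.Ico 2 (2 ^ (h + 1))) par ≤
      (a + 2) * (2 ^ (h + 1) * (q + 2)) := by
  have h1 : ∀ v, nodePot a (max (heapHeight h v) q) (heapHeight h (par v)) ≤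
      (a + 2) * (heapHeight h v + (q + 1)) := fun v =>
    (nodePot_le _ _ _).trans (Nat.mul_le_mul_left _ (by omega))
  refine (Finset.sum_le_sum fun v _ => h1 v).trans ?_
  rw [← Finset.mul_sum]
  refine Nat.mul_le_mul_left _ ?_
  have h2 := sum_heapHeight h
  have h3 : ∑ v ∈ Finset.Ico 2 (2 ^ (h + 1)), (heapHeight h v + (q + 1)) ≤
      ∑ v ∈ Finset.Ico 1 (2 ^ (h + 1)), (heapHeight h v + (q + 1)) :=
    Finset.sum_le_sum_of_subset (Finset.Ico_subset_Ico_left (by norm_num))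
  rw [Finset.sum_add_distrib (s := Finset.Ico 1 (2 ^ (h + 1))), Finset.sum_const, Nat.card_Ico,
    smul_eq_mul] at h3
  have h4 : (2 ^ (h + 1) - 1) * (q + 1) ≤ 2 ^ (h + 1) * (q + 1) := Nat.mul_le_mul_right _ (by omega)
  have h5 : 2 ^ (h + 1) * (q + 2) = 2 ^ (h + 1) * (q + 1) + 2 ^ (h + 1) := by ring
  omega

/-! ### The order of the variables along a vtree -/

/-- The leaves of `T` have the positions `1, 2, …` from left to right. -/
def VTree.Positions {n : ℕ} (T : VTree n) (pos : ℕ → ℕ) : Prop :=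
  ∀ i (h : i < T.leaves.length), pos (T.leaves[i]) = i + 1

namespace VTree

variable {n : ℕ}

/-- The number of nodes. -/
def nodes : VTree n → ℕ
  | .leaf _ => 1
  | .node l r => l.nodes + r.nodes + 1

theorem nodes_add_one (T : VTree n) : T.nodes + 1 = 2 * T.leaves.length := by
  induction T with
  | leaf x => rfl
  | node l r hl hr => simp only [nodes, leaves, List.length_append]; omega

theorem IsVTree.length_leaves {T : VTree n} (h : T.IsVTree) : T.leaves.length = n := by
  rw [← List.toFinset_card_of_nodup h.1, Finset.eq_univ_iff_forall.2 fun x =>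
    List.mem_toFinset.2 (h.2 x), Finset.card_univ, Fintype.card_fin]

theorem IsVTree.pos {T : VTree n} (h : T.IsVTree) : 1 ≤ n := by
  have := h.length_leaves
  have := T.nodes_add_one
  omega

theorem StoredAt.lt {s : RamState} {T : VTree n} {v : ℕ} (h : T.StoredAt s v) : v < 2 * n - 1 := by
  cases T with
  | leaf x => exact h.1
  | node l r => exact h.1

theorem Positions.pos_le {T : VTree n} {pos : ℕ → ℕ} (h : T.Positions pos) (hT : T.IsVTree)
    (x : Fin n) : 1 ≤ pos x ∧ pos x ≤ n := by
  obtain ⟨i, hi, rfl⟩ := List.getElem_of_mem (hT.2 x)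
  have := hT.length_leaves
  rw [h i hi]
  omega

theorem Positions.injective {T : VTree n} {pos : ℕ → ℕ} (h : T.Positions pos) (hT : T.IsVTree)
    {x y : Fin n} (hxy : pos x = pos y) : x = y := by
  obtain ⟨i, hi, rfl⟩ := List.getElem_of_mem (hT.2 x)
  obtain ⟨j, hj, rfl⟩ := List.getElem_of_mem (hT.2 y)
  rw [h i hi, h j hj] at hxy
  congr 1
  omega

theorem Desc.leaves_infix {s t : VTree n} (h : Desc s t) : s.leaves <:+: t.leaves := by
  induction h with
  | refl => exact List.infix_rfl
  | left r h ih => exact ih.trans (List.prefix_append _ _).isInfix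
  | right l h ih => exact ih.trans (List.suffix_append _ _).isInfix

theorem Positions.lt {T l r : VTree n} {pos : ℕ → ℕ} (h : T.Positions pos)
    (hd : Desc (.node l r) T) {x y : Fin n} (hx : x ∈ l.leaves) (hy : y ∈ r.leaves) :
    pos x < pos y := by
  obtain ⟨a, b, hab⟩ := hd.leaves_infix
  obtain ⟨i, hi, rfl⟩ := List.getElem_of_mem hx
  obtain ⟨j, hj, rfl⟩ := List.getElem_of_mem hy
  simp only [leaves] at hab
  have h1 := h (a.length + i) (by rw [← hab]; simp only [List.length_append]; omega)
  have h2 := h (a.length + l.leaves.length + j) (by rw [← hab]; simp only [List.length_append]; omega)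
  simp only [← hab] at h1 h2
  rw [List.getElem_append_left (by simp only [List.length_append]; omega),
    List.getElem_append_right (by omega), List.getElem_append_left (by simp; omega)] at h1
  rw [List.getElem_append_left (by simp only [List.length_append]; omega),
    List.getElem_append_right (by omega), List.getElem_append_right (by omega)] at h2
  simp only [Nat.add_sub_cancel_left] at h1
  simp only [show a.length + l.leaves.length + j - a.length - l.leaves.length = j by omega] at h2
  rw [h1, h2]
  omega

end VTree

/-! ### Traversal of the vtree -/

/-- The left child is pushed above the right one, so leaves are popped from left to right. -/
def traverseBody : RamProg :=
  .assign 5 (.op .sub (.reg 5) (.const 1)) ;;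
  .assign 7 (.load 8 (.reg 5)) ;;
  .ite (.load 4 (.reg 7))
    (.store 8 (.reg 5) (.load 6 (.reg 7)) ;;
      .store 8 (.op .add (.reg 5) (.const 1)) (.load 5 (.reg 7)) ;;
      .assign 5 (.op .add (.reg 5) (.const 2)))
    (.assign 6 (.op .add (.reg 6) (.const 1)) ;;
      .store 7 (.load 5 (.reg 7)) (.reg 6))

/-- Depth-first traversal of the vtree: register 5 is the height of the stack in bank 8, register 6
the number of leaves found, and the positions of the variables are written to bank 7. -/
def traverse : RamProg :=
  (.assign 6 (.const 0) ;; .store 8 (.const 0) (.reg 3) ;; .assign 5 (.const 1)) ;;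
  .while (.reg 5) traverseBody

/-- The leaves found, followed by the leaves of the subtrees on the stack read from the top, always
make up all leaves of `T`. The number of nodes in these subtrees drops by exactly one per round. -/
theorem traverse_spec {n : ℕ} {T : VTree n} (hT : T.IsVTree) {s : RamState} {V : ℕ}
    (hs : T.StoredAt s (s.reg 3)) (hV : 2 * n ≤ V) :
    Runs V traverse s (100 * n) fun s' => T.Positions (s'.mem 7) := by
  have hn := hT.pos
  set s₁ := ((s.setReg 6 0).setMem 8 0 (s.reg 3)).setReg 5 1 with hs₁
  refine (Runs.step_seq (T := 10) rfl (by decide) (by simp) (Runs.count (s := s₁) 30 (fun k s' => ∃ (ts : List (VTree n)) (done : List (Fin n)),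
    k = (ts.map VTree.nodes).sum ∧ s'.reg 5 = ts.length ∧ s'.reg 6 = done.length ∧
    (∀ i (h : i < ts.length), ts[i].StoredAt s (s'.mem 8 i)) ∧
    (∀ i (h : i < done.length), s'.mem 7 done[i] = i + 1) ∧
    done ++ (ts.reverse.flatMap VTree.leaves) = T.leaves) T.nodes ⟨[T], [], ?_⟩ ?_ ?_ ?_)).mono ?_
    fun s' _ h => h
  · simpa [hs₁] using hs
  · intro k s' ha _
    simp
  · rintro k s' ha ⟨ts, done, hk, h5, h6, hts, hdone, hleaves⟩
    have e4 : s'.mem 4 = s.mem 4 := (ha.2 4 (by decide)).trans (by simp [hs₁])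
    have e5 : s'.mem 5 = s.mem 5 := (ha.2 5 (by decide)).trans (by simp [hs₁])
    have e6 : s'.mem 6 = s.mem 6 := (ha.2 6 (by decide)).trans (by simp [hs₁])
    rcases List.eq_nil_or_concat ts with rfl | ⟨ts, t, rfl⟩
    · simp at hk
    · have ht := hts ts.length (by simp)
      simp only [List.concat_eq_append, List.length_append, List.length_cons, List.length_nil] at h5 ht
      have hts' : ∀ i (h : i < ts.length), ts[i].StoredAt s (s'.mem 8 i) := fun i h => by
        simpa [List.getElem_append_left h] using hts i (by simp; omega)
      simp only [List.getElem_append_right le_rfl, Nat.sub_self,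
        List.getElem_cons_zero] at ht
      refine ⟨by simp [h5], ?_⟩
      cases t with
      | leaf x =>
        obtain ⟨u1, u2, u3⟩ := ht
        refine Runs.of_loopFree rfl (by decide) ?_ ⟨ts, done ++ [x], ?_⟩
        · simp [traverseBody, h5, e4, e5, e6, u2, u3]
          omega
        · simp [traverseBody, h5, e4, e5, u2, u3, h6]
          refine ⟨by simp [VTree.nodes] at hk; omega, hts', fun i hi => ?_, ?_⟩
          · rcases Nat.lt_or_eq_of_le hi with h | rfl
            · rw [List.getElem_append_left h, Function.update_apply, if_neg, hdone i h]
              intro hxx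
              -- As the leaves of a vtree are distinct, the new entry does not overwrite the
              -- position of a variable found earlier.
              have hnd := hT.1
              rw [← hleaves] at hnd
              refine List.disjoint_of_nodup_append hnd (List.getElem_mem h) ?_
              simp [VTree.leaves, Fin.ext hxx]
            · simp
          · simpa [VTree.leaves] using hleaves
      | node l r =>
        obtain ⟨u1, u2, u3, u4⟩ := ht
        refine Runs.of_loopFree rfl (by decide) ?_ ⟨ts ++ [r, l], done, ?_⟩
        · have := u3.lt
          have := u4.lt
          simp [traverseBody, h5, e4, e5, e6, u2]
          omega
        · simp [traverseBody, h5, e4, e5, e6, u2, h6]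
          refine ⟨by simp [VTree.nodes] at hk; omega, fun i hi => ?_, hdone, ?_⟩
          · rcases Nat.lt_or_ge i ts.length with h | h
            · rw [List.getElem_append_left h]
              simp only [Function.update_apply]
              rw [if_neg (by omega), if_neg (by omega)]
              exact hts' i h
            · rw [List.getElem_append_right h]
              obtain rfl | rfl : i = ts.length ∨ i = ts.length + 1 := by omega
              · simpa using u4
              · simpa using u3
          · simpa [VTree.leaves] using hleaves
  · rintro s' ha ⟨ts, done, hk, h5, h6, hts, hdone, hleaves⟩
    have : ts = [] := by
      cases ts with
      | nil => rfl
      | cons t ts =>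
        have : 1 ≤ t.nodes := by cases t <;> simp [VTree.nodes]
        simp at hk
        omega
    subst this
    simp at hleaves
    subst hleaves
    exact ⟨by simpa using h5, hdone⟩
  · have := T.nodes_add_one
    rw [hT.length_leaves] at this
    rw [this]
    simp only [RamExp.cost]
    omega

/-! ### The layout of a circuit in memory -/

/-- The circuit `C` is represented by the arrays of types, of variables, of starting positions of the
lists of children, and of children. -/
structure Circuit.Layout {n : ℕ} (C : Circuit n) (ty var off ch : ℕ → ℕ) : Prop where
  ty_eq : ∀ i : Fin C.N, ty i = (C.gate i).code
  var_eq : ∀ (i : Fin C.N) x b, C.gate i = .lit x b → var i = x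
  off_zero : off 0 = 0
  off_succ : ∀ i : Fin C.N, off (i + 1) = off i + (C.gate i).children.length
  ch_eq : ∀ (i : Fin C.N) (k : ℕ) (hk : k < (C.gate i).children.length),
    ch (off i + k) = (C.gate i).children[k]

theorem Circuit.StoredIn.layout {n : ℕ} {C : Circuit n} {s : RamState} (h : C.StoredIn s) :
    C.Layout (s.mem 0) (s.mem 1) (s.mem 2) (s.mem 3) :=
  ⟨h.2.2.1, h.2.2.2.1, h.2.2.2.2.1, h.2.2.2.2.2.1, h.2.2.2.2.2.2⟩

namespace Circuit

variable {n : ℕ} {C : Circuit n}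

/-- Every gate other than the root has an incoming edge, because it is reachable. So times linear in
the number of gates are linear in the size. -/
theorem N_le (C : Circuit n) : C.N ≤ C.size + 1 := by
  classical
  have h : Finset.univ.erase C.root ⊆
      Finset.univ.biUnion fun p => (C.gate p).children.toFinset := by
    intro c hc
    rcases Relation.ReflTransGen.cases_tail (C.rooted c) with h | ⟨p, -, hp⟩
    · exact absurd h (Finset.ne_of_mem_erase hc)
    · exact Finset.mem_biUnion.2 ⟨p, Finset.mem_univ _, List.mem_toFinset.2 hp⟩
  have h1 := (Finset.card_le_card h).trans Finset.card_biUnion_le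
  have h2 : ∑ p, (C.gate p).children.toFinset.card ≤ C.size :=
    Finset.sum_le_sum fun p _ => List.toFinset_card_le _
  rw [Finset.card_erase_of_mem (Finset.mem_univ _), Finset.card_univ, Fintype.card_fin] at h1
  omega

namespace Layout

variable {ty var off ch : ℕ → ℕ}

theorem off_mono (h : C.Layout ty var off ch) {i j : ℕ} (hij : i ≤ j) (hj : j ≤ C.N) :
    off i ≤ off j := by
  induction j, hij using Nat.le_induction with
  | base => exact le_rfl
  | succ j _ ih =>
    have := h.off_succ ⟨j, hj⟩
    simp only at this
    have := ih (by omega)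
    omega

theorem off_last (h : C.Layout ty var off ch) : off C.N = C.size := by
  have key : ∀ k (hk : k ≤ C.N), off k = ∑ i : Fin k, (C.gate (i.castLE hk)).children.length := by
    intro k
    induction k with
    | zero => intro _; simpa using h.off_zero
    | succ k ih =>
      intro hk
      rw [Fin.sum_univ_castSucc]
      have h1 := h.off_succ ⟨k, hk⟩
      simp only at h1
      rw [h1, ih (by omega)]
      rfl
  exact key C.N le_rfl

theorem off_le (h : C.Layout ty var off ch) {i : ℕ} (hi : i ≤ C.N) : off i ≤ C.size :=
  h.off_last ▸ h.off_mono hi le_rfl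

theorem exists_owner (h : C.Layout ty var off ch) {e : ℕ} (he : e < C.size) :
    ∃ p : Fin C.N, off p ≤ e ∧ e < off (p + 1) := by
  rw [← h.off_last] at he
  have h0 : ∃ k, e < off k := ⟨_, he⟩
  classical
  have h1 := Nat.find_spec h0
  have h2 : Nat.find h0 ≤ C.N := Nat.find_le he
  have h3 : Nat.find h0 ≠ 0 := fun h3 => by rw [h3, h.off_zero] at h1; omega
  obtain ⟨p, hp⟩ := Nat.exists_eq_succ_of_ne_zero h3
  have h4 : off p ≤ e := not_lt.1 (Nat.find_min h0 (by omega))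
  refine ⟨⟨p, by omega⟩, h4, ?_⟩
  rwa [hp] at h1

theorem owner_unique (h : C.Layout ty var off ch) {e : ℕ} {p q : ℕ} (hp : p < C.N) (hq : q < C.N)
    (h1 : off p ≤ e) (h2 : e < off (p + 1)) (h3 : off q ≤ e) (h4 : e < off (q + 1)) : p = q := by
  rcases lt_trichotomy p q with h' | h' | h'
  · have := h.off_mono (show p + 1 ≤ q from h') hq.le
    omega
  · exact h'
  · have := h.off_mono (show q + 1 ≤ p from h') hp.le
    omega

theorem mem_children (h : C.Layout ty var off ch) {p c : Fin C.N} :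
    c ∈ (C.gate p).children ↔ ∃ e, off p ≤ e ∧ e < off (p + 1) ∧ ch e = c := by
  rw [h.off_succ]
  constructor
  · intro hc
    obtain ⟨k, hk, rfl⟩ := List.getElem_of_mem hc
    exact ⟨off p + k, by omega, by omega, h.ch_eq p k hk⟩
  · rintro ⟨e, h1, h2, h3⟩
    have := h.ch_eq p (e - off p) (by omega)
    rw [Nat.add_sub_cancel' h1, h3] at this
    rw [Fin.ext this]
    exact List.getElem_mem _

theorem ch_lt (h : C.Layout ty var off ch) {e : ℕ} (he : e < C.size) : ch e < C.N := by
  obtain ⟨p, h1, h2⟩ := h.exists_owner he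
  rw [h.off_succ] at h2
  have := h.ch_eq p (e - off p) (by omega)
  rw [Nat.add_sub_cancel' h1] at this
  rw [this]
  exact Fin.is_lt _

theorem exists_child (h : C.Layout ty var off ch) {p : Fin C.N} {e : ℕ} (h1 : off p ≤ e)
    (h2 : e < off (p + 1)) : ∃ c ∈ (C.gate p).children, ch e = c := by
  rw [h.off_succ] at h2
  have := h.ch_eq p (e - off p) (by omega)
  rw [Nat.add_sub_cancel' h1] at this
  exact ⟨_, List.getElem_mem _, this⟩

theorem edge_lt (h : C.Layout ty var off ch) {p : Fin C.N} {e : ℕ} (h2 : e < off (p + 1)) :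
    e < C.size := h2.trans_le (h.off_le p.2)

theorem ty_le (h : C.Layout ty var off ch) (p : Fin C.N) : ty p ≤ 3 := by
  rw [h.ty_eq]
  rcases C.gate p with ⟨x, _ | _⟩ | _ | _ <;> simp [Gate.code]

theorem ty_cases (h : C.Layout ty var off ch) (p : Fin C.N) :
    (∃ x b, C.gate p = .lit x b ∧ ty p = (if b then 1 else 0)) ∨
      (∃ cs, C.gate p = .or cs ∧ ty p = 2) ∨ ∃ cs, C.gate p = .and cs ∧ ty p = 3 := by
  have := h.ty_eq p
  rcases hg : C.gate p with ⟨x, _ | _⟩ | cs | cs <;> rw [hg] at this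
  · exact .inl ⟨x, false, rfl, this⟩
  · exact .inl ⟨x, true, rfl, this⟩
  · exact .inr (.inl ⟨cs, rfl, this⟩)
  · exact .inr (.inr ⟨cs, rfl, this⟩)

end Layout

/-- `ord` lists the gates of `C` such that every gate follows its parents. -/
structure TopoOrder (C : Circuit n) (ord : ℕ → ℕ) : Prop where
  lt : ∀ i < C.N, ord i < C.N
  inj : ∀ i < C.N, ∀ j < C.N, ord i = ord j → i = j
  surj : ∀ c : Fin C.N, ∃ i < C.N, ord i = c
  parent : ∀ j < C.N, ∀ p c : Fin C.N, ord j = c → c ∈ (C.gate p).children → ∃ i < j, ord i = p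

/-- Acyclicity is stated as well-foundedness towards the children. On a finite set the reverse of
its transitive closure is well-founded too, being transitive and irreflexive. -/
theorem exists_minimal_parent (C : Circuit n) (P : Fin C.N → Prop) {c : Fin C.N} (hc : P c) :
    ∃ c, P c ∧ ∀ p, c ∈ (C.gate p).children → ¬P p := by
  have hwf : WellFounded fun p c : Fin C.N =>
      Relation.TransGen (fun c p : Fin C.N => c ∈ (C.gate p).children) c p := by
    have h1 := C.acyclic.transGen
    have : Std.Irrefl fun p c : Fin C.N =>
        Relation.TransGen (fun c p : Fin C.N => c ∈ (C.gate p).children) c p :=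
      ⟨fun p hp => h1.irrefl.irrefl p hp⟩
    have : IsTrans _ fun p c : Fin C.N =>
        Relation.TransGen (fun c p : Fin C.N => c ∈ (C.gate p).children) c p :=
      ⟨fun a b c h h' => h'.trans h⟩
    exact Finite.wellFounded_of_trans_of_irrefl _
  obtain ⟨c, hc, h⟩ := hwf.has_min {c | P c} ⟨c, hc⟩
  exact ⟨c, hc, fun p hp hP => h p hP (.single hp)⟩

end Circuit

/-! ### Topological sorting -/

def indegreesBody : RamProg :=
  .assign 14 (.load 3 (.reg 9)) ;;
  .store 9 (.reg 14) (.op .add (.load 9 (.reg 14)) (.const 1)) ;;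
  .assign 9 (.op .add (.reg 9) (.const 1))

/-- The numbers of parents of the gates are written to bank 9. -/
def indegrees : RamProg :=
  (.assign 8 (.load 2 (.reg 0)) ;; .assign 9 (.const 0)) ;;
  .while (.op .lt (.reg 9) (.reg 8)) indegreesBody

/-- One round either removes a single edge of the gate at the head of the queue or advances the
head. This avoids a nested loop. -/
def topoSortBody : RamProg :=
  .assign 13 (.load 10 (.reg 10)) ;;
  .ite (.op .lt (.op .add (.load 2 (.reg 13)) (.reg 12))
      (.load 2 (.op .add (.reg 13) (.const 1))))
    (.assign 14 (.load 3 (.op .add (.load 2 (.reg 13)) (.reg 12))) ;;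
      .store 9 (.reg 14) (.op .sub (.load 9 (.reg 14)) (.const 1)) ;;
      .ite (.load 9 (.reg 14)) .skip
        (.store 10 (.reg 11) (.reg 14) ;; .assign 11 (.op .add (.reg 11) (.const 1))) ;;
      .assign 12 (.op .add (.reg 12) (.const 1)))
    (.assign 10 (.op .add (.reg 10) (.const 1)) ;; .assign 12 (.const 0))

/-- The gates are listed in bank 10 such that every gate follows its parents: registers 10 and 11 are
the head and the tail of a queue, and register 12 is the number of edges that have been removed from
the gate at its head. -/
def topoSort : RamProg :=
  indegrees ;;
  (.store 10 (.const 0) (.reg 1) ;; .assign 11 (.const 1) ;; .assign 10 (.const 0) ;;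
    .assign 12 (.const 0)) ;;
  .while (.op .lt (.reg 10) (.reg 11)) topoSortBody

theorem indegrees_spec {n : ℕ} {C : Circuit n} {s : RamState} {V : ℕ}
    (hl : C.Layout (s.mem 0) (s.mem 1) (s.mem 2) (s.mem 3)) (h0 : s.reg 0 = C.N)
    (h9 : ∀ i, s.mem 9 i = 0) (hV : C.size + 1 ≤ V) :
    Runs V indegrees s (10 + (C.size + 1) * 30) fun s' =>
      ∀ c, s'.mem 9 c = ((Finset.range C.size).filter fun e => s.mem 3 e = c).card := by
  refine (Runs.step_seq (T := 10) rfl (by decide) ?_ (Runs.count 26 (fun k s' =>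
    k + s'.reg 9 = C.size ∧ ∀ c, s'.mem 9 c = ((Finset.range (s'.reg 9)).filter
      fun e => s.mem 3 e = c).card) C.size ?_ ?_ ?_ ?_)).mono le_rfl fun s' _ h => h
  · simp [h0, hl.off_last]
    omega
  · simp [h9]
  · simp
  · rintro k s' ha ⟨hk, hc⟩
    have e3 : s'.mem 3 = s.mem 3 := (ha.2 3 (by decide)).trans (by simp)
    have e8 : s'.reg 8 = C.size := (ha.1 8 (by decide)).trans (by simp [h0, hl.off_last])
    have hlt := hl.ch_lt (e := s'.reg 9) (by omega)
    have := C.N_le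
    refine ⟨by simp [e8]; omega, Runs.of_loopFree rfl (by decide) ?_ ?_⟩
    · simp [indegreesBody, e3]
      omega
    · simp [indegreesBody, e3, Function.update_apply]
      refine ⟨by omega, fun c => ?_⟩
      rw [Finset.range_add_one, Finset.filter_insert]
      split_ifs with h1 h2 h2
      · rw [Finset.card_insert_of_notMem (by simp), hc, h1]
      · exact absurd h1.symm h2
      · exact absurd h2.symm h1
      · exact hc c
  · rintro s' ha ⟨hk, hc⟩
    have e8 : s'.reg 8 = C.size := (ha.1 8 (by decide)).trans (by simp [h0, hl.off_last])
    rw [show s'.reg 9 = C.size by omega] at hc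
    exact ⟨by simp [e8]; omega, hc⟩

/-- The state of the topological sorting: `R` is the set of edges that have been removed. -/
structure TopoInv {n : ℕ} (C : Circuit n) (off ch : ℕ → ℕ) (R : Finset ℕ) (deg ord : ℕ → ℕ)
    (head tail k : ℕ) : Prop where
  sub : R ⊆ Finset.range C.size
  mem_R : ∀ e, e ∈ R ↔ (∃ i < head, off (ord i) ≤ e ∧ e < off (ord i + 1)) ∨
    (head < tail ∧ off (ord head) ≤ e ∧ e < off (ord head) + k)
  deg_eq : ∀ c < C.N, deg c = ((Finset.range C.size \ R).filter fun e => ch e = c).card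
  lt : ∀ i < tail, ord i < C.N
  inj : ∀ i < tail, ∀ j < tail, ord i = ord j → i = j
  queue : ∀ c < C.N, (∃ i < tail, ord i = c) ↔ deg c = 0
  head_le : head ≤ tail
  k_le : head < tail → off (ord head) + k ≤ off (ord head + 1)
  parent : ∀ j < tail, ∀ p c : Fin C.N, ord j = c → c ∈ (C.gate p).children → ∃ i < j, ord i = p

namespace TopoInv

variable {n : ℕ} {C : Circuit n} {ty var off ch deg ord : ℕ → ℕ} {R : Finset ℕ} {head tail k : ℕ}

theorem tail_le (h : TopoInv C off ch R deg ord head tail k) : tail ≤ C.N := by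
  have := Finset.card_le_card_of_injOn (s := Finset.range tail) (t := Finset.range C.N) ord
    (fun i hi => by simpa using h.lt i (by simpa using hi))
    (fun i hi j hj hij => h.inj i (by simpa using hi) j (by simpa using hj) hij)
  simpa using this

/-- If some gate were missing when the queue is exhausted, then so would be one all of whose parents
are listed. All its incoming edges have been removed, hence its degree is zero and it is in the
queue after all. -/
theorem topoOrder (h : TopoInv C off ch R deg ord head tail k) (hl : C.Layout ty var off ch)
    (hh : tail ≤ head) : C.TopoOrder ord := by
  obtain rfl : head = tail := le_antisymm h.head_le hh
  have hall : ∀ c : Fin C.N, ∃ i < head, ord i = c := by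
    by_contra hc
    push Not at hc
    obtain ⟨c, hc⟩ := hc
    obtain ⟨c, hc, hmin⟩ := C.exists_minimal_parent (fun c => ∀ i < head, ord i ≠ c) hc
    have h1 : deg c ≠ 0 := fun h1 => by
      obtain ⟨i, hi, hi'⟩ := (h.queue c c.2).2 h1
      exact hc i hi hi'
    rw [h.deg_eq c c.2, Finset.card_ne_zero] at h1
    obtain ⟨e, he⟩ := h1
    simp only [Finset.mem_filter, Finset.mem_sdiff, Finset.mem_range] at he
    obtain ⟨p, hp1, hp2⟩ := hl.exists_owner he.1.1
    have h2 := hmin p (hl.mem_children.2 ⟨e, hp1, hp2, he.2⟩)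
    push Not at h2
    obtain ⟨i, hi, hi'⟩ := h2
    exact he.1.2 ((h.mem_R e).2 (.inl ⟨i, hi, by rw [hi']; exact hp1, by rw [hi']; exact hp2⟩))
  have hN : C.N ≤ head := by
    have := Finset.card_le_card_of_surjOn (s := Finset.range head) (t := Finset.range C.N) ord
      (fun c hc => by
        obtain ⟨i, hi, hi'⟩ := hall ⟨c, by simpa using hc⟩
        exact ⟨i, by simpa using hi, hi'⟩)
    simpa using this
  obtain rfl : head = C.N := le_antisymm h.tail_le hN
  exact ⟨h.lt, h.inj, hall, h.parent⟩

/-- Removing the next edge of the head lowers the degree of its target by one. The target is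
appended exactly when that degree becomes zero. -/
theorem edge (h : TopoInv C off ch R deg ord head tail k) (hl : C.Layout ty var off ch)
    (hh : head < tail) (hk : off (ord head) + k < off (ord head + 1)) {deg' : ℕ → ℕ}
    (hd : ∀ c, deg' c = if c = ch (off (ord head) + k) then deg c - 1 else deg c)
    {ord' : ℕ → ℕ} {tail' : ℕ}
    (hq : (deg' (ch (off (ord head) + k)) ≠ 0 ∧ ord' = ord ∧ tail' = tail) ∨
      (deg' (ch (off (ord head) + k)) = 0 ∧
        ord' = Function.update ord tail (ch (off (ord head) + k)) ∧ tail' = tail + 1)) :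
    ∃ R', R.card < R'.card ∧ TopoInv C off ch R' deg' ord' head tail' (k + 1) := by
  set e := off (ord head) + k with he
  have hp := h.lt head hh
  have heM : e < C.size := hl.edge_lt (p := ⟨_, hp⟩) hk
  -- An edge has only one owner, and a gate occurs only once in the queue, so this edge cannot have
  -- been removed earlier.
  have heR : e ∉ R := by
    rw [h.mem_R]
    rintro (⟨i, hi, h1, h2⟩ | ⟨_, _, h2⟩)
    · have := hl.owner_unique (h.lt i (by omega)) hp h1 h2 (by omega) hk
      have := h.inj i (by omega) head hh this
      omega
    · omega
  have hc := hl.ch_lt heM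
  have hmemF : e ∈ (Finset.range C.size \ R).filter fun e' => ch e' = ch e := by
    simp [heM, heR]
  have hpos : 1 ≤ deg (ch e) := by
    rw [h.deg_eq _ hc]
    exact Finset.card_pos.2 ⟨e, hmemF⟩
  have hnq : ∀ i < tail, ord i ≠ ch e := fun i hi hi' => by
    have := (h.queue _ hc).1 ⟨i, hi, hi'⟩
    omega
  have hdeg : ∀ c < C.N, deg' c =
      ((Finset.range C.size \ insert e R).filter fun e => ch e = c).card := by
    intro c hcN
    rw [hd, Finset.sdiff_insert, Finset.filter_erase]
    split_ifs with h1
    · subst h1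
      rw [Finset.card_erase_of_mem hmemF, h.deg_eq _ hc]
    · rw [Finset.erase_eq_of_notMem (by simp [Ne.symm h1]), h.deg_eq _ hcN]
  have hord : ∀ i < tail, ord' i = ord i := fun i hi => by
    rcases hq with ⟨-, h1, -⟩ | ⟨-, h1, -⟩
    · rw [h1]
    · rw [h1, Function.update_apply, if_neg (by omega)]
  have hoh := hord head hh
  have htail : tail ≤ tail' := by omega
  have hmem : ∀ e', e' ∈ insert e R ↔ (∃ i < head, off (ord' i) ≤ e' ∧ e' < off (ord' i + 1)) ∨
      (head < tail' ∧ off (ord' head) ≤ e' ∧ e' < off (ord' head) + (k + 1)) := by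
    intro e'
    rw [Finset.mem_insert, h.mem_R, hoh]
    have : (∃ i < head, off (ord' i) ≤ e' ∧ e' < off (ord' i + 1)) ↔
        ∃ i < head, off (ord i) ≤ e' ∧ e' < off (ord i + 1) := by
      constructor <;> rintro ⟨i, hi, h'⟩ <;> refine ⟨i, hi, ?_⟩ <;>
        simpa only [hord i (by omega)] using h'
    rw [this]
    constructor
    · rintro (rfl | h' | h')
      · right; omega
      · exact .inl h'
      · right; omega
    · rintro (h' | h')
      · exact .inr (.inl h')
      · by_cases h2 : e' = e
        · exact .inl h2
        · exact .inr (.inr (by omega))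
  refine ⟨insert e R, by rw [Finset.card_insert_of_notMem heR]; omega, ?_, hmem, hdeg, ?_, ?_, ?_,
    by omega, fun _ => by rw [hoh]; omega, ?_⟩
  · exact Finset.insert_subset (Finset.mem_range.2 heM) h.sub
  · rcases hq with ⟨-, rfl, rfl⟩ | ⟨-, rfl, rfl⟩
    · exact h.lt
    · intro i hi
      rw [Function.update_apply]
      split_ifs
      exacts [hc, h.lt i (by omega)]
  · rcases hq with ⟨-, rfl, rfl⟩ | ⟨-, rfl, rfl⟩
    · exact h.inj
    · intro i hi j hj hij
      simp only [Function.update_apply] at hij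
      split_ifs at hij with h1 h2 h2
      · omega
      · exact absurd hij.symm (hnq j (by omega))
      · exact absurd hij (hnq i (by omega))
      · exact h.inj i (by omega) j (by omega) hij
  · intro c hcN
    by_cases hce : c = ch e
    · subst hce
      rcases hq with ⟨h1, rfl, rfl⟩ | ⟨h1, rfl, rfl⟩
      · exact ⟨fun ⟨i, hi, hi'⟩ => absurd hi' (hnq i hi), fun h' => absurd h' h1⟩
      · exact ⟨fun _ => h1, fun _ => ⟨tail, by omega, by simp⟩⟩
    · rw [hd, if_neg hce, ← h.queue c hcN]
      constructor
      · rintro ⟨i, hi, hi'⟩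
        by_cases hit : i < tail
        · exact ⟨i, hit, by rw [← hord i hit, hi']⟩
        · rcases hq with ⟨h1, rfl, rfl⟩ | ⟨h1, rfl, rfl⟩
          · omega
          · obtain rfl : i = tail := by omega
            simp at hi'
            exact absurd hi'.symm hce
      · rintro ⟨i, hi, hi'⟩
        exact ⟨i, by omega, by rw [hord i hi, hi']⟩
  · intro j hj p c hjc hcp
    by_cases hjt : j < tail
    · obtain ⟨i, hi, hi'⟩ := h.parent j hjt p c (by rw [← hord j hjt, hjc]) hcp
      exact ⟨i, hi, by rw [hord i (by omega), hi']⟩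
    · have h1 : deg' (ch e) = 0 ∧ j = tail ∧ ord' j = ch e := by
        rcases hq with ⟨h1, rfl, rfl⟩ | ⟨h1, rfl, rfl⟩
        · omega
        · obtain rfl : j = tail := by omega
          exact ⟨h1, rfl, by simp⟩
      obtain ⟨e', h3, h4, h5⟩ := hl.mem_children.1 hcp
      -- The degree of the new entry is zero, so all its incoming edges are removed. Hence each of
      -- its parents is at or before the head.
      have h6 : e' ∈ insert e R := by
        have h2 := h1.1
        rw [hdeg _ hc, Finset.card_eq_zero] at h2
        by_contra hn
        have : e' ∈ (Finset.range C.size \ insert e R).filter fun e' => ch e' = ch e := by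
          rw [Finset.mem_filter, Finset.mem_sdiff, Finset.mem_range]
          exact ⟨⟨hl.edge_lt h4, hn⟩, by rw [h5, ← hjc, h1.2.2]⟩
        rw [h2] at this
        simp at this
      rcases (hmem e').1 h6 with ⟨i, hi, h7, h8⟩ | ⟨-, h7, h8⟩
      · refine ⟨i, by omega, ?_⟩
        rw [hord i (by omega)] at h7 h8 ⊢
        exact hl.owner_unique (h.lt i (by omega)) p.2 h7 h8 h3 h4
      · refine ⟨head, by omega, ?_⟩
        rw [hoh] at h7 h8 ⊢
        exact hl.owner_unique hp p.2 h7 (by omega) h3 h4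

theorem advance (h : TopoInv C off ch R deg ord head tail k) (hl : C.Layout ty var off ch)
    (hh : head < tail)
    (hk : ¬off (ord head) + k < off (ord head + 1)) :
    TopoInv C off ch R deg ord (head + 1) tail 0 := by
  have h1 := h.k_le hh
  refine ⟨h.sub, fun e => ?_, h.deg_eq, h.lt, h.inj, h.queue, hh, fun h' => ?_, h.parent⟩
  · rw [h.mem_R]
    constructor
    · rintro (⟨i, hi, h'⟩ | h')
      · exact .inl ⟨i, by omega, h'⟩
      · exact .inl ⟨head, by omega, by omega⟩
    · rintro (⟨i, hi, h'⟩ | h')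
      · by_cases hih : i < head
        · exact .inl ⟨i, hih, h'⟩
        · obtain rfl : i = head := by omega
          exact .inr (by omega)
      · omega
  · have := h.lt _ h'
    have := hl.off_mono (show ord (head + 1) ≤ ord (head + 1) + 1 by omega) (by omega)
    omega

end TopoInv

theorem topoSort_spec {n : ℕ} {C : Circuit n} {s : RamState} {V : ℕ} (hs : C.StoredIn s)
    (h9 : ∀ i, s.mem 9 i = 0) (hV : C.size + 1 ≤ V) :
    Runs V topoSort s (250 * (C.size + 1)) fun s' => C.TopoOrder (s'.mem 10) := by
  have hl := hs.layout
  have hN := C.N_le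
  -- A parent of the root would be reachable from the root and close a cycle.
  have hroot : ∀ p, C.root ∉ (C.gate p).children := fun p hp => by
    have h1 : Relation.TransGen (fun c p : Fin C.N => c ∈ (C.gate p).children) C.root C.root := by
      have h2 := (C.rooted p).swap
      exact Relation.TransGen.head' hp h2
    exact C.acyclic.transGen.irrefl.irrefl _ h1
  refine ((indegrees_spec hl hs.1 h9 hV).seq (T' := 30 + (C.size + (C.size + 1) + 1) * 80)
    fun s₁ ha₁ hdeg => ?_).mono (by omega) fun s' _ h => h
  have f0 : s₁.mem 2 = s.mem 2 := ha₁.2 2 (by decide)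
  have f1 : s₁.mem 3 = s.mem 3 := ha₁.2 3 (by decide)
  have f2 : s₁.reg 1 = C.root := (ha₁.1 1 (by decide)).trans hs.2.1
  refine Runs.step_seq (T := 30) rfl (by decide) (by simp) ?_
  -- The sum of the number of removed edges and the position of the head increases in every round
  -- and is at most the number of edges plus the number of gates.
  refine (Runs.while_lt 70 (fun k s' => ∃ R, k + (R.card + s'.reg 10) = C.size + C.N ∧
    TopoInv C (s.mem 2) (s.mem 3) R (s'.mem 9) (s'.mem 10) (s'.reg 10) (s'.reg 11) (s'.reg 12))
    (C.size + C.N) ⟨∅, by simp, ?_⟩ ?_ ?_ ?_).mono ?_ fun s' _ h => h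
  · simp [f2]
    refine ⟨by simp, by simp, by simp [hdeg], by simp, by simp, ?_, by simp, ?_, ?_⟩
    -- Initially the queue holds the root only. It is the one gate without incoming edges, every
    -- other gate being reachable.
    · intro c hc
      rw [hdeg, Finset.card_eq_zero, Finset.filter_eq_empty_iff]
      constructor
      · rintro ⟨i, hi, hi'⟩ e he hec
        obtain ⟨p, hp1, hp2⟩ := hl.exists_owner (Finset.mem_range.1 he)
        obtain rfl : i = 0 := by omega
        simp at hi'
        exact hroot p (hl.mem_children.2 ⟨e, hp1, hp2, by rw [hec, ← hi']⟩)
      · intro h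
        refine ⟨0, by omega, ?_⟩
        rcases Relation.ReflTransGen.cases_tail (C.rooted ⟨c, hc⟩) with h' | ⟨p, -, hp⟩
        · simp [← h']
        · obtain ⟨e, h3, h4, h5⟩ := hl.mem_children.1 hp
          exact absurd h5 (h (Finset.mem_range.2 (hl.edge_lt h4)))
    · intro _
      simpa using hl.off_mono (show (C.root : ℕ) ≤ C.root + 1 by omega) (by omega)
    · intro j hj p c hjc hcp
      obtain rfl : j = 0 := by omega
      simp at hjc
      exact absurd hcp (Fin.ext hjc ▸ hroot p)
  · simp
  · rintro k s' ha ⟨R, hk, hI⟩ hcond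
    have e2 : s'.mem 2 = s.mem 2 := (ha.2 2 (by decide)).trans (by simp [f0])
    have e3 : s'.mem 3 = s.mem 3 := (ha.2 3 (by decide)).trans (by simp [f1])
    have hlt : s'.reg 10 < s'.reg 11 := by
      by_contra h
      simp [h] at hcond
    have hp := hI.lt _ hlt
    have h1 := hl.off_le (Nat.le_of_lt hp)
    have h2 := hl.off_le (i := s'.mem 10 (s'.reg 10) + 1) hp
    have htail := hI.tail_le
    have hR := Finset.card_le_card hI.sub
    rw [Finset.card_range] at hR
    by_cases hkk : s.mem 2 (s'.mem 10 (s'.reg 10)) + s'.reg 12 < s.mem 2 (s'.mem 10 (s'.reg 10) + 1)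
    · have hch := hl.ch_lt (hl.edge_lt (p := ⟨_, hp⟩) hkk)
      refine Runs.of_loopFree rfl (by decide) ?_ ?_
      · simp [topoSortBody, e2, e3, hkk]
        omega
      · by_cases hz : s'.mem 9 (s.mem 3 (s.mem 2 (s'.mem 10 (s'.reg 10)) + s'.reg 12)) - 1 = 0
        · obtain ⟨R', hR', hI'⟩ := hI.edge hl hlt hkk (deg' := Function.update (s'.mem 9)
            (s.mem 3 (s.mem 2 (s'.mem 10 (s'.reg 10)) + s'.reg 12))
            (s'.mem 9 (s.mem 3 (s.mem 2 (s'.mem 10 (s'.reg 10)) + s'.reg 12)) - 1))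
            (fun c => by rw [Function.update_apply]; split_ifs with h <;> simp [h])
            (.inr ⟨by simpa using hz, rfl, rfl⟩)
          have hR1 := Finset.card_le_card hI'.sub
          rw [Finset.card_range] at hR1
          refine ⟨k - (R'.card - R.card), by omega, R', ?_, ?_⟩
          · simp [topoSortBody, e2, e3, hkk, hz]
            omega
          · simpa [topoSortBody, e2, e3, hkk, hz] using hI'
        · obtain ⟨R', hR', hI'⟩ := hI.edge hl hlt hkk (deg' := Function.update (s'.mem 9)
            (s.mem 3 (s.mem 2 (s'.mem 10 (s'.reg 10)) + s'.reg 12))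
            (s'.mem 9 (s.mem 3 (s.mem 2 (s'.mem 10 (s'.reg 10)) + s'.reg 12)) - 1))
            (fun c => by rw [Function.update_apply]; split_ifs with h <;> simp [h])
            (.inl ⟨by simpa using hz, rfl, rfl⟩)
          have hR1 := Finset.card_le_card hI'.sub
          rw [Finset.card_range] at hR1
          refine ⟨k - (R'.card - R.card), by omega, R', ?_, ?_⟩
          · simp [topoSortBody, e2, e3, hkk, hz]
            omega
          · simpa [topoSortBody, e2, e3, hkk, hz] using hI'
    · refine Runs.of_loopFree rfl (by decide) ?_ ⟨k - 1, by omega, R, ?_, ?_⟩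
      · simp [topoSortBody, e2, hkk]
        omega
      · simp [topoSortBody, e2, hkk]
        omega
      · simpa [topoSortBody, e2, hkk] using hI.advance hl hlt hkk
  · rintro k s' ha ⟨R, hk, hI⟩ hcond
    exact hI.topoOrder hl (by by_contra h; simp [not_le.1 h] at hcond)
  · simp only [RamExp.cost]
    exact Nat.mul_le_mul (by omega) (by omega)

/-! ### Variables below a gate, and sums of costs over all gates -/

namespace Circuit

variable {n : ℕ} {C : Circuit n}

theorem vars_lit {p : Fin C.N} {x : Fin n} {b : Bool} (h : C.gate p = .lit x b) :
    C.vars p = {x} := by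
  ext y
  constructor
  · rintro ⟨q, b', hq, hy⟩
    rcases Relation.ReflTransGen.cases_head hq with rfl | ⟨c, hc, -⟩
    · rw [h] at hy
      cases hy
      rfl
    · rw [h] at hc
      simp [Gate.children] at hc
  · rintro rfl
    exact ⟨p, b, .refl, h⟩

theorem vars_eq_iUnion {p : Fin C.N} (h : ∀ x b, C.gate p ≠ .lit x b) :
    C.vars p = {x | ∃ c ∈ (C.gate p).children, x ∈ C.vars c} := by
  ext y
  constructor
  · rintro ⟨q, b', hq, hy⟩
    rcases Relation.ReflTransGen.cases_head hq with rfl | ⟨c, hc, hcq⟩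
    · exact absurd hy (h _ _)
    · exact ⟨c, hc, q, b', hcq, hy⟩
  · rintro ⟨c, hc, q, b, hcq, hy⟩
    exact ⟨q, b, hcq.head hc, hy⟩

theorem TopoOrder.sum_eq {ord : ℕ → ℕ} (h : C.TopoOrder ord) (f : ℕ → ℕ) :
    ∑ i ∈ Finset.range C.N, f (ord i) = ∑ p : Fin C.N, f p := by
  refine Finset.sum_bij (fun i hi => ⟨ord i, h.lt i (Finset.mem_range.1 hi)⟩) (by simp) ?_ ?_ ?_
  · intro i hi j hj hij
    exact h.inj i (Finset.mem_range.1 hi) j (Finset.mem_range.1 hj) (by simpa using hij)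
  · intro c _
    obtain ⟨i, hi, hi'⟩ := h.surj c
    exact ⟨i, Finset.mem_range.2 hi, Fin.ext hi'⟩
  · intro i hi
    rfl

/-- The sum over the gates of costs that are linear in the numbers of children. -/
theorem TopoOrder.sum_cost {ord ty var off ch : ℕ → ℕ} (h : C.TopoOrder ord)
    (hl : C.Layout ty var off ch) (a b : ℕ) :
    ∑ i ∈ Finset.range C.N, (a * (off (ord i + 1) - off (ord i)) + b) = a * C.size + b * C.N := by
  rw [h.sum_eq fun p => a * (off (p + 1) - off p) + b, Finset.sum_add_distrib, ← Finset.mul_sum,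
    Finset.sum_const, Finset.card_univ, Fintype.card_fin, smul_eq_mul, mul_comm C.N b, size]
  congr 2
  exact Finset.sum_congr rfl fun p _ => by rw [hl.off_succ]; omega

end Circuit

/-! ### The ranges of positions of the variables of gates -/

/-- `lo` and `hi` are the extreme positions of the variables in `U`. -/
structure HullOf {n : ℕ} (pos : ℕ → ℕ) (U : Set (Fin n)) (lo hi : ℕ) : Prop where
  le : ∀ x ∈ U, lo ≤ pos x ∧ pos x ≤ hi
  attained : (U = ∅ ∧ lo = n + 1 ∧ hi = 0) ∨ ∃ x ∈ U, ∃ y ∈ U, lo = pos x ∧ hi = pos y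

namespace HullOf

variable {n : ℕ} {pos : ℕ → ℕ} {U U' : Set (Fin n)} {lo hi lo' hi' : ℕ}

theorem empty : HullOf pos (∅ : Set (Fin n)) (n + 1) 0 := ⟨by simp, .inl (by simp)⟩

theorem singleton (x : Fin n) : HullOf pos {x} (pos x) (pos x) :=
  ⟨by simp, .inr ⟨x, rfl, x, rfl, rfl, rfl⟩⟩

/-- The convention that the empty set has the range from n+1 to 0 makes it neutral for minimum and
maximum, so empty sets need no separate treatment in the program. -/
theorem union (hpos : ∀ x : Fin n, pos x ≤ n) (h : HullOf pos U lo hi) (h' : HullOf pos U' lo' hi') :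
    HullOf pos (U ∪ U') (min lo lo') (max hi hi') := by
  refine ⟨?_, ?_⟩
  · rintro x (hx | hx)
    · have := h.le x hx
      omega
    · have := h'.le x hx
      omega
  · rcases h.attained with ⟨rfl, rfl, rfl⟩ | ⟨x, hx, y, hy, rfl, rfl⟩ <;>
    rcases h'.attained with ⟨rfl, rfl, rfl⟩ | ⟨x', hx', y', hy', rfl, rfl⟩
    · simp
    · have := hpos x'
      exact .inr ⟨x', .inr hx', y', .inr hy', by omega, by omega⟩
    · have := hpos x
      exact .inr ⟨x, .inl hx, y, .inl hy, by omega, by omega⟩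
    · have h1 : ∃ z ∈ U ∪ U', min (pos x) (pos x') = pos z := by
        rcases min_choice (pos x) (pos x') with h1 | h1
        exacts [⟨x, .inl hx, h1⟩, ⟨x', .inr hx', h1⟩]
      have h2 : ∃ z ∈ U ∪ U', max (pos y) (pos y') = pos z := by
        rcases max_choice (pos y) (pos y') with h1 | h1
        exacts [⟨y, .inl hy, h1⟩, ⟨y', .inr hy', h1⟩]
      obtain ⟨z, hz, h1⟩ := h1
      obtain ⟨w, hw, h2⟩ := h2
      exact .inr ⟨z, hz, w, hw, h1, h2⟩

end HullOf

def hullEdge : RamProg :=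
  .assign 14 (.load 3 (.reg 12)) ;;
  .ite (.op .lt (.load 11 (.reg 14)) (.reg 16)) (.assign 16 (.load 11 (.reg 14))) .skip ;;
  .ite (.op .lt (.reg 17) (.load 12 (.reg 14))) (.assign 17 (.load 12 (.reg 14))) .skip ;;
  .assign 12 (.op .add (.reg 12) (.const 1))

def hullGate : RamProg :=
  (.assign 15 (.op .sub (.reg 15) (.const 1)) ;; .assign 13 (.load 10 (.reg 15)) ;;
    .assign 16 (.op .add (.reg 2) (.const 1)) ;; .assign 17 (.const 0) ;;
    .assign 12 (.load 2 (.reg 13))) ;;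
  .while (.op .lt (.reg 12) (.load 2 (.op .add (.reg 13) (.const 1)))) hullEdge ;;
  (.ite (.op .lt (.load 0 (.reg 13)) (.const 2))
    (.assign 16 (.load 7 (.load 1 (.reg 13))) ;; .assign 17 (.reg 16)) .skip ;;
    .store 11 (.reg 13) (.reg 16) ;; .store 12 (.reg 13) (.reg 17))

/-- The extreme positions of the variables of the gates are written to banks 11 and 12. -/
def hulls : RamProg :=
  .assign 15 (.reg 0) ;; .while (.reg 15) hullGate

/-- The sets of variables below the children at the edges from `a` to `b`. -/
def Circuit.edgeVars {n : ℕ} (C : Circuit n) (ch : ℕ → ℕ) (a b : ℕ) : Set (Fin n) :=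
  {x | ∃ e, a ≤ e ∧ e < b ∧ ∃ c : Fin C.N, ch e = c ∧ x ∈ C.vars c}

theorem Circuit.Layout.edgeVars_eq {n : ℕ} {C : Circuit n} {ty var off ch : ℕ → ℕ}
    (hl : C.Layout ty var off ch) {p : Fin C.N} (h : ∀ x b, C.gate p ≠ .lit x b) :
    C.edgeVars ch (off p) (off (p + 1)) = C.vars p := by
  rw [vars_eq_iUnion h]
  ext x
  constructor
  · rintro ⟨e, h1, h2, c, h3, h4⟩
    exact ⟨c, hl.mem_children.2 ⟨e, h1, h2, h3⟩, h4⟩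
  · rintro ⟨c, h3, h4⟩
    obtain ⟨e, h1, h2, h3⟩ := hl.mem_children.1 h3
    exact ⟨e, h1, h2, c, h3, h4⟩

theorem hullGate_spec {n : ℕ} {C : Circuit n} {ty var off ch pos : ℕ → ℕ}
    (hl : C.Layout ty var off ch) (hpos : ∀ x : Fin n, pos x ≤ n) {s : RamState} {V : ℕ}
    (hV : C.size + 3 ≤ V) (hVn : n ≤ V)
    (e0 : s.mem 0 = ty) (e1 : s.mem 1 = var) (e2 : s.mem 2 = off) (e3 : s.mem 3 = ch)
    (e7 : s.mem 7 = pos) (r2 : s.reg 2 = n) (p : Fin C.N) (hp : s.mem 10 (s.reg 15 - 1) = p)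
    (hch : ∀ c ∈ (C.gate p).children, HullOf pos (C.vars c) (s.mem 11 c) (s.mem 12 c)) :
    Runs V hullGate s (40 * (off (p + 1) - off p) + 90) fun s' =>
      s'.reg 15 = s.reg 15 - 1 ∧ ∃ lo hi, HullOf pos (C.vars p) lo hi ∧
        s'.mem 11 = Function.update (s.mem 11) p lo ∧
        s'.mem 12 = Function.update (s.mem 12) p hi := by
  have hN := C.N_le
  have h1 := hl.off_le p.2.le
  have h2 := hl.off_le (i := p + 1) p.2
  have hmono := hl.off_mono (show (p : ℕ) ≤ p + 1 by omega) p.2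
  refine (Runs.step_seq (T := 25) (T' := (off (p + 1) - off p + 1) * (30 + 6 + 1) + 25) rfl (by decide)
    (by simp [hp, e2]; omega) (Runs.seq (Q := fun s' => HullOf pos
      (C.edgeVars ch (off p) (off (p + 1))) (s'.reg 16) (s'.reg 17)) (Runs.count 30 (fun k s' =>
    k + s'.reg 12 = off (p + 1) ∧ off p ≤ s'.reg 12 ∧
      HullOf pos (C.edgeVars ch (off p) (s'.reg 12)) (s'.reg 16) (s'.reg 17))
      (off (p + 1) - off p) ?_ ?_ ?_ ?_) fun s' ha h => ?_)).mono (by omega) fun s' _ h => h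
  · simp [hp, e2, r2]
    refine ⟨by omega, ?_⟩
    rw [show C.edgeVars ch (off p) (off p) = ∅ from ?_]
    · exact HullOf.empty
    · refine Set.eq_empty_iff_forall_notMem.2 ?_
      rintro x ⟨e, h1, h2, -⟩
      omega
  · rintro k s' ha -
    have f13 : s'.reg 13 = p := (ha.1 13 (by decide)).trans (by simp [hp])
    have f2 : s'.mem 2 = off := (ha.2 2 (by decide)).trans (by simp [e2])
    simp [f13, f2]
    omega
  · rintro k s' ha ⟨hk, hge, hh⟩
    have f13 : s'.reg 13 = p := (ha.1 13 (by decide)).trans (by simp [hp])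
    have f2 : s'.mem 2 = off := (ha.2 2 (by decide)).trans (by simp [e2])
    have f3 : s'.mem 3 = ch := (ha.2 3 (by decide)).trans (by simp [e3])
    have f11 : s'.mem 11 = s.mem 11 := (ha.2 11 (by decide)).trans (by simp)
    have f12 : s'.mem 12 = s.mem 12 := (ha.2 12 (by decide)).trans (by simp)
    obtain ⟨c, hc, hce⟩ := hl.exists_child hge (show s'.reg 12 < off (p + 1) by omega)
    refine ⟨by simp [f13, f2]; omega, Runs.of_loopFree rfl (by decide) ?_ ?_⟩
    · simp [hullEdge, f3, hce]
      omega
    · have hu := hh.union hpos (hch c hc)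
      have hUU : C.edgeVars ch (off p) (s'.reg 12 + 1) =
          C.edgeVars ch (off p) (s'.reg 12) ∪ C.vars c := by
        ext x
        constructor
        · rintro ⟨e, u1, u2, c', u3, u4⟩
          by_cases he : e < s'.reg 12
          · exact .inl ⟨e, u1, he, c', u3, u4⟩
          · obtain rfl : e = s'.reg 12 := by omega
            rw [hce] at u3
            exact .inr (Fin.ext u3 ▸ u4)
        · rintro (⟨e, u1, u2, h⟩ | hx)
          · exact ⟨e, u1, by omega, h⟩
          · exact ⟨_, hge, by omega, c, hce, hx⟩
      rw [← hUU] at hu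
      by_cases k1 : s.mem 11 c < s'.reg 16 <;> by_cases k2 : s'.reg 17 < s.mem 12 c <;>
        simp [hullEdge, f3, hce, f11, f12, k1, k2]
      · rw [min_eq_right k1.le, max_eq_right k2.le] at hu
        exact ⟨by omega, by omega, hu⟩
      · rw [min_eq_right k1.le, max_eq_left (not_lt.1 k2)] at hu
        exact ⟨by omega, by omega, hu⟩
      · rw [min_eq_left (not_lt.1 k1), max_eq_right k2.le] at hu
        exact ⟨by omega, by omega, hu⟩
      · rw [min_eq_left (not_lt.1 k1), max_eq_left (not_lt.1 k2)] at hu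
        exact ⟨by omega, by omega, hu⟩
  · rintro s' ha ⟨hk, hge, hh⟩
    have f13 : s'.reg 13 = p := (ha.1 13 (by decide)).trans (by simp [hp])
    have f2 : s'.mem 2 = off := (ha.2 2 (by decide)).trans (by simp [e2])
    rw [show s'.reg 12 = off (p + 1) by omega] at hh
    exact ⟨by simp [f13, f2]; omega, hh⟩
  · have f13 : s'.reg 13 = p := (ha.1 13 (by decide)).trans (by simp [hp])
    have f15 : s'.reg 15 = s.reg 15 - 1 := (ha.1 15 (by decide)).trans (by simp)
    have f0 : s'.mem 0 = ty := (ha.2 0 (by decide)).trans (by simp [e0])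
    have f1 : s'.mem 1 = var := (ha.2 1 (by decide)).trans (by simp [e1])
    have f7 : s'.mem 7 = pos := (ha.2 7 (by decide)).trans (by simp [e7])
    have f11 : s'.mem 11 = s.mem 11 := (ha.2 11 (by decide)).trans (by simp)
    have f12 : s'.mem 12 = s.mem 12 := (ha.2 12 (by decide)).trans (by simp)
    have hty := hl.ty_le p
    rcases hl.ty_cases p with ⟨x, b, hg, ht⟩ | hor
    · have ht' : ty p < 2 := by rw [ht]; split <;> omega
      have hx := hl.var_eq p x b hg
      refine Runs.of_loopFree rfl (by decide) ?_ ?_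
      · simp [f13, f0, f1, ht', hx]
        omega
      · simp [f13, f0, f1, f7, ht', hx, f11, f12, f15]
        exact ⟨_, _, by rw [Circuit.vars_lit hg]; exact HullOf.singleton x, rfl, rfl⟩
    · have ht' : ¬ty p < 2 := by rcases hor with ⟨cs, -, h⟩ | ⟨cs, -, h⟩ <;> omega
      rw [hl.edgeVars_eq (fun x b hg => by
        rcases hor with ⟨cs, h, -⟩ | ⟨cs, h, -⟩ <;> rw [h] at hg <;> cases hg)] at h
      refine Runs.of_loopFree rfl (by decide) ?_ ?_
      · simp [f13, f0, ht']
        omega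
      · simp [f13, f0, ht', f11, f12, f15]
        exact ⟨_, _, h, rfl, rfl⟩

/-- The gates are treated in reverse topological order, so the ranges of the children are known when
a gate is reached. -/
theorem hulls_spec {n : ℕ} {C : Circuit n} {pos ord : ℕ → ℕ} (hpos : ∀ x : Fin n, pos x ≤ n)
    (hord : C.TopoOrder ord) {s : RamState} {V : ℕ} (hs : C.StoredIn s)
    (hV : C.size + 3 ≤ V) (hVn : n ≤ V) (e7 : s.mem 7 = pos) (e10 : s.mem 10 = ord)
    (r2 : s.reg 2 = n) :
    Runs V hulls s (150 * (C.size + 1)) fun s' =>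
      ∀ p : Fin C.N, HullOf pos (C.vars p) (s'.mem 11 p) (s'.mem 12 p) := by
  have hl := hs.layout
  have hN := C.N_le
  -- 92 is the constant 90 in the time for one gate plus 2 for the test of the loop.
  have hsum := hord.sum_cost hl 40 92
  refine (Runs.step_seq (T := 2) rfl (by decide) (by simp) (Runs.count_sum
    (fun i => 40 * (s.mem 2 (ord i + 1) - s.mem 2 (ord i)) + 90) (fun k s' => s'.reg 15 = k ∧
      k ≤ C.N ∧ ∀ i, k ≤ i → ∀ p : Fin C.N, i < C.N → ord i = p →
        HullOf pos (C.vars p) (s'.mem 11 p) (s'.mem 12 p)) C.N ?_ ?_ ?_ ?_)).mono ?_ fun s' _ h => h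
  · simp [hs.1]
    omega
  · simp
  · rintro k s' ha ⟨h15, hk, hh⟩
    refine ⟨by simp [h15], ?_⟩
    have hp := hord.lt k (by omega)
    refine (hullGate_spec (s := s') hl hpos hV hVn ((ha.2 0 (by decide)).trans (by simp))
      ((ha.2 1 (by decide)).trans (by simp)) ((ha.2 2 (by decide)).trans (by simp))
      ((ha.2 3 (by decide)).trans (by simp)) ((ha.2 7 (by decide)).trans (by simp [e7]))
      ((ha.1 2 (by decide)).trans (by simp [r2])) ⟨ord k, hp⟩ ?_ ?_).mono le_rfl ?_
    · rw [h15, (ha.2 10 (by decide)).trans (by simp [e10] : _ = ord)]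
      rfl
    · intro c hc
      obtain ⟨j, hj, hj'⟩ := hord.surj c
      obtain ⟨i, hi, hi'⟩ := hord.parent j hj ⟨ord k, hp⟩ c hj' hc
      have := hord.inj i (by omega) k (by omega) hi'
      exact hh j (by omega) c hj hj'
    · rintro s'' - ⟨h1, lo, hi, h2, h3, h4⟩
      refine ⟨by omega, by omega, fun i hki p hi hip => ?_⟩
      by_cases hik : i = k
      · subst hik
        have : p = ⟨ord i, hp⟩ := Fin.ext hip.symm
        rw [h3, h4, this]
        simpa using h2
      · have : (p : ℕ) ≠ ord k := fun h => hik (hord.inj i hi k (by omega) (hip.trans h))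
        rw [h3, h4]
        simpa [Function.update_apply, this] using hh i (by omega) p hi hip
  · rintro s' ha ⟨h15, -, hh⟩
    refine ⟨by simpa using h15, fun p => ?_⟩
    obtain ⟨i, hi, hi'⟩ := hord.surj p
    exact hh i (Nat.zero_le _) p hi hi'
  · simp only [RamExp.cost]
    rw [show ∑ i ∈ Finset.range C.N, (40 * (s.mem 2 (ord i + 1) - s.mem 2 (ord i)) + 90 + 1 + 1) =
      _ from hsum]
    omega

/-! ### Comparison of ranges, and the gaps at the edges -/

namespace HullOf

variable {n : ℕ} {pos : ℕ → ℕ} {U U' : Set (Fin n)} {lo hi lo' hi' : ℕ}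

theorem unique (h : HullOf pos U lo hi) (h' : HullOf pos U lo' hi') : lo = lo' ∧ hi = hi' := by
  rcases h.attained with ⟨rfl, rfl, rfl⟩ | ⟨x, hx, y, hy, h1, h2⟩ <;>
  rcases h'.attained with ⟨h3, h4, h5⟩ | ⟨x', hx', y', hy', h3, h4⟩
  · exact ⟨h4.symm, h5.symm⟩
  · simp at hx'
  · rw [h3] at hx
    simp at hx
  · have := h.le x' hx'
    have := h.le y' hy'
    have := h'.le x hx
    have := h'.le y hy
    omega

theorem bounds (hpos : ∀ x : Fin n, 1 ≤ pos x ∧ pos x ≤ n) (h : HullOf pos U lo hi) :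
    (lo = n + 1 ∧ hi = 0) ∨ (1 ≤ lo ∧ lo ≤ hi ∧ hi ≤ n) := by
  rcases h.attained with ⟨rfl, rfl, rfl⟩ | ⟨x, hx, y, hy, rfl, rfl⟩
  · simp
  · have := h.le x hx
    have := hpos x
    have := hpos y
    omega

theorem of_subset (h : HullOf pos U lo hi) (h' : HullOf pos U' lo' hi') (hs : U ⊆ U') : (lo = n + 1 ∧ hi = 0) ∨ (lo' ≤ lo ∧ hi ≤ hi') := by
  rcases h.attained with ⟨rfl, rfl, rfl⟩ | ⟨x, hx, y, hy, rfl, rfl⟩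
  · simp
  · have := h'.le x (hs hx)
    have := h'.le y (hs hy)
    omega

theorem lt_of_separated (h : HullOf pos U lo hi) (h' : HullOf pos U' lo' hi')
    (hs : ∀ x ∈ U, ∀ y ∈ U', pos x < pos y) : hi = 0 ∨ hi' = 0 ∨ hi < lo' := by
  rcases h.attained with ⟨rfl, rfl, rfl⟩ | ⟨x, hx, y, hy, rfl, rfl⟩
  · simp
  · rcases h'.attained with ⟨rfl, rfl, rfl⟩ | ⟨x', hx', y', hy', rfl, rfl⟩
    · simp
    · exact .inr (.inr (hs y hy x' hx'))

end HullOf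

/-- The variables at positions strictly between `a` and `b`. -/
def posGap {n : ℕ} (pos : ℕ → ℕ) (a b : ℕ) : Set (Fin n) := {x | a < pos x ∧ pos x < b}

/-- The variables at positions from `a` to `b`. -/
def posRange {n : ℕ} (pos : ℕ → ℕ) (a b : ℕ) : Set (Fin n) := {x | a ≤ pos x ∧ pos x ≤ b}

/-- `A` is the disjoint union of `B`, `C` and `D`. -/
def Split {α : Type*} (A B C D : Set α) : Prop := A = B ∪ C ∪ D ∧ Disjoint B C ∧ Disjoint (B ∪ C) D

theorem split_iff {α : Type*} {A B C D : Set α} : Split A B C D ↔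
    ∀ x, (x ∈ A ↔ x ∈ B ∨ x ∈ C ∨ x ∈ D) ∧ ¬(x ∈ B ∧ x ∈ C) ∧ ¬((x ∈ B ∨ x ∈ C) ∧ x ∈ D) := by
  simp only [Split, Set.ext_iff, Set.mem_union, Set.disjoint_left, or_assoc]
  constructor
  · rintro ⟨h1, h2, h3⟩ x
    exact ⟨h1 x, fun h => h2 h.1 h.2, fun h => h3 h.1 h.2⟩
  · intro h
    exact ⟨fun x => (h x).1, fun x hb hc => (h x).2.1 ⟨hb, hc⟩, fun x hb hc => (h x).2.2 ⟨hb, hc⟩⟩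

/-- The variables in the ranges of the children of `⊗`-gates are separated. -/
def Circuit.Separated {n : ℕ} (C : Circuit n) (pos : ℕ → ℕ) : Prop :=
  ∀ p cs, C.gate p = .and cs → cs = [] ∨ ∃ c d, cs = [c, d] ∧
    ((∀ x ∈ C.vars c, ∀ y ∈ C.vars d, pos x < pos y) ∨
      ∀ x ∈ C.vars d, ∀ y ∈ C.vars c, pos x < pos y)

/-- The gaps `(a, b)` and `(a', b')` at the edge `e` are those that have to be filled. -/
structure Circuit.EdgeGaps {n : ℕ} (C : Circuit n) (pos off ch lo hi : ℕ → ℕ) (e a b a' b' : ℕ) :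
    Prop where
  lt : a < b
  le : b ≤ n + 1
  lt' : a' < b'
  le' : b' ≤ n + 1
  or_gate : ∀ (p : Fin C.N) cs, C.gate p = .or cs → off p ≤ e → e < off (p + 1) →
    Split (α := Fin n) (posRange pos (lo p) (hi p)) (posRange pos (lo (ch e)) (hi (ch e)))
      (posGap pos a b) (posGap pos a' b')
  and_gate : ∀ (p : Fin C.N) cs, C.gate p = .and cs → off p = e → e < off (p + 1) →
    Split (α := Fin n) (posRange pos (lo p) (hi p)) (posRange pos (lo (ch e)) (hi (ch e)))
      (posRange pos (lo (ch (e + 1))) (hi (ch (e + 1)))) (posGap pos a b)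

/-- The default gap (0,1) is empty, and an upper end 0 marks an empty range. If a child of an ⊕-gate
has no variables, the first gap becomes the whole range of the gate. For a ⊗-gate the gap is
recorded at the first of its two edges, and it is empty if one of the children has no variables. -/
def gapsEdge : RamProg :=
  .assign 14 (.load 3 (.reg 12)) ;;
  (.assign 20 (.const 0) ;; .assign 21 (.const 1) ;; .assign 22 (.const 0) ;; .assign 23 (.const 1)) ;;
  .ite (.op .eq (.load 0 (.reg 13)) (.const 2))
    (.ite (.load 12 (.reg 14))
      (.assign 20 (.op .sub (.load 11 (.reg 13)) (.const 1)) ;; .assign 21 (.load 11 (.reg 14)) ;;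
        .assign 22 (.load 12 (.reg 14)) ;; .assign 23 (.op .add (.load 12 (.reg 13)) (.const 1)))
      (.ite (.load 12 (.reg 13))
        (.assign 20 (.op .sub (.load 11 (.reg 13)) (.const 1)) ;;
          .assign 21 (.op .add (.load 12 (.reg 13)) (.const 1))) .skip))
    (.ite (.op .eq (.reg 12) (.load 2 (.reg 13)))
      (.assign 16 (.load 3 (.op .add (.reg 12) (.const 1))) ;;
        .ite (.op .mul (.load 12 (.reg 14)) (.load 12 (.reg 16)))
          (.ite (.op .lt (.load 12 (.reg 14)) (.load 11 (.reg 16)))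
            (.assign 20 (.load 12 (.reg 14)) ;; .assign 21 (.load 11 (.reg 16)))
            (.assign 20 (.load 12 (.reg 16)) ;; .assign 21 (.load 11 (.reg 14)))) .skip) .skip) ;;
  (.store 13 (.op .add (.reg 18) (.const 1)) (.reg 20) ;;
    .store 14 (.op .add (.reg 18) (.const 1)) (.reg 21) ;;
    .store 13 (.op .add (.reg 18) (.const 2)) (.reg 22) ;;
    .store 14 (.op .add (.reg 18) (.const 2)) (.reg 23)) ;;
  .assign 12 (.op .add (.reg 12) (.const 1)) ;; .assign 18 (.op .add (.reg 18) (.const 2))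

/-- For every edge `e` two gaps of positions are written to banks 13 and 14, at `2e+1` and `2e+2`. -/
def gaps : RamProg :=
  (.assign 13 (.const 0) ;; .assign 12 (.const 0) ;; .assign 18 (.const 0)) ;;
  .while (.op .lt (.reg 13) (.reg 0))
    (.ite (.op .lt (.reg 12) (.load 2 (.op .add (.reg 13) (.const 1)))) gapsEdge
      (.assign 13 (.op .add (.reg 13) (.const 1))))

/-- After the case distinction of the program, each splitting is a statement about single positions
in linear arithmetic. For ⊕-gates it rests on the inclusion of the range of the child in that of the
gate, for ⊗-gates on the separation of the two children. -/
theorem gapsEdge_spec {n : ℕ} {C : Circuit n} {ty var off ch pos : ℕ → ℕ}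
    (hl : C.Layout ty var off ch) (hpos : ∀ x : Fin n, 1 ≤ pos x ∧ pos x ≤ n)
    (hsep : C.Separated pos) {s : RamState} {V : ℕ} (hV : C.size + 3 ≤ V)
    (e0 : s.mem 0 = ty) (e2 : s.mem 2 = off) (e3 : s.mem 3 = ch)
    (p : Fin C.N) (hp : s.reg 13 = p) (hge : off p ≤ s.reg 12) (hlt : s.reg 12 < off (p + 1))
    (hh : ∀ c : Fin C.N, HullOf pos (C.vars c) (s.mem 11 c) (s.mem 12 c)) :
    Runs V gapsEdge s 100 fun s' =>
      s'.reg 12 = s.reg 12 + 1 ∧ s'.reg 13 = s.reg 13 ∧ s'.reg 18 = s.reg 18 + 2 ∧ ∃ a b a' b',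
        C.EdgeGaps pos off ch (s.mem 11) (s.mem 12) (s.reg 12) a b a' b' ∧
        s'.mem 13 = Function.update (Function.update (s.mem 13) (s.reg 18 + 1) a) (s.reg 18 + 2) a' ∧
        s'.mem 14 = Function.update (Function.update (s.mem 14) (s.reg 18 + 1) b) (s.reg 18 + 2) b' := by
  have hN := C.N_le
  have hM := hl.edge_lt hlt
  have h2 := hl.off_le (i := p) p.2.le
  obtain ⟨c, hc, hce⟩ := hl.exists_child hge hlt
  have hp' := (hh p).bounds hpos
  have hc' := (hh c).bounds hpos
  have huniq : ∀ q : Fin C.N, off q ≤ s.reg 12 → s.reg 12 < off (q + 1) → q = p := fun q h1 h2 =>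
    Fin.ext (hl.owner_unique q.2 p.2 h1 h2 hge hlt)
  have hty := hl.ty_le p
  rcases hl.ty_cases p with ⟨x, b, hg, -⟩ | ⟨cs, hg, ht⟩ | ⟨cs, hg, ht⟩
  · rw [hg] at hc
    simp [Gate.children] at hc
  · have hsub : C.vars c ⊆ C.vars p := fun x hx => by
      rw [Circuit.vars_eq_iUnion (p := p) (fun x b h => by rw [hg] at h; cases h)]
      exact ⟨c, hc, hx⟩
    have hcp := (hh c).of_subset (hh p) hsub
    have hgaps : ∀ {a b a' b' : ℕ}, a < b → b ≤ n + 1 → a' < b' → b' ≤ n + 1 →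
        (∀ y, 1 ≤ y → y ≤ n → ((s.mem 11 p ≤ y ∧ y ≤ s.mem 12 p) ↔ (s.mem 11 c ≤ y ∧ y ≤ s.mem 12 c) ∨
          (a < y ∧ y < b) ∨ (a' < y ∧ y < b')) ∧ ¬((s.mem 11 c ≤ y ∧ y ≤ s.mem 12 c) ∧ a < y ∧ y < b) ∧
          ¬(((s.mem 11 c ≤ y ∧ y ≤ s.mem 12 c) ∨ a < y ∧ y < b) ∧ a' < y ∧ y < b')) →
        C.EdgeGaps pos off ch (s.mem 11) (s.mem 12) (s.reg 12) a b a' b' := by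
      intro a b a' b' h1 h2 h3 h4 h5
      refine ⟨h1, h2, h3, h4, fun q cs' hq hq1 hq2 => ?_, fun q cs' hq hq1 hq2 => ?_⟩
      · obtain rfl := huniq q hq1 hq2
        rw [hce]
        exact split_iff.2 fun x => h5 (pos x) (hpos x).1 (hpos x).2
      · obtain rfl := huniq q hq1.le hq2
        rw [hg] at hq
        cases hq
    by_cases k1 : s.mem 12 c = 0
    · by_cases k2 : s.mem 12 p = 0
      · refine Runs.of_loopFree rfl (by decide) ?_ ?_
        · simp [gapsEdge, e0, e3, hp, hce, ht, k1, k2]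
          omega
        · simp [gapsEdge, e0, e3, hp, hce, ht, k1, k2]
          exact ⟨_, _, _, _, hgaps (by omega) (by omega) (by omega) (by omega)
            (fun y h1 h2 => by omega), rfl, rfl⟩
      · refine Runs.of_loopFree rfl (by decide) ?_ ?_
        · simp [gapsEdge, e0, e3, hp, hce, ht, k1, k2]
          omega
        · simp [gapsEdge, e0, e3, hp, hce, ht, k1, k2]
          exact ⟨_, _, _, _, hgaps (by omega) (by omega) (by omega) (by omega)
            (fun y h1 h2 => by omega), rfl, rfl⟩
    · refine Runs.of_loopFree rfl (by decide) ?_ ?_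
      · simp [gapsEdge, e0, e3, hp, hce, ht, k1]
        omega
      · simp [gapsEdge, e0, e3, hp, hce, ht, k1]
        exact ⟨_, _, _, _, hgaps (by omega) (by omega) (by omega) (by omega)
          (fun y h1 h2 => by omega), rfl, rfl⟩
  · have hgaps : ∀ {a b : ℕ}, a < b → b ≤ n + 1 →
        (off p = s.reg 12 → Split (α := Fin n) (posRange pos (s.mem 11 p) (s.mem 12 p))
          (posRange pos (s.mem 11 c) (s.mem 12 c)) (posRange pos (s.mem 11 (ch (s.reg 12 + 1)))
          (s.mem 12 (ch (s.reg 12 + 1)))) (posGap pos a b)) →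
        C.EdgeGaps pos off ch (s.mem 11) (s.mem 12) (s.reg 12) a b 0 1 := by
      intro a b h1 h2 h5
      refine ⟨h1, h2, by omega, by omega, fun q cs' hq hq1 hq2 => ?_, fun q cs' hq hq1 hq2 => ?_⟩
      · obtain rfl := huniq q hq1 hq2
        rw [hg] at hq
        cases hq
      · obtain rfl := huniq q hq1.le hq2
        rw [hce]
        exact h5 hq1
    by_cases k0 : s.reg 12 = off p
    · obtain rfl | ⟨c', d, rfl, hs⟩ := hsep p cs hg
      · rw [hg] at hc
        simp [Gate.children] at hc
      · have hlen := hl.off_succ p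
        have hc1 := hl.ch_eq p 0 (by simp [hg, Gate.children])
        have hd1 := hl.ch_eq p 1 (by simp [hg, Gate.children])
        simp only [hg, Gate.children, List.length_cons, List.length_nil, add_zero,
          List.getElem_cons_zero, List.getElem_cons_succ, ← k0] at hlen hc1 hd1
        obtain rfl : c = c' := Fin.ext (hce.symm.trans hc1)
        have hd' := (hh d).bounds hpos
        have hvars : C.vars p = C.vars c ∪ C.vars d := by
          rw [Circuit.vars_eq_iUnion (p := p) (fun x b h => by rw [hg] at h; cases h)]
          ext x
          simp [hg, Gate.children]
        have hu := (hh c).union (fun x => (hpos x).2) (hh d)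
        rw [← hvars] at hu
        have hu' := (hh p).unique hu
        have hs' : s.mem 12 c = 0 ∨ s.mem 12 d = 0 ∨ s.mem 12 c < s.mem 11 d ∨
            (s.mem 12 d < s.mem 11 c ∧ ¬s.mem 12 c < s.mem 11 d) := by
          rcases hs with hs | hs
          · have := (hh c).lt_of_separated (hh d) hs
            omega
          · have := (hh d).lt_of_separated (hh c) hs
            omega
        have hM' : s.reg 12 + 1 < C.size := hl.edge_lt (p := p) (by omega)
        have k0' := k0.symm
        by_cases k1 : s.mem 12 c = 0 ∨ s.mem 12 d = 0
        · refine Runs.of_loopFree rfl (by decide) ?_ ?_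
          · simp [gapsEdge, e0, e2, e3, hp, hce, ht, ← k0, hd1, k1]
            omega
          · simp [gapsEdge, e0, e2, e3, hp, hce, ht, ← k0, hd1, k1]
            refine ⟨_, _, _, _, hgaps (by omega) (by omega) fun _ => split_iff.2 fun x => ?_, rfl,
              rfl⟩
            have := hpos x
            simp only [posRange, posGap, Set.mem_ofPred_eq, hd1]
            omega
        · by_cases k2 : s.mem 12 c < s.mem 11 d
          · refine Runs.of_loopFree rfl (by decide) ?_ ?_
            · simp [gapsEdge, e0, e2, e3, hp, hce, ht, ← k0, hd1, k1, k2]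
              omega
            · simp [gapsEdge, e0, e2, e3, hp, hce, ht, ← k0, hd1, k1, k2]
              refine ⟨_, _, _, _, hgaps (by omega) (by omega) fun _ => split_iff.2 fun x => ?_, rfl,
                rfl⟩
              have := hpos x
              simp only [posRange, posGap, Set.mem_ofPred_eq, hd1]
              omega
          · refine Runs.of_loopFree rfl (by decide) ?_ ?_
            · simp [gapsEdge, e0, e2, e3, hp, hce, ht, ← k0, hd1, k1, k2]
              omega
            · simp [gapsEdge, e0, e2, e3, hp, hce, ht, ← k0, hd1, k1, k2]
              refine ⟨_, _, _, _, hgaps (by omega) (by omega) fun _ => split_iff.2 fun x => ?_, rfl,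
                rfl⟩
              have := hpos x
              simp only [posRange, posGap, Set.mem_ofPred_eq, hd1]
              omega
    · refine Runs.of_loopFree rfl (by decide) ?_ ?_
      · simp [gapsEdge, e0, e2, e3, hp, hce, ht, k0]
        omega
      · simp [gapsEdge, e0, e2, e3, hp, hce, ht, k0]
        exact ⟨_, _, _, _, hgaps (by omega) (by omega) (fun h => absurd h.symm k0), rfl, rfl⟩

/-- Gates and edges advance in a single loop, in which every round increases the gate or the edge by
one. -/
theorem gaps_spec {n : ℕ} {C : Circuit n} {pos lo hi : ℕ → ℕ}
    (hpos : ∀ x : Fin n, 1 ≤ pos x ∧ pos x ≤ n) (hsep : C.Separated pos) {s : RamState} {V : ℕ}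
    (hs : C.StoredIn s) (hV : C.size + 3 ≤ V) (e11 : s.mem 11 = lo) (e12 : s.mem 12 = hi)
    (hh : ∀ p : Fin C.N, HullOf pos (C.vars p) (lo p) (hi p)) :
    Runs V gaps s (300 * (C.size + 1)) fun s' => ∀ e < C.size,
      C.EdgeGaps pos (s.mem 2) (s.mem 3) lo hi e (s'.mem 13 (2 * e + 1)) (s'.mem 14 (2 * e + 1))
        (s'.mem 13 (2 * e + 2)) (s'.mem 14 (2 * e + 2)) := by
  have hl := hs.layout
  have hN := C.N_le
  refine (Runs.step_seq (T := 10) (T' := (C.size + C.N + 1) * (107 + 3 + 1)) rfl (by decide) (by simp)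
    (Runs.while_lt (e := .op .lt (.reg 13) (.reg 0)) 107
    (fun k s' => k + (s'.reg 12 + s'.reg 13) = C.size + C.N ∧ s'.reg 13 ≤ C.N ∧
      s.mem 2 (s'.reg 13) ≤ s'.reg 12 ∧ (s'.reg 13 < C.N → s'.reg 12 ≤ s.mem 2 (s'.reg 13 + 1)) ∧
      s'.reg 12 ≤ C.size ∧
      s'.reg 18 = 2 * s'.reg 12 ∧ ∀ e < s'.reg 12,
      C.EdgeGaps pos (s.mem 2) (s.mem 3) lo hi e (s'.mem 13 (2 * e + 1)) (s'.mem 14 (2 * e + 1))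
        (s'.mem 13 (2 * e + 2)) (s'.mem 14 (2 * e + 2))) (C.size + C.N) ?_ ?_ ?_ ?_)).mono ?_
    fun s' _ h => h
  · simp [hl.off_zero]
  · simp
  · rintro k s' ha ⟨hk, h13, hge, hle, hM, h18, hE⟩ hcond
    have f0 : s'.reg 0 = C.N := (ha.1 0 (by decide)).trans (by simp [hs.1])
    have f2 : s'.mem 2 = s.mem 2 := (ha.2 2 (by decide)).trans (by simp)
    have f11 : s'.mem 11 = lo := (ha.2 11 (by decide)).trans (by simp [e11])
    have f12 : s'.mem 12 = hi := (ha.2 12 (by decide)).trans (by simp [e12])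
    have hlt : s'.reg 13 < C.N := by
      by_contra h
      simp [f0, h] at hcond
    have hoff := hl.off_le (i := s'.reg 13 + 1) hlt
    refine (Runs.ite (T := 100) (e := .op .lt (.reg 12) (.load 2 (.op .add (.reg 13) (.const 1))))
      (by simp [f2]; omega) (fun h => ?_) fun h => ?_).mono le_rfl fun s'' _ h => h
    · have h' : s'.reg 12 < s.mem 2 (s'.reg 13 + 1) := by
        by_contra h'
        simp [f2, h'] at h
      refine (gapsEdge_spec hl hpos hsep hV ((ha.2 0 (by decide)).trans (by simp)) f2
        ((ha.2 3 (by decide)).trans (by simp)) ⟨s'.reg 13, hlt⟩ rfl hge h'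
        (by rw [f11, f12]; exact hh)).mono le_rfl ?_
      rintro s'' - ⟨g12, g13, g18, a, b, a', b', hg, g13', g14'⟩
      rw [f11, f12] at hg
      have := hl.edge_lt (p := ⟨s'.reg 13, hlt⟩) h'
      refine ⟨k - 1, by omega, by omega, by omega, by rw [g12, g13]; omega,
        fun _ => by rw [g12, g13]; omega, by omega, by omega, fun e he => ?_⟩
      rw [g13', g14', h18]
      simp only [Function.update_apply]
      by_cases hee : e = s'.reg 12
      · subst hee
        simpa using hg
      · rw [if_neg (by omega), if_neg (by omega), if_neg (by omega), if_neg (by omega),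
          if_neg (by omega), if_neg (by omega), if_neg (by omega), if_neg (by omega)]
        exact hE e (by omega)
    · have h' : ¬s'.reg 12 < s.mem 2 (s'.reg 13 + 1) := by
        intro h'
        simp [f2, h'] at h
      have := hle hlt
      refine Runs.of_loopFree rfl (by decide) (by simp) ⟨k - 1, by omega, ?_⟩
      simp
      refine ⟨by omega, hlt, by omega, fun h1 => ?_, hM, h18, hE⟩
      have := hl.off_mono (show s'.reg 13 + 1 ≤ s'.reg 13 + 1 + 1 by omega) h1
      omega
  · rintro k s' ha ⟨hk, h13, hge, hle, hM, h18, hE⟩ hcond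
    have f0 : s'.reg 0 = C.N := (ha.1 0 (by decide)).trans (by simp [hs.1])
    have hlt : s'.reg 13 = C.N := by
      by_contra h
      simp [f0, show s'.reg 13 < C.N by omega] at hcond
    rw [hlt, hl.off_last] at hge
    exact fun e he => hE e (by omega)
  · omega

/-! ### From the vtree to separated children -/

namespace Circuit

variable {n : ℕ} {C : Circuit n} {T : VTree n}

/-- By induction along the paths below p, all variables of p are leaves of ρ(p). The children of a
binary ⊗-gate therefore have their variables in the left and in the right subtree of one node, up to
the order in which they are listed. -/
theorem Respects.separated (hR : C.Respects T) {pos : ℕ → ℕ} (hpos : T.Positions pos) :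
    C.Separated pos := by
  obtain ⟨ρ, h1, h2, h3, h4⟩ := hR
  have hdesc : ∀ {s t : VTree n}, VTree.Desc s t → ∀ {x}, x ∈ s.leaves → x ∈ t.leaves :=
    fun hd x hx => hd.leaves_infix.subset hx
  have hv : ∀ p, ∀ x ∈ C.vars p, x ∈ (ρ p).leaves := by
    rintro p x ⟨q, b, hpq, hq⟩
    induction hpq using Relation.ReflTransGen.head_induction_on with
    | refl => simp [h2 q x b hq, VTree.leaves]
    | @head p c hpc _ ih =>
      rcases hg : C.gate p with ⟨y, b'⟩ | cs | cs <;> rw [hg] at hpc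
      · simp [Gate.children] at hpc
      · exact hdesc (h3 p cs hg c hpc) ih
      · rcases h4 p cs hg with rfl | ⟨c₁, c₂, vl, vr, hperm, hρ, hd₁, hd₂⟩
        · simp [Gate.children] at hpc
        · rw [hρ]
          simp only [VTree.leaves, List.mem_append]
          have : c ∈ [c₁, c₂] := hperm.subset hpc
          simp only [List.mem_cons, List.not_mem_nil, or_false] at this
          rcases this with rfl | rfl
          · exact .inl (hdesc hd₁ ih)
          · exact .inr (hdesc hd₂ ih)
  intro p cs hg
  rcases h4 p cs hg with h | ⟨c₁, c₂, vl, vr, hperm, hρ, hd₁, hd₂⟩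
  · exact .inl h
  · right
    have hlt : ∀ x ∈ C.vars c₁, ∀ y ∈ C.vars c₂, pos x < pos y := fun x hx y hy =>
      hpos.lt (hρ ▸ h1 p) (hdesc hd₁ (hv _ x hx)) (hdesc hd₂ (hv _ y hy))
    have hlen := hperm.length_eq
    match cs, hlen with
    | [c, d], _ =>
      have hc : c ∈ [c₁, c₂] := hperm.subset (by simp)
      have hd : d ∈ [c₁, c₂] := hperm.subset (by simp)
      have hnd := C.nodup p
      simp only [hg, Gate.children, List.nodup_cons, List.mem_singleton] at hnd
      simp only [List.mem_cons, List.not_mem_nil, or_false] at hc hd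
      refine ⟨c, d, rfl, ?_⟩
      rcases hc with rfl | rfl <;> rcases hd with rfl | rfl
      · exact absurd rfl hnd.1
      · exact .inl hlt
      · exact .inr hlt
      · exact absurd rfl hnd.1

end Circuit

/-! ### Lists of gates under construction -/

/-- A gate with type `ty`, variable `x` and children `kids`, together with the set of variables below
it and the function that it computes. -/
structure PGate (n : ℕ) where
  ty : ℕ
  x : ℕ
  kids : List ℕ
  vars : Set (Fin n)
  val : (Fin n → Bool) → Prop

namespace PGate

variable {n : ℕ} {L L' : List (PGate n)} {i j : ℕ}

/-- The set of variables of the gate number `i`. -/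
def varsAt (L : List (PGate n)) (i : ℕ) : Set (Fin n) := (L[i]?).elim ∅ PGate.vars

/-- The function computed by the gate number `i`. -/
def valAt (L : List (PGate n)) (i : ℕ) : (Fin n → Bool) → Prop :=
  (L[i]?).elim (fun _ => False) PGate.val

theorem getElem?_of_prefix (h : L <+: L') (hi : i < L.length) : L'[i]? = L[i]? := by
  obtain ⟨M, rfl⟩ := h
  rw [List.getElem?_append_left hi]

theorem varsAt_of_prefix (h : L <+: L') (hi : i < L.length) : varsAt L' i = varsAt L i := by
  rw [varsAt, varsAt, getElem?_of_prefix h hi]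

theorem valAt_of_prefix (h : L <+: L') (hi : i < L.length) : valAt L' i = valAt L i := by
  rw [valAt, valAt, getElem?_of_prefix h hi]

/-- The gate `g`, which has number `i`, satisfies the requirements on smooth and decomposable
circuits, and if `D` holds, then also those on deterministic circuits. -/
structure Valid (D : Prop) (L : List (PGate n)) (i : ℕ) (g : PGate n) : Prop where
  nodup : g.kids.Nodup
  lt : ∀ c ∈ g.kids, c < i
  spec : (g.ty ≤ 1 ∧ g.kids = [] ∧ ∃ y : Fin n, g.x = y ∧ g.vars = {y} ∧
      ∀ a, g.val a ↔ a y = (g.ty == 1)) ∨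
    (g.ty = 2 ∧ (∀ c ∈ g.kids, varsAt L c = g.vars) ∧ (g.kids = [] → g.vars = ∅) ∧
      (∀ a, g.val a ↔ ∃ c ∈ g.kids, valAt L c a) ∧
      (D → ∀ a, ∀ c ∈ g.kids, ∀ d ∈ g.kids, valAt L c a → valAt L d a → c = d)) ∨
    (g.ty = 3 ∧ (∀ y, y ∈ g.vars ↔ ∃ c ∈ g.kids, y ∈ varsAt L c) ∧
      (∀ c ∈ g.kids, ∀ d ∈ g.kids, c ≠ d → Disjoint (varsAt L c) (varsAt L d)) ∧
      ∀ a, g.val a ↔ ∀ c ∈ g.kids, valAt L c a)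

/-- Children have smaller numbers than their parent, so validity never refers to gates appended
later. -/
theorem Valid.of_prefix {D : Prop} {g : PGate n} (h : g.Valid D L i) (hL : L <+: L')
    (hi : i ≤ L.length) : g.Valid D L' i := by
  have hv : ∀ c ∈ g.kids, varsAt L' c = varsAt L c := fun c hc =>
    varsAt_of_prefix hL ((h.lt c hc).trans_le hi)
  have hf : ∀ c ∈ g.kids, valAt L' c = valAt L c := fun c hc =>
    valAt_of_prefix hL ((h.lt c hc).trans_le hi)
  refine ⟨h.nodup, h.lt, ?_⟩
  rcases h.spec with h | ⟨h1, h2, h3, h4, h5⟩ | ⟨h1, h2, h3, h4⟩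
  · exact .inl h
  · refine .inr (.inl ⟨h1, fun c hc => (hv c hc).trans (h2 c hc), h3, fun a => ?_, fun hD a c hc d hd => ?_⟩)
    · rw [h4]
      exact exists_congr fun c => and_congr_right fun hc => by rw [hf c hc]
    · rw [hf c hc, hf d hd]
      exact h5 hD a c hc d hd
  · refine .inr (.inr ⟨h1, fun y => ?_, fun c hc d hd => ?_, fun a => ?_⟩)
    · rw [h2]
      exact exists_congr fun c => and_congr_right fun hc => by rw [hv c hc]
    · rw [hv c hc, hv d hd]
      exact h3 c hc d hd
    · rw [h4]
      exact forall₂_congr fun c hc => by rw [hf c hc]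

/-- All gates of the list are valid. -/
def AllValid (D : Prop) (L : List (PGate n)) : Prop := ∀ (i : ℕ) (g : PGate n),
  L[i]? = some g → g.Valid D L i

theorem AllValid.snoc {D : Prop} (h : AllValid D L) {g : PGate n} (hg : g.Valid D L L.length) :
    AllValid D (L ++ [g]) := by
  intro i g' hi
  rcases Nat.lt_or_ge i L.length with hlt | hge
  · rw [List.getElem?_append_left hlt] at hi
    exact (h i g' hi).of_prefix (List.prefix_append _ _) hlt.le
  · have hlt : i < (L ++ [g]).length := by
      by_contra hc
      rw [List.getElem?_eq_none (not_lt.1 hc)] at hi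
      cases hi
    obtain rfl : i = L.length := by simp at hlt; omega
    simp at hi
    subst hi
    exact hg.of_prefix (List.prefix_append _ _) le_rfl

theorem varsAt_snoc (g : PGate n) : varsAt (L ++ [g]) L.length = g.vars := by simp [varsAt]

theorem valAt_snoc (g : PGate n) : valAt (L ++ [g]) L.length = g.val := by simp [valAt]

end PGate

open PGate (varsAt valAt AllValid)

/-- The array starts with the list. -/
def ListAt (f : ℕ → ℕ) (l : List ℕ) : Prop := ∀ j (h : j < l.length), f j = l[j]

theorem ListAt.snoc {f : ℕ → ℕ} {l : List ℕ} (h : ListAt f l) (x : ℕ) :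
    ListAt (Function.update f l.length x) (l ++ [x]) := by
  intro j hj
  rw [Function.update_apply]
  split_ifs with h1
  · subst h1
    simp
  · have hj' : j < l.length := by simp at hj; omega
    rw [List.getElem_append_left hj', h j hj']

/-- The arrays `ty`, `var`, `off` and `ch` hold the list `L` of `gc` gates, followed by a list of
children of the next gate; `ec` is the number of edges. -/
structure Built {n : ℕ} (L : List (PGate n)) (cur : List ℕ) (ty var off ch : ℕ → ℕ) (gc ec : ℕ) :
    Prop where
  gc_eq : gc = L.length
  ty_at : ListAt ty (L.map PGate.ty)
  var_at : ListAt var (L.map PGate.x)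
  off_at : ∀ i ≤ L.length, off i = ((L.take i).flatMap PGate.kids).length
  ch_at : ListAt ch (L.flatMap PGate.kids ++ cur)
  ec_eq : ec = (L.flatMap PGate.kids ++ cur).length

namespace Built

variable {n : ℕ} {L : List (PGate n)} {cur : List ℕ} {ty var off ch : ℕ → ℕ} {gc ec : ℕ}

theorem push (h : Built L cur ty var off ch gc ec) (x : ℕ) :
    Built L (cur ++ [x]) ty var off (Function.update ch ec x) gc (ec + 1) := by
  refine ⟨h.gc_eq, h.ty_at, h.var_at, h.off_at, ?_, by rw [h.ec_eq]; simp; omega⟩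
  rw [← List.append_assoc, h.ec_eq]
  exact h.ch_at.snoc x

theorem close (h : Built L cur ty var off ch gc ec) (t x : ℕ) (U : Set (Fin n))
    (f : (Fin n → Bool) → Prop) :
    Built (L ++ [⟨t, x, cur, U, f⟩]) [] (Function.update ty gc t) (Function.update var gc x)
      (Function.update off (gc + 1) ec) ch (gc + 1) ec := by
  have hty := h.ty_at.snoc t
  have hvar := h.var_at.snoc x
  rw [List.length_map, ← h.gc_eq] at hty hvar
  refine ⟨by simp [h.gc_eq], by simpa using hty, by simpa using hvar, fun i hi => ?_, ?_, ?_⟩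
  · rw [Function.update_apply]
    split_ifs with h1
    · rw [h1, h.gc_eq, List.take_of_length_le (by simp), h.ec_eq]
      simp
    · have : i ≤ L.length := by
        rw [h.gc_eq] at h1
        simp at hi
        omega
      rw [h.off_at i this, List.take_append_of_le_length this]
  · simpa using h.ch_at
  · simpa using h.ec_eq

theorem off_succ (h : Built L cur ty var off ch gc ec) {i : ℕ} {g : PGate n} (hi : L[i]? = some g) :
    off (i + 1) = off i + g.kids.length := by
  obtain ⟨hlt, hg⟩ := List.getElem?_eq_some_iff.1 hi
  rw [h.off_at (i + 1) hlt, h.off_at i hlt.le, List.take_add_one, hi]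
  simp

theorem ch_eq (h : Built L cur ty var off ch gc ec) {i : ℕ} {g : PGate n} (hi : L[i]? = some g)
    {k : ℕ} (hk : k < g.kids.length) : ch (off i + k) = g.kids[k] := by
  obtain ⟨hlt, hg⟩ := List.getElem?_eq_some_iff.1 hi
  have hsplit : L.flatMap PGate.kids = (L.take i).flatMap PGate.kids ++ (g.kids ++
      (L.drop (i + 1)).flatMap PGate.kids) := by
    conv_lhs => rw [← List.take_append_drop i L, List.drop_eq_getElem_cons hlt, hg]
    simp
  have h1 := h.ch_at (off i + k) (by
    rw [h.off_at i hlt.le, hsplit]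
    simp only [List.length_append]
    omega)
  rw [h1]
  have h2 := h.off_at i hlt.le
  simp only [hsplit, h2]
  rw [List.getElem_append_left (by simp only [List.length_append]; omega),
    List.getElem_append_right (by omega), List.getElem_append_left (by omega)]
  congr 1
  omega

theorem ty_eq (h : Built L cur ty var off ch gc ec) {i : ℕ} {g : PGate n} (hi : L[i]? = some g) :
    ty i = g.ty ∧ var i = g.x := by
  obtain ⟨hlt, hg⟩ := List.getElem?_eq_some_iff.1 hi
  rw [h.ty_at i (by simpa using hlt), h.var_at i (by simpa using hlt)]
  simp [hg]

end Built

/-- The state holds the list `L` of gates in banks 30 to 33; registers 24 and 25 hold the numbers of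
gates and edges. -/
def RamState.Holds {n : ℕ} (s : RamState) (D : Prop) (L : List (PGate n)) : Prop :=
  Built L [] (s.mem 30) (s.mem 31) (s.mem 32) (s.mem 33) (s.reg 24) (s.reg 25) ∧ AllValid D L

theorem RamState.Holds.congr {n : ℕ} {s s' : RamState} {D : Prop} {L : List (PGate n)}
    (h : s.Holds D L) (h0 : s'.mem 30 = s.mem 30) (h1 : s'.mem 31 = s.mem 31)
    (h2 : s'.mem 32 = s.mem 32) (h3 : s'.mem 33 = s.mem 33) (h4 : s'.reg 24 = s.reg 24)
    (h5 : s'.reg 25 = s.reg 25) : s'.Holds D L := by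
  rw [Holds, h0, h1, h2, h3, h4, h5]
  exact h

theorem RamProg.Agree.holds {n : ℕ} {p : RamProg} {s s' : RamState} {D : Prop} {L : List (PGate n)}
    (ha : p.Agree s s') (h : s.Holds D L) (hr : 24 ∉ p.regs ∧ 25 ∉ p.regs)
    (hb : 30 ∉ p.banks ∧ 31 ∉ p.banks ∧ 32 ∉ p.banks ∧ 33 ∉ p.banks) : s'.Holds D L :=
  h.congr (ha.2 _ hb.1) (ha.2 _ hb.2.1) (ha.2 _ hb.2.2.1) (ha.2 _ hb.2.2.2) (ha.1 _ hr.1)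
    (ha.1 _ hr.2)

/-- `g` is the number of a valid gate on the variables in `U`, or zero if there are none. -/
def IsProduct {n : ℕ} (L : List (PGate n)) (g : ℕ) (U : Set (Fin n)) : Prop :=
  (g = 0 ∧ U = ∅) ∨ (g ≠ 0 ∧ g < L.length ∧ varsAt L g = U ∧ U.Nonempty ∧ ∀ a, valAt L g a)

theorem IsProduct.of_prefix {n : ℕ} {L L' : List (PGate n)} {g : ℕ} {U : Set (Fin n)}
    (h : IsProduct L g U) (hL : L <+: L') : IsProduct L' g U := by
  rcases h with h | ⟨h1, h2, h3, h4, h5⟩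
  · exact .inl h
  · refine .inr ⟨h1, h2.trans_le hL.length_le, ?_, h4, ?_⟩
    · rw [PGate.varsAt_of_prefix hL h2, h3]
    · rwa [PGate.valAt_of_prefix hL h2]

/-- Add a child to the gate that is being constructed. -/
def pushChild (e : RamExp) : RamProg :=
  .store 33 (.reg 25) e ;; .assign 25 (.op .add (.reg 25) (.const 1))

/-- Finish the gate that is being constructed. -/
def closeGate (ty : ℕ) (x : RamExp) : RamProg :=
  .store 30 (.reg 24) (.const ty) ;; .store 31 (.reg 24) x ;;
  .assign 24 (.op .add (.reg 24) (.const 1)) ;; .store 32 (.reg 24) (.reg 25)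

/-- The product of the gates in registers 40 and 41 is written to register 42. -/
def combine : RamProg :=
  .ite (.reg 40)
    (.ite (.reg 41)
      (pushChild (.reg 40) ;; pushChild (.reg 41) ;; closeGate 3 (.const 0) ;;
        .assign 42 (.op .sub (.reg 24) (.const 1)))
      (.assign 42 (.reg 40)))
    (.assign 42 (.reg 41))

/-- The number zero is neutral and requires no new gate. Two proper products have nonempty disjoint
sets of variables, so their gates are distinct and the new list of children has no repetition. -/
theorem combine_spec {n : ℕ} {s : RamState} {V : ℕ} {D : Prop} {L : List (PGate n)}
    {U₁ U₂ : Set (Fin n)} (hs : s.Holds D L) (h₁ : IsProduct L (s.reg 40) U₁)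
    (h₂ : IsProduct L (s.reg 41) U₂) (hd : Disjoint U₁ U₂) :
    Runs V combine s 40 fun s' =>
      ∃ L', L <+: L' ∧ s'.Holds D L' ∧ IsProduct L' (s'.reg 42) (U₁ ∪ U₂) := by
  refine Runs.of_loopFree rfl (by decide) (by simp [combine, pushChild, closeGate]) ?_
  rcases h₁ with ⟨k1, rfl⟩ | ⟨k1, l1, v1, ne1, f1⟩
  · refine ⟨L, List.prefix_rfl, ?_⟩
    simpa [combine, k1, RamState.Holds] using ⟨hs, h₂⟩
  · rcases h₂ with ⟨k2, rfl⟩ | ⟨k2, l2, v2, ne2, f2⟩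
    · refine ⟨L, List.prefix_rfl, ?_⟩
      simpa [combine, k1, k2, RamState.Holds] using ⟨hs, .inr ⟨k1, l1, v1, ne1, f1⟩⟩
    · have hB := ((hs.1.push (s.reg 40)).push (s.reg 41)).close 3 0 (U₁ ∪ U₂) fun _ => True
      have hlen := hs.1.gc_eq
      refine ⟨L ++ [⟨3, 0, [s.reg 40, s.reg 41], U₁ ∪ U₂, fun _ => True⟩], List.prefix_append _ _,
        ⟨?_, hs.2.snoc ⟨?_, ?_, .inr (.inr ⟨rfl, ?_, ?_, ?_⟩)⟩⟩, ?_⟩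
      · simpa [combine, k1, k2, pushChild, closeGate] using hB
      · simp only [List.nodup_cons, List.mem_singleton,
          List.not_mem_nil, not_false_eq_true, List.nodup_nil, and_true]
        intro h
        rw [← v1, ← v2, h, disjoint_self] at hd
        rw [← v2, hd] at ne2
        exact Set.not_nonempty_empty ne2
      · simp [l1, l2]
      · simp [v1, v2]
      · simp [v1, v2, hd, hd.symm]
      · simp [f1, f2]
      · right
        have e : (combine.step s).reg 42 = L.length := by
          simp [combine, k1, k2, pushChild, closeGate, hlen]
        rw [e]
        refine ⟨by omega, by simp, PGate.varsAt_snoc _, ne1.inl, fun a => ?_⟩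
        rw [PGate.valAt_snoc]
        trivial

/-! ### Intervals of the nodes of a heap -/

/-- The first position below the node `v` of a complete binary tree of height `h`. -/
def heapStart (h v : ℕ) : ℕ := v * 2 ^ heapHeight h v - 2 ^ h

/-- The end of the interval of positions below the node `v` of a complete binary tree. -/
def heapEnd (h v : ℕ) : ℕ := (v + 1) * 2 ^ heapHeight h v - 2 ^ h

theorem heapHeight_of_leaf (h j : ℕ) : heapHeight h (2 ^ h + j) = 0 := by
  have : h ≤ Nat.log 2 (2 ^ h + j) := Nat.le_log_of_pow_le (by norm_num) (by omega)
  simp only [heapHeight]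
  omega

theorem heapStart_leaf (h j : ℕ) : heapStart h (2 ^ h + j) = j := by
  simp [heapStart, heapHeight_of_leaf]

theorem heapEnd_leaf (h j : ℕ) : heapEnd h (2 ^ h + j) = j + 1 := by
  simp only [heapEnd, heapHeight_of_leaf]
  omega

/-- This ensures that the truncated subtractions in `heapStart` and `heapEnd` are genuine. -/
theorem le_mul_heapHeight {h v : ℕ} (h1 : 1 ≤ v) (h2 : v < 2 ^ (h + 1)) :
    2 ^ h ≤ v * 2 ^ heapHeight h v := by
  have h3 : Nat.log 2 v < h + 1 := Nat.log_lt_of_lt_pow (by omega) h2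
  have h4 := Nat.pow_log_le_self 2 (x := v) (by omega)
  calc 2 ^ h = 2 ^ Nat.log 2 v * 2 ^ (h - Nat.log 2 v) := by
        rw [← pow_add]
        congr 1
        omega
    _ ≤ v * 2 ^ heapHeight h v := Nat.mul_le_mul_right _ h4

/-- Dividing by 2^k leads to the k-th ancestor, whose interval of positions contains that of the
node. -/
theorem heap_div_le {h v : ℕ} (k : ℕ) (hk : 1 ≤ v / 2 ^ k) (hv : v < 2 ^ (h + 1)) :
    heapStart h (v / 2 ^ k) ≤ heapStart h v ∧ heapEnd h v ≤ heapEnd h (v / 2 ^ k) := by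
  have h0 : 0 < 2 ^ k := by positivity
  have hv' : 2 ^ k ≤ v := by
    by_contra h
    rw [Nat.div_eq_of_lt (not_le.1 h)] at hk
    omega
  have h1 := heapHeight_div k hv' hv
  have h2 := Nat.div_mul_le_self v (2 ^ k)
  have h3 := Nat.lt_div_mul_add (a := v) h0
  have h4 : v + 1 ≤ (v / 2 ^ k + 1) * 2 ^ k := by
    rw [add_mul]
    omega
  constructor
  · refine Nat.sub_le_sub_right ?_ _
    calc v / 2 ^ k * 2 ^ heapHeight h (v / 2 ^ k)
        = v / 2 ^ k * 2 ^ k * 2 ^ heapHeight h v := by rw [h1, pow_add]; ring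
      _ ≤ _ := Nat.mul_le_mul_right _ h2
  · refine Nat.sub_le_sub_right ?_ _
    calc (v + 1) * 2 ^ heapHeight h v ≤ (v / 2 ^ k + 1) * 2 ^ k * 2 ^ heapHeight h v :=
          Nat.mul_le_mul_right _ h4
      _ = _ := by rw [h1, pow_add]; ring

theorem heap_lt {h v : ℕ} (h1 : 1 ≤ v) (h2 : v < 2 ^ (h + 1)) : heapStart h v < heapEnd h v := by
  have := le_mul_heapHeight h1 h2
  have : 0 < 2 ^ heapHeight h v := by positivity
  simp only [heapStart, heapEnd, add_mul]
  omega

theorem heap_children {h v : ℕ} (h1 : 1 ≤ v) (h2 : v < 2 ^ h) :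
    heapStart h (2 * v) = heapStart h v ∧ heapEnd h (2 * v) = heapStart h (2 * v + 1) ∧
      heapEnd h (2 * v + 1) = heapEnd h v := by
  have e1 : heapHeight h v = heapHeight h (2 * v) + 1 := by
    have := heapHeight_div (h := h) (v := 2 * v) 1 (by omega) (by rw [pow_succ]; omega)
    rwa [pow_one, Nat.mul_div_cancel_left v (by norm_num)] at this
  have e2 : heapHeight h v = heapHeight h (2 * v + 1) + 1 := by
    have := heapHeight_div (h := h) (v := 2 * v + 1) 1 (by omega) (by rw [pow_succ]; omega)
    rwa [pow_one, show (2 * v + 1) / 2 = v by omega] at this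
  have e3 : heapHeight h (2 * v + 1) = heapHeight h (2 * v) := by omega
  refine ⟨?_, ?_, ?_⟩
  · rw [heapStart, heapStart, e1, pow_succ]
    congr 1
    ring
  · rw [heapEnd, heapStart, e3]
  · rw [heapEnd, heapEnd, e2, pow_succ]
    congr 1
    ring

/-- The variables at positions from `a` to `b`, without `b`. -/
def posIco {n : ℕ} (pos : ℕ → ℕ) (a b : ℕ) : Set (Fin n) := {x | a ≤ pos x ∧ pos x < b}

theorem posIco_union {n : ℕ} (pos : ℕ → ℕ) {a b c : ℕ} (h1 : a ≤ b) (h2 : b ≤ c) :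
    posIco pos a b ∪ posIco pos b c = (posIco pos a c : Set (Fin n)) := by
  ext x
  simp only [posIco, Set.mem_union, Set.mem_ofPred_eq]
  omega

theorem posIco_disjoint {n : ℕ} (pos : ℕ → ℕ) {a b c : ℕ} :
    Disjoint (posIco pos a b : Set (Fin n)) (posIco pos b c) :=
  Set.disjoint_left.2 fun x h1 h2 => by
    simp only [posIco, Set.mem_ofPred_eq] at h1 h2
    omega

theorem posIco_self {n : ℕ} (pos : ℕ → ℕ) (a : ℕ) : (posIco pos a a : Set (Fin n)) = ∅ :=
  Set.eq_empty_iff_forall_notMem.2 fun x h => by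
    simp only [posIco, Set.mem_ofPred_eq] at h
    omega

/-! ### The height at which two leaves meet -/

/-- The number of binary digits up to the first one in which `a` and `b` differ. -/
def meetHeight (a b : ℕ) : ℕ := if a = b then 0 else meetHeight (a / 2) (b / 2) + 1
termination_by a + b
decreasing_by omega

theorem meetHeight_self (a : ℕ) : meetHeight a a = 0 := by rw [meetHeight, if_pos rfl]

theorem meetHeight_of_ne {a b : ℕ} (h : a ≠ b) :
    meetHeight a b = meetHeight (a / 2) (b / 2) + 1 := by rw [meetHeight, if_neg h]

/-- Equality of the ancestors at height k characterises the meeting height. The reductions to halves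
of the binary digits follow by comparing upper bounds. -/
theorem meetHeight_le_iff {a b k : ℕ} : meetHeight a b ≤ k ↔ a / 2 ^ k = b / 2 ^ k := by
  induction k generalizing a b with
  | zero =>
    by_cases h : a = b
    · simp [h, meetHeight_self]
    · simp [h, meetHeight_of_ne h]
  | succ k ih =>
    by_cases h : a = b
    · simp [h, meetHeight_self]
    · rw [meetHeight_of_ne h, Nat.succ_le_succ_iff, ih, Nat.div_div_eq_div_mul,
        Nat.div_div_eq_div_mul, pow_succ']

/-- Together with `meetHeight_of_div_eq` this reduces the meeting height of two words to a table for
half-words: the high halves decide unless they agree, and then the low halves do. -/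
theorem meetHeight_of_div_ne {a b : ℕ} (β : ℕ) (h : a / 2 ^ β ≠ b / 2 ^ β) :
    meetHeight a b = meetHeight (a / 2 ^ β) (b / 2 ^ β) + β := by
  refine eq_of_forall_ge_iff fun k => ?_
  rw [meetHeight_le_iff]
  rcases Nat.lt_or_ge k β with hk | hk
  · refine iff_of_false (fun h' => h ?_) (by omega)
    obtain ⟨j, rfl⟩ := Nat.exists_eq_add_of_lt hk
    rw [show k + j + 1 = k + (j + 1) by omega, pow_add, ← Nat.div_div_eq_div_mul,
      ← Nat.div_div_eq_div_mul, h']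
  · obtain ⟨j, rfl⟩ := Nat.exists_eq_add_of_le hk
    rw [show (meetHeight (a / 2 ^ β) (b / 2 ^ β) + β ≤ β + j ↔
      meetHeight (a / 2 ^ β) (b / 2 ^ β) ≤ j) by omega, meetHeight_le_iff, pow_add,
      Nat.div_div_eq_div_mul, Nat.div_div_eq_div_mul]

theorem meetHeight_of_div_eq {a b : ℕ} (β : ℕ) (h : a / 2 ^ β = b / 2 ^ β) :
    meetHeight a b = meetHeight (a % 2 ^ β) (b % 2 ^ β) := by
  refine eq_of_forall_ge_iff fun k => ?_
  rw [meetHeight_le_iff, meetHeight_le_iff]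
  rcases Nat.lt_or_ge k β with hk | hk
  · obtain ⟨j, rfl⟩ := Nat.exists_eq_add_of_lt hk
    have key : ∀ c, c / 2 ^ k = c / 2 ^ (k + j + 1) * 2 ^ (j + 1) + c % 2 ^ (k + j + 1) / 2 ^ k := by
      intro c
      have h0 : 0 < 2 ^ k := by positivity
      conv_lhs => rw [← Nat.div_add_mod' c (2 ^ (k + j + 1))]
      rw [show c / 2 ^ (k + j + 1) * 2 ^ (k + j + 1) = c / 2 ^ (k + j + 1) * 2 ^ (j + 1) * 2 ^ k by
        rw [mul_assoc, ← pow_add]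
        congr 2
        omega, mul_comm _ (2 ^ k), Nat.mul_add_div h0]
    rw [key a, key b, h]
    omega
  · have hz : ∀ c, c % 2 ^ β / 2 ^ k = 0 := fun c => Nat.div_eq_of_lt
      ((Nat.mod_lt _ (by positivity)).trans_le (Nat.pow_le_pow_right (by norm_num) hk))
    rw [hz, hz]
    refine iff_of_true ?_ rfl
    obtain ⟨j, rfl⟩ := Nat.exists_eq_add_of_le hk
    rw [pow_add, ← Nat.div_div_eq_div_mul, ← Nat.div_div_eq_div_mul, h]

/-! ### Powers of two -/

/-- The expression r - (r - 2y) is min(r, 2y). It replaces the doubling of y because a difference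
counts as bounded by its first operand, so that the growth condition `RamProg.Safe` can be checked
syntactically. Register 4 is large enough for the minimum to be 2y. -/
def powersBody : RamProg :=
  .assign 19 (.op .sub (.reg 4) (.op .sub (.reg 4) (.op .add (.reg 19) (.reg 19)))) ;;
  .assign 28 (.op .add (.reg 28) (.const 1)) ;; .store 15 (.reg 28) (.reg 19)

/-- Register 19 is set to a power `2^h` of two that is at least `n + 2`, register 28 to `h`, register
45 to `⌈h/2⌉` and register 29 to the corresponding power; bank 15 holds the powers of two. -/
def powers : RamProg :=
  (.assign 19 (.const 1) ;; .assign 28 (.const 0) ;; .store 15 (.const 0) (.const 1)) ;;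
  .while (.op .lt (.reg 19) (.op .add (.reg 2) (.const 2))) powersBody ;;
  (.assign 45 (.op .add (.reg 28) (.const 1)) ;; .assign 45 (.op .div (.reg 45) (.const 2)) ;;
    .assign 29 (.load 15 (.reg 45)))

/-- The result of `powers`. -/
structure PowersOK (n h : ℕ) (s : RamState) : Prop where
  r19 : s.reg 19 = 2 ^ h
  r28 : s.reg 28 = h
  r45 : s.reg 45 = (h + 1) / 2
  r29 : s.reg 29 = 2 ^ ((h + 1) / 2)
  m15 : ∀ i ≤ h, s.mem 15 i = 2 ^ i
  le : n + 2 ≤ 2 ^ h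
  lt : 2 ^ h ≤ 2 * (n + 1)

/-- The ends of gaps range over 0, …, n+1, hence at least n+2 leaves are required. Stopping at the
first sufficient power keeps the tree linear in n. -/
theorem powers_spec {n : ℕ} {s : RamState} {V : ℕ} (r2 : s.reg 2 = n) (r4 : s.reg 4 = 4 * n + 8) :
    Runs V powers s (30 * n + 150) fun s' => ∃ h, PowersOK n h s' := by
  refine (Runs.step_seq (T := 10) (T' := (n + 1 + 1) * (20 + 5 + 1) + 20) rfl (by decide) (by simp)
    (Runs.seq (Q := fun s' => ∃ h, s'.reg 19 = 2 ^ h ∧ s'.reg 28 = h ∧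
      (∀ i ≤ h, s'.mem 15 i = 2 ^ i) ∧ n + 2 ≤ 2 ^ h ∧ 2 ^ h ≤ 2 * (n + 1))
    (Runs.while_lt 20 (fun k s' => ∃ h, s'.reg 19 = 2 ^ h ∧ s'.reg 28 = h ∧
      (∀ i ≤ h, s'.mem 15 i = 2 ^ i) ∧ n + 2 - 2 ^ h ≤ k ∧ 2 ^ h ≤ 2 * (n + 1)) (n + 1) ?_ ?_ ?_ ?_)
    fun s' ha h => ?_)).mono (by omega) fun s' _ h => h
  · exact ⟨0, by simp; omega⟩
  · simp
  · rintro k s' ha ⟨h, h19, h28, hm, hk, hlt⟩ hcond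
    have f2 : s'.reg 2 = n := (ha.1 2 (by decide)).trans (by simp [r2])
    have f4 : s'.reg 4 = 4 * n + 8 := (ha.1 4 (by decide)).trans (by simp [r4])
    have hl : 2 ^ h < n + 2 := by
      by_contra hc
      simp [h19, f2, hc] at hcond
    have h1 : 1 ≤ 2 ^ h := Nat.one_le_two_pow
    refine Runs.of_loopFree rfl (by decide) (by simp [powersBody]) ⟨k - 1, by omega, h + 1, ?_⟩
    simp [powersBody, h19, h28, f4, pow_succ]
    have e : 4 * n + 8 - (4 * n + 8 - (2 ^ h + 2 ^ h)) = 2 ^ h * 2 := by omega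
    rw [e]
    refine ⟨rfl, fun i hi => ?_, by omega, by omega⟩
    rw [Function.update_apply]
    split_ifs with hih
    · rw [hih, pow_succ]
    · exact hm i (by omega)
  · rintro k s' ha ⟨h, h19, h28, hm, hk, hlt⟩ hcond
    have f2 : s'.reg 2 = n := (ha.1 2 (by decide)).trans (by simp [r2])
    refine ⟨h, h19, h28, hm, ?_, hlt⟩
    by_contra hc
    simp [h19, f2, show 2 ^ h < n + 2 by omega] at hcond
  · obtain ⟨h, h19, h28, hm, hge, hle⟩ := h
    refine Runs.of_loopFree rfl (by decide) (by simp) ⟨h, ?_⟩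
    constructor <;> simp [h19, h28, hge, hle]
    · exact hm _ (by omega)
    · exact hm

/-! ### The gates for single variables and for the intervals of a heap -/

def leafGatesBody : RamProg :=
  closeGate 0 (.reg 26) ;; closeGate 1 (.reg 26) ;; pushChild (.op .sub (.reg 24) (.const 2)) ;;
  pushChild (.op .sub (.reg 24) (.const 1)) ;; closeGate 2 (.const 0) ;;
  .store 17 (.op .add (.reg 19) (.load 7 (.reg 26))) (.op .sub (.reg 24) (.const 1)) ;;
  .assign 26 (.op .add (.reg 26) (.const 1))

/-- For every variable `x` a gate `x ∨ ¬x` is written to the leaf at the position of `x` in bank 17. -/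
def leafGates : RamProg :=
  (.assign 26 (.const 0) ;; .assign 24 (.const 0) ;; .assign 25 (.const 0) ;;
    closeGate 3 (.const 0)) ;;
  .while (.op .lt (.reg 26) (.reg 2)) leafGatesBody

/-- Leaves of the tree that are not the position of a variable keep the entry 0, which stands for
the empty product. -/
theorem leafGates_spec {n h : ℕ} {pos : ℕ → ℕ} {D : Prop} {s : RamState} {V : ℕ}
    (hinj : ∀ x y : Fin n, pos x = pos y → x = y)
    (e7 : s.mem 7 = pos) (r2 : s.reg 2 = n) (r19 : s.reg 19 = 2 ^ h)
    (hz : s.mem 32 0 = 0) (h17 : ∀ i, s.mem 17 i = 0) :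
    Runs V leafGates s (100 * n + 150) fun s' => ∃ L : List (PGate n), s'.Holds D L ∧ L ≠ [] ∧
      ∀ j < 2 ^ h, IsProduct L (s'.mem 17 (2 ^ h + j)) {y : Fin n | pos y = j} := by
  refine (Runs.step_seq (T := 40) (T' := (n + 1) * (90 + 3 + 1)) rfl (by decide)
    (by simp [closeGate]) (Runs.count (e := .op .lt (.reg 26) (.reg 2)) 90
    (fun k s' => k + s'.reg 26 = n ∧ ∃ L : List (PGate n), s'.Holds D L ∧ L ≠ [] ∧
      ∀ j < 2 ^ h, IsProduct L (s'.mem 17 (2 ^ h + j)) {y : Fin n | y < s'.reg 26 ∧ pos y = j})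
    n ?_ ?_ ?_ ?_)).mono (by omega) fun s' _ h => h
  -- The list starts with an empty conjunction that only occupies the number zero, so that zero can
  -- mean the absence of a gate in `IsProduct`.
  · refine ⟨by simp [closeGate], [⟨3, 0, [], ∅, fun _ => True⟩], ⟨?_, ?_⟩, by simp, fun j hj => ?_⟩
    · simp only [RamProg.step, closeGate, RamState.reg_setReg, RamState.mem_setReg,
        RamState.reg_setMem, RamState.mem_setMem, RamExp.eval, WordOp.apply]
      refine ⟨by simp, ?_, ?_, ?_, by simp [ListAt], by simp⟩
      · intro j hj
        simp at hj
        simp [hj]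
      · intro j hj
        simp at hj
        simp [hj]
      · intro i hi
        have : i = 0 ∨ i = 1 := by simp at hi; omega
        rcases this with rfl | rfl <;> simp [hz]
    · intro i g hi
      have := List.mem_singleton.1 (List.mem_of_getElem? hi)
      subst this
      refine ⟨by simp, by simp, .inr (.inr (by simp))⟩
    · left
      simp [closeGate, h17]
  · simp
  · rintro k s' ha ⟨hk, L, hL, hne, hj⟩
    have f2 : s'.reg 2 = n := (ha.1 2 (by decide)).trans (by simp [closeGate, r2])
    have f7 : s'.mem 7 = pos := (ha.2 7 (by decide)).trans (by simp [closeGate, e7])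
    have f19 : s'.reg 19 = 2 ^ h := (ha.1 19 (by decide)).trans (by simp [closeGate, r19])
    refine ⟨by simp [f2]; omega, Runs.of_loopFree rfl (by decide) (by simp [leafGatesBody, closeGate,
      pushChild]) ?_⟩
    have hlt : s'.reg 26 < n := by omega
    obtain ⟨y, hy⟩ : ∃ y : Fin n, (y : ℕ) = s'.reg 26 := ⟨⟨_, hlt⟩, rfl⟩
    have hgc := hL.1.gc_eq
    have hlen : 0 < L.length := List.length_pos_iff.2 hne
    set g0 : PGate n := ⟨0, s'.reg 26, [], {y}, fun a => a y = false⟩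
    set g1 : PGate n := ⟨1, s'.reg 26, [], {y}, fun a => a y = true⟩
    set g2 : PGate n := ⟨2, 0, [s'.reg 24, s'.reg 24 + 1], {y}, fun _ => True⟩
    have v0 : varsAt (L ++ [g0] ++ [g1]) L.length = {y} := by simp [varsAt, g0]
    have v1 : varsAt (L ++ [g0] ++ [g1]) (L.length + 1) = {y} := by simp [varsAt, g1]
    have w0 : valAt (L ++ [g0] ++ [g1]) L.length = fun a => a y = false := by simp [valAt, g0]
    have w1 : valAt (L ++ [g0] ++ [g1]) (L.length + 1) = fun a => a y = true := by
      simp [valAt, g1]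
    have hB := ((((hL.1.close 0 (s'.reg 26) {y} fun a => a y = false).close 1 (s'.reg 26) {y}
      fun a => a y = true).push (s'.reg 24)).push (s'.reg 24 + 1)).close 2 0 {y} fun _ => True
    refine ⟨?_, L ++ [g0] ++ [g1] ++ [g2], ⟨?_, ?_⟩, by simp, fun j hjh => ?_⟩
    · simp [leafGatesBody, closeGate, pushChild]
      omega
    · simpa [leafGatesBody, closeGate, pushChild, g0, g1, g2] using hB
    · refine ((hL.2.snoc ?_).snoc ?_).snoc ?_
      · exact ⟨by simp [g0], by simp [g0], .inl ⟨by simp [g0], rfl, y, by simp [g0, hy], rfl,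
          fun a => by simp [g0]⟩⟩
      · exact ⟨by simp [g1], by simp [g1], .inl ⟨by simp [g1], rfl, y, by simp [g1, hy], rfl,
          fun a => by simp [g1]⟩⟩
      · refine ⟨by simp [g2], by simp [g2, hgc], .inr (.inl ⟨rfl, ?_, by simp [g2], ?_, ?_⟩)⟩
        · simp only [g2, hgc, List.mem_cons, List.not_mem_nil, or_false, forall_eq_or_imp,
            forall_eq]
          exact ⟨v0, v1⟩
        · intro a
          simp only [g2, hgc, List.mem_cons, List.not_mem_nil, or_false, exists_eq_or_imp,
            exists_eq_left, w0, w1]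
          cases a y <;> simp
        · intro _ a
          simp only [g2, hgc, List.mem_cons, List.not_mem_nil, or_false, forall_eq_or_imp,
            forall_eq, w0, w1]
          cases a y <;> simp
    · have e : (leafGatesBody.step s').mem 17 =
          Function.update (s'.mem 17) (2 ^ h + pos y) (L.length + 2) := by
        simp [leafGatesBody, closeGate, pushChild, f19, f7, hgc, hy]
      have e26 : (leafGatesBody.step s').reg 26 = s'.reg 26 + 1 := by
        simp [leafGatesBody, closeGate, pushChild]
      rw [e, e26, Function.update_apply]
      split_ifs with hjy
      · right
        have hset : {y' : Fin n | y' < s'.reg 26 + 1 ∧ pos y' = j} = {y} := by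
          ext y'
          simp only [Set.mem_ofPred_eq, Set.mem_singleton_iff]
          constructor
          · rintro ⟨-, h2⟩
            exact hinj _ _ (by omega)
          · rintro rfl
            omega
        rw [hset]
        refine ⟨by omega, by simp, ?_, by simp, fun a => ?_⟩
        · rw [show L.length + 2 = (L ++ [g0] ++ [g1]).length by simp, PGate.varsAt_snoc]
        · rw [show L.length + 2 = (L ++ [g0] ++ [g1]).length by simp, PGate.valAt_snoc]
          trivial
      · have hset : {y' : Fin n | y' < s'.reg 26 + 1 ∧ pos y' = j} =
            {y' : Fin n | y' < s'.reg 26 ∧ pos y' = j} := by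
          ext y'
          simp only [Set.mem_ofPred_eq]
          constructor
          · rintro ⟨h1, h2⟩
            refine ⟨lt_of_le_of_ne (by omega) fun h3 => hjy ?_, h2⟩
            rw [← h2, show y' = y from Fin.ext (by omega)]
          · rintro ⟨h1, h2⟩
            omega
        rw [hset]
        exact (hj j hjh).of_prefix ⟨[g0, g1, g2], by simp⟩
  · rintro s' ha ⟨hk, L, hL, hne, hj⟩
    have f2 : s'.reg 2 = n := (ha.1 2 (by decide)).trans (by simp [closeGate, r2])
    refine ⟨by simp [f2]; omega, L, hL, hne, fun j hjh => ?_⟩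
    have := hj j hjh
    rwa [show {y : Fin n | y < s'.reg 26 ∧ pos y = j} = {y : Fin n | pos y = j} by
      ext y
      have := y.2
      simp only [Set.mem_ofPred_eq]
      omega] at this

/-- The products of the intervals below the nodes are written to bank 17. -/
def heapGates : RamProg :=
  .assign 27 (.op .sub (.reg 19) (.const 1)) ;;
  .while (.reg 27)
    ((.assign 40 (.load 17 (.op .add (.reg 27) (.reg 27))) ;;
      .assign 41 (.load 17 (.op .add (.op .add (.reg 27) (.reg 27)) (.const 1)))) ;;
    combine ;;
    (.store 17 (.reg 27) (.reg 42) ;; .assign 27 (.op .sub (.reg 27) (.const 1))))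

/-- Children of a heap node have larger numbers, so counting down meets them first. Their two
intervals are adjacent and make up the interval of the node. -/
theorem heapGates_spec {n h : ℕ} {pos : ℕ → ℕ} {D : Prop} {s : RamState} {V : ℕ}
    {L : List (PGate n)} (r19 : s.reg 19 = 2 ^ h) (hL : s.Holds D L)
    (hleaf : ∀ j < 2 ^ h, IsProduct L (s.mem 17 (2 ^ h + j)) {y : Fin n | pos y = j}) :
    Runs V heapGates s (100 * 2 ^ h) fun s' => ∃ L' : List (PGate n), L <+: L' ∧ s'.Holds D L' ∧
      ∀ v, 1 ≤ v → v < 2 ^ (h + 1) →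
        IsProduct L' (s'.mem 17 v) (posIco pos (heapStart h v) (heapEnd h v) : Set (Fin n)) := by
  have h1 : 1 ≤ 2 ^ h := Nat.one_le_two_pow
  refine (Runs.step_seq (T := 10) (T' := (2 ^ h - 1 + 1) * (80 + 1 + 1)) rfl (by decide) (by simp)
    (Runs.count (e := .reg 27) 80 (fun k s' => s'.reg 27 = k ∧ k < 2 ^ h ∧
      ∃ L' : List (PGate n), L <+: L' ∧ s'.Holds D L' ∧ ∀ v, k < v → v < 2 ^ (h + 1) →
        IsProduct L' (s'.mem 17 v) (posIco pos (heapStart h v) (heapEnd h v) : Set (Fin n)))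
    (2 ^ h - 1) ?_ ?_ ?_ ?_)).mono (by omega) fun s' _ h => h
  · refine ⟨by simp [r19], by omega, L, List.prefix_rfl, hL.congr rfl rfl rfl rfl rfl rfl,
      fun v hv1 hv2 => ?_⟩
    obtain ⟨j, rfl⟩ := Nat.exists_eq_add_of_le (show 2 ^ h ≤ v by omega)
    have hj : j < 2 ^ h := by rw [pow_succ] at hv2; omega
    rw [heapStart_leaf, heapEnd_leaf]
    have := hleaf j hj
    rwa [show {y : Fin n | pos y = j} = posIco pos j (j + 1) by
      ext y
      simp only [posIco, Set.mem_ofPred_eq]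
      omega] at this
  · simp
  · rintro k s' ha ⟨h27, hk, L', hLL', hL', hv⟩
    refine ⟨by simp [h27], ?_⟩
    obtain ⟨c1, c2, c3⟩ := heap_children (h := h) (v := k + 1) (by omega) hk
    have hpow : 2 ^ (h + 1) = 2 ^ h * 2 := pow_succ _ _
    refine (Runs.step_seq (T := 20) (T' := 40 + 10) rfl (by decide) (by simp) (Runs.seq (combine_spec
      (D := D) (L := L') (U₁ := posIco pos (heapStart h (2 * (k + 1))) (heapEnd h (2 * (k + 1))))
      (U₂ := posIco pos (heapStart h (2 * (k + 1) + 1)) (heapEnd h (2 * (k + 1) + 1)))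
      (hL'.congr rfl rfl rfl rfl rfl rfl) ?_ ?_ ?_) fun s'' ha'' h'' => ?_)).mono (by omega)
      fun s' _ h => h
    · have := hv (2 * (k + 1)) (by omega) (by omega)
      simpa [h27, two_mul] using this
    · have := hv (2 * (k + 1) + 1) (by omega) (by omega)
      simpa [h27, two_mul] using this
    · rw [c2]
      exact posIco_disjoint pos
    · obtain ⟨L'', hLL'', hL'', hp⟩ := h''
      have f27 : s''.reg 27 = k + 1 := (ha''.1 27 (by decide)).trans (by simp [h27])
      have f17 : s''.mem 17 = s'.mem 17 := (ha''.2 17 (by decide)).trans (by simp)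
      refine Runs.of_loopFree rfl (by decide) (by simp) ⟨by simp [f27], by omega, L'',
        hLL'.trans hLL'', hL''.congr rfl rfl rfl rfl rfl rfl, fun v hv1 hv2 => ?_⟩
      simp only [RamProg.step, RamExp.eval, RamState.mem_setReg, RamState.mem_setMem, if_true, f27,
        f17, Function.update_apply]
      split_ifs with hvk
      · subst hvk
        have hlt1 := heap_lt (h := h) (v := 2 * (k + 1)) (by omega) (by omega)
        have hlt2 := heap_lt (h := h) (v := 2 * (k + 1) + 1) (by omega) (by omega)
        rw [← c2, posIco_union pos (by omega) (by omega), c1, c3] at hp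
        exact hp
      · exact (hv v (by omega) hv2).of_prefix hLL''
  · rintro s' ha ⟨h27, hk, L', hLL', hL', hv⟩
    exact ⟨by simp [h27], L', hLL', hL', fun v hv1 => hv v hv1⟩

/-! ### The initial forest -/

/-- `par`, `A` and `B` describe a forest on the nodes of the heap: the pointer of `v` leads to a proper
ancestor, which is the parent or has height at most `j`, and `A` and `B` hold the products of
the positions below this ancestor that are right and left of `v`. -/
def ForestInv {n : ℕ} (L : List (PGate n)) (pos : ℕ → ℕ) (h j : ℕ) (par A B : ℕ → ℕ) : Prop :=
  ∀ v, 2 ≤ v → v < 2 ^ (h + 1) →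
    (∃ k, 1 ≤ k ∧ par v = v / 2 ^ k ∧ 1 ≤ par v ∧ (k = 1 ∨ heapHeight h (par v) ≤ j)) ∧
    IsProduct L (A v) (posIco pos (heapEnd h v) (heapEnd h (par v)) : Set (Fin n)) ∧
    IsProduct L (B v) (posIco pos (heapStart h (par v)) (heapStart h v) : Set (Fin n))

/-- The parents of the nodes are written to bank 18, and the products of their siblings to bank 19 or
bank 20. -/
def forest : RamProg :=
  .assign 27 (.const 2) ;;
  .while (.op .lt (.reg 27) (.op .add (.reg 19) (.reg 19)))
    (.store 18 (.reg 27) (.op .div (.reg 27) (.const 2)) ;;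
    .ite (.op .sub (.reg 27) (.op .mul (.op .div (.reg 27) (.const 2)) (.const 2)))
      (.store 19 (.reg 27) (.const 0) ;;
        .store 20 (.reg 27) (.load 17 (.op .sub (.reg 27) (.const 1))))
      (.store 19 (.reg 27) (.load 17 (.op .add (.reg 27) (.const 1))) ;;
        .store 20 (.reg 27) (.const 0)) ;;
    .assign 27 (.op .add (.reg 27) (.const 1)))

/-- Below the parent, the sibling is everything to the right of a left child and everything to the
left of a right child. The other product is empty. -/
theorem forest_spec {n h : ℕ} {pos : ℕ → ℕ} {s : RamState} {V : ℕ} {L : List (PGate n)}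
    (r19 : s.reg 19 = 2 ^ h) (hfull : ∀ v, 1 ≤ v → v < 2 ^ (h + 1) →
      IsProduct L (s.mem 17 v) (posIco pos (heapStart h v) (heapEnd h v) : Set (Fin n))) :
    Runs V forest s (100 * 2 ^ (h + 1)) fun s' =>
      ForestInv L pos h 0 (s'.mem 18) (s'.mem 19) (s'.mem 20) := by
  have h1 : 1 ≤ 2 ^ h := Nat.one_le_two_pow
  have hpow : 2 ^ (h + 1) = 2 ^ h * 2 := pow_succ _ _
  refine (Runs.step_seq (T := 10) (T' := (2 ^ (h + 1) - 2 + 1) * (60 + 5 + 1)) rfl (by decide)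
    (by simp) (Runs.count (e := .op .lt (.reg 27) (.op .add (.reg 19) (.reg 19))) 60 (fun k s' =>
      s'.reg 27 + k = 2 ^ (h + 1) ∧ 2 ≤ s'.reg 27 ∧ ∀ v, 2 ≤ v → v < s'.reg 27 → v < 2 ^ (h + 1) →
    (∃ k, 1 ≤ k ∧ s'.mem 18 v = v / 2 ^ k ∧ 1 ≤ s'.mem 18 v ∧
      (k = 1 ∨ heapHeight h (s'.mem 18 v) ≤ 0)) ∧
    IsProduct L (s'.mem 19 v) (posIco pos (heapEnd h v) (heapEnd h (s'.mem 18 v)) : Set (Fin n)) ∧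
    IsProduct L (s'.mem 20 v) (posIco pos (heapStart h (s'.mem 18 v)) (heapStart h v) : Set (Fin n)))
    (2 ^ (h + 1) - 2) ?_ ?_ ?_ ?_)).mono (by omega) fun s' _ h => h
  · simp
    exact ⟨by omega, fun v h1 h2 => by omega⟩
  · simp
  · rintro k s' ha ⟨hk, hge, hv⟩
    have f19 : s'.reg 19 = 2 ^ h := (ha.1 19 (by decide)).trans (by simp [r19])
    have f17 : s'.mem 17 = s.mem 17 := (ha.2 17 (by decide)).trans (by simp)
    refine ⟨by simp [f19]; omega, Runs.of_loopFree rfl (by decide) (by simp) ?_⟩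
    obtain ⟨c1, c2, c3⟩ := heap_children (h := h) (v := s'.reg 27 / 2) (by omega) (by omega)
    rcases Nat.even_or_odd' (s'.reg 27) with ⟨u, hu | hu⟩
    · have k2 : s'.reg 27 - s'.reg 27 / 2 * 2 = 0 := by omega
      simp [k2, f17]
      refine ⟨by omega, by omega, fun v hv1 hv2 hv3 => ?_⟩
      by_cases hvr : v = s'.reg 27
      · subst hvr
        have e : 2 * (s'.reg 27 / 2) = s'.reg 27 := by omega
        rw [e] at c1 c2 c3
        simp only [Function.update_self]
        refine ⟨⟨1, le_rfl, by simp, by omega, .inl rfl⟩, ?_, ?_⟩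
        · rw [← c3, c2]
          exact hfull _ (by omega) (by omega)
        · rw [c1, posIco_self]
          exact .inl ⟨rfl, rfl⟩
      · simp only [Function.update_of_ne hvr]
        simpa using hv v hv1 (by omega) hv3
    · have k2 : s'.reg 27 - s'.reg 27 / 2 * 2 ≠ 0 := by omega
      simp [k2, f17]
      refine ⟨by omega, by omega, fun v hv1 hv2 hv3 => ?_⟩
      by_cases hvr : v = s'.reg 27
      · subst hvr
        have e : 2 * (s'.reg 27 / 2) + 1 = s'.reg 27 := by omega
        rw [e] at c2 c3
        simp only [Function.update_self]
        refine ⟨⟨1, le_rfl, by simp, by omega, .inl rfl⟩, ?_, ?_⟩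
        · rw [c3, posIco_self]
          exact .inl ⟨rfl, rfl⟩
        · rw [← c1, ← c2, show s'.reg 27 - 1 = 2 * (s'.reg 27 / 2) by omega]
          exact hfull _ (by omega) (by omega)
      · simp only [Function.update_of_ne hvr]
        simpa using hv v hv1 (by omega) hv3
  · rintro s' ha ⟨hk, hge, hv⟩
    have f19 : s'.reg 19 = 2 ^ h := (ha.1 19 (by decide)).trans (by simp [r19])
    exact ⟨by simp [f19]; omega, fun v h1 h2 => hv v h1 (by omega) h2⟩

/-! ### The table of meeting heights -/

/-- The meeting heights of pairs of numbers below `2^⌈h/2⌉` are written to bank 16. -/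
def meetTable : RamProg :=
  .assign 27 (.const 0) ;;
  .while (.op .lt (.reg 27) (.op .mul (.reg 29) (.reg 29)))
    (.assign 43 (.op .div (.reg 27) (.reg 29)) ;;
    .assign 44 (.op .sub (.reg 27) (.op .mul (.reg 43) (.reg 29))) ;;
    .ite (.op .eq (.reg 43) (.reg 44)) (.store 16 (.reg 27) (.const 0))
      (.store 16 (.reg 27) (.op .add (.load 16 (.op .add (.op .mul (.op .div (.reg 43) (.const 2))
        (.reg 29)) (.op .div (.reg 44) (.const 2)))) (.const 1))) ;;
    .assign 27 (.op .add (.reg 27) (.const 1)))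

/-- The recursion refers to the halved pair, which lies earlier in the row-by-row order. Since B is
about the square root of the number of leaves, the table has linear size. -/
theorem meetTable_spec {s : RamState} {V B : ℕ} (hB : 1 ≤ B) (r29 : s.reg 29 = B) :
    Runs V meetTable s (70 * (B * B) + 70) fun s' =>
      ∀ a < B, ∀ b < B, s'.mem 16 (a * B + b) = meetHeight a b := by
  refine (Runs.step_seq (T := 5) (T' := (B * B + 1) * (50 + 5 + 1)) rfl (by decide)
    (by simp) (Runs.count (e := .op .lt (.reg 27) (.op .mul (.reg 29) (.reg 29))) 50 (fun k s' =>
      s'.reg 27 + k = B * B ∧ ∀ a < B, ∀ b < B, a * B + b < s'.reg 27 →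
        s'.mem 16 (a * B + b) = meetHeight a b) (B * B) ?_ ?_ ?_ ?_)).mono (by omega) fun s' _ h => h
  · simp
  · simp
  · rintro k s' ha ⟨hk, hab⟩
    have f29 : s'.reg 29 = B := (ha.1 29 (by decide)).trans (by simp [r29])
    refine ⟨by simp [f29]; omega, Runs.of_loopFree rfl (by decide) (by simp) ?_⟩
    obtain ⟨i, hi⟩ : ∃ i, s'.reg 27 = i := ⟨_, rfl⟩
    obtain ⟨q, hq⟩ : ∃ q, i / B = q := ⟨_, rfl⟩
    obtain ⟨r, hr⟩ : ∃ r, i % B = r := ⟨_, rfl⟩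
    have hdm := Nat.div_add_mod' i B
    have hmod := Nat.mod_lt i hB
    rw [hi] at hk hab
    rw [hr] at hmod
    rw [hq, hr] at hdm
    have hm : i - q * B = r := by omega
    have hdiv : q < B := hq ▸ Nat.div_lt_of_lt_mul (by omega)
    have huniq : ∀ a b, b < B → a * B + b = i → a = q ∧ b = r := by
      intro a b hb hab
      have := (Nat.div_mod_unique (a := i) (b := B) (c := b) (d := a) hB).2
        ⟨by rw [← hab, mul_comm]; omega, hb⟩
      omega
    by_cases k1 : q = r
    · have hm' : i - r * B = r := by rw [← k1] at hm ⊢; exact hm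
      simp [f29, hi, hq, hm', k1]
      refine ⟨by omega, fun a ha b hb hlt => ?_⟩
      rw [Function.update_apply]
      split_ifs with hai
      · obtain ⟨rfl, rfl⟩ := huniq a b hb hai
        rw [k1, meetHeight_self]
      · exact hab a ha b hb (by omega)
    · simp [f29, hi, hq, hm, k1]
      refine ⟨by omega, fun a ha b hb hlt => ?_⟩
      rw [Function.update_apply]
      split_ifs with hai
      · obtain ⟨rfl, rfl⟩ := huniq a b hb hai
        rw [meetHeight_of_ne k1, hab _ (by omega) _ (by omega)]
        have h2 : a / 2 * B ≤ a * B := Nat.mul_le_mul_right _ (by omega)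
        by_cases hz : b = 0
        · have h3 : (a / 2 + 1) * B ≤ a * B := Nat.mul_le_mul_right _ (by omega)
          rw [add_mul] at h3
          omega
        · omega
      · exact hab a ha b hb (by omega)
  · rintro s' ha ⟨hk, hab⟩
    have f29 : s'.reg 29 = B := (ha.1 29 (by decide)).trans (by simp [r29])
    refine ⟨by simp [f29]; omega, fun a ha b hb => hab a ha b hb ?_⟩
    have : (a + 1) * B ≤ B * B := Nat.mul_le_mul_right _ ha
    rw [add_mul] at this
    omega

/-! ### Exact running times, for the amortised analysis -/

/-- Started in `s`, the program halts in a state that, together with the running time, satisfies `Q`. -/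
def RunsIn (V : ℕ) (p : RamProg) (s : RamState) (Q : ℕ → RamState → Prop) : Prop :=
  ∃ t s', Exec V p s t s' ∧ Q t s'

namespace RunsIn

variable {V : ℕ} {p q : RamProg} {s : RamState} {Q R : ℕ → RamState → Prop}

theorem mono (h : RunsIn V p s Q) (hQ : ∀ t s', p.Agree s s' → Q t s' → R t s') : RunsIn V p s R := by
  obtain ⟨t, s', h1, h2⟩ := h
  exact ⟨t, s', h1, hQ t s' h1.agree h2⟩

theorem seq (h₁ : RunsIn V p s Q)
    (h₂ : ∀ t s', p.Agree s s' → Q t s' → RunsIn V q s' fun t' s'' => R (t + t') s'') :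
    RunsIn V (p ;; q) s R := by
  obtain ⟨t, s', h1, h2⟩ := h₁
  obtain ⟨t', s'', h1', h2'⟩ := h₂ t s' h1.agree h2
  exact ⟨_, s'', .seq h1 h1', h2'⟩

theorem runs (h : RunsIn V p s Q) : ∃ T, Runs V p s T (Q T) := by
  obtain ⟨t, s', h1, h2⟩ := h
  exact ⟨t, t, s', h1, le_rfl, h2⟩

end RunsIn

theorem Runs.runsIn {V : ℕ} {p : RamProg} {s : RamState} {T : ℕ} {Q : RamState → Prop}
    (h : Runs V p s T Q) : RunsIn V p s fun t s' => t ≤ T ∧ Q s' := h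

/-! ### Lists of gaps with the same meeting height -/

/-- The gaps up to `cnt` are contained in linked lists, in decreasing order, according to `lam`. -/
structure Buckets (lam : ℕ → ℕ) (cnt : ℕ) (head next : ℕ → ℕ) : Prop where
  head_cases : ∀ j, head j = 0 ∨ (1 ≤ head j ∧ head j ≤ cnt ∧ lam (head j) = j)
  le_head : ∀ q, 1 ≤ q → q ≤ cnt → q ≤ head (lam q)
  next_cases : ∀ q, 1 ≤ q → q ≤ cnt → next q = 0 ∨ (1 ≤ next q ∧ next q < q ∧ lam (next q) = lam q)
  le_next : ∀ q q', 1 ≤ q' → q' < q → q ≤ cnt → lam q' = lam q → q' ≤ next q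

/-- The new gap has the largest number so far and is put at the front of its list, so the lists
remain decreasing. In a decreasing list, `le_head` and `le_next` express that no gap is left out. -/
theorem Buckets.succ {lam : ℕ → ℕ} {cnt : ℕ} {head next : ℕ → ℕ} (h : Buckets lam cnt head next) :
    Buckets lam (cnt + 1) (Function.update head (lam (cnt + 1)) (cnt + 1))
      (Function.update next (cnt + 1) (head (lam (cnt + 1)))) := by
  refine ⟨fun j => ?_, fun q h1 h2 => ?_, fun q h1 h2 => ?_, fun q q' h1 h2 h3 h4 => ?_⟩
  · rw [Function.update_apply]
    split_ifs with hj
    · subst hj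
      right
      simp
    · have := h.head_cases j
      omega
  · rw [Function.update_apply]
    split_ifs with hq
    · exact h2
    · exact h.le_head q h1 (by rcases Nat.lt_or_eq_of_le h2 with h | rfl <;> [omega; exact absurd rfl hq])
  · rw [Function.update_apply]
    split_ifs with hq
    · subst hq
      have := h.head_cases (lam (cnt + 1))
      omega
    · exact h.next_cases q h1 (by omega)
  · rw [Function.update_apply]
    split_ifs with hq
    · subst hq
      rw [← h4]
      exact h.le_head q' h1 (by omega)
    · exact h.le_next q q' h1 h2 (by omega) h4

/-- The gaps are sorted by the meeting heights of their ends: bank 21 holds the first elements of the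
lists and bank 22 pointers to the next elements. -/
def buckets : RamProg :=
  .assign 27 (.const 1) ;;
  .while (.op .lt (.reg 27) (.op .add (.op .add (.reg 8) (.reg 8)) (.const 1)))
    (.assign 43 (.load 13 (.reg 27)) ;; .assign 44 (.load 14 (.reg 27)) ;;
    .assign 47 (.op .div (.reg 43) (.reg 29)) ;; .assign 48 (.op .div (.reg 44) (.reg 29)) ;;
    .ite (.op .eq (.reg 47) (.reg 48))
      (.assign 46 (.load 16 (.op .add
        (.op .mul (.op .sub (.reg 43) (.op .mul (.reg 47) (.reg 29))) (.reg 29))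
        (.op .sub (.reg 44) (.op .mul (.reg 48) (.reg 29))))))
      (.assign 46 (.op .sub (.reg 4) (.op .sub (.reg 4) (.op .add
        (.load 16 (.op .add (.op .mul (.reg 47) (.reg 29)) (.reg 48))) (.reg 45))))) ;;
    .store 22 (.reg 27) (.load 21 (.reg 46)) ;; .store 21 (.reg 46) (.reg 27) ;;
    .assign 27 (.op .add (.reg 27) (.const 1)))

theorem meetHeight_le {a b h : ℕ} (ha : a < 2 ^ h) (hb : b < 2 ^ h) : meetHeight a b ≤ h := by
  rw [meetHeight_le_iff, Nat.div_eq_of_lt ha, Nat.div_eq_of_lt hb]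

/-- The meeting height is looked up for the high halves of the two words and corrected by the length
of a half, or looked up for the low halves if the high ones agree. -/
theorem buckets_spec {n h M : ℕ} {qa qb : ℕ → ℕ} {s : RamState} {V : ℕ} (hP : PowersOK n h s)
    (r4 : s.reg 4 = 4 * n + 8) (r8 : s.reg 8 = M)
    (h16 : ∀ a < 2 ^ ((h + 1) / 2), ∀ b < 2 ^ ((h + 1) / 2),
      s.mem 16 (a * 2 ^ ((h + 1) / 2) + b) = meetHeight a b)
    (e13 : s.mem 13 = qa) (e14 : s.mem 14 = qb)
    (hq : ∀ q, 1 ≤ q → q ≤ 2 * M → qa q < 2 ^ h ∧ qb q < 2 ^ h)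
    (h21 : ∀ i, s.mem 21 i = 0) :
    Runs V buckets s (250 * (M + 1)) fun s' =>
      Buckets (fun q => meetHeight (qa q) (qb q)) (2 * M) (s'.mem 21) (s'.mem 22) := by
  set β := (h + 1) / 2 with hβ
  -- A half is rounded up, so two halves cover all h digits and both parts of a word are valid
  -- indices of the table.
  have hBB : 2 ^ h ≤ 2 ^ β * 2 ^ β := by
    rw [← pow_add]
    exact Nat.pow_le_pow_right (by norm_num) (by omega)
  refine (Runs.step_seq (T := 5) (T' := (2 * M + 1) * (80 + 7 + 1)) rfl (by decide)
    (by simp) (Runs.count (e := .op .lt (.reg 27) (.op .add (.op .add (.reg 8) (.reg 8)) (.const 1)))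
      80 (fun k s' => s'.reg 27 + k = 2 * M + 1 ∧ 1 ≤ s'.reg 27 ∧
        Buckets (fun q => meetHeight (qa q) (qb q)) (s'.reg 27 - 1) (s'.mem 21) (s'.mem 22)) (2 * M)
      ?_ ?_ ?_ ?_)).mono (by omega) fun s' _ h => h
  · simp only [RamProg.step, RamExp.eval, RamState.reg_setReg, RamState.mem_setReg, if_true]
    exact ⟨by omega, le_rfl, fun j => .inl (h21 j), fun q h1 h2 => by omega,
      fun q h1 h2 => by omega, fun q q' h1 h2 h3 => by omega⟩
  · simp
  · rintro k s' ha ⟨hk, hge, hb⟩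
    have f4 : s'.reg 4 = 4 * n + 8 := (ha.1 4 (by decide)).trans (by simp [r4])
    have f8 : s'.reg 8 = M := (ha.1 8 (by decide)).trans (by simp [r8])
    have f29 : s'.reg 29 = 2 ^ β := (ha.1 29 (by decide)).trans (by simp [hP.r29, hβ])
    have f45 : s'.reg 45 = β := (ha.1 45 (by decide)).trans (by simp [hP.r45, hβ])
    have f13 : s'.mem 13 = qa := (ha.2 13 (by decide)).trans (by simp [e13])
    have f14 : s'.mem 14 = qb := (ha.2 14 (by decide)).trans (by simp [e14])
    have f16 : s'.mem 16 = s.mem 16 := (ha.2 16 (by decide)).trans (by simp)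
    refine ⟨by simp [f8]; omega, Runs.of_loopFree rfl (by decide) (by simp) ?_⟩
    obtain ⟨q, hq'⟩ : ∃ q, s'.reg 27 = q + 1 := ⟨s'.reg 27 - 1, by omega⟩
    rw [hq'] at hk hge hb
    obtain ⟨a, hqa⟩ : ∃ a, qa (q + 1) = a := ⟨_, rfl⟩
    obtain ⟨b, hqb⟩ : ∃ b, qb (q + 1) = b := ⟨_, rfl⟩
    have hab := hq (q + 1) (by omega) (by omega)
    rw [hqa, hqb] at hab
    have hs := hb.succ
    simp only [Nat.add_sub_cancel, hqa, hqb] at hs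
    have hle := meetHeight_le hab.1 hab.2
    have hh : h < 2 ^ h := Nat.lt_two_pow_self
    have hlt := hP.lt
    have hda : a / 2 ^ β < 2 ^ β := Nat.div_lt_of_lt_mul (by omega)
    have hdb : b / 2 ^ β < 2 ^ β := Nat.div_lt_of_lt_mul (by omega)
    by_cases k1 : a / 2 ^ β = b / 2 ^ β
    · have e1 : a - b / 2 ^ β * 2 ^ β = a % 2 ^ β := by
        rw [← k1]
        have := Nat.div_add_mod' a (2 ^ β)
        omega
      have e2 : b - b / 2 ^ β * 2 ^ β = b % 2 ^ β := by
        have := Nat.div_add_mod' b (2 ^ β)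
        omega
      have hm := h16 (a % 2 ^ β) (Nat.mod_lt _ (by positivity)) (b % 2 ^ β)
        (Nat.mod_lt _ (by positivity))
      rw [← meetHeight_of_div_eq β k1] at hm
      simp [hq', f13, f14, f29, f16, hqa, hqb, k1, e1, e2, hm]
      exact ⟨by omega, hs⟩
    · have hm := h16 _ hda _ hdb
      -- The difference from register 4 is again a disguised minimum, which has no effect because
      -- the meeting height is at most h.
      have e1 : 4 * n + 8 - (4 * n + 8 - (meetHeight (a / 2 ^ β) (b / 2 ^ β) + β)) =
          meetHeight a b := by
        have := meetHeight_of_div_ne β k1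
        omega
      simp [hq', f13, f14, f29, f16, f4, f45, hqa, hqb, k1, hm, e1]
      exact ⟨by omega, hs⟩
  · rintro s' ha ⟨hk, hge, hb⟩
    have f8 : s'.reg 8 = M := (ha.1 8 (by decide)).trans (by simp [r8])
    rw [show s'.reg 27 - 1 = 2 * M by omega] at hb
    exact ⟨by simp [f8]; omega, hb⟩

/-! ### Compression of a path -/

def climb : RamProg :=
  (.assign 51 (.reg 49) ;; .assign 52 (.const 0)) ;;
  .while (.op .eq (.op .eq (.reg 51) (.reg 50)) (.const 0))
    (.store 24 (.reg 52) (.reg 51) ;; .assign 52 (.op .add (.reg 52) (.const 1)) ;;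
      .assign 51 (.load 18 (.reg 51)))

theorem climb_spec {s : RamState} {V : ℕ} {l : List ℕ}
    (hl : PathTo (s.mem 18) (s.reg 50) (s.reg 49) l) :
    Runs V climb s (30 * (l.length + 1) + 10) fun s' =>
      s'.reg 52 = l.length ∧ ListAt (s'.mem 24) l := by
  refine (Runs.step_seq (T := 10) (T' := (l.length + 1) * (20 + 5 + 1)) rfl (by decide)
    (by simp) (Runs.count (e := .op .eq (.op .eq (.reg 51) (.reg 50)) (.const 0)) 20
      (fun k s' => ∃ l₁ l₂, l = l₁ ++ l₂ ∧ l₂.length = k ∧ s'.reg 52 = l₁.length ∧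
        ListAt (s'.mem 24) l₁ ∧ PathTo (s.mem 18) (s.reg 50) (s'.reg 51) l₂) l.length
      ?_ ?_ ?_ ?_)).mono (by omega) fun s' _ h => h
  · exact ⟨[], l, by simp, rfl, by simp, fun j hj => by simp at hj, by simpa using hl⟩
  · simp
  · rintro k s' ha ⟨l₁, l₂, rfl, hk, h52, h24, hp⟩
    have f50 : s'.reg 50 = s.reg 50 := (ha.1 50 (by decide)).trans (by simp)
    have f18 : s'.mem 18 = s.mem 18 := (ha.2 18 (by decide)).trans (by simp)
    generalize hx : s'.reg 51 = x at hp
    cases hp with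
    | nil => simp at hk
    | @cons x l₂ hne hp =>
      refine ⟨by simp [f50, hx, hne], Runs.of_loopFree rfl (by decide) (by simp) ?_⟩
      refine ⟨l₁ ++ [x], l₂, by simp, by simpa using hk, by simp [h52], ?_, by simpa [hx, f18] using hp⟩
      simpa [h52, hx] using h24.snoc x
  · rintro s' ha ⟨l₁, l₂, rfl, hk, h52, h24, hp⟩
    have f50 : s'.reg 50 = s.reg 50 := (ha.1 50 (by decide)).trans (by simp)
    obtain rfl := List.length_eq_zero_iff.1 hk
    generalize hx : s'.reg 51 = x at hp
    cases hp
    exact ⟨by simp [f50, hx], by simpa using h52, by simpa using h24⟩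

/-- When a path is compressed from the top, the parent of the next node either is the target or has
already been redirected to it. -/
theorem PathTo.getElem {par : ℕ → ℕ} {u x : ℕ} {l : List ℕ} (h : PathTo par u x l) (k : ℕ)
    (hk : k < l.length) : par l[k] = u ∨ par l[k] ∈ l.drop (k + 1) := by
  induction h generalizing k with
  | nil => simp at hk
  | @cons x l hx h ih =>
    cases k with
    | zero =>
      generalize hy : par x = y at h
      cases h with
      | nil => exact .inl hy
      | cons _ _ => exact .inr (by simp [hy])
    | succ k => exact ih k (by simpa using hk)

theorem PathTo.head_mem {par : ℕ → ℕ} {u x : ℕ} {l : List ℕ} (h : PathTo par u x l) (hx : x ≠ u) :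
    x ∈ l := by
  cases h with
  | nil => exact absurd rfl hx
  | cons _ _ => simp

/-- The products at the node in register 51 are extended to the node in register 50. -/
def extendNode : RamProg :=
  (.assign 40 (.load 19 (.reg 51)) ;; .assign 41 (.load 19 (.reg 53))) ;; combine ;;
  (.store 19 (.reg 51) (.reg 42) ;;
    .assign 40 (.load 20 (.reg 53)) ;; .assign 41 (.load 20 (.reg 51))) ;; combine ;;
  (.store 20 (.reg 51) (.reg 42) ;; .store 18 (.reg 51) (.reg 50))

theorem extendNode_spec {n : ℕ} {s : RamState} {V : ℕ} {D : Prop} {L : List (PGate n)}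
    {A₁ A₂ B₁ B₂ : Set (Fin n)} (hs : s.Holds D L)
    (hA₁ : IsProduct L (s.mem 19 (s.reg 51)) A₁) (hA₂ : IsProduct L (s.mem 19 (s.reg 53)) A₂)
    (hB₁ : IsProduct L (s.mem 20 (s.reg 53)) B₁) (hB₂ : IsProduct L (s.mem 20 (s.reg 51)) B₂)
    (hA : Disjoint A₁ A₂) (hB : Disjoint B₁ B₂) :
    Runs V extendNode s 120 fun s' => ∃ L', L <+: L' ∧ s'.Holds D L' ∧
      s'.mem 18 = Function.update (s.mem 18) (s.reg 51) (s.reg 50) ∧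
      ∃ a b, IsProduct L' a (A₁ ∪ A₂) ∧ IsProduct L' b (B₁ ∪ B₂) ∧
        s'.mem 19 = Function.update (s.mem 19) (s.reg 51) a ∧
        s'.mem 20 = Function.update (s.mem 20) (s.reg 51) b := by
  refine (Runs.step_seq (T := 10) (T' := 40 + (15 + (40 + 10))) rfl (by decide) (by simp)
    (Runs.seq (combine_spec (D := D) (L := L) (hs.congr rfl rfl rfl rfl rfl rfl) (by simpa using hA₁)
      (by simpa using hA₂) hA) fun s₁ ha₁ h₁ => ?_)).mono (by omega) fun s' _ h => h
  obtain ⟨L₁, hL₁, hs₁, hp₁⟩ := h₁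
  have a50 : s₁.reg 50 = s.reg 50 := (ha₁.1 50 (by decide)).trans (by simp)
  have a51 : s₁.reg 51 = s.reg 51 := (ha₁.1 51 (by decide)).trans (by simp)
  have a53 : s₁.reg 53 = s.reg 53 := (ha₁.1 53 (by decide)).trans (by simp)
  have a18 : s₁.mem 18 = s.mem 18 := (ha₁.2 18 (by decide)).trans (by simp)
  have a19 : s₁.mem 19 = s.mem 19 := (ha₁.2 19 (by decide)).trans (by simp)
  have a20 : s₁.mem 20 = s.mem 20 := (ha₁.2 20 (by decide)).trans (by simp)
  refine Runs.step_seq (T := 15) rfl (by decide) (by simp) (Runs.seq (combine_spec (D := D) (L := L₁)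
    (hs₁.congr rfl rfl rfl rfl rfl rfl) (by simpa [a53, a20] using hB₁.of_prefix hL₁)
    (by simpa [a51, a20] using hB₂.of_prefix hL₁) hB) fun s₂ ha₂ h₂ => ?_)
  obtain ⟨L₂, hL₂, hs₂, hp₂⟩ := h₂
  have b50 : s₂.reg 50 = s.reg 50 := (ha₂.1 50 (by decide)).trans (by simp [a50])
  have b51 : s₂.reg 51 = s.reg 51 := (ha₂.1 51 (by decide)).trans (by simp [a51])
  have b18 : s₂.mem 18 = s.mem 18 := (ha₂.2 18 (by decide)).trans (by simp [a18])
  have b19 : s₂.mem 19 = Function.update (s.mem 19) (s.reg 51) (s₁.reg 42) :=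
    (ha₂.2 19 (by decide)).trans (by simp [a19, a51])
  have b20 : s₂.mem 20 = s.mem 20 := (ha₂.2 20 (by decide)).trans (by simp [a20])
  refine Runs.of_loopFree rfl (by decide) (by simp) ⟨L₂, hL₁.trans hL₂,
    hs₂.congr rfl rfl rfl rfl rfl rfl, by simp [b18, b50, b51], s₁.reg 42, s₂.reg 42,
    hp₁.of_prefix hL₂, hp₂, by simp [b19], by simp [b20, b51]⟩

def compressPath : RamProg :=
  .while (.reg 52)
    ((.assign 52 (.op .sub (.reg 52) (.const 1)) ;; .assign 51 (.load 24 (.reg 52)) ;;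
      .assign 53 (.load 18 (.reg 51))) ;;
    .ite (.op .eq (.reg 53) (.reg 50)) .skip extendNode)

/-- Nodes are treated from the top of the path downwards. When y is reached, its old parent already
points to u, so the products of y up to u arise from those of y up to its parent and those of the
parent up to u, by one combination on each side. -/
theorem compressPath_spec {n h j x u : ℕ} {pos par : ℕ → ℕ} {D : Prop} {L : List (PGate n)}
    {s : RamState} {V : ℕ} {l : List ℕ} (hs : s.Holds D L)
    (hF : ForestInv L pos h j par (s.mem 19) (s.mem 20)) (e18 : s.mem 18 = par)
    (hl : PathTo par u x l) (hnd : l.Nodup) (r50 : s.reg 50 = u) (r52 : s.reg 52 = l.length)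
    (h24 : ListAt (s.mem 24) l) (hu1 : 1 ≤ u) (huj : heapHeight h u ≤ j)
    (hl2 : ∀ y ∈ l, 2 ≤ y ∧ y < 2 ^ (h + 1) ∧ ∃ k, 1 ≤ k ∧ u = y / 2 ^ k) :
    Runs V compressPath s (160 * (l.length + 1)) fun s' => ∃ L', L <+: L' ∧ s'.Holds D L' ∧
      s'.mem 18 = compress par u l ∧
      ForestInv L' pos h j (compress par u l) (s'.mem 19) (s'.mem 20) := by
  refine (Runs.count (e := .reg 52) 145 (fun k s' => s'.reg 52 = k ∧ k ≤ l.length ∧ ∃ L', L <+: L' ∧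
    s'.Holds D L' ∧ s'.mem 18 = compress par u (l.drop k) ∧
    ForestInv L' pos h j (compress par u (l.drop k)) (s'.mem 19) (s'.mem 20)) l.length
      ?_ ?_ ?_ ?_).mono (by simp only [RamExp.cost]; omega) fun s' _ h => h
  · have e : compress par u [] = par := by
      funext v
      simp [compress]
    refine ⟨r52, le_rfl, L, List.prefix_rfl, hs, ?_⟩
    rw [List.drop_length, e]
    exact ⟨e18, hF⟩
  · simp
  · rintro k s' ha ⟨h52, hk, L', hLL', hs', f18, hF'⟩
    have f24 : s'.mem 24 = s.mem 24 := ha.2 24 (by decide)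
    have f50 : s'.reg 50 = u := (ha.1 50 (by decide)).trans r50
    refine ⟨by simp [h52], ?_⟩
    have hdrop : l.drop k = l[k] :: l.drop (k + 1) := List.drop_eq_getElem_cons (by omega)
    have hy : s.mem 24 k = l[k] := h24 k (by omega)
    obtain ⟨y, hyl⟩ : ∃ y, l[k] = y := ⟨_, rfl⟩
    have hyn : y ∉ l.drop (k + 1) := by
      have := (List.drop_sublist k l).nodup hnd
      rw [hdrop, hyl] at this
      exact (List.nodup_cons.1 this).1
    have hpy : compress par u (l.drop (k + 1)) y = par y := by simp [compress, hyn]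
    obtain ⟨y2, yh, m, hm, hum⟩ := hl2 y (hyl ▸ List.getElem_mem _)
    -- One round redirects exactly the pointer of y. If y already points to u, this changes nothing.
    have hcomp : compress par u (l.drop k) = Function.update (compress par u (l.drop (k + 1))) y u := by
      funext v
      rw [hdrop, hyl, Function.update_apply]
      by_cases hv : v = y <;> simp [compress, hv]
    rw [hyl] at hy
    refine (Runs.step_seq (T := 15) (T' := 3 + 1 + 120) rfl (by decide) (by simp)
      (Runs.ite (e := .op .eq (.reg 53) (.reg 50)) (by simp) (fun hc => ?_) fun hc => ?_)).mono
      (by omega) fun s'' _ h => h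
    · have hc' : par y = u := by
        by_contra h
        simp [h52, f24, hy, f18, hpy, f50, h] at hc
      have e : compress par u (l.drop k) = compress par u (l.drop (k + 1)) := by
        rw [hcomp]
        exact Function.update_eq_self_iff.2 (by rw [hpy, hc'])
      rw [e]
      exact Runs.of_loopFree rfl (by decide) (by simp) ⟨by simp [h52], by omega, L', hLL',
        hs'.congr rfl rfl rfl rfl rfl rfl, by simpa using f18, by simpa using hF'⟩
    · have hc' : par y ≠ u := by
        intro h
        simp [h52, f24, hy, f18, hpy, f50, h] at hc
      have hz : par y ∈ l.drop (k + 1) := by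
        have := hl.getElem k (by omega)
        rw [hyl] at this
        exact this.resolve_left hc'
      have hpz : compress par u (l.drop (k + 1)) (par y) = u := by simp [compress, hz]
      obtain ⟨z2, zh, m', hm', hum'⟩ := hl2 _ (List.mem_of_mem_drop hz)
      obtain ⟨⟨ky, hky, hpk, -⟩, hAy, hBy⟩ := hF' y y2 yh
      obtain ⟨-, hAz, hBz⟩ := hF' (par y) z2 zh
      rw [hpy] at hpk hAy hBy
      rw [hpz] at hAz hBz
      have o1 := heap_div_le (h := h) (v := y) ky (by rw [← hpk]; omega) yh
      have o2 := heap_div_le (h := h) (v := par y) m' (by rw [← hum']; omega) zh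
      rw [← hpk] at o1
      rw [← hum'] at o2
      refine Runs.mono (extendNode_spec (D := D) (L := L') (hs'.congr rfl rfl rfl rfl rfl rfl)
        (by simpa [h52, f24, hy] using hAy)
        (by simpa [h52, f24, hy, f18, hpy] using hAz) (by simpa [h52, f24, hy, f18, hpy] using hBz)
        (by simpa [h52, f24, hy] using hBy) (posIco_disjoint pos)
        (posIco_disjoint pos)) le_rfl ?_
      rintro s'' ha'' ⟨L'', hL'', hs'', g18, a, b, hpa, hpb, g19, g20⟩
      rw [posIco_union pos o1.2 o2.2] at hpa
      rw [posIco_union pos o2.1 o1.1] at hpb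
      have t51 : ((RamProg.assign 52 (.op .sub (.reg 52) (.const 1)) ;;
        .assign 51 (.load 24 (.reg 52)) ;; .assign 53 (.load 18 (.reg 51))).step s').reg 51 = y := by
        simp [h52, f24, hy]
      have t50 : ((RamProg.assign 52 (.op .sub (.reg 52) (.const 1)) ;;
        .assign 51 (.load 24 (.reg 52)) ;; .assign 53 (.load 18 (.reg 51))).step s').reg 50 = u := by
        simp [f50]
      rw [t51] at g18 g19 g20
      rw [t50] at g18
      simp only [RamProg.step, RamState.mem_setReg] at g18 g19 g20
      refine ⟨(ha''.1 52 (by decide)).trans (by simp [h52]), by omega, L'', hLL'.trans hL'', hs'', ?_, ?_⟩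
      · rw [g18, f18, hcomp]
      · intro v hv1 hv2
        rw [g19, g20, hcomp]
        by_cases hvy : v = y
        · subst hvy
          simp only [Function.update_self]
          exact ⟨⟨m, hm, hum, hu1, .inr huj⟩, hpa, hpb⟩
        · simp only [Function.update_of_ne hvy]
          obtain ⟨q1, q2, q3⟩ := hF' v hv1 hv2
          exact ⟨q1, q2.of_prefix hL'', q3.of_prefix hL''⟩
  · rintro s' ha ⟨h52, hk, L', hLL', hs', f18, hF'⟩
    exact ⟨by simpa using h52, L', hLL', hs', f18, hF'⟩

/-- A pointer from a node strictly below u leads either to its parent or to an ancestor of height at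
most j, the height of u. In both cases it does not pass u, so following pointers arrives at u. -/
theorem ForestInv.exists_path {n h j : ℕ} {L : List (PGate n)} {pos par A B : ℕ → ℕ}
    (hF : ForestInv L pos h j par A B) {u : ℕ} (hu : 1 ≤ u) (huj : heapHeight h u = j) (i : ℕ) :
    ∀ x, u = x / 2 ^ i → x < 2 ^ (h + 1) → ∃ l, PathTo par u x l ∧
      ∀ y ∈ l, 2 ≤ y ∧ y < 2 ^ (h + 1) ∧ heapHeight h y < heapHeight h (par y) ∧
        ∃ k, 1 ≤ k ∧ u = y / 2 ^ k := by
  induction i using Nat.strong_induction_on with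
  | _ i ih =>
    intro x hux hx
    rcases Nat.eq_zero_or_pos i with rfl | hi
    · obtain rfl : u = x := by simpa using hux
      exact ⟨[], .nil, by simp⟩
    · have hpow : ∀ k, 1 ≤ x / 2 ^ k → 2 ^ k ≤ x := fun k hk => by
        by_contra h
        rw [Nat.div_eq_of_lt (not_le.1 h)] at hk
        omega
      have hxi := hpow i (hux ▸ hu)
      have h2i : 2 ≤ 2 ^ i := Nat.le_self_pow (by omega) 2
      obtain ⟨⟨k, hk1, hk2, hk3, hk4⟩, -, -⟩ := hF x (by omega) hx
      have hxk := hpow k (hk2 ▸ hk3)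
      have e1 := heapHeight_div i hxi hx
      have e2 := heapHeight_div k hxk hx
      rw [← hux] at e1
      rw [← hk2] at e2
      -- The pointer climbs k levels and u is i levels up. A jump with k > 1 ends at height at most
      -- that of u.
      have hki : k ≤ i := by omega
      have hpx : par x < 2 ^ (h + 1) := hk2 ▸ (Nat.div_le_self _ _).trans_lt hx
      obtain ⟨l, hl, hl'⟩ := ih (i - k) (by omega) (par x)
        (by rw [hk2, Nat.div_div_eq_div_mul, ← pow_add, Nat.add_sub_cancel' hki, hux]) hpx
      refine ⟨x :: l, .cons (fun h => by rw [h] at e1; omega) hl, ?_⟩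
      intro y hy
      rcases List.mem_cons.1 hy with rfl | hy
      · exact ⟨by omega, hx, by omega, i, hi, hux⟩
      · exact hl' y hy

theorem ForestInv.mono {n h j j' : ℕ} {L : List (PGate n)} {pos par A B : ℕ → ℕ}
    (hF : ForestInv L pos h j par A B) (hj : j ≤ j') : ForestInv L pos h j' par A B := by
  intro v h1 h2
  obtain ⟨⟨k, u1, u2, u3, u4⟩, h3⟩ := hF v h1 h2
  exact ⟨⟨k, u1, u2, u3, u4.imp_right fun h => h.trans hj⟩, h3⟩

/-- The path from the node in register 49 to the node in register 50 is compressed. -/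
def findPath : RamProg := climb ;; compressPath

/-- Climbing and compressing take at most 200 units per node of the path and 200 more. With 200
units of time per unit of potential, the length of the path cancels and an amortised cost of
200(a+2) remains. -/
theorem findPath_spec {n h j i x u a q : ℕ} {pos : ℕ → ℕ} {D : Prop} {L : List (PGate n)}
    {s : RamState} {V : ℕ} (hs : s.Holds D L) (hF : ForestInv L pos h j (s.mem 18) (s.mem 19) (s.mem 20))
    (r49 : s.reg 49 = x) (r50 : s.reg 50 = u) (hu : 1 ≤ u) (huj : heapHeight h u = j)
    (hux : u = x / 2 ^ i) (hx : x < 2 ^ (h + 1)) (hq : 4 ≤ q) (hh : h < tarjanA a q) :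
    RunsIn V findPath s fun t s' => ∃ L', L <+: L' ∧ s'.Holds D L' ∧
      t + 200 * forestPot a q (heapHeight h) (Finset.Ico 2 (2 ^ (h + 1))) (s'.mem 18) ≤
        200 * forestPot a q (heapHeight h) (Finset.Ico 2 (2 ^ (h + 1))) (s.mem 18) + 200 * (a + 2) ∧
      ForestInv L' pos h j (s'.mem 18) (s'.mem 19) (s'.mem 20) ∧ (x ≠ u → s'.mem 18 x = u) := by
  obtain ⟨l, hl, hl2⟩ := hF.exists_path hu huj i x hux hx
  have huh : heapHeight h u ≤ h := by unfold heapHeight; omega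
  have hnd : l.Nodup := hl.nodup fun y hy => (hl2 y hy).2.2.1
  have hpot := hl.forestPot_compress (D := Finset.Ico 2 (2 ^ (h + 1))) hq
    (fun y hy => ⟨(hl2 y hy).2.2.1, by simpa using ⟨(hl2 y hy).1, (hl2 y hy).2.1⟩⟩)
    (huh.trans_lt hh)
  refine (Runs.seq (climb_spec (V := V) (by rw [r50, r49]; exact hl)) (T' := 160 * (l.length + 1))
    (R := fun s' => ∃ L', L <+: L' ∧ s'.Holds D L' ∧ s'.mem 18 = compress (s.mem 18) u l ∧
      ForestInv L' pos h j (compress (s.mem 18) u l) (s'.mem 19) (s'.mem 20))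
    fun s₁ ha₁ h₁ => ?_).runsIn.mono ?_
  · have a18 : s₁.mem 18 = s.mem 18 := ha₁.2 18 (by decide)
    have a19 : s₁.mem 19 = s.mem 19 := ha₁.2 19 (by decide)
    have a20 : s₁.mem 20 = s.mem 20 := ha₁.2 20 (by decide)
    refine compressPath_spec (D := D) (L := L) (ha₁.holds hs (by decide) (by decide))
      (by rw [a19, a20]; exact hF) a18 hl hnd ((ha₁.1 50 (by decide)).trans r50) h₁.1 h₁.2 hu huj.le
      fun y hy => ?_
    have := hl2 y hy
    exact ⟨this.1, this.2.1, this.2.2.2⟩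
  · rintro t s' - ⟨ht, L', hL', hs', e18, hF'⟩
    refine ⟨L', hL', hs', by rw [e18]; omega, e18 ▸ hF', fun hxu => ?_⟩
    rw [e18]
    simp [compress, hl.head_mem hxu]

/-! ### The products of the variables in gaps -/

/-- One level below the meeting point, the ancestors of the two leaves are siblings 2w and 2w+1, and
c is the common boundary of their intervals. The gap is cut there into [a+1, c) and [c, b). -/
theorem meetHeight_split {h a b : ℕ} (hab : a < b) (hb : b < 2 ^ h) :
    ∃ i c, meetHeight a b = i + 1 ∧ i < h ∧
      1 ≤ (2 ^ h + a) / 2 ^ i ∧ 1 ≤ (2 ^ h + b) / 2 ^ i ∧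
      heapHeight h ((2 ^ h + a) / 2 ^ i) = i ∧ heapHeight h ((2 ^ h + b) / 2 ^ i) = i ∧
      heapEnd h ((2 ^ h + a) / 2 ^ i) = c ∧ heapStart h ((2 ^ h + b) / 2 ^ i) = c ∧
      a + 1 ≤ c ∧ c ≤ b := by
  obtain ⟨i, hi⟩ : ∃ i, meetHeight a b = i + 1 :=
    ⟨_, meetHeight_of_ne hab.ne⟩
  have h1 : a / 2 ^ (i + 1) = b / 2 ^ (i + 1) := meetHeight_le_iff.1 hi.le
  have h2 : ¬a / 2 ^ i = b / 2 ^ i := fun h => by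
    have := meetHeight_le_iff.2 h
    omega
  have h3 : i < h := by
    have := meetHeight_le (hab.trans hb) hb
    omega
  have h4 : a / 2 ^ i ≤ b / 2 ^ i := Nat.div_le_div_right hab.le
  rw [pow_succ, ← Nat.div_div_eq_div_mul, ← Nat.div_div_eq_div_mul] at h1
  obtain ⟨k, rfl⟩ : ∃ k, h = i + k + 1 := ⟨h - i - 1, by omega⟩
  have hpow : 2 ^ (i + k + 1) = 2 ^ i * (2 * 2 ^ k) := by ring
  have e : ∀ x, (2 ^ (i + k + 1) + x) / 2 ^ i = 2 * 2 ^ k + x / 2 ^ i := fun x => by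
    rw [hpow, Nat.mul_add_div (by positivity)]
  have hk : 1 ≤ 2 ^ k := Nat.one_le_two_pow
  have hi1 : 1 ≤ 2 ^ i := Nat.one_le_two_pow
  have hle : 2 ^ i ≤ 2 ^ (i + k + 1) := Nat.pow_le_pow_right (by norm_num) (by omega)
  have hlt2 : ∀ x, x < 2 ^ (i + k + 1) → 2 ^ (i + k + 1) + x < 2 ^ (i + k + 1 + 1) := fun x hx => by
    rw [pow_succ _ (i + k + 1)]
    omega
  have hh : ∀ x, x < 2 ^ (i + k + 1) → heapHeight (i + k + 1) ((2 ^ (i + k + 1) + x) / 2 ^ i) = i := by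
    intro x hx
    rw [heapHeight_div i (by omega) (hlt2 x hx), heapHeight_of_leaf, zero_add]
  have hk2 : ∀ x, 1 ≤ (2 ^ (i + k + 1) + x) / 2 ^ i := fun x => by
    rw [e]
    exact Nat.le_add_right_of_le (by omega)
  generalize ha' : a / 2 ^ i = a' at h1 h2 h4
  generalize hb' : b / 2 ^ i = b' at h1 h2 h4
  have d1 := heap_div_le (h := i + k + 1) (v := 2 ^ (i + k + 1) + a) i (hk2 _)
    (hlt2 a (hab.trans hb))
  have d2 := heap_div_le (h := i + k + 1) (v := 2 ^ (i + k + 1) + b) i (hk2 _)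
    (hlt2 b hb)
  rw [heapEnd_leaf] at d1
  rw [heapStart_leaf] at d2
  have hbi : b' < 2 * 2 ^ k := hb' ▸ Nat.div_lt_of_lt_mul (by rw [← hpow]; exact hb)
  have hw := heap_children (h := i + k + 1) (v := 2 ^ k + a' / 2) (by omega) (by
    have : 2 * 2 ^ k ≤ 2 ^ (i + k + 1) := by
      rw [hpow]
      exact Nat.le_mul_of_pos_left _ (by omega)
    omega)
  have ea : (2 ^ (i + k + 1) + a) / 2 ^ i = 2 * (2 ^ k + a' / 2) := by
    rw [e, ha']
    omega
  have eb : (2 ^ (i + k + 1) + b) / 2 ^ i = 2 * (2 ^ k + a' / 2) + 1 := by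
    rw [e, hb']
    omega
  refine ⟨i, _, hi, h3, hk2 _, hk2 _, hh a (hab.trans hb), hh b hb, rfl, ?_,
    d1.2, ?_⟩
  · rw [ea, eb, hw.2.1]
  · rw [ea, hw.2.1, ← eb]
    exact d2.1

/-- The nodes in registers 49 and 50 are the leaf at the end of the current gap in the given bank and
its ancestor below the meeting point. -/
def gapEnd (b : ℕ) : RamProg :=
  .assign 49 (.op .sub (.reg 4) (.op .sub (.reg 4) (.op .add (.reg 19) (.load b (.reg 55))))) ;;
  .assign 50 (.op .div (.reg 49) (.load 15 (.op .sub (.reg 54) (.const 1))))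

/-- The product of the variables in the gap in register 55 is written to bank 23. -/
def gapProduct : RamProg :=
  gapEnd 13 ;; findPath ;;
  (.ite (.op .eq (.reg 49) (.reg 50)) (.assign 57 (.const 0)) (.assign 57 (.load 19 (.reg 49))) ;;
    gapEnd 14) ;; findPath ;;
  (.assign 40 (.reg 57) ;;
    .ite (.op .eq (.reg 49) (.reg 50)) (.assign 41 (.const 0)) (.assign 41 (.load 20 (.reg 49)))) ;;
  combine ;;
  (.store 23 (.reg 55) (.reg 42) ;; .assign 55 (.load 22 (.reg 55)))

/-- Both halves of the gap are stored at leaves after the compression of their paths: to the right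
of x up to c, and to the left of y from c on. If the leaf itself is the required ancestor, its half
is empty and the stored product, which belongs to another ancestor, must not be used. -/
theorem gapProduct_spec {n h a q x y g : ℕ} {pos : ℕ → ℕ} {D : Prop} {L : List (PGate n)}
    {s : RamState} {V : ℕ} (hP : PowersOK n h s) (hs : s.Holds D L) (r4 : s.reg 4 = 4 * n + 8)
    (r55 : s.reg 55 = g) (hx : s.mem 13 g = x) (hy : s.mem 14 g = y) (hxy : x < y) (hyh : y < 2 ^ h)
    (r54 : s.reg 54 = meetHeight x y) (hq : 4 ≤ q) (hh : h < tarjanA a q)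
    (hF : ForestInv L pos h (s.reg 54 - 1) (s.mem 18) (s.mem 19) (s.mem 20)) :
    RunsIn V gapProduct s fun t s' => ∃ L', L <+: L' ∧ s'.Holds D L' ∧
      t + 200 * forestPot a q (heapHeight h) (Finset.Ico 2 (2 ^ (h + 1))) (s'.mem 18) ≤
        200 * forestPot a q (heapHeight h) (Finset.Ico 2 (2 ^ (h + 1))) (s.mem 18) +
          400 * (a + 3) ∧
      ForestInv L' pos h (s.reg 54 - 1) (s'.mem 18) (s'.mem 19) (s'.mem 20) ∧
      s'.reg 55 = s.mem 22 g ∧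
      ∃ r, s'.mem 23 = Function.update (s.mem 23) g r ∧ IsProduct L' r (posGap pos x y) := by
  obtain ⟨i, c, hi, hih, hx1, hy1, hxi, hyi, hxc, hyc, hc1, hc2⟩ := meetHeight_split hxy hyh
  have hlt := hP.lt
  have hr : s.reg 54 - 1 = i := by omega
  rw [hr] at hF ⊢
  have m15 := hP.m15 i (by omega)
  have hpow : 2 ^ (h + 1) = 2 ^ h * 2 := pow_succ _ _
  -- The minimum with register 4 is harmless, as leaf numbers are below 2 · 2^h ≤ 4n + 4.
  have big : ∀ z, z < 2 ^ h → 4 * n + 8 - (4 * n + 8 - (2 ^ h + z)) = 2 ^ h + z := fun z hz => by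
    omega
  have bx := big x (hxy.trans hyh)
  have by' := big y hyh
  refine (Runs.of_loopFree (V := V) (p := gapEnd 13) (T := 30) (Q := (· = (gapEnd 13).step s)) rfl
    (by decide) (by simp [gapEnd]) rfl).runsIn.seq ?_
  rintro t₀ s₀ ha₀ ⟨ht₀, h₀⟩
  have b49 : s₀.reg 49 = 2 ^ h + x := by
    rw [h₀]
    simp [gapEnd, r4, hP.r19, r55, hx, bx]
  have b50 : s₀.reg 50 = (2 ^ h + x) / 2 ^ i := by
    rw [h₀]
    simp [gapEnd, r4, hP.r19, r55, hx, bx, hr, m15]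
  clear h₀
  have b18 : s₀.mem 18 = s.mem 18 := ha₀.2 18 (by decide)
  have b19 : s₀.mem 19 = s.mem 19 := ha₀.2 19 (by decide)
  have b20 : s₀.mem 20 = s.mem 20 := ha₀.2 20 (by decide)
  refine (findPath_spec (a := a) (q := q) (ha₀.holds hs (by decide) (by decide))
    (by rw [b18, b19, b20]; exact hF) b49 b50 hx1 hxi rfl (by omega) hq hh).seq ?_
  rintro t₁ s₁ ha₁ ⟨L₁, hL₁, hs₁, ht₁, hF₁, hp₁⟩
  rw [b18] at ht₁
  have c49 : s₁.reg 49 = 2 ^ h + x := (ha₁.1 49 (by decide)).trans b49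
  have c50 : s₁.reg 50 = (2 ^ h + x) / 2 ^ i := (ha₁.1 50 (by decide)).trans b50
  have c4 : s₁.reg 4 = 4 * n + 8 := (ha₁.1 4 (by decide)).trans ((ha₀.1 4 (by decide)).trans r4)
  have c19 : s₁.reg 19 = 2 ^ h := (ha₁.1 19 (by decide)).trans ((ha₀.1 19 (by decide)).trans hP.r19)
  have c54 : s₁.reg 54 = s.reg 54 := (ha₁.1 54 (by decide)).trans (ha₀.1 54 (by decide))
  have c55 : s₁.reg 55 = g := (ha₁.1 55 (by decide)).trans ((ha₀.1 55 (by decide)).trans r55)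
  have d14 : s₁.mem 14 = s.mem 14 := (ha₁.2 14 (by decide)).trans (ha₀.2 14 (by decide))
  have d15 : s₁.mem 15 = s.mem 15 := (ha₁.2 15 (by decide)).trans (ha₀.2 15 (by decide))
  have d22 : s₁.mem 22 = s.mem 22 := (ha₁.2 22 (by decide)).trans (ha₀.2 22 (by decide))
  have d23 : s₁.mem 23 = s.mem 23 := (ha₁.2 23 (by decide)).trans (ha₀.2 23 (by decide))
  set p₁ : RamProg := .ite (.op .eq (.reg 49) (.reg 50)) (.assign 57 (.const 0))
    (.assign 57 (.load 19 (.reg 49))) ;; gapEnd 14 with hp₁def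
  refine (Runs.of_loopFree (V := V) (p := p₁) (T := 40) (Q := (· = p₁.step s₁)) rfl
    (by decide) (by simp [p₁, gapEnd]) rfl).runsIn.seq ?_
  rintro t₂ s₂ ha₂ ⟨ht₂, h₂⟩
  have e57 : s₂.reg 57 = if 2 ^ h + x = (2 ^ h + x) / 2 ^ i then 0 else s₁.mem 19 (2 ^ h + x) := by
    rw [h₂]
    by_cases hc : 2 ^ h + x = (2 ^ h + x) / 2 ^ i
    · have : s₁.reg 49 = s₁.reg 50 := by rw [c49, c50, ← hc]
      simp [p₁, gapEnd, this, if_pos hc]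
    · simp [p₁, gapEnd, c49, c50, if_neg hc]
  have e49 : s₂.reg 49 = 2 ^ h + y := by
    rw [h₂]
    by_cases hc : s₁.reg 49 = s₁.reg 50 <;>
    simp [p₁, gapEnd, hc, c4, c19, c55, d14, hy, by']
  have e50 : s₂.reg 50 = (2 ^ h + y) / 2 ^ i := by
    rw [h₂]
    by_cases hc : s₁.reg 49 = s₁.reg 50 <;>
    simp [p₁, gapEnd, hc, c4, c19, c55, d14, hy, by', c54, hr, d15, m15]
  clear h₂
  have f18 : s₂.mem 18 = s₁.mem 18 := ha₂.2 18 (by decide)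
  have f19 : s₂.mem 19 = s₁.mem 19 := ha₂.2 19 (by decide)
  have f20 : s₂.mem 20 = s₁.mem 20 := ha₂.2 20 (by decide)
  have f22 : s₂.mem 22 = s.mem 22 := (ha₂.2 22 (by decide)).trans d22
  have f23 : s₂.mem 23 = s.mem 23 := (ha₂.2 23 (by decide)).trans d23
  have f55 : s₂.reg 55 = g := (ha₂.1 55 (by decide)).trans c55
  have hprod : IsProduct L₁ (s₂.reg 57) (posIco pos (x + 1) c : Set (Fin n)) := by
    rw [e57]
    split_ifs with hc
    · refine .inl ⟨rfl, ?_⟩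
      rw [← hxc, ← hc, heapEnd_leaf, posIco_self]
    · have := (hF₁ (2 ^ h + x) (by have := hP.le; omega) (by omega)).2.1
      rwa [hp₁ hc, hxc, heapEnd_leaf] at this
  refine (findPath_spec (a := a) (q := q) (ha₂.holds hs₁ (by decide) (by decide))
    (by rw [f18, f19, f20]; exact hF₁) e49 e50 hy1 hyi rfl (by omega) hq hh).seq ?_
  rintro t₃ s₃ ha₃ ⟨L₂, hL₂, hs₂, ht₃, hF₂, hp₂⟩
  rw [f18] at ht₃
  have g49 : s₃.reg 49 = 2 ^ h + y := (ha₃.1 49 (by decide)).trans e49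
  have g50 : s₃.reg 50 = (2 ^ h + y) / 2 ^ i := (ha₃.1 50 (by decide)).trans e50
  have g57 : s₃.reg 57 = s₂.reg 57 := ha₃.1 57 (by decide)
  set p₂ : RamProg := .assign 40 (.reg 57) ;; .ite (.op .eq (.reg 49) (.reg 50))
    (.assign 41 (.const 0)) (.assign 41 (.load 20 (.reg 49))) with hp₂def
  refine (Runs.of_loopFree (V := V) (p := p₂) (T := 15) (Q := (· = p₂.step s₃)) rfl
    (by decide) (by simp [p₂]) rfl).runsIn.seq ?_
  rintro t₄ s₄ ha₄ ⟨ht₄, h₄⟩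
  have k40 : s₄.reg 40 = s₂.reg 57 := by
    rw [h₄]
    by_cases hc : s₃.reg 49 = s₃.reg 50 <;> simp [p₂, hc, g57]
  have k41 : s₄.reg 41 = if 2 ^ h + y = (2 ^ h + y) / 2 ^ i then 0 else s₃.mem 20 (2 ^ h + y) := by
    rw [h₄]
    by_cases hc : 2 ^ h + y = (2 ^ h + y) / 2 ^ i
    · have : s₃.reg 49 = s₃.reg 50 := by rw [g49, g50, ← hc]
      simp [p₂, this, if_pos hc]
    · simp [p₂, g49, g50, if_neg hc]
  clear h₄
  have hprod₂ : IsProduct L₂ (s₄.reg 41) (posIco pos c y : Set (Fin n)) := by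
    rw [k41]
    split_ifs with hc
    · refine .inl ⟨rfl, ?_⟩
      rw [← hyc, ← hc, heapStart_leaf, posIco_self]
    · have := (hF₂ (2 ^ h + y) (by have := hP.le; omega) (by omega)).2.2
      rwa [hp₂ hc, hyc, heapStart_leaf] at this
  have hgap : (posIco pos (x + 1) c : Set (Fin n)) ∪ posIco pos c y = posGap pos x y := by
    rw [posIco_union pos hc1 hc2]
    rfl
  refine (combine_spec (V := V) (ha₄.holds hs₂ (by decide) (by decide))
    (by rw [k40]; exact hprod.of_prefix hL₂) hprod₂ (posIco_disjoint pos)).runsIn.seq ?_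
  rintro t₅ s₅ ha₅ ⟨ht₅, L₃, hL₃, hs₃, hprod₃⟩
  rw [hgap] at hprod₃
  have m18 : s₅.mem 18 = s₃.mem 18 := (ha₅.2 18 (by decide)).trans (ha₄.2 18 (by decide))
  have m19 : s₅.mem 19 = s₃.mem 19 := (ha₅.2 19 (by decide)).trans (ha₄.2 19 (by decide))
  have m20 : s₅.mem 20 = s₃.mem 20 := (ha₅.2 20 (by decide)).trans (ha₄.2 20 (by decide))
  have m22 : s₅.mem 22 = s.mem 22 :=
    (ha₅.2 22 (by decide)).trans ((ha₄.2 22 (by decide)).trans ((ha₃.2 22 (by decide)).trans f22))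
  have m23 : s₅.mem 23 = s.mem 23 :=
    (ha₅.2 23 (by decide)).trans ((ha₄.2 23 (by decide)).trans ((ha₃.2 23 (by decide)).trans f23))
  have m55 : s₅.reg 55 = g :=
    (ha₅.1 55 (by decide)).trans ((ha₄.1 55 (by decide)).trans ((ha₃.1 55 (by decide)).trans f55))
  set p₃ : RamProg := .store 23 (.reg 55) (.reg 42) ;; .assign 55 (.load 22 (.reg 55)) with hp₃def
  refine (Runs.of_loopFree (V := V) (p := p₃) (T := 10) (Q := (· = p₃.step s₅)) rfl
    (by decide) (by simp [p₃]) rfl).runsIn.mono ?_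
  rintro t₆ s₆ ha₆ ⟨ht₆, rfl⟩
  refine ⟨L₃, hL₁.trans (hL₂.trans hL₃), hs₃.congr rfl rfl rfl rfl rfl rfl, ?_, ?_, ?_, s₅.reg 42, ?_,
    hprod₃⟩
  · simp only [p₃, RamProg.step, RamState.mem_setReg, RamState.mem_setMem, m18,
      show ¬(18 = 23) by decide, if_false]
    omega
  · intro v hv1 hv2
    obtain ⟨q1, q2, q3⟩ := hF₂ v hv1 hv2
    simp only [p₃, RamProg.step, RamState.mem_setReg, RamState.mem_setMem, m18, m19, m20,
      show ¬(18 = 23) by decide, show ¬(19 = 23) by decide, show ¬(20 = 23) by decide, if_false]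
    exact ⟨q1, q2.of_prefix hL₃, q3.of_prefix hL₃⟩
  · simp [p₃, m55, m22]
  · simp [p₃, m55, m23]

/-- The products of the variables in all gaps are written to bank 23. -/
def fillGaps : RamProg :=
  (.assign 54 (.const 0) ;; .assign 55 (.const 0)) ;;
  .while (.op .lt (.reg 54) (.op .add (.reg 28) (.const 1)))
    (.ite (.reg 55) gapProduct
      (.assign 54 (.op .add (.reg 54) (.const 1)) ;; .assign 55 (.load 21 (.reg 54))))

theorem RunsIn.ite {V : ℕ} {p q : RamProg} {s : RamState} {Q : ℕ → RamState → Prop} {e : RamExp}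
    (he : e.LowBdd V s) (h₁ : e.eval s ≠ 0 → RunsIn V p s fun t => Q (e.cost + 1 + t))
    (h₂ : e.eval s = 0 → RunsIn V q s fun t => Q (e.cost + 1 + t)) :
    RunsIn V (.ite e p q) s Q := by
  by_cases h : e.eval s = 0
  · obtain ⟨t, s', h1, h2⟩ := h₂ h
    exact ⟨_, s', .iteFalse p he h h1, h2⟩
  · obtain ⟨t, s', h1, h2⟩ := h₁ h
    exact ⟨_, s', .iteTrue q he h h1, h2⟩

theorem PowersOK.of_agree {n h : ℕ} {p : RamProg} {s s' : RamState} (hP : PowersOK n h s)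
    (ha : p.Agree s s') (hr : 19 ∉ p.regs ∧ 28 ∉ p.regs ∧ 45 ∉ p.regs ∧ 29 ∉ p.regs)
    (hb : 15 ∉ p.banks) : PowersOK n h s' :=
  ⟨(ha.1 _ hr.1).trans hP.r19, (ha.1 _ hr.2.1).trans hP.r28, (ha.1 _ hr.2.2.1).trans hP.r45,
    (ha.1 _ hr.2.2.2).trans hP.r29, by rw [ha.2 _ hb]; exact hP.m15, hP.le, hP.lt⟩

/-- The gaps that remain when the gap `cur` with meeting height `j` is the next one. -/
def gapsLeft (lam : ℕ → ℕ) (m j cur : ℕ) : Finset ℕ :=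
  {g ∈ Finset.Icc 1 m | j < lam g ∨ (lam g = j ∧ g ≤ cur)}

/-- The remaining time is bounded by 200 times the potential, plus 400(a+4) for each gap left, plus
a constant for each height left. Increasing heights are essential: the forest invariant for height j
only weakens when j grows. -/
theorem fillGaps_spec {n h a q m : ℕ} {pos qa qb : ℕ → ℕ} {D : Prop} {L : List (PGate n)}
    {s : RamState} {V : ℕ} (hP : PowersOK n h s) (hs : s.Holds D L) (r4 : s.reg 4 = 4 * n + 8)
    (e13 : s.mem 13 = qa) (e14 : s.mem 14 = qb)
    (hab : ∀ g, 1 ≤ g → g ≤ m → qa g < qb g ∧ qb g < 2 ^ h) (hq : 4 ≤ q) (hh : h < tarjanA a q)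
    (hB : Buckets (fun g => meetHeight (qa g) (qb g)) m (s.mem 21) (s.mem 22))
    (hF : ForestInv L pos h 0 (s.mem 18) (s.mem 19) (s.mem 20)) :
    Runs V fillGaps s (200 * forestPot a q (heapHeight h) (Finset.Ico 2 (2 ^ (h + 1))) (s.mem 18) +
      m * (400 * (a + 4)) + 30 * h + 100) fun s' => ∃ L', L <+: L' ∧ s'.Holds D L' ∧
        ∀ g, 1 ≤ g → g ≤ m → IsProduct L' (s'.mem 23 g) (posGap pos (qa g) (qb g)) := by
  have hlam : ∀ g, 1 ≤ g → g ≤ m → meetHeight (qa g) (qb g) ≤ h := fun g h1 h2 =>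
    meetHeight_le ((hab g h1 h2).1.trans (hab g h1 h2).2) (hab g h1 h2).2
  set lam := fun g => meetHeight (qa g) (qb g) with hlamdef
  have hlam' : ∀ g, lam g = meetHeight (qa g) (qb g) := fun _ => rfl
  clear_value lam
  refine (Runs.step_seq (T := 10) (T' := 200 * forestPot a q (heapHeight h)
    (Finset.Ico 2 (2 ^ (h + 1))) (s.mem 18) + m * (400 * (a + 4)) + 30 * (h + 2) + 10) rfl (by decide)
    (by simp) (Runs.loop (e := .op .lt (.reg 54) (.op .add (.reg 28) (.const 1))) (fun c s' =>
      (200 * forestPot a q (heapHeight h) (Finset.Ico 2 (2 ^ (h + 1))) (s'.mem 18) +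
        (gapsLeft lam m (s'.reg 54) (s'.reg 55)).card * (400 * (a + 4)) + 30 * (h + 2 - s'.reg 54) + 10
          ≤ c) ∧ s'.reg 54 ≤ h + 1 ∧
      (s'.reg 55 = 0 ∨ (1 ≤ s'.reg 55 ∧ s'.reg 55 ≤ m ∧ lam (s'.reg 55) = s'.reg 54)) ∧
      ∃ L', L <+: L' ∧ s'.Holds D L' ∧
        ForestInv L' pos h (s'.reg 54 - 1) (s'.mem 18) (s'.mem 19) (s'.mem 20) ∧
        ∀ g, 1 ≤ g → g ≤ m → (lam g < s'.reg 54 ∨ (lam g = s'.reg 54 ∧ s'.reg 55 < g)) →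
          IsProduct L' (s'.mem 23 g) (posGap pos (qa g) (qb g))) ?_ ?_)).mono (by omega)
    fun s' _ h => h
  · have hcard : (gapsLeft lam m 0 0).card ≤ m :=
      (Finset.card_filter_le _ _).trans (by simp)
    refine ⟨?_, by simp, by simp, L, List.prefix_rfl, hs.congr rfl rfl rfl rfl rfl rfl, by simpa using hF, ?_⟩
    · have := Nat.mul_le_mul_right (400 * (a + 4)) hcard
      simp
      omega
    · intro g h1 h2 h3
      -- The ends of a gap differ, so meeting heights are positive and no gap is due at height 0.
      have h4 := meetHeight_of_ne (hab g h1 h2).1.ne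
      rw [← hlam'] at h4
      simp at h3
      omega
  · rintro c s' ha ⟨hc, hj, hcur, L', hLL', hs', hF', hdone⟩
    have f28 : s'.reg 28 = h := (ha.1 28 (by decide)).trans (by simp [hP.r28])
    have f4 : s'.reg 4 = 4 * n + 8 := (ha.1 4 (by decide)).trans (by simp [r4])
    have f13 : s'.mem 13 = qa := (ha.2 13 (by decide)).trans (by simp [e13])
    have f14 : s'.mem 14 = qb := (ha.2 14 (by decide)).trans (by simp [e14])
    have f21 : s'.mem 21 = s.mem 21 := (ha.2 21 (by decide)).trans (by simp)
    have f22 : s'.mem 22 = s.mem 22 := (ha.2 22 (by decide)).trans (by simp)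
    obtain ⟨j, hjj⟩ : ∃ j, s'.reg 54 = j := ⟨_, rfl⟩
    obtain ⟨cur, hcc⟩ : ∃ j, s'.reg 55 = j := ⟨_, rfl⟩
    simp only [hjj, hcc] at hc hj hcur hF' hdone
    refine ⟨by simp, fun he => ?_, fun he => ⟨by simp only [RamExp.cost]; omega, ?_⟩⟩
    · have hjh : j < h + 1 := by
        by_contra hn
        simp [hjj, f28, hn] at he
      refine RunsIn.runs (RunsIn.ite (by simp) (fun h55 => ?_) fun h55 => ?_)
      · have hc0 : cur ≠ 0 := by
          intro h0
          simp [hcc, h0] at h55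
        obtain ⟨c1, c2, c3⟩ := hcur.resolve_left hc0
        have hP' : PowersOK n h s' :=
          ⟨(ha.1 19 (by decide)).trans (by simp [hP.r19]), f28,
            (ha.1 45 (by decide)).trans (by simp [hP.r45]),
            (ha.1 29 (by decide)).trans (by simp [hP.r29]),
            by rw [ha.2 15 (by decide)]; simpa using hP.m15, hP.le, hP.lt⟩
        refine (gapProduct_spec hP' hs' f4 hcc (congrFun f13 cur) (congrFun f14 cur) (hab cur c1 c2).1
          (hab cur c1 c2).2 (by rw [hjj, ← c3, hlam']) hq hh (by rw [hjj]; exact hF')).mono ?_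
        rintro t s'' ha' ⟨L'', hL'', hs'', ht, hF'', h55', r, hr, hprod⟩
        have g54 : s''.reg 54 = j := (ha'.1 54 (by decide)).trans hjj
        rw [f22] at h55'
        have hnext := hB.next_cases cur c1 c2
        have hle := hB.le_next cur
        rw [← h55'] at hnext hle
        have hcard : (gapsLeft lam m j (s''.reg 55)).card + 1 ≤ (gapsLeft lam m j cur).card := by
          refine Finset.card_lt_card ⟨fun g hg => ?_, fun hsub => ?_⟩
          · simp only [gapsLeft, Finset.mem_filter, Finset.mem_Icc] at hg ⊢
            omega
          · have hmem : cur ∈ gapsLeft lam m j cur := by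
              simp only [gapsLeft, Finset.mem_filter, Finset.mem_Icc]
              omega
            have := hsub hmem
            simp only [gapsLeft, Finset.mem_filter, Finset.mem_Icc] at this
            omega
        have hmul := Nat.mul_le_mul_right (400 * (a + 4)) hcard
        rw [add_mul, one_mul] at hmul
        refine ⟨_, ?_, le_rfl, by omega, by rw [g54]; omega, L'', hLL'.trans hL'', hs'', ?_, ?_⟩
        · simp only [RamExp.cost, g54]
          omega
        · rw [g54, ← hjj]
          exact hF''
        · intro g h1 h2 h3
          rw [g54] at h3
          rw [hr, Function.update_apply]
          split_ifs with hg
          · rw [hg]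
            exact hprod
          -- The lists are decreasing and complete, so no gap of this height lies strictly between
          -- the current gap and its successor.
          · refine (hdone g h1 h2 ?_).of_prefix hL''
            rcases h3 with h3 | ⟨h3, h4⟩
            · exact .inl h3
            · refine .inr ⟨h3, ?_⟩
              by_contra hgc
              have := hle g h1 (by omega) c2 (h3.trans c3.symm)
              omega
      · have hc0 : cur = 0 := by simpa [hcc] using h55
        subst hc0
        refine (Runs.of_loopFree (T := 10) (Q := fun s'' => s'' = _) rfl (by decide) (by simp)
          rfl).runsIn.mono ?_
        rintro t s'' - ⟨ht, rfl⟩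
        have hhead := hB.head_cases (j + 1)
        have hle := hB.le_head
        have hcard : (gapsLeft lam m (j + 1) (s.mem 21 (j + 1))).card ≤ (gapsLeft lam m j 0).card := by
          refine Finset.card_le_card fun g hg => ?_
          simp only [gapsLeft, Finset.mem_filter, Finset.mem_Icc] at hg ⊢
          omega
        have hmul := Nat.mul_le_mul_right (400 * (a + 4)) hcard
        refine ⟨_, ?_, le_rfl, ?_, ?_, L', hLL', hs'.congr rfl rfl rfl rfl rfl rfl, ?_, ?_⟩
        · simp [RamExp.cost, hjj, f21]
          omega
        · simp [hjj]
          omega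
        · simp [hjj, f21]
          omega
        · simp [hjj]
          exact hF'.mono (by omega)
        · intro g h1 h2 h3
          simp [hjj, f21] at h3 ⊢
          refine hdone g h1 h2 ?_
          rcases h3 with h3 | ⟨h3, h4⟩
          · have : lam g < j ∨ lam g = j := by omega
            exact this.imp_right fun h => ⟨h, h1⟩
          · have := hle g h1 h2
            simp only [h3] at this
            omega
    · have hjh : j = h + 1 := by
        by_contra hn
        simp [hjj, f28, show j < h + 1 by omega] at he
      exact ⟨L', hLL', hs', fun g h1 h2 => hdone g h1 h2 (.inl (by have := hlam g h1 h2; rw [← hlam'] at this; omega))⟩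

/-! ### The gates of the new circuit -/

namespace Circuit

variable {n : ℕ} {C : Circuit n} {a : Fin n → Bool} {p : Fin C.N}

theorem sat_lit_iff {x : Fin n} {b : Bool} (h : C.gate p = .lit x b) : C.Sat a p ↔ a x = b := by
  constructor
  · intro hs
    cases hs with
    | lit _ x' b' h' hx =>
      rw [h] at h'
      cases h'
      exact hx
    | or _ cs h' => rw [h] at h'; cases h'
    | and _ cs h' => rw [h] at h'; cases h'
  · exact .lit p x b h

theorem sat_or_iff {cs : List (Fin C.N)} (h : C.gate p = .or cs) :
    C.Sat a p ↔ ∃ c ∈ cs, C.Sat a c := by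
  constructor
  · intro hs
    cases hs with
    | lit _ x' b' h' hx => rw [h] at h'; cases h'
    | or _ cs h' c hc hs =>
      rw [h] at h'
      cases h'
      exact ⟨c, hc, hs⟩
    | and _ cs h' => rw [h] at h'; cases h'
  · rintro ⟨c, hc, hs⟩
    exact .or p cs h c hc hs

theorem sat_and_iff {cs : List (Fin C.N)} (h : C.gate p = .and cs) :
    C.Sat a p ↔ ∀ c ∈ cs, C.Sat a c := by
  constructor
  · intro hs
    cases hs with
    | lit _ x' b' h' hx => rw [h] at h'; cases h'
    | or _ cs h' => rw [h] at h'; cases h'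
    | and _ cs h' hs =>
      rw [h] at h'
      cases h'
      exact hs
  · exact .and p cs h

end Circuit

/-- The one-element list of a number other than zero. -/
def optList (r : ℕ) : List ℕ := if r = 0 then [] else [r]

/-- The splitting makes the variables of the child and of the two products pairwise disjoint. Since
actual products have nonempty sets of variables, the children are also distinct. The products are
tautologies, so the gate computes the function of `c`. -/
theorem PGate.valid_fill {n : ℕ} {D : Prop} {L : List (PGate n)} {c r r' : ℕ}
    {U U₁ U₂ : Set (Fin n)} (hc : c < L.length) (h₁ : IsProduct L r U₁) (h₂ : IsProduct L r' U₂)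
    (hS : Split U (varsAt L c) U₁ U₂) :
    PGate.Valid D L L.length ⟨3, 0, c :: optList r ++ optList r', U, valAt L c⟩ := by
  rw [split_iff] at hS
  rcases h₁ with ⟨rfl, rfl⟩ | ⟨k1, l1, v1, ⟨y1, ne1⟩, f1⟩ <;>
  rcases h₂ with ⟨rfl, rfl⟩ | ⟨k2, l2, v2, ⟨y2, ne2⟩, f2⟩
  · refine ⟨by simp [optList], by simp [optList, hc], .inr (.inr ⟨rfl, ?_, ?_, ?_⟩)⟩
    · intro y
      simpa [optList] using (hS y).1
    · simp [optList]
    · simp [optList]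
  · have n2 : c ≠ r' := by
      rintro rfl
      have := hS y2
      simp [v2, ne2] at this
    refine ⟨by simp [optList, k2, n2], by simp [optList, k2, hc, l2], .inr (.inr ⟨rfl, ?_, ?_, ?_⟩)⟩
    · intro y
      simpa [optList, k2, v2] using (hS y).1
    · have : Disjoint (varsAt L c) U₂ := Set.disjoint_left.2 fun x hx hx' => (hS x).2.2 ⟨.inl hx, hx'⟩
      simp [optList, k2, v2, this, this.symm]
    · simp [optList, k2, f2]
  · have n1 : c ≠ r := by
      rintro rfl
      have := hS y1
      simp [v1, ne1] at this
    refine ⟨by simp [optList, k1, n1], by simp [optList, k1, hc, l1], .inr (.inr ⟨rfl, ?_, ?_, ?_⟩)⟩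
    · intro y
      simpa [optList, k1, v1] using (hS y).1
    · have : Disjoint (varsAt L c) U₁ := Set.disjoint_left.2 fun x hx hx' => (hS x).2.1 ⟨hx, hx'⟩
      simp [optList, k1, v1, this, this.symm]
    · simp [optList, k1, f1]
  · have n1 : c ≠ r := by
      rintro rfl
      have := hS y1
      simp [v1, ne1] at this
    have n2 : c ≠ r' := by
      rintro rfl
      have := hS y2
      simp [v2, ne2] at this
    have n3 : r ≠ r' := by
      rintro rfl
      rw [v1] at v2
      subst v2
      have := hS y1
      simp [ne1] at this
    refine ⟨by simp [optList, k1, k2, n1, n2, n3], by simp [optList, k1, k2, hc, l1, l2],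
      .inr (.inr ⟨rfl, ?_, ?_, ?_⟩)⟩
    · intro y
      simpa [optList, k1, v1, k2, v2] using (hS y).1
    · have d1 : Disjoint (varsAt L c) U₁ := Set.disjoint_left.2 fun x hx hx' => (hS x).2.1 ⟨hx, hx'⟩
      have d2 : Disjoint (varsAt L c) U₂ := Set.disjoint_left.2 fun x hx hx' =>
        (hS x).2.2 ⟨.inl hx, hx'⟩
      have d3 : Disjoint U₁ U₂ := Set.disjoint_left.2 fun x hx hx' => (hS x).2.2 ⟨.inr hx, hx'⟩
      simp [optList, k1, k2, v1, v2, d1, d2, d3, d1.symm, d2.symm, d3.symm]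
    · simp [optList, k1, k2, f1, f2]

theorem PGate.valid_and {n : ℕ} {D : Prop} {L : List (PGate n)} {c d r : ℕ}
    {U U₁ : Set (Fin n)} (hc : c < L.length) (hd : d < L.length) (hcd : c ≠ d)
    (h₁ : IsProduct L r U₁) (hS : Split U (varsAt L c) (varsAt L d) U₁) :
    PGate.Valid D L L.length ⟨3, 0, c :: d :: optList r, U, fun a => valAt L c a ∧ valAt L d a⟩ := by
  rw [split_iff] at hS
  have d0 : Disjoint (varsAt L c) (varsAt L d) :=
    Set.disjoint_left.2 fun x hx hx' => (hS x).2.1 ⟨hx, hx'⟩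
  rcases h₁ with ⟨rfl, rfl⟩ | ⟨k1, l1, v1, ⟨y1, ne1⟩, f1⟩
  · refine ⟨by simp [optList, hcd], by simp [optList, hc, hd], .inr (.inr ⟨rfl, ?_, ?_, ?_⟩)⟩
    · intro y
      simpa [optList] using (hS y).1
    · simp [optList, d0, d0.symm]
    · simp [optList]
  · have n1 : c ≠ r := by
      rintro rfl
      have := hS y1
      simp [v1, ne1] at this
    have n2 : d ≠ r := by
      rintro rfl
      have := hS y1
      simp [v1, ne1] at this
    refine ⟨by simp [optList, k1, n1, n2, hcd], by simp [optList, k1, hc, hd, l1],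
      .inr (.inr ⟨rfl, ?_, ?_, ?_⟩)⟩
    · intro y
      simpa [optList, k1, v1] using (hS y).1
    · have d1 : Disjoint (varsAt L c) U₁ := Set.disjoint_left.2 fun x hx hx' =>
        (hS x).2.2 ⟨.inl hx, hx'⟩
      have d2 : Disjoint (varsAt L d) U₁ := Set.disjoint_left.2 fun x hx hx' =>
        (hS x).2.2 ⟨.inr hx, hx'⟩
      simp [optList, k1, v1, d0, d0.symm, d1, d2, d1.symm, d2.symm]
    · simp [optList, k1, f1]

theorem RamProg.agree_step (p : RamProg) (s : RamState) : p.Agree s (p.step s) := by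
  induction p generalizing s with
  | skip => exact .refl _ _
  | assign x e =>
    refine ⟨fun y hy => ?_, fun _ _ => rfl⟩
    simp only [RamProg.regs, List.mem_singleton] at hy
    simp [hy]
  | store b a e =>
    refine ⟨fun _ _ => rfl, fun b' hb' => ?_⟩
    simp only [RamProg.banks, List.mem_singleton] at hb'
    simp [hb']
  | seq p q ihp ihq =>
    exact ((ihp s).of_subset (by simp [RamProg.regs]) (by simp [RamProg.banks])).trans
      ((ihq _).of_subset (by simp [RamProg.regs]) (by simp [RamProg.banks]))
  | ite e p q ihp ihq =>
    simp only [RamProg.step]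
    split_ifs
    · exact (ihq s).of_subset (by simp [RamProg.regs]) (by simp [RamProg.banks])
    · exact (ihp s).of_subset (by simp [RamProg.regs]) (by simp [RamProg.banks])
  | _ => exact .refl _ _

/-- Add a child to the gate that is being constructed, unless its number is zero. -/
def pushOpt (e : RamExp) : RamProg :=
  .assign 58 e ;; .ite (.reg 58) (pushChild (.reg 58)) .skip

/-- The state holds the list `L` of gates, followed by a list of children of the next gate. -/
def RamState.HoldsWith {n : ℕ} (s : RamState) (D : Prop) (L : List (PGate n)) (cur : List ℕ) : Prop :=
  Built L cur (s.mem 30) (s.mem 31) (s.mem 32) (s.mem 33) (s.reg 24) (s.reg 25) ∧ AllValid D L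

theorem RamState.HoldsWith.pushChild {n : ℕ} {s : RamState} {D : Prop} {L : List (PGate n)}
    {cur : List ℕ} (h : s.HoldsWith D L cur) (e : RamExp) :
    ((pushChild e).step s).HoldsWith D L (cur ++ [e.eval s]) :=
  ⟨by simpa [_root_.pushChild] using h.1.push (e.eval s), h.2⟩

theorem RamState.HoldsWith.pushOpt {n : ℕ} {s : RamState} {D : Prop} {L : List (PGate n)}
    {cur : List ℕ} (h : s.HoldsWith D L cur) (e : RamExp) :
    ((pushOpt e).step s).HoldsWith D L (cur ++ optList (e.eval s)) := by
  by_cases he : e.eval s = 0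
  · refine ⟨?_, h.2⟩
    simpa [_root_.pushOpt, he, optList] using h.1
  · refine ⟨?_, h.2⟩
    simpa [_root_.pushOpt, he, optList, _root_.pushChild] using h.1.push (e.eval s)

theorem RamState.HoldsWith.closeGate {n : ℕ} {s : RamState} {D : Prop} {L : List (PGate n)}
    {cur : List ℕ} (h : s.HoldsWith D L cur) (t : ℕ) (x : RamExp) {U : Set (Fin n)}
    {f : (Fin n → Bool) → Prop} {v : ℕ} (hx : x.eval (s.setMem 30 (s.reg 24) t) = v)
    (hv : PGate.Valid D L L.length ⟨t, v, cur, U, f⟩) :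
    ((closeGate t x).step s).Holds D (L ++ [⟨t, v, cur, U, f⟩]) := by
  subst hx
  refine ⟨?_, h.2.snoc hv⟩
  simpa [_root_.closeGate] using h.1.close t _ U f

theorem RamState.Holds.with {n : ℕ} {s : RamState} {D : Prop} {L : List (PGate n)} (h : s.Holds D L) :
    s.HoldsWith D L [] := h

/-- `g` is the number of a gate that corresponds to the gate `p` of `C`, and whose variables are those
between the extreme variables of `p`. -/
def Circuit.IsCopy {n : ℕ} (C : Circuit n) (pos lo hi : ℕ → ℕ) (L : List (PGate n)) (g : ℕ) (p : Fin C.N) :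
    Prop :=
  g < L.length ∧ varsAt L g = posRange pos (lo p) (hi p) ∧ ∀ a, valAt L g a ↔ C.Sat a p

theorem Circuit.IsCopy.of_prefix {n : ℕ} {C : Circuit n} {pos lo hi : ℕ → ℕ} {L L' : List (PGate n)}
    {g : ℕ} {p : Fin C.N} (h : C.IsCopy pos lo hi L g p) (hL : L <+: L') :
    C.IsCopy pos lo hi L' g p := by
  refine ⟨h.1.trans_le hL.length_le, ?_, ?_⟩
  · rw [PGate.varsAt_of_prefix hL h.1, h.2.1]
  · rw [PGate.valAt_of_prefix hL h.1]
    exact h.2.2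

/-- The child of an `⊕`-gate at the edge in register 12 is extended to the variables of the gate. -/
def orEdge : RamProg :=
  pushChild (.load 25 (.load 3 (.reg 12))) ;;
  pushOpt (.load 23 (.op .add (.op .add (.reg 12) (.reg 12)) (.const 1))) ;;
  pushOpt (.load 23 (.op .add (.op .add (.reg 12) (.reg 12)) (.const 2))) ;;
  closeGate 3 (.const 0) ;; .assign 12 (.op .add (.reg 12) (.const 1))

def orEdges : RamProg :=
  .while (.op .lt (.reg 12) (.load 2 (.op .add (.reg 13) (.const 1)))) orEdge

/-- The gates made for the edges of one ⊕-gate have consecutive numbers, from register 59 up to the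
last gate, so they can be listed by counting. -/
def orKids : RamProg :=
  .while (.op .lt (.reg 59) (.reg 24))
    (pushChild (.reg 59) ;; .assign 59 (.op .add (.reg 59) (.const 1)))

/-- An ⊕-gate first gets one ⊗-gate per edge, which fills the gaps, and then the ⊕-gate over these.
A ⊗-gate receives the filling of its single gap as an additional child. -/
def buildGate : RamProg :=
  (.assign 15 (.op .sub (.reg 15) (.const 1)) ;; .assign 13 (.load 10 (.reg 15)) ;;
    .assign 12 (.load 2 (.reg 13)) ;; .assign 59 (.reg 24)) ;;
  .ite (.op .lt (.load 0 (.reg 13)) (.const 2))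
    (.ite (.load 0 (.reg 13)) (closeGate 1 (.load 1 (.reg 13))) (closeGate 0 (.load 1 (.reg 13))))
    (.ite (.op .eq (.load 0 (.reg 13)) (.const 2))
      (orEdges ;; orKids ;; closeGate 2 (.const 0))
      (.ite (.op .lt (.reg 12) (.load 2 (.op .add (.reg 13) (.const 1))))
        (pushChild (.load 25 (.load 3 (.reg 12))) ;;
          pushChild (.load 25 (.load 3 (.op .add (.reg 12) (.const 1)))) ;;
          pushOpt (.load 23 (.op .add (.op .add (.reg 12) (.reg 12)) (.const 1)))) .skip ;;
        closeGate 3 (.const 0))) ;;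
  .store 25 (.reg 13) (.op .sub (.reg 24) (.const 1))

/-- The new gates are constructed from the leaves to the root; their numbers are written to bank 25. -/
def build : RamProg :=
  .assign 15 (.reg 0) ;; .while (.reg 15) buildGate

theorem orEdge_spec {n : ℕ} {D : Prop} {L : List (PGate n)} {s : RamState} {V e c : ℕ}
    {U U₁ U₂ : Set (Fin n)} (hs : s.Holds D L) (h12 : s.reg 12 = e)
    (hc : s.mem 25 (s.mem 3 e) = c) (hcL : c < L.length) (hV : s.mem 3 e ≤ V)
    (h₁ : IsProduct L (s.mem 23 (2 * e + 1)) U₁) (h₂ : IsProduct L (s.mem 23 (2 * e + 2)) U₂)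
    (hS : Split U (varsAt L c) U₁ U₂) :
    Runs V orEdge s 80 fun s' => s'.reg 12 = e + 1 ∧
      ∃ ks, s'.Holds D (L ++ [⟨3, 0, ks, U, valAt L c⟩]) := by
  have e1 : e + e + 1 = 2 * e + 1 := by omega
  have e2 : e + e + 2 = 2 * e + 2 := by omega
  have k0 := hs.with.pushChild (.load 25 (.load 3 (.reg 12)))
  have a0 := RamProg.agree_step (pushChild (.load 25 (.load 3 (.reg 12)))) s
  have l0 : (.load 25 (.load 3 (.reg 12)) : RamExp).eval s = c := by simp [h12, hc]
  have b12 := a0.1 12 (by decide)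
  have b23 := a0.2 23 (by decide)
  rw [l0] at k0
  set s₀ := (pushChild (.load 25 (.load 3 (.reg 12)))).step s with hs₀
  set e' : RamExp := .load 23 (.op .add (.op .add (.reg 12) (.reg 12)) (.const 1)) with he'
  have k1 := k0.pushOpt e'
  have a1 := RamProg.agree_step (pushOpt e') s₀
  have l1 : e'.eval s₀ = s.mem 23 (2 * e + 1) := by simp [he', b12, b23, h12, e1]
  have c12 := a1.1 12 (by decide)
  have c23 := a1.2 23 (by decide)
  rw [l1] at k1
  set s₁ := (pushOpt e').step s₀ with hs₁
  set e'' : RamExp := .load 23 (.op .add (.op .add (.reg 12) (.reg 12)) (.const 2)) with he''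
  have k2 := k1.pushOpt e''
  have a2 := RamProg.agree_step (pushOpt e'') s₁
  have l2 : e''.eval s₁ = s.mem 23 (2 * e + 2) := by simp [he'', c12, c23, b12, b23, h12, e2]
  have d12 := a2.1 12 (by decide)
  rw [l2] at k2
  set s₂ := (pushOpt e'').step s₁ with hs₂
  have k3 := k2.closeGate 3 (.const 0) rfl (PGate.valid_fill hcL h₁ h₂ hS)
  have a3 := RamProg.agree_step (closeGate 3 (.const 0)) s₂
  have f12 := a3.1 12 (by decide)
  refine Runs.of_loopFree rfl (by decide) ?_ ⟨?_, _, k3.congr rfl rfl rfl rfl rfl rfl⟩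
  · simp [orEdge, pushChild, pushOpt, closeGate, h12, hV]
  · simp only [orEdge, RamProg.step]
    rw [← hs₀, ← hs₁, ← hs₂]
    simp [f12, d12, c12, b12, h12]

theorem orEdges_spec {n : ℕ} {C : Circuit n} {ty var off ch pos lo hi : ℕ → ℕ} {D : Prop}
    {L : List (PGate n)} {s : RamState} {V : ℕ} (hl : C.Layout ty var off ch) (hV : C.size + 1 ≤ V)
    (hs : s.Holds D L) (e2 : s.mem 2 = off) (e3 : s.mem 3 = ch) (p : Fin C.N) (r13 : s.reg 13 = p)
    (r12 : s.reg 12 = off p)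
    (hfill : ∀ e, off p ≤ e → e < off (p + 1) → ∃ U₁ U₂, IsProduct L (s.mem 23 (2 * e + 1)) U₁ ∧
      IsProduct L (s.mem 23 (2 * e + 2)) U₂ ∧ Split (posRange pos (lo p) (hi p))
        (posRange pos (lo (ch e)) (hi (ch e))) U₁ U₂)
    (hch : ∀ c ∈ (C.gate p).children, C.IsCopy pos lo hi L (s.mem 25 c) c) :
    Runs V orEdges s (100 * (off (p + 1) - off p) + 100) fun s' => ∃ L', L <+: L' ∧ s'.Holds D L' ∧
      L'.length = L.length + (off (p + 1) - off p) ∧ ∀ j < off (p + 1) - off p,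
        varsAt L' (L.length + j) = posRange pos (lo p) (hi p) ∧
        ∀ c : Fin C.N, ch (off p + j) = c → ∀ a, valAt L' (L.length + j) a ↔ C.Sat a c := by
  have hN := C.N_le
  have h2 := hl.off_le (i := p + 1) p.2
  have hmono := hl.off_mono (show (p : ℕ) ≤ p + 1 by omega) p.2
  refine (Runs.count (e := .op .lt (.reg 12) (.load 2 (.op .add (.reg 13) (.const 1)))) 80 (fun k s' =>
    s'.reg 12 + k = off (p + 1) ∧ off p ≤ s'.reg 12 ∧ ∃ L', L <+: L' ∧ s'.Holds D L' ∧
      L'.length = L.length + (s'.reg 12 - off p) ∧ ∀ j < s'.reg 12 - off p,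
        varsAt L' (L.length + j) = posRange pos (lo p) (hi p) ∧
        ∀ c : Fin C.N, ch (off p + j) = c → ∀ a, valAt L' (L.length + j) a ↔ C.Sat a c)
      (off (p + 1) - off p) ?_ ?_ ?_ ?_).mono (by simp only [RamExp.cost]; omega) fun s' _ h => h
  · exact ⟨by omega, r12.ge, L, List.prefix_rfl, hs, by omega, fun j hj => by omega⟩
  · rintro k s' ha -
    have f13 : s'.reg 13 = p := (ha.1 13 (by decide)).trans r13
    have f2 : s'.mem 2 = off := (ha.2 2 (by decide)).trans e2
    simp [f13, f2]
    omega
  · rintro k s' ha ⟨hk, hge, L', hLL', hs', hlen, hL'⟩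
    have f13 : s'.reg 13 = p := (ha.1 13 (by decide)).trans r13
    have f2 : s'.mem 2 = off := (ha.2 2 (by decide)).trans e2
    have f3 : s'.mem 3 = ch := (ha.2 3 (by decide)).trans e3
    have f23 : s'.mem 23 = s.mem 23 := ha.2 23 (by decide)
    have f25 : s'.mem 25 = s.mem 25 := ha.2 25 (by decide)
    obtain ⟨e, he⟩ : ∃ e, s'.reg 12 = e := ⟨_, rfl⟩
    rw [he] at hk hge hlen hL'
    obtain ⟨c, hc, hce⟩ := hl.exists_child hge (show e < off (p + 1) by omega)
    obtain ⟨U₁, U₂, h₁, h₂, hS⟩ := hfill e hge (by omega)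
    have hcp := (hch c hc).of_prefix hLL'
    refine ⟨by simp [f13, f2, he]; omega, (orEdge_spec (c := s.mem 25 c) (U₁ := U₁) (U₂ := U₂)
      (U := posRange pos (lo p) (hi p)) hs' he
      (by rw [f3, f25, hce]) hcp.1 (by rw [f3, hce]; omega) (by rw [f23]; exact h₁.of_prefix hLL')
      (by rw [f23]; exact h₂.of_prefix hLL') (by rw [hcp.2.1, ← hce]; exact hS)).mono le_rfl ?_⟩
    rintro s'' - ⟨h12, ks, hs''⟩
    refine ⟨by omega, by omega, _, hLL'.trans (List.prefix_append _ _), hs'', ?_, fun j hj => ?_⟩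
    · rw [List.length_append, List.length_singleton, hlen, h12]
      omega
    · rw [h12] at hj
      rcases Nat.lt_or_ge j (e - off p) with hj' | hj'
      · rw [PGate.varsAt_of_prefix (List.prefix_append _ _) (by omega),
          PGate.valAt_of_prefix (List.prefix_append _ _) (by omega)]
        exact hL' j hj'
      · obtain rfl : j = e - off p := by omega
        rw [← hlen, PGate.varsAt_snoc, PGate.valAt_snoc]
        refine ⟨rfl, fun c' hc' => ?_⟩
        rw [Nat.add_sub_cancel' hge, hce] at hc'
        rw [← Fin.ext hc']
        exact hcp.2.2
  · rintro s' ha ⟨hk, hge, L', hLL', hs', hlen, hL'⟩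
    have f13 : s'.reg 13 = p := (ha.1 13 (by decide)).trans r13
    have f2 : s'.mem 2 = off := (ha.2 2 (by decide)).trans e2
    rw [show s'.reg 12 = off (p + 1) by omega] at hlen hL'
    exact ⟨by simp [f13, f2]; omega, L', hLL', hs', hlen, hL'⟩

theorem orKids_spec {n : ℕ} {D : Prop} {L : List (PGate n)} {s : RamState} {V b k : ℕ}
    (hs : s.Holds D L) (r59 : s.reg 59 = b) (hk : L.length = b + k) :
    Runs V orKids s (30 * k + 30) fun s' => s'.HoldsWith D L (List.range' b k) := by
  refine (Runs.count (e := .op .lt (.reg 59) (.reg 24)) 15 (fun i s' => ∃ j, i + j = k ∧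
    s'.reg 59 = b + j ∧ s'.HoldsWith D L (List.range' b j)) k ?_ ?_ ?_ ?_).mono
    (by simp only [RamExp.cost]; omega) fun s' _ h => h
  · exact ⟨0, by omega, r59, hs⟩
  · simp
  · rintro i s' ha ⟨j, hj, h59, hs'⟩
    have h24 := hs'.1.gc_eq
    refine ⟨by simp [h59, h24]; omega, Runs.of_loopFree rfl (by decide) (by simp [pushChild]) ?_⟩
    have h1 := hs'.pushChild (.reg 59)
    have h2 := RamProg.agree_step (pushChild (.reg 59)) s'
    refine ⟨j + 1, by omega, ?_, ?_⟩
    · simp [h2.1 59 (by decide), h59]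
      omega
    · rw [List.range'_concat]
      simpa [RamState.HoldsWith, h59] using h1
  · rintro s' ha ⟨j, hj, h59, hs'⟩
    have h24 := hs'.1.gc_eq
    obtain rfl : j = k := by omega
    exact ⟨by simp [h59, h24]; omega, hs'⟩

/-- The hypotheses refer to edges instead of gate numbers, which keeps the later proof of
determinism close to the children of the original gate. -/
theorem PGate.valid_or {n : ℕ} {D : Prop} {L : List (PGate n)} {b k : ℕ} {U : Set (Fin n)}
    {f : (Fin n → Bool) → Prop} (hk : L.length = b + k) (hv : ∀ j < k, varsAt L (b + j) = U)
    (h0 : k = 0 → U = ∅) (hf : ∀ a, f a ↔ ∃ j < k, valAt L (b + j) a)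
    (hD : D → ∀ a, ∀ i < k, ∀ j < k, valAt L (b + i) a → valAt L (b + j) a → i = j) :
    PGate.Valid D L L.length ⟨2, 0, List.range' b k, U, f⟩ := by
  refine ⟨List.nodup_range', fun c hc => ?_, .inr (.inl ⟨rfl, fun c hc => ?_, fun h => h0 ?_,
    fun a => ?_, fun hd a c hc d hd' h1 h2 => ?_⟩)⟩
  · have := List.mem_range'_1.1 hc
    omega
  · have := List.mem_range'_1.1 hc
    rw [show c = b + (c - b) by omega]
    exact hv _ (by omega)
  · simpa using h
  · refine (hf a).trans ⟨?_, ?_⟩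
    · rintro ⟨j, hj, h⟩
      exact ⟨b + j, List.mem_range'_1.2 (by omega), h⟩
    · rintro ⟨c, hc, h⟩
      have := List.mem_range'_1.1 hc
      exact ⟨c - b, by omega, by rwa [Nat.add_sub_cancel' this.1]⟩
  · have hc' := List.mem_range'_1.1 hc
    have hd'' := List.mem_range'_1.1 hd'
    have := hD hd a (c - b) (by omega) (d - b) (by omega) (by rwa [Nat.add_sub_cancel' hc'.1])
      (by rwa [Nat.add_sub_cancel' hd''.1])
    omega

/-- Determinism is inherited because an edge gate computes the function of its child and distinct
edges lead to distinct children. The injectivity hypothesis on copies is needed for ⊗-gates: two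
children without variables have disjoint variable sets without being distinguished by them. -/
theorem buildGate_spec {n : ℕ} {C : Circuit n} {ty var off ch pos lo hi : ℕ → ℕ}
    {L : List (PGate n)} {s : RamState} {V : ℕ} (hl : C.Layout ty var off ch)
    (hinj : ∀ x y : Fin n, pos x = pos y → x = y) (hsep : C.Separated pos)
    (hhull : ∀ p : Fin C.N, HullOf pos (C.vars p) (lo p) (hi p)) (hV : C.size + 3 ≤ V) (hVn : n ≤ V)
    (hs : s.Holds C.Deterministic L)
    (e0 : s.mem 0 = ty) (e1 : s.mem 1 = var) (e2 : s.mem 2 = off) (e3 : s.mem 3 = ch)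
    (p : Fin C.N) (hp : s.mem 10 (s.reg 15 - 1) = p)
    (hfill : ∀ cs, C.gate p = .or cs → ∀ e, off p ≤ e → e < off (p + 1) →
      ∃ U₁ U₂, IsProduct L (s.mem 23 (2 * e + 1)) U₁ ∧
      IsProduct L (s.mem 23 (2 * e + 2)) U₂ ∧ Split (posRange pos (lo p) (hi p))
        (posRange pos (lo (ch e)) (hi (ch e))) U₁ U₂)
    (hfill' : ∀ cs, C.gate p = .and cs → off p < off (p + 1) →
      ∃ U₁, IsProduct L (s.mem 23 (2 * off p + 1)) U₁ ∧
      Split (posRange pos (lo p) (hi p)) (posRange pos (lo (ch (off p))) (hi (ch (off p))))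
        (posRange pos (lo (ch (off p + 1))) (hi (ch (off p + 1)))) U₁)
    (hch : ∀ c ∈ (C.gate p).children, C.IsCopy pos lo hi L (s.mem 25 c) c)
    (hnew : ∀ c ∈ (C.gate p).children, ∀ d ∈ (C.gate p).children, s.mem 25 c = s.mem 25 d → c = d) :
    Runs V buildGate s (150 * (off (p + 1) - off p) + 300) fun s' => s'.reg 15 = s.reg 15 - 1 ∧
      ∃ L' g, L <+: L' ∧ s'.Holds C.Deterministic L' ∧ L.length ≤ g ∧ C.IsCopy pos lo hi L' g p ∧
        s'.mem 25 = Function.update (s.mem 25) p g := by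
  have hN := C.N_le
  have h1 := hl.off_le p.2.le
  have h2 := hl.off_le (i := p + 1) p.2
  have hmono := hl.off_mono (show (p : ℕ) ≤ p + 1 by omega) p.2
  have hempty : posRange pos (n + 1) 0 = (∅ : Set (Fin n)) := by
    ext x
    simp [posRange]
    omega
  set pre : RamProg := .assign 15 (.op .sub (.reg 15) (.const 1)) ;; .assign 13 (.load 10 (.reg 15)) ;;
    .assign 12 (.load 2 (.reg 13)) ;; .assign 59 (.reg 24) with hpre
  refine (Runs.seq (Runs.of_loopFree (T := 20) (p := pre) (Q := fun s' => s' = pre.step s) rfl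
    (by decide) (by simp [pre, hp, e2]; omega) rfl) (T' := (150 * (off (p + 1) - off p) + 260) + 10)
    fun s₀ ha₀ h₀ => ?_).mono (by omega) fun s' _ h => h
  have hs₀ : s₀.Holds C.Deterministic L := ha₀.holds hs (by decide) (by decide)
  have a0 : s₀.mem 0 = ty := (ha₀.2 0 (by decide)).trans e0
  have a1 : s₀.mem 1 = var := (ha₀.2 1 (by decide)).trans e1
  have a2 : s₀.mem 2 = off := (ha₀.2 2 (by decide)).trans e2
  have a3 : s₀.mem 3 = ch := (ha₀.2 3 (by decide)).trans e3
  have a23 : s₀.mem 23 = s.mem 23 := ha₀.2 23 (by decide)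
  have a25 : s₀.mem 25 = s.mem 25 := ha₀.2 25 (by decide)
  have r13 : s₀.reg 13 = p := by rw [h₀]; simp [pre, hp]
  have r12 : s₀.reg 12 = off p := by rw [h₀]; simp [pre, hp, e2]
  have r15 : s₀.reg 15 = s.reg 15 - 1 := by rw [h₀]; simp [pre]
  have r59 : s₀.reg 59 = L.length := by rw [h₀]; simp [pre, hs.1.gc_eq]
  clear h₀
  refine Runs.seq (Q := fun s' => ∃ g L', L <+: L' ∧ L.length ≤ L'.length ∧
    g.vars = posRange pos (lo p) (hi p) ∧ (∀ a, g.val a ↔ C.Sat a p) ∧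
    s'.Holds C.Deterministic (L' ++ [g])) ?_ fun s' ha h => ?_
  · refine (Runs.ite (T := 150 * (off (p + 1) - off p) + 250) (by simp [r13, a0]; have := hl.ty_le p; omega)
      (fun hc => ?_) fun hc => ?_).mono
      (by simp only [RamExp.cost]; omega) fun s' _ h => h
    · have hlt : ty p < 2 := by
        by_contra h
        simp [r13, a0, h] at hc
      obtain ⟨x, b, hg, ht⟩ : ∃ x b, C.gate p = .lit x b ∧ ty p = (if b then 1 else 0) := by
        rcases hl.ty_cases p with h | ⟨cs, -, h⟩ | ⟨cs, -, h⟩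
        · exact h
        · omega
        · omega
      have hx := hl.var_eq p x b hg
      have hu : posRange pos (lo p) (hi p) = {x} := by
        have := (hhull p).unique (Circuit.vars_lit hg ▸ HullOf.singleton x)
        rw [this.1, this.2]
        ext y
        simp only [posRange, Set.mem_ofPred_eq, Set.mem_singleton_iff]
        exact ⟨fun h => hinj y x (by omega), fun h => by rw [h]; simp⟩
      have hv : PGate.Valid C.Deterministic L L.length
          ⟨if b then 1 else 0, x, [], posRange pos (lo p) (hi p), fun a => C.Sat a p⟩ := by
        refine ⟨by simp, by simp, .inl ⟨by cases b <;> simp, rfl, x, rfl, hu, fun a => ?_⟩⟩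
        simp only [Circuit.sat_lit_iff hg]
        cases b <;> simp
      cases b
      · have ht' : ty p = 0 := by simpa using ht
        have hx' : (.load 1 (.reg 13) : RamExp).eval (s₀.setMem 30 (s₀.reg 24) 0) = x := by
          simp [r13, a1, hx]
        refine Runs.of_loopFree rfl (by simp [RamProg.time, closeGate, RamExp.cost]) ?_
          ⟨(⟨0, x, [], posRange pos (lo p) (hi p), fun a => C.Sat a p⟩ : PGate n), L,
            List.prefix_rfl, le_rfl, rfl, fun a => Iff.rfl, ?_⟩
        · simp [closeGate, r13, a0, a1, ht', hx]
          omega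
        · have := hs₀.with.closeGate 0 (.load 1 (.reg 13)) hx' hv
          simpa [r13, a0, ht'] using this
      · have ht' : ty p = 1 := by simpa using ht
        have hx' : (.load 1 (.reg 13) : RamExp).eval (s₀.setMem 30 (s₀.reg 24) 1) = x := by
          simp [r13, a1, hx]
        refine Runs.of_loopFree rfl (by simp [RamProg.time, closeGate, RamExp.cost]) ?_
          ⟨(⟨1, x, [], posRange pos (lo p) (hi p), fun a => C.Sat a p⟩ : PGate n), L,
            List.prefix_rfl, le_rfl, rfl, fun a => Iff.rfl, ?_⟩
        · simp [closeGate, r13, a0, a1, ht', hx]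
          omega
        · have := hs₀.with.closeGate 1 (.load 1 (.reg 13)) hx' hv
          simpa [r13, a0, ht'] using this
    · have hge : ¬ty p < 2 := by
        intro h
        simp [r13, a0, h] at hc
      refine (Runs.ite (T := 150 * (off (p + 1) - off p) + 240) (by simp [r13, a0]; have := hl.ty_le p; omega)
        (fun hc => ?_) fun hc => ?_).mono (by simp only [RamExp.cost]; omega) fun s' _ h => h
      · have hty : ty p = 2 := by
          by_contra h
          simp [r13, a0, h] at hc
        obtain ⟨cs, hg⟩ : ∃ cs, C.gate p = .or cs := by
          rcases hl.ty_cases p with ⟨x, b, -, h⟩ | ⟨cs, h, -⟩ | ⟨cs, -, h⟩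
          · cases b <;> simp at h <;> omega
          · exact ⟨cs, h⟩
          · omega
        have hcs : (C.gate p).children = cs := by rw [hg, Gate.children]
        have hlen := hl.off_succ p
        refine (Runs.seq (orEdges_spec hl (by omega) hs₀ a2 a3 p r13 r12
          (by rw [a23]; exact hfill cs hg) (by rw [a25]; exact hch)) fun s₁ ha₁ h₁ => ?_).mono
          (T := (100 * (off (p + 1) - off p) + 100) + (30 * (off (p + 1) - off p) + 30 + 15))
          (by omega) fun s' _ h => h
        obtain ⟨L₁, hL₁, hs₁, hlen₁, hk₁⟩ := h₁
        refine Runs.seq (orKids_spec hs₁ ((ha₁.1 59 (by decide)).trans r59) hlen₁) fun s₂ ha₂ h₂ => ?_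
        have hv : PGate.Valid C.Deterministic L₁ L₁.length ⟨2, 0,
            List.range' L.length (off (p + 1) - off p), posRange pos (lo p) (hi p),
            fun a => C.Sat a p⟩ := by
          refine PGate.valid_or hlen₁ (fun j hj => (hk₁ j hj).1) (fun hk => ?_) (fun a => ?_) ?_
          · have hv : C.vars p = ∅ := by
              rw [Circuit.vars_eq_iUnion (by rw [hg]; simp), show (C.gate p).children = [] from List.eq_nil_of_length_eq_zero (by omega)]
              simp
            have := (hhull p).unique (hv ▸ HullOf.empty)
            rw [this.1, this.2, hempty]
          · rw [Circuit.sat_or_iff hg]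
            constructor
            · rintro ⟨c, hc, hsat⟩
              obtain ⟨e, u1, u2, u3⟩ := hl.mem_children.1 (hcs ▸ hc)
              refine ⟨e - off p, by omega, ((hk₁ _ (by omega)).2 c ?_ a).2 hsat⟩
              rw [Nat.add_sub_cancel' u1, u3]
            · rintro ⟨j, hj, hval⟩
              obtain ⟨c, hc, hce⟩ := hl.exists_child (p := p) (e := off p + j) (by omega) (by omega)
              exact ⟨c, hcs ▸ hc, ((hk₁ j hj).2 c hce a).1 hval⟩
          · intro hD a i hi j hj h1 h2
            obtain ⟨c, hc, hce⟩ := hl.exists_child (p := p) (e := off p + i) (by omega) (by omega)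
            obtain ⟨d, hd, hde⟩ := hl.exists_child (p := p) (e := off p + j) (by omega) (by omega)
            have hcd := hD a p cs hg c (hcs ▸ hc) d (hcs ▸ hd) (((hk₁ i hi).2 c hce a).1 h1)
              (((hk₁ j hj).2 d hde a).1 h2)
            rw [hl.ch_eq p i (by omega)] at hce
            rw [hl.ch_eq p j (by omega)] at hde
            have : (C.gate p).children[i]'(by omega) = (C.gate p).children[j]'(by omega) := by
              rw [Fin.ext hce, Fin.ext hde, hcd]
            exact (C.nodup p).getElem_inj_iff.1 this
        exact Runs.of_loopFree rfl (by decide) (by simp [closeGate])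
          ⟨_, L₁, hL₁, hL₁.length_le, rfl, fun a => Iff.rfl, h₂.closeGate 2 (.const 0) rfl hv⟩
      · have hty : ty p ≠ 2 := by
          intro h
          simp [r13, a0, h] at hc
        obtain ⟨cs, hg⟩ : ∃ cs, C.gate p = .and cs := by
          rcases hl.ty_cases p with ⟨x, b, -, h⟩ | ⟨cs, -, h⟩ | ⟨cs, h, -⟩
          · cases b <;> simp at h <;> omega
          · omega
          · exact ⟨cs, h⟩
        have hcs : (C.gate p).children = cs := by rw [hg, Gate.children]
        have hlen := hl.off_succ p
        rw [hcs] at hlen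
        rcases hsep p cs hg with rfl | ⟨c, d, rfl, -⟩
        · have hlen' : off (p + 1) = off p := by simpa using hlen
          have hv : C.vars p = ∅ := by
            rw [Circuit.vars_eq_iUnion (by rw [hg]; simp), hcs]
            simp
          have hu : posRange pos (lo p) (hi p) = (∅ : Set (Fin n)) := by
            have := (hhull p).unique (hv ▸ HullOf.empty)
            rw [this.1, this.2, hempty]
          have hv : PGate.Valid C.Deterministic L L.length ⟨3, 0, [], posRange pos (lo p) (hi p),
              fun a => C.Sat a p⟩ := by
            refine ⟨by simp, by simp, .inr (.inr ⟨rfl, by simp [hu], by simp, fun a => ?_⟩)⟩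
            simp [Circuit.sat_and_iff hg]
          refine Runs.of_loopFree rfl ?_ ?_ ⟨(⟨3, 0, [], posRange pos (lo p) (hi p), fun a => C.Sat a p⟩ : PGate n), L,
            List.prefix_rfl, le_rfl, rfl, fun a => Iff.rfl, ?_⟩
          rotate_right
          · have := hs₀.with.closeGate 3 (.const 0) rfl hv
            simpa [r13, r12, a2, hlen'] using this
          · simp [RamProg.time, closeGate, RamExp.cost, pushChild, pushOpt]
          · simp [closeGate, r13, r12, a2, hlen']
            omega
        · have hlen' : off (p + 1) = off p + 2 := by simpa using hlen
          have hce : ch (off p) = c := by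
            have := hl.ch_eq p 0 (by rw [hcs]; simp)
            simpa [hcs] using this
          have hde : ch (off p + 1) = d := by
            have := hl.ch_eq p 1 (by rw [hcs]; simp)
            simpa [hcs] using this
          have hnd : c ≠ d := by
            have := C.nodup p
            rw [hcs] at this
            simpa using this
          obtain ⟨U₁, hU₁, hS⟩ := hfill' _ hg (by omega)
          have hc := hch c (by rw [hcs]; simp)
          have hd := hch d (by rw [hcs]; simp)
          rw [hce, hde, ← hc.2.1, ← hd.2.1] at hS
          have hv := PGate.valid_and (D := C.Deterministic) hc.1 hd.1
            (fun h => hnd (hnew c (by rw [hcs]; simp) d (by rw [hcs]; simp) h)) hU₁ hS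
          have hf : ∀ a, valAt L (s.mem 25 c) a ∧ valAt L (s.mem 25 d) a ↔ C.Sat a p := fun a => by
            rw [hc.2.2, hd.2.2, Circuit.sat_and_iff hg]
            simp
          have k0 := hs₀.with.pushChild (.load 25 (.load 3 (.reg 12)))
          have b0 := RamProg.agree_step (pushChild (.load 25 (.load 3 (.reg 12)))) s₀
          have l0 : (.load 25 (.load 3 (.reg 12)) : RamExp).eval s₀ = s.mem 25 c := by
            simp [r12, a3, hce, a25]
          have b12 := (b0.1 12 (by decide)).trans r12
          have b3 := (b0.2 3 (by decide)).trans a3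
          have b23 := (b0.2 23 (by decide)).trans a23
          have b25 := (b0.2 25 (by decide)).trans a25
          rw [l0] at k0
          set s₁ := (pushChild (.load 25 (.load 3 (.reg 12)))).step s₀ with hs₁
          set e' : RamExp := .load 25 (.load 3 (.op .add (.reg 12) (.const 1))) with he'
          have k1 := k0.pushChild e'
          have c0 := RamProg.agree_step (pushChild e') s₁
          have l1 : e'.eval s₁ = s.mem 25 d := by simp [he', b12, b3, hde, b25]
          have c12 := (c0.1 12 (by decide)).trans b12
          have c23 := (c0.2 23 (by decide)).trans b23
          rw [l1] at k1
          set s₂ := (pushChild e').step s₁ with hs₂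
          set e'' : RamExp := .load 23 (.op .add (.op .add (.reg 12) (.reg 12)) (.const 1)) with he''
          have k2 := k1.pushOpt e''
          have l2 : e''.eval s₂ = s.mem 23 (2 * off p + 1) := by
            simp [he'', c12, c23]
            congr 1
            omega
          rw [l2] at k2
          refine Runs.of_loopFree rfl ?_ ?_ ⟨(⟨3, 0, s.mem 25 c :: s.mem 25 d :: optList (s.mem 23 (2 * off p + 1)),
            posRange pos (lo p) (hi p), fun a => valAt L (s.mem 25 c) a ∧ valAt L (s.mem 25 d) a⟩ :
            PGate n), L, List.prefix_rfl, le_rfl, rfl, hf, ?_⟩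
          rotate_right
          · have := k2.closeGate 3 (.const 0) rfl hv
            have hcond : (RamExp.op WordOp.lt (.reg 12)
                (.load 2 (.op .add (.reg 13) (.const 1)))).eval s₀ ≠ 0 := by
              simp [r12, r13, a2, hlen']
            simp only [RamProg.step, if_neg hcond]
            exact this
          · simp [RamProg.time, closeGate, RamExp.cost, pushChild, pushOpt, he', he'']
          · simp [closeGate, pushChild, pushOpt, he', he'', r13, r12, a2, a3, hlen', hce, hde]
            omega
  · obtain ⟨g, L', hL, hlen, hgv, hgf, hs'⟩ := h
    have b13 : s'.reg 13 = p := (ha.1 13 (by decide)).trans r13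
    have b15 : s'.reg 15 = s.reg 15 - 1 := (ha.1 15 (by decide)).trans r15
    have b24 := hs'.1.gc_eq
    have b25 : s'.mem 25 = s.mem 25 := (ha.2 25 (by decide)).trans a25
    refine Runs.of_loopFree rfl (by decide) (by simp) ⟨by simp [b15], L' ++ [g], L'.length,
      hL.trans (List.prefix_append _ _), hs'.congr rfl rfl rfl rfl rfl rfl, hlen,
      ⟨by simp, by rw [PGate.varsAt_snoc, hgv], fun a => by rw [PGate.valAt_snoc, hgf]⟩, ?_⟩
    simp [b13, b25, b24]

/-- Each copy gets a number beyond the previous end of the list, hence a larger number than all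
earlier copies. This provides the injectivity on the children. -/
theorem build_spec {n : ℕ} {C : Circuit n} {pos ord lo hi : ℕ → ℕ} {L : List (PGate n)}
    {s : RamState} {V : ℕ} (hinj : ∀ x y : Fin n, pos x = pos y → x = y) (hsep : C.Separated pos)
    (hhull : ∀ p : Fin C.N, HullOf pos (C.vars p) (lo p) (hi p)) (hord : C.TopoOrder ord)
    (hst : C.StoredIn s) (hV : C.size + 3 ≤ V) (hVn : n ≤ V) (hs : s.Holds C.Deterministic L)
    (e10 : s.mem 10 = ord) {qa qb : ℕ → ℕ}
    (hgaps : ∀ e < C.size, C.EdgeGaps pos (s.mem 2) (s.mem 3) lo hi e (qa (2 * e + 1))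
      (qb (2 * e + 1)) (qa (2 * e + 2)) (qb (2 * e + 2)))
    (hfill : ∀ g, 1 ≤ g → g ≤ 2 * C.size → IsProduct L (s.mem 23 g) (posGap pos (qa g) (qb g))) :
    Runs V build s (500 * (C.size + 1)) fun s' => ∃ L', L <+: L' ∧ s'.Holds C.Deterministic L' ∧
      C.IsCopy pos lo hi L' (s'.mem 25 C.root) C.root := by
  have hl := hst.layout
  have hN := C.N_le
  have hsum := hord.sum_cost hl 150 302
  refine (Runs.step_seq (T := 2) rfl (by decide) (by simp) (Runs.count_sum
    (fun i => 150 * (s.mem 2 (ord i + 1) - s.mem 2 (ord i)) + 300) (fun k s' => s'.reg 15 = k ∧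
      k ≤ C.N ∧ ∃ L', L <+: L' ∧ s'.Holds C.Deterministic L' ∧
        (∀ i, k ≤ i → ∀ p : Fin C.N, i < C.N → ord i = p →
          C.IsCopy pos lo hi L' (s'.mem 25 p) p) ∧
        ∀ i j, k ≤ i → i < C.N → k ≤ j → j < C.N → s'.mem 25 (ord i) = s'.mem 25 (ord j) → i = j)
      C.N ?_ ?_ ?_ ?_)).mono ?_ fun s' _ h => h
  · refine ⟨by simp [hst.1], le_rfl, L, List.prefix_rfl, hs.congr rfl rfl rfl rfl rfl rfl,
      fun i _ p _ _ => by omega, fun i j _ _ _ _ => by omega⟩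
  · simp
  · rintro k s' ha ⟨h15, hk, L', hLL', hs', hcopy, hne⟩
    refine ⟨by simp [h15], ?_⟩
    have hp := hord.lt k (by omega)
    have f2 : s'.mem 2 = s.mem 2 := (ha.2 2 (by decide)).trans (by simp)
    have f3 : s'.mem 3 = s.mem 3 := (ha.2 3 (by decide)).trans (by simp)
    have f23 : s'.mem 23 = s.mem 23 := (ha.2 23 (by decide)).trans (by simp)
    have hchild : ∀ c ∈ (C.gate ⟨ord k, hp⟩).children, ∃ j, k + 1 ≤ j ∧ j < C.N ∧ ord j = c := by
      intro c hc
      obtain ⟨j, hj, hj'⟩ := hord.surj c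
      obtain ⟨i, hi, hi'⟩ := hord.parent j hj ⟨ord k, hp⟩ c hj' hc
      have := hord.inj i (by omega) k (by omega) hi'
      exact ⟨j, by omega, hj, hj'⟩
    have hfill' : ∀ g, 1 ≤ g → g ≤ 2 * C.size →
        IsProduct L' (s'.mem 23 g) (posGap pos (qa g) (qb g)) := fun g h1 h2 => by
      rw [f23]
      exact (hfill g h1 h2).of_prefix hLL'
    refine (buildGate_spec (s := s') (lo := lo) (hi := hi) hl hinj hsep hhull hV hVn hs'
      ((ha.2 0 (by decide)).trans (by simp)) ((ha.2 1 (by decide)).trans (by simp)) f2 f3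
      ⟨ord k, hp⟩ ?_ ?_ ?_ ?_ ?_).mono le_rfl ?_
    · rw [h15, (ha.2 10 (by decide)).trans (by simp [e10] : _ = ord)]
      rfl
    · intro cs hg e h1 h2
      have he := hl.edge_lt (p := ⟨ord k, hp⟩) h2
      exact ⟨_, _, hfill' _ (by omega) (by omega), hfill' _ (by omega) (by omega),
        (hgaps e he).or_gate _ cs hg h1 h2⟩
    · intro cs hg h2
      have he := hl.edge_lt (p := ⟨ord k, hp⟩) h2
      exact ⟨_, hfill' _ (by omega) (by omega), (hgaps _ he).and_gate _ cs hg rfl h2⟩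
    · intro c hc
      obtain ⟨j, h1, h2, h3⟩ := hchild c hc
      exact hcopy j h1 c h2 h3
    · intro c hc d hd hcd
      obtain ⟨j, h1, h2, h3⟩ := hchild c hc
      obtain ⟨j', h1', h2', h3'⟩ := hchild d hd
      rw [← h3, ← h3'] at hcd
      have := hne j j' h1 h2 h1' h2' hcd
      exact Fin.ext (by rw [← h3, ← h3', this])
    · rintro s'' - ⟨h1, L'', g, hLL'', hs'', hg, hgc, h25⟩
      have hupd : ∀ i, i ≠ k → i < C.N → s''.mem 25 (ord i) = s'.mem 25 (ord i) := fun i hi hiN => by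
        rw [h25, Function.update_of_ne]
        exact fun h => hi (hord.inj i hiN k (by omega) h)
      have hk25 : s''.mem 25 (ord k) = g := by rw [h25]; exact Function.update_self _ _ _
      have hlt : ∀ i, k + 1 ≤ i → i < C.N → s''.mem 25 (ord i) < g := fun i h1 h2 => by
        rw [hupd i (by omega) h2]
        exact (hcopy i h1 ⟨ord i, hord.lt i h2⟩ h2 rfl).1.trans_le hg
      refine ⟨by omega, by omega, L'', hLL'.trans hLL'', hs'', fun i hki p hi hip => ?_,
        fun i j hi hiN hj hjN hij => ?_⟩
      · by_cases hik : i = k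
        · subst hik
          have : p = ⟨ord i, hp⟩ := Fin.ext hip.symm
          rw [← hip, hk25, this]
          exact hgc
        · rw [← hip, hupd i hik hi, hip]
          exact (hcopy i (by omega) p hi hip).of_prefix hLL''
      · by_cases hik : i = k <;> by_cases hjk : j = k
        · omega
        · have := hlt j (by omega) hjN
          rw [← hij, hik, hk25] at this
          omega
        · have := hlt i (by omega) hiN
          rw [hij, hjk, hk25] at this
          omega
        · rw [hupd i hik hiN, hupd j hjk hjN] at hij
          exact hne i j (by omega) hiN (by omega) hjN hij
  · rintro s' ha ⟨h15, -, L', hLL', hs', hcopy, -⟩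
    refine ⟨by simpa using h15, L', hLL', hs', ?_⟩
    obtain ⟨i, hi, hi'⟩ := hord.surj C.root
    exact hcopy i (Nat.zero_le _) _ hi hi'
  · simp only [RamExp.cost]
    rw [show ∑ i ∈ Finset.range C.N, (150 * (s.mem 2 (ord i + 1) - s.mem 2 (ord i)) + 300 + 1 + 1) =
      _ from hsum]
    omega

/-! ### The circuit described by a list of gates -/

theorem PGate.Valid.exists_gate {n : ℕ} {D : Prop} {L : List (PGate n)} {i N : ℕ} {g : PGate n}
    (h : g.Valid D L i) (hN : i ≤ N) : ∃ G : Gate n N, G.code = g.ty ∧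
      (∀ x b, G = .lit x b → g.x = x) ∧ G.children.map Fin.val = g.kids := by
  have hlt : ∀ c ∈ g.kids, c < N := fun c hc => (h.lt c hc).trans_le hN
  have hmap : (g.kids.pmap (fun c hc => (⟨c, hc⟩ : Fin N)) hlt).map Fin.val = g.kids := by
    rw [List.map_pmap]
    simp
  rcases h.spec with ⟨h1, h2, y, h3, -⟩ | ⟨h1, -⟩ | ⟨h1, -⟩
  · refine ⟨.lit y (g.ty == 1), ?_, fun x b hx => ?_, by simp [Gate.children, h2]⟩
    · rcases Nat.le_one_iff_eq_zero_or_eq_one.1 h1 with h | h <;> simp [h, Gate.code]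
    · cases hx
      exact h3
  · exact ⟨.or (g.kids.pmap (fun c hc => ⟨c, hc⟩) hlt), by simp [Gate.code, h1],
      (fun x b hx => by cases hx), hmap⟩
  · exact ⟨.and (g.kids.pmap (fun c hc => ⟨c, hc⟩) hlt), by simp [Gate.code, h1],
      (fun x b hx => by cases hx), hmap⟩

/-- The circuit `C` has the gates in the list `L`. -/
structure Circuit.OfList {n : ℕ} (C : Circuit n) (L : List (PGate n)) : Prop where
  N_eq : C.N = L.length
  gate_eq : ∀ (i : Fin C.N) g, L[(i : ℕ)]? = some g → (C.gate i).code = g.ty ∧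
    (∀ x b, C.gate i = .lit x b → g.x = x) ∧ (C.gate i).children.map Fin.val = g.kids
  root_eq : (C.root : ℕ) + 1 = L.length

/-- Children have smaller numbers, which excludes cycles. Each gate but the last has a parent, which
has a larger number, so climbing ends at the last gate, the root. -/
theorem exists_ofList {n : ℕ} {D : Prop} {L : List (PGate n)} (hv : AllValid D L) (hne : L ≠ [])
    (hroot : ∀ i, i + 1 < L.length → ∃ (p : ℕ) (g : PGate n), L[p]? = some g ∧ i ∈ g.kids) :
    ∃ C : Circuit n, C.OfList L := by
  have hpos := List.length_pos_iff.2 hne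
  have hL : ∀ i : Fin L.length, L[(i : ℕ)]? = some L[i] := fun i => by simp
  choose gate h1 h2 h3 using fun i : Fin L.length => (hv i _ (hL i)).exists_gate i.2.le
  have hmem : ∀ p c, c ∈ (gate p).children ↔ (c : ℕ) ∈ (L[p]).kids := fun p c => by
    rw [← h3, List.mem_map]
    exact ⟨fun h => ⟨c, h, rfl⟩, fun ⟨d, hd, h⟩ => Fin.ext h ▸ hd⟩
  refine ⟨⟨L.length, gate, ⟨L.length - 1, by omega⟩, fun i => ?_, ?_, ?_⟩, rfl, fun i g hg => ?_, ?_⟩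
  · refine List.Nodup.of_map Fin.val ?_
    rw [h3]
    exact (hv i _ (hL i)).nodup
  · refine Subrelation.wf (r := fun c p : Fin L.length => c < p) (fun {c p} h => ?_) wellFounded_lt
    exact (hv p _ (hL p)).lt c ((hmem p c).1 h)
  · suffices H : ∀ k, ∀ i : Fin L.length, (i : ℕ) + k + 1 = L.length → Relation.ReflTransGen
        (fun p c : Fin L.length => c ∈ (gate p).children) ⟨L.length - 1, by omega⟩ i from
      fun i => H (L.length - 1 - i) i (by omega)
    intro k
    induction k using Nat.strong_induction_on with
    | _ k ih =>
      intro i hi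
      by_cases hik : (i : ℕ) + 1 < L.length
      · obtain ⟨p, g, hg, hip⟩ := hroot i hik
        obtain ⟨hp, rfl⟩ := List.getElem?_eq_some_iff.1 hg
        have hlt := (hv p _ hg).lt i hip
        exact (ih (L.length - 1 - p) (by omega) ⟨p, hp⟩ (by simp; omega)).tail
          ((hmem ⟨p, hp⟩ i).2 hip)
      · have : i = ⟨L.length - 1, by omega⟩ := Fin.ext (by simp; omega)
        rw [this]
  · have : g = L[i] := by
      have := hL i
      rw [hg] at this
      exact Option.some.inj this
    subst this
    exact ⟨h1 i, h2 i, h3 i⟩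
  · simp
    omega

namespace Circuit.OfList

variable {n : ℕ} {C : Circuit n} {D : Prop} {L : List (PGate n)}

theorem get (h : C.OfList L) (i : Fin C.N) : ∃ g, L[(i : ℕ)]? = some g :=
  ⟨_, List.getElem?_eq_getElem (h.N_eq ▸ i.2)⟩

theorem mem_iff (h : C.OfList L) {i : Fin C.N} {g : PGate n} (hg : L[(i : ℕ)]? = some g) {c : ℕ} :
    c ∈ g.kids ↔ ∃ d ∈ (C.gate i).children, (d : ℕ) = c := by
  rw [← (h.gate_eq i g hg).2.2, List.mem_map]

/-- Induction from the leaves upwards shows that the recorded sets of variables are the true ones.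
An ⊕-gate without children needs the clause that its recorded set is empty. -/
theorem vars_eq (h : C.OfList L) (hv : AllValid D L) (i : Fin C.N) : C.vars i = varsAt L i := by
  induction i using C.acyclic.induction with
  | _ i ih =>
    obtain ⟨g, hg⟩ := h.get i
    have hV := hv i g hg
    obtain ⟨h1, h2, h3⟩ := h.gate_eq i g hg
    have hva : varsAt L i = g.vars := by simp [varsAt, hg]
    rw [hva]
    rcases hV.spec with ⟨s1, s2, y, s3, s4, -⟩ | ⟨s1, s2, s3, -⟩ | ⟨s1, s2, -⟩
    · rcases hG : C.gate i with ⟨x, b⟩ | cs | cs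
      · rw [vars_lit hG, s4]
        have := h2 x b hG
        rw [show x = y from Fin.ext (this.symm.trans s3)]
      · rw [hG] at h1
        simp [Gate.code] at h1
        omega
      · rw [hG] at h1
        simp [Gate.code] at h1
        omega
    · rw [vars_eq_iUnion fun x b hG => by rw [hG] at h1; cases b <;> simp [Gate.code] at h1 <;> omega]
      ext x
      simp only [Set.mem_ofPred_eq]
      constructor
      · rintro ⟨c, hc, hx⟩
        rw [ih c hc, s2 c ((h.mem_iff hg).2 ⟨c, hc, rfl⟩)] at hx
        exact hx
      · intro hx
        rcases hk : g.kids with _ | ⟨c, cs⟩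
        · rw [s3 hk] at hx
          exact absurd hx (Set.notMem_empty x)
        · have hc : c ∈ g.kids := by simp [hk]
          obtain ⟨d, hd, rfl⟩ := (h.mem_iff hg).1 hc
          exact ⟨d, hd, by rw [ih d hd, s2 _ hc]; exact hx⟩
    · rw [vars_eq_iUnion fun x b hG => by rw [hG] at h1; cases b <;> simp [Gate.code] at h1 <;> omega]
      ext x
      rw [s2]
      simp only [Set.mem_ofPred_eq]
      constructor
      · rintro ⟨c, hc, hx⟩
        exact ⟨c, (h.mem_iff hg).2 ⟨c, hc, rfl⟩, by rwa [← ih c hc]⟩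
      · rintro ⟨c, hc, hx⟩
        obtain ⟨d, hd, rfl⟩ := (h.mem_iff hg).1 hc
        exact ⟨d, hd, by rwa [ih d hd]⟩

theorem sat_iff (h : C.OfList L) (hv : AllValid D L) (a : Fin n → Bool) (i : Fin C.N) :
    C.Sat a i ↔ valAt L i a := by
  induction i using C.acyclic.induction with
  | _ i ih =>
    obtain ⟨g, hg⟩ := h.get i
    have hV := hv i g hg
    obtain ⟨h1, h2, h3⟩ := h.gate_eq i g hg
    have hva : valAt L i = g.val := by simp [valAt, hg]
    rw [hva]
    rcases hG : C.gate i with ⟨x, b⟩ | cs | cs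
    · have hx := h2 x b hG
      rw [hG] at h1
      rcases hV.spec with ⟨s1, s2, y, s3, s4, s5⟩ | ⟨s1, -⟩ | ⟨s1, -⟩
      · rw [s5, sat_lit_iff hG, ← h1, show x = y from Fin.ext (hx.symm.trans s3)]
        cases b <;> simp [Gate.code]
      · cases b <;> simp [Gate.code] at h1 <;> omega
      · cases b <;> simp [Gate.code] at h1 <;> omega
    · rw [hG] at h1
      simp only [Gate.code] at h1
      have hc : (C.gate i).children = cs := by rw [hG, Gate.children]
      rcases hV.spec with ⟨s1, -⟩ | ⟨s1, -, -, s4, -⟩ | ⟨s1, -⟩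
      · omega
      · rw [sat_or_iff hG, s4]
        constructor
        · rintro ⟨c, hc', hx⟩
          exact ⟨c, (h.mem_iff hg).2 ⟨c, hc ▸ hc', rfl⟩, (ih c (hc ▸ hc')).1 hx⟩
        · rintro ⟨c, hc', hx⟩
          obtain ⟨d, hd, rfl⟩ := (h.mem_iff hg).1 hc'
          exact ⟨d, hc ▸ hd, (ih d hd).2 hx⟩
      · omega
    · rw [hG] at h1
      simp only [Gate.code] at h1
      have hc : (C.gate i).children = cs := by rw [hG, Gate.children]
      rcases hV.spec with ⟨s1, -⟩ | ⟨s1, -⟩ | ⟨s1, -, -, s4⟩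
      · omega
      · omega
      · rw [sat_and_iff hG, s4]
        constructor
        · intro hx c hc'
          obtain ⟨d, hd, rfl⟩ := (h.mem_iff hg).1 hc'
          exact (ih d hd).1 (hx d (hc ▸ hd))
        · intro hx c hc'
          exact (ih c (hc ▸ hc')).2 (hx c ((h.mem_iff hg).2 ⟨c, hc ▸ hc', rfl⟩))

theorem smooth (h : C.OfList L) (hv : AllValid D L) : C.Smooth := by
  intro p cs hG c hc d hd
  obtain ⟨g, hg⟩ := h.get p
  obtain ⟨h1, -⟩ := h.gate_eq p g hg
  have hch : (C.gate p).children = cs := by rw [hG, Gate.children]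
  rw [hG] at h1
  simp only [Gate.code] at h1
  rcases (hv p g hg).spec with ⟨s1, -⟩ | ⟨s1, s2, -⟩ | ⟨s1, -⟩
  · omega
  · rw [h.vars_eq hv, h.vars_eq hv, s2 c ((h.mem_iff hg).2 ⟨c, hch ▸ hc, rfl⟩),
      s2 d ((h.mem_iff hg).2 ⟨d, hch ▸ hd, rfl⟩)]
  · omega

theorem decomposable (h : C.OfList L) (hv : AllValid D L) : C.Decomposable := by
  intro p cs hG c hc d hd hcd
  obtain ⟨g, hg⟩ := h.get p
  obtain ⟨h1, -⟩ := h.gate_eq p g hg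
  have hch : (C.gate p).children = cs := by rw [hG, Gate.children]
  rw [hG] at h1
  simp only [Gate.code] at h1
  rcases (hv p g hg).spec with ⟨s1, -⟩ | ⟨s1, -⟩ | ⟨s1, -, s3, -⟩
  · omega
  · omega
  · rw [h.vars_eq hv, h.vars_eq hv]
    exact s3 c ((h.mem_iff hg).2 ⟨c, hch ▸ hc, rfl⟩) d ((h.mem_iff hg).2 ⟨d, hch ▸ hd, rfl⟩)
      fun h => hcd (Fin.ext h)

theorem deterministic (h : C.OfList L) (hv : AllValid D L) (hD : D) : C.Deterministic := by
  intro a p cs hG c hc d hd h1' h2'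
  obtain ⟨g, hg⟩ := h.get p
  obtain ⟨h1, -⟩ := h.gate_eq p g hg
  have hch : (C.gate p).children = cs := by rw [hG, Gate.children]
  rw [hG] at h1
  simp only [Gate.code] at h1
  rcases (hv p g hg).spec with ⟨s1, -⟩ | ⟨s1, -, -, -, s5⟩ | ⟨s1, -⟩
  · omega
  · exact Fin.ext (s5 hD a c ((h.mem_iff hg).2 ⟨c, hch ▸ hc, rfl⟩) d
      ((h.mem_iff hg).2 ⟨d, hch ▸ hd, rfl⟩) ((h.sat_iff hv a c).1 h1') ((h.sat_iff hv a d).1 h2'))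
  · omega

theorem storedIn (h : C.OfList L) {s : RamState} {ec : ℕ}
    (hB : Built L [] (s.mem 0) (s.mem 1) (s.mem 2) (s.mem 3) (s.reg 0) ec)
    (h1 : s.reg 1 + 1 = s.reg 0) : C.StoredIn s := by
  have hgc := hB.gc_eq
  have hN := h.N_eq
  have hr := h.root_eq
  refine ⟨by omega, by omega, fun i => ?_, fun i x b hG => ?_, ?_, fun i => ?_, fun i k hk => ?_⟩
  · obtain ⟨g, hg⟩ := h.get i
    rw [(hB.ty_eq hg).1, (h.gate_eq i g hg).1]
  · obtain ⟨g, hg⟩ := h.get i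
    rw [(hB.ty_eq hg).2, (h.gate_eq i g hg).2.1 x b hG]
  · simpa using hB.off_at 0 (Nat.zero_le _)
  · obtain ⟨g, hg⟩ := h.get i
    rw [hB.off_succ hg, ← (h.gate_eq i g hg).2.2, List.length_map]
  · obtain ⟨g, hg⟩ := h.get i
    have h3 := (h.gate_eq i g hg).2.2
    rw [hB.ch_eq hg (k := k) (by rw [← h3]; simpa using hk)]
    simp only [← h3, List.getElem_map]

end Circuit.OfList

/-! ### Removal of the gates that are not reachable -/

/-- The gates that have been marked when the children of all marked gates from `k` have been
marked. -/
structure Marked {n : ℕ} (L : List (PGate n)) (g k : ℕ) (mark : ℕ → ℕ) : Prop where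
  root : mark g ≠ 0
  le : ∀ j, mark j ≠ 0 → j ≤ g
  kids : ∀ (i : ℕ) (gi : PGate n), k ≤ i → mark i ≠ 0 → L[i]? = some gi → ∀ c ∈ gi.kids, mark c ≠ 0
  parent : ∀ j, mark j ≠ 0 → j ≠ g → ∃ (i : ℕ) (gi : PGate n), L[i]? = some gi ∧ mark i ≠ 0 ∧ j ∈ gi.kids

/-- The gates of `L2` are the marked gates of `L` with numbers less than `i`. -/
structure Renumbered {n : ℕ} (D : Prop) (L L2 : List (PGate n)) (mark id : ℕ → ℕ) (i : ℕ) : Prop where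
  valid : AllValid D L2
  get : ∀ (j : ℕ) (gj : PGate n), j < i → mark j ≠ 0 → L[j]? = some gj →
    L2[id j]? = some { gj with kids := gj.kids.map id }
  mono : ∀ j j', j < j' → j' < i → mark j ≠ 0 → mark j' ≠ 0 → id j < id j'
  surj : ∀ k < L2.length, ∃ j < i, mark j ≠ 0 ∧ id j = k

namespace Renumbered

variable {n : ℕ} {D : Prop} {L L2 : List (PGate n)} {mark id : ℕ → ℕ} {i : ℕ}

theorem eqs (h : Renumbered D L L2 mark id i) (hi : i ≤ L.length) {c : ℕ} (hc : c < i)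
    (hm : mark c ≠ 0) : id c < L2.length ∧ varsAt L2 (id c) = varsAt L c ∧ valAt L2 (id c) = valAt L c := by
  have h1 : L[c]? = some L[c] := List.getElem?_eq_getElem (hc.trans_le hi)
  have h2 := h.get c _ hc hm h1
  refine ⟨(List.getElem?_eq_some_iff.1 h2).1, ?_, ?_⟩
  · simp [varsAt, h1, h2]
  · simp [valAt, h1, h2]

theorem inj (h : Renumbered D L L2 mark id i) {c d : ℕ} (hc : c < i) (hd : d < i)
    (hm : mark c ≠ 0) (hm' : mark d ≠ 0) (hcd : id c = id d) : c = d := by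
  rcases lt_trichotomy c d with h' | h' | h'
  · exact absurd hcd (h.mono c d h' hd hm hm').ne
  · exact h'
  · exact absurd hcd (h.mono d c h' hc hm' hm).ne'

theorem skip (h : Renumbered D L L2 mark id i) (hm : mark i = 0) :
    Renumbered D L L2 mark id (i + 1) := by
  refine ⟨h.valid, fun j gj hj hmj => h.get j gj ?_ hmj, fun j j' hj hj' hm1 hm2 =>
    h.mono j j' hj ?_ hm1 hm2, fun k hk => ?_⟩
  · rcases Nat.lt_succ_iff_lt_or_eq.1 hj with h | rfl
    exacts [h, absurd hm hmj]
  · rcases Nat.lt_succ_iff_lt_or_eq.1 hj' with h | rfl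
    exacts [h, absurd hm hm2]
  · obtain ⟨j, hj, h'⟩ := h.surj k hk
    exact ⟨j, by omega, h'⟩

/-- All children are marked and treated earlier, and the renumbering preserves their recorded
variables and functions. It is injective on them, so lists without repetition and the conditions on
distinct children carry over. -/
theorem valid_snoc (h : Renumbered D L L2 mark id i) (hv : AllValid D L) {g : PGate n}
    (hg : L[i]? = some g) (hkids : ∀ c ∈ g.kids, mark c ≠ 0) :
    PGate.Valid D L2 L2.length { g with kids := g.kids.map id } := by
  have hV := hv i g hg
  have hi : i ≤ L.length := (List.getElem?_eq_some_iff.1 hg).1.le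
  have hE : ∀ c ∈ g.kids, id c < L2.length ∧ varsAt L2 (id c) = varsAt L c ∧
      valAt L2 (id c) = valAt L c := fun c hc => h.eqs hi (hV.lt c hc) (hkids c hc)
  refine ⟨?_, ?_, ?_⟩
  · refine hV.nodup.map_on fun c hc d hd hcd => ?_
    exact h.inj (hV.lt c hc) (hV.lt d hd) (hkids c hc) (hkids d hd) hcd
  · intro c hc
    obtain ⟨d, hd, rfl⟩ := List.mem_map.1 hc
    exact (hE d hd).1
  · rcases hV.spec with ⟨s1, s2, s3⟩ | ⟨s1, s2, s3, s4, s5⟩ | ⟨s1, s2, s3, s4⟩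
    · exact .inl ⟨s1, by simp [s2], s3⟩
    · refine .inr (.inl ⟨s1, ?_, ?_, fun a => ?_, fun hD a => ?_⟩)
      · simp only [List.forall_mem_map]
        exact fun c hc => (hE c hc).2.1.trans (s2 c hc)
      · intro hk
        exact s3 (List.map_eq_nil_iff.1 hk)
      · simp only [List.mem_map, exists_exists_and_eq_and]
        exact (s4 a).trans (exists_congr fun c => and_congr_right fun hc => by rw [(hE c hc).2.2])
      · simp only [List.forall_mem_map]
        intro c hc d hd h1 h2
        rw [(hE c hc).2.2] at h1
        rw [(hE d hd).2.2] at h2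
        rw [s5 hD a c hc d hd h1 h2]
    · refine .inr (.inr ⟨s1, fun y => ?_, ?_, fun a => ?_⟩)
      · simp only [List.mem_map, exists_exists_and_eq_and]
        exact (s2 y).trans (exists_congr fun c => and_congr_right fun hc => by rw [(hE c hc).2.1])
      · simp only [List.forall_mem_map]
        intro c hc d hd hcd
        rw [(hE c hc).2.1, (hE d hd).2.1]
        exact s3 c hc d hd fun h => hcd (by rw [h])
      · simp only [List.forall_mem_map]
        rw [s4]
        exact forall₂_congr fun c hc => by rw [(hE c hc).2.2]

theorem snoc (h : Renumbered D L L2 mark id i) (hv : AllValid D L) {g : PGate n}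
    (hg : L[i]? = some g) (hkids : ∀ c ∈ g.kids, mark c ≠ 0) (hm : mark i ≠ 0) :
    Renumbered D L (L2 ++ [{ g with kids := g.kids.map id }]) mark
      (Function.update id i L2.length) (i + 1) := by
  have hi : i ≤ L.length := (List.getElem?_eq_some_iff.1 hg).1.le
  have hmap : ∀ (j : ℕ) (gj : PGate n), j ≤ i → L[j]? = some gj →
      gj.kids.map (Function.update id i L2.length) = gj.kids.map id := fun j gj hj hgj =>
    List.map_congr_left fun c hc => Function.update_of_ne
      (by have := (hv j gj hgj).lt c hc; omega) _ _
  refine ⟨h.valid.snoc (h.valid_snoc hv hg hkids), fun j gj hj hmj hgj => ?_,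
    fun j j' hj hj' hm1 hm2 => ?_, fun k hk => ?_⟩
  · rw [hmap j gj (by omega) hgj]
    rcases Nat.lt_succ_iff_lt_or_eq.1 hj with h' | rfl
    · rw [Function.update_of_ne h'.ne, List.getElem?_append_left (h.eqs hi h' hmj).1]
      exact h.get j gj h' hmj hgj
    · rw [hg] at hgj
      cases hgj
      simp
  · rw [Function.update_of_ne (by omega)]
    rcases Nat.lt_succ_iff_lt_or_eq.1 hj' with h' | rfl
    · rw [Function.update_of_ne h'.ne]
      exact h.mono j j' hj h' hm1 hm2
    · rw [Function.update_self]
      exact (h.eqs hi hj hm1).1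
  · rcases Nat.lt_or_ge k L2.length with hk' | hk'
    · obtain ⟨j, hj, h1, h2⟩ := h.surj k hk'
      exact ⟨j, by omega, h1, by rw [Function.update_of_ne hj.ne]; exact h2⟩
    · refine ⟨i, by omega, hm, ?_⟩
      simp at hk
      rw [Function.update_self]
      omega

/-- The numbering is increasing and onto, so the largest marked gate, which is the root, becomes the
last one. -/
theorem id_root (h : Renumbered D L L2 mark id (i + 1)) (hM : Marked L i 0 mark) (hi : i < L.length) :
    id i + 1 = L2.length := by
  have h1 := h.eqs hi (Nat.lt_succ_self i) hM.root
  obtain ⟨j, hj, hm, hk⟩ := h.surj (L2.length - 1) (by omega)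
  rcases Nat.lt_succ_iff_lt_or_eq.1 hj with h' | rfl
  · have := h.mono j i h' (by omega) hm hM.root
    omega
  · omega

theorem exists_parent (h : Renumbered D L L2 mark id (i + 1)) (hM : Marked L i 0 mark)
    (hi : i < L.length) (k : ℕ) (hk : k + 1 < L2.length) :
    ∃ (p : ℕ) (g : PGate n), L2[p]? = some g ∧ k ∈ g.kids := by
  have hroot := h.id_root hM hi
  obtain ⟨j, hj, hm, rfl⟩ := h.surj k (by omega)
  obtain ⟨p, g, hg, hmp, hjk⟩ := hM.parent j hm (by rintro rfl; omega)
  have hp := hM.le p hmp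
  exact ⟨id p, _, h.get p g (by omega) hmp hg, List.mem_map_of_mem hjk⟩

end Renumbered

/-- Children have smaller numbers, so one downward sweep from the root finds everything reachable,
without a stack. -/
def markGate : RamProg :=
  .assign 60 (.op .sub (.reg 60) (.const 1)) ;;
  .ite (.load 26 (.reg 60))
    (.assign 61 (.load 32 (.reg 60)) ;;
      .while (.op .lt (.reg 61) (.load 32 (.op .add (.reg 60) (.const 1))))
        (.store 26 (.load 33 (.reg 61)) (.const 1) ;; .assign 61 (.op .add (.reg 61) (.const 1))))
    .skip

/-- The gates that are reachable from the new root are marked in bank 26. -/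
def markGates : RamProg :=
  (.assign 63 (.load 25 (.reg 1)) ;; .store 26 (.reg 63) (.const 1) ;;
    .assign 60 (.op .add (.reg 63) (.const 1))) ;;
  .while (.reg 60) markGate

/-- The output overwrites the input in banks 0 to 3, from which nothing is read any more. Cell 0 of
bank 2 still holds the zero with which the starting positions begin. -/
def renumberGate : RamProg :=
  .ite (.load 26 (.reg 60))
    (.assign 61 (.load 32 (.reg 60)) ;;
      .while (.op .lt (.reg 61) (.load 32 (.op .add (.reg 60) (.const 1))))
        (.store 3 (.reg 62) (.load 27 (.load 33 (.reg 61))) ;;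
          .assign 62 (.op .add (.reg 62) (.const 1)) ;; .assign 61 (.op .add (.reg 61) (.const 1))) ;;
      (.store 0 (.reg 0) (.load 30 (.reg 60)) ;; .store 1 (.reg 0) (.load 31 (.reg 60)) ;;
        .store 27 (.reg 60) (.reg 0) ;; .assign 0 (.op .add (.reg 0) (.const 1)) ;;
        .store 2 (.reg 0) (.reg 62)))
    .skip ;;
  .assign 60 (.op .add (.reg 60) (.const 1))

/-- The marked gates are written to banks 0 to 3. -/
def renumber : RamProg :=
  (.assign 0 (.const 0) ;; .assign 62 (.const 0) ;; .assign 60 (.const 0)) ;;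
  .while (.op .lt (.reg 60) (.op .add (.reg 63) (.const 1))) renumberGate ;;
  .assign 1 (.op .sub (.reg 0) (.const 1))

namespace Built

variable {n : ℕ} {L : List (PGate n)} {cur : List ℕ} {ty var off ch : ℕ → ℕ} {gc ec : ℕ}

theorem off_le (h : Built L cur ty var off ch gc ec) {i : ℕ} (hi : i ≤ L.length) : off i ≤ ec := by
  rw [h.off_at i hi, h.ec_eq, List.length_append]
  refine le_trans (List.Sublist.length_le ?_) (Nat.le_add_right _ _)
  conv_rhs => rw [← List.take_append_drop i L, List.flatMap_append]
  exact List.sublist_append_left _ _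

theorem sum_cost (h : Built L cur ty var off ch gc ec) (a b : ℕ) {k : ℕ} (hk : k ≤ L.length) :
    ∑ i ∈ Finset.range k, (a * (off (i + 1) - off i) + b) = a * off k + b * k := by
  induction k with
  | zero => simp [h.off_at 0 (Nat.zero_le _)]
  | succ k ih =>
    have h1 : L[k]? = some L[k] := List.getElem?_eq_getElem hk
    rw [Finset.sum_range_succ, ih (by omega), h.off_succ h1]
    rw [Nat.add_sub_cancel_left]
    ring

end Built

theorem markGate_spec {n g k : ℕ} {D : Prop} {L : List (PGate n)} {s : RamState} {V : ℕ}
    (hs : s.Holds D L) (hk : k < L.length) (h60 : s.reg 60 = k + 1)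
    (hM : Marked L g (k + 1) (s.mem 26)) :
    Runs V markGate s (30 * (s.mem 32 (k + 1) - s.mem 32 k) + 60) fun s' =>
      s'.reg 60 = k ∧ Marked L g k (s'.mem 26) := by
  have hgk : L[k]? = some L[k] := List.getElem?_eq_getElem hk
  generalize hgk' : L[k] = gk at hgk
  have hoff := hs.1.off_succ hgk
  have hV := hs.2 k gk hgk
  refine (Runs.step_seq (T := 5) (T' := 3 + (5 + (gk.kids.length + 1) * (15 + 6 + 1))) rfl (by decide)
    (by simp) (Runs.ite (by simp) (fun hc => ?_) fun hc => ?_)).mono (by omega) fun s' _ h => h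
  · have hm : s.mem 26 k ≠ 0 := by simpa [h60] using hc
    refine Runs.step_seq (T := 5) rfl (by decide) (by simp) (Runs.count
      (e := .op .lt (.reg 61) (.load 32 (.op .add (.reg 60) (.const 1)))) 15 (fun r s' =>
        ∃ t, t + r = gk.kids.length ∧ s'.reg 61 = s.mem 32 k + t ∧
          ∀ j, s'.mem 26 j ≠ 0 ↔ s.mem 26 j ≠ 0 ∨ j ∈ gk.kids.take t) gk.kids.length ?_ ?_ ?_ ?_)
    · exact ⟨0, by omega, by simp [h60], by simp⟩
    · simp
    · rintro r s' ha ⟨t, ht, h61, h26⟩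
      have f60 : s'.reg 60 = k := (ha.1 60 (by decide)).trans (by simp [h60])
      have f32 : s'.mem 32 = s.mem 32 := (ha.2 32 (by decide)).trans (by simp)
      have f33 : s'.mem 33 = s.mem 33 := (ha.2 33 (by decide)).trans (by simp)
      refine ⟨by simp [f60, f32, h61, hoff]; omega, Runs.of_loopFree rfl (by decide) (by simp)
        ⟨t + 1, by omega, by simp [h61]; omega, fun j => ?_⟩⟩
      have hch := hs.1.ch_eq hgk (k := t) (by omega)
      have hmem : j ∈ gk.kids.take (t + 1) ↔ j ∈ gk.kids.take t ∨ j = gk.kids[t] := by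
        rw [← List.take_append_getElem (by omega : t < gk.kids.length), List.mem_append,
          List.mem_singleton]
      rw [hmem, ← or_assoc, ← h26 j]
      by_cases hj : j = gk.kids[t]
      · simp [f33, h61, hch, hj]
      · simp [f33, h61, hch, hj]
    · rintro s' ha ⟨t, ht, h61, h26⟩
      have f60 : s'.reg 60 = k := (ha.1 60 (by decide)).trans (by simp [h60])
      have f32 : s'.mem 32 = s.mem 32 := (ha.2 32 (by decide)).trans (by simp)
      obtain rfl : t = gk.kids.length := by omega
      rw [List.take_length] at h26
      refine ⟨by simp [f60, f32, h61, hoff], f60, (h26 g).2 (.inl hM.root), fun j hj => ?_,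
        fun i gi hi hmi hgi c hc => ?_, fun j hj hjg => ?_⟩
      · rcases (h26 j).1 hj with h | h
        · exact hM.le j h
        · have := hM.le k hm
          have := hV.lt j h
          omega
      · by_cases hik : i = k
        · subst hik
          rw [hgk] at hgi
          cases hgi
          exact (h26 c).2 (.inr hc)
        · have hnk : i ∉ gk.kids := fun h => by
            have := hV.lt i h
            omega
          exact (h26 c).2 (.inl (hM.kids i gi (by omega) (((h26 i).1 hmi).resolve_right hnk) hgi c hc))
      · rcases (h26 j).1 hj with h | h
        · obtain ⟨i, gi, h1, h2, h3⟩ := hM.parent j h hjg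
          exact ⟨i, gi, h1, (h26 i).2 (.inl h2), h3⟩
        · exact ⟨k, gk, hgk, (h26 k).2 (.inl hm), h⟩
  · have hm : s.mem 26 k = 0 := by simpa [h60] using hc
    refine Runs.of_loopFree rfl (by simp [RamProg.time]; omega) (by simp) ⟨by simp [h60], hM.root, hM.le,
      fun i gi hi hmi hgi => ?_, hM.parent⟩
    have hik : i ≠ k := by
      rintro rfl
      exact hmi hm
    exact hM.kids i gi (by omega) hmi hgi

theorem markGates_spec {n g : ℕ} {D : Prop} {L : List (PGate n)} {s : RamState} {V : ℕ}
    (hs : s.Holds D L) (hg : s.mem 25 (s.reg 1) = g) (hgL : g < L.length) (h26 : ∀ i, s.mem 26 i = 0) :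
    Runs V markGates s (30 * s.reg 25 + 62 * s.reg 24 + 50) fun s' =>
      s'.reg 63 = g ∧ Marked L g 0 (s'.mem 26) := by
  have hsum := hs.1.sum_cost 30 62 (k := g + 1) hgL
  have hle := hs.1.off_le (i := g + 1) hgL
  have hgc := hs.1.gc_eq
  refine (Runs.step_seq (T := 20) rfl (by decide) (by simp) (Runs.count_sum (e := .reg 60)
    (fun k => 30 * (s.mem 32 (k + 1) - s.mem 32 k) + 60) (fun k s' => s'.reg 60 = k ∧ k ≤ g + 1 ∧
      s'.reg 63 = g ∧ Marked L g k (s'.mem 26)) (g + 1) ?_ ?_ ?_ ?_)).mono ?_ fun s' _ h => h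
  · refine ⟨by simp [hg], le_rfl, by simp [hg], by simp [hg], fun j hj => ?_, fun i gi hi hmi => ?_,
      fun j hj hjg => ?_⟩
    · by_contra h
      simp [hg, show j ≠ g by omega, h26] at hj
    · simp [hg, show i ≠ g by omega, h26] at hmi
    · simp [hg, hjg, h26] at hj
  · simp
  · rintro k s' ha ⟨h60, hk, h63, hM⟩
    have hs' : s'.Holds D L := (ha.holds (hs.congr rfl rfl rfl rfl rfl rfl) (by decide) (by decide))
    have f32 : s'.mem 32 = s.mem 32 := (ha.2 32 (by decide)).trans (by simp)
    refine ⟨by simp [h60], (markGate_spec hs' (by omega) h60 hM).mono (by rw [f32]) ?_⟩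
    rintro s'' ha'' ⟨h1, h2⟩
    exact ⟨h1, by omega, (ha''.1 63 (by decide)).trans h63, h2⟩
  · rintro s' ha ⟨h60, -, h63, hM⟩
    exact ⟨by simp [h60], h63, hM⟩
  · simp only [RamExp.cost]
    rw [show ∑ i ∈ Finset.range (g + 1), (30 * (s.mem 32 (i + 1) - s.mem 32 i) + 60 + 1 + 1) = _
      from hsum]
    omega

theorem renumberGate_spec {n i : ℕ} {D : Prop} {L L2 : List (PGate n)} {s : RamState} {V : ℕ}
    {mark : ℕ → ℕ} (hs : s.Holds D L) (hi : i < L.length) (h60 : s.reg 60 = i) (h26 : s.mem 26 = mark)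
    (hkids : ∀ (gi : PGate n), mark i ≠ 0 → L[i]? = some gi → ∀ c ∈ gi.kids, mark c ≠ 0)
    (hB : Built L2 [] (s.mem 0) (s.mem 1) (s.mem 2) (s.mem 3) (s.reg 0) (s.reg 62))
    (hR : Renumbered D L L2 mark (s.mem 27) i) :
    Runs V renumberGate s (40 * (s.mem 32 (i + 1) - s.mem 32 i) + 80) fun s' =>
      s'.reg 60 = i + 1 ∧ ∃ L3,
        Built L3 [] (s'.mem 0) (s'.mem 1) (s'.mem 2) (s'.mem 3) (s'.reg 0) (s'.reg 62) ∧
        Renumbered D L L3 mark (s'.mem 27) (i + 1) := by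
  have hgi : L[i]? = some L[i] := List.getElem?_eq_getElem hi
  generalize hgi' : L[i] = gi at hgi
  have hoff := hs.1.off_succ hgi
  refine (Runs.seq (T := 3 + (5 + ((gi.kids.length + 1) * (20 + 6 + 1) + 25))) (T' := 5)
    (Q := fun s' => ∃ L3,
        Built L3 [] (s'.mem 0) (s'.mem 1) (s'.mem 2) (s'.mem 3) (s'.reg 0) (s'.reg 62) ∧
        Renumbered D L L3 mark (s'.mem 27) (i + 1))
    (Runs.ite (by simp) (fun hc => ?_) fun hc => ?_) ?_).mono (by omega) fun s' _ h => h
  · have hm : mark i ≠ 0 := by simpa [h60, h26] using hc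
    have hreg0 := hB.gc_eq
    refine Runs.step_seq (T := 5) rfl (by decide) (by simp) (Runs.seq (Runs.count
      (e := .op .lt (.reg 61) (.load 32 (.op .add (.reg 60) (.const 1)))) 20 (fun r s' =>
        ∃ t, t + r = gi.kids.length ∧ s'.reg 61 = s.mem 32 i + t ∧
          Built L2 ((gi.kids.take t).map (s.mem 27)) (s'.mem 0) (s'.mem 1) (s'.mem 2) (s'.mem 3)
            (s'.reg 0) (s'.reg 62)) gi.kids.length
        (Q := fun s' => Built L2 (gi.kids.map (s.mem 27)) (s'.mem 0) (s'.mem 1) (s'.mem 2) (s'.mem 3)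
            (s'.reg 0) (s'.reg 62)) ?_ ?_ ?_ ?_) fun s' ha hB' => ?_)
    · exact ⟨0, by omega, by simp [h60], by simpa using hB⟩
    · simp
    · rintro r s' ha ⟨t, ht, h61, hB'⟩
      have f60 : s'.reg 60 = i := (ha.1 60 (by decide)).trans (by simp [h60])
      have f32 : s'.mem 32 = s.mem 32 := (ha.2 32 (by decide)).trans (by simp)
      have f33 : s'.mem 33 = s.mem 33 := (ha.2 33 (by decide)).trans (by simp)
      have f27 : s'.mem 27 = s.mem 27 := (ha.2 27 (by decide)).trans (by simp)
      have hch := hs.1.ch_eq hgi (k := t) (by omega)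
      refine ⟨by simp [f60, f32, h61, hoff]; omega, Runs.of_loopFree rfl (by decide) (by simp)
        ⟨t + 1, by omega, by simp [h61]; omega, ?_⟩⟩
      have := hB'.push (s.mem 27 gi.kids[t])
      rw [← List.take_append_getElem (by omega : t < gi.kids.length), List.map_append, List.map_singleton]
      simpa [f27, f33, h61, hch] using this
    · rintro s' ha ⟨t, ht, h61, hB'⟩
      have f60 : s'.reg 60 = i := (ha.1 60 (by decide)).trans (by simp [h60])
      have f32 : s'.mem 32 = s.mem 32 := (ha.2 32 (by decide)).trans (by simp)
      obtain rfl : t = gi.kids.length := by omega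
      rw [List.take_length] at hB'
      exact ⟨by simp [f60, f32, h61, hoff], hB'⟩
    · have f60 : s'.reg 60 = i := (ha.1 60 (by decide)).trans (by simp [h60])
      have f0 : s'.reg 0 = s.reg 0 := (ha.1 0 (by decide)).trans (by simp)
      have f30 : s'.mem 30 = s.mem 30 := (ha.2 30 (by decide)).trans (by simp)
      have f31 : s'.mem 31 = s.mem 31 := (ha.2 31 (by decide)).trans (by simp)
      have f27 : s'.mem 27 = s.mem 27 := (ha.2 27 (by decide)).trans (by simp)
      obtain ⟨hty, hx⟩ := hs.1.ty_eq hgi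
      refine Runs.of_loopFree rfl (by decide) (by simp) 
        ⟨L2 ++ [{ gi with kids := gi.kids.map (s.mem 27) }], ?_, ?_⟩
      · have := hB'.close gi.ty gi.x gi.vars gi.val
        simpa [f60, f0, f30, f31, hty, hx] using this
      · have := hR.snoc hs.2 hgi (hkids gi hm hgi) hm
        simpa [f60, f0, f27, hreg0] using this
  · have hm : mark i = 0 := by simpa [h60, h26] using hc
    exact Runs.of_loopFree rfl (by simp [RamProg.time]; omega) (by simp) ⟨L2, by simpa using hB,
      by simpa using hR.skip hm⟩
  · rintro s' ha ⟨L3, h1, h2⟩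
    have f60 : s'.reg 60 = i := (ha.1 60 (by decide)).trans (by simp [h60])
    exact Runs.of_loopFree rfl (by decide) (by simp) ⟨by simp [f60], L3, by simpa using h1,
      by simpa using h2⟩

theorem renumber_spec {n g : ℕ} {D : Prop} {L : List (PGate n)} {s : RamState} {V : ℕ}
    (hs : s.Holds D L) (hgL : g < L.length) (h63 : s.reg 63 = g) (hM : Marked L g 0 (s.mem 26))
    (h2 : s.mem 2 0 = 0) :
    Runs V renumber s (40 * s.reg 25 + 90 * s.reg 24 + 50) fun s' => ∃ L2 id,
      Built L2 [] (s'.mem 0) (s'.mem 1) (s'.mem 2) (s'.mem 3) (s'.reg 0) (s'.reg 62) ∧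
        Renumbered D L L2 (s.mem 26) id (g + 1) ∧ s'.reg 1 + 1 = s'.reg 0 := by
  have hsum := hs.1.sum_cost 40 86 (k := g + 1) hgL
  -- `Runs.count_sum` indexes the rounds by how many are left, whereas the gates are treated in
  -- increasing order.
  rw [← Finset.sum_range_reflect] at hsum
  have hle := hs.1.off_le (i := g + 1) hgL
  have hgc := hs.1.gc_eq
  refine (Runs.step_seq (T := 20) rfl (by decide) (by simp) (Runs.seq (Runs.count_sum
    (e := .op .lt (.reg 60) (.op .add (.reg 63) (.const 1))) (k := g + 1)
    (fun k => 40 * (s.mem 32 (g + 1 - 1 - k + 1) - s.mem 32 (g + 1 - 1 - k)) + 80)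
    (fun k s' => ∃ i, i + k = g + 1 ∧ s'.reg 60 = i ∧ ∃ L2,
      Built L2 [] (s'.mem 0) (s'.mem 1) (s'.mem 2) (s'.mem 3) (s'.reg 0) (s'.reg 62) ∧
        Renumbered D L L2 (s.mem 26) (s'.mem 27) i)
    (Q := fun s' => ∃ L2,
      Built L2 [] (s'.mem 0) (s'.mem 1) (s'.mem 2) (s'.mem 3) (s'.reg 0) (s'.reg 62) ∧
        Renumbered D L L2 (s.mem 26) (s'.mem 27) (g + 1))
    ?_ ?_ ?_ ?_) (T' := 8) ?_)).mono ?_ fun s' _ h => h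
  · refine ⟨0, by omega, by simp, [], ⟨by simp, ?_, ?_, ?_, ?_, by simp⟩, ?_, ?_, ?_, ?_⟩
    · intro i hi
      simp at hi
    · intro i hi
      simp at hi
    · simp [h2]
    · intro i hi
      simp at hi
    · intro i gi hi
      simp at hi
    · intro j gj hj
      omega
    · intro j j' hj hj'
      omega
    · intro k hk
      simp at hk
  · simp
  · rintro k s' ha ⟨i, hik, h60, L2, hB, hR⟩
    have f63 : s'.reg 63 = g := (ha.1 63 (by decide)).trans (by simp [h63])
    have f26 : s'.mem 26 = s.mem 26 := (ha.2 26 (by decide)).trans (by simp)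
    have f32 : s'.mem 32 = s.mem 32 := (ha.2 32 (by decide)).trans (by simp)
    have hs' : s'.Holds D L := ha.holds (hs.congr rfl rfl rfl rfl rfl rfl) (by decide) (by decide)
    obtain rfl : i = g + 1 - 1 - k := by omega
    refine ⟨by simp [h60, f63], (renumberGate_spec hs' (by omega) h60 f26
      (fun gi hm hgi => hM.kids _ gi (Nat.zero_le _) hm hgi) hB hR).mono (by rw [f32]) ?_⟩
    rintro s'' ha'' ⟨h1, h2⟩
    exact ⟨_, by omega, h1, h2⟩
  · rintro s' ha ⟨i, hik, h60, L2, hB, hR⟩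
    have f63 : s'.reg 63 = g := (ha.1 63 (by decide)).trans (by simp [h63])
    obtain rfl : i = g + 1 := by omega
    exact ⟨by simp [h60, f63], L2, hB, hR⟩
  · rintro s' ha ⟨L2, hB, hR⟩
    have h1 := hB.gc_eq
    have h3 := (hR.eqs hgL (Nat.lt_succ_self g) hM.root).1
    refine Runs.of_loopFree rfl (by decide) (by simp) ⟨L2, _, by simpa using hB, hR, ?_⟩
    simp
    omega
  · simp only [RamExp.cost]
    rw [show ∑ k ∈ Finset.range (g + 1), (40 * (s.mem 32 (g + 1 - 1 - k + 1) - s.mem 32 (g + 1 - 1 - k)) +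
      80 + (1 + (1 + 1 + 1) + 1) + 1) = _ from hsum]
    omega

/-! ### The algorithm -/

/-- Register 4 is set to a number larger than all positions. -/
def setBig : RamProg :=
  (.assign 4 (.const 8) ;; .assign 5 (.reg 2)) ;;
  .while (.reg 5)
    (.assign 4 (.op .add (.reg 4) (.const 4)) ;; .assign 5 (.op .sub (.reg 5) (.const 1)))

/-- The gaps at the edges of the circuit are determined. -/
def analyse : RamProg := traverse ;; setBig ;; topoSort ;; hulls ;; gaps

/-- The gates for the gaps are constructed. -/
def prepare : RamProg :=
  powers ;; leafGates ;; heapGates ;; forest ;; meetTable ;; .assign 8 (.load 2 (.reg 0)) ;; buckets ;;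
  fillGaps

def smoothen : RamProg := analyse ;; prepare ;; build

def prune : RamProg := markGates ;; renumber

theorem Circuit.StoredIn.of_agree {n : ℕ} {C : Circuit n} {p : RamProg} {s s' : RamState}
    (h : C.StoredIn s) (ha : p.Agree s s') (hr : 0 ∉ p.regs ∧ 1 ∉ p.regs)
    (hb : 0 ∉ p.banks ∧ 1 ∉ p.banks ∧ 2 ∉ p.banks ∧ 3 ∉ p.banks) : C.StoredIn s' := by
  rw [Circuit.StoredIn, ha.1 0 hr.1, ha.1 1 hr.2, ha.2 0 hb.1, ha.2 1 hb.2.1, ha.2 2 hb.2.2.1,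
    ha.2 3 hb.2.2.2]
  exact h

theorem setBig_spec {n : ℕ} {s : RamState} {V : ℕ} (r2 : s.reg 2 = n) :
    Runs V setBig s (20 * n + 30) fun s' => s'.reg 4 = 4 * n + 8 := by
  refine (Runs.step_seq (T := 8) rfl (by decide) (by simp) (Runs.count (e := .reg 5) 10
    (fun k s' => s'.reg 5 = k ∧ s'.reg 4 + 4 * k = 4 * n + 8) n ?_ ?_ ?_ ?_)).mono ?_ fun s' _ h => h
  · simp [r2]
    omega
  · simp
  · rintro k s' ha ⟨h5, h4⟩
    exact ⟨by simp [h5], Runs.of_loopFree rfl (by decide) (by simp) (by simp [h5]; omega)⟩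
  · rintro s' ha ⟨h5, h4⟩
    exact ⟨by simp [h5], by omega⟩
  · simp only [RamExp.cost]
    omega

/-- The registers that count gates and edges are bounded by the running time. This yields the size
of the constructed list without a separate count. -/
theorem Runs.bdd {V κ c T : ℕ} {p : RamProg} {s : RamState} {Q : RamState → Prop} (h : Runs V p s T Q)
    (hp : p.Safe κ c) (hs : s.Bdd V) : Runs V p s T fun s' => Q s' ∧ s'.Bdd (V + κ * T) := by
  obtain ⟨t, s', h1, h2, h3⟩ := h
  exact ⟨t, s', h1, h2, h3, ((h1.ramRun hp V le_rfl hs (Nat.lt_succ_self _)).2).mono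
    (Nat.add_le_add_left (Nat.mul_le_mul_left κ h2) V)⟩

theorem IsInputState.bdd {n : ℕ} {C : Circuit n} {T : VTree n} {s : RamState} (h : IsInputState C T s)
    (hn : n ≤ C.size) : s.Bdd (4 * C.size + 8) := by
  obtain ⟨hC, h2, hT, hr, hm⟩ := h
  refine ⟨fun x => ?_, fun b hb i => by simp [hm b hb i]⟩
  have hN := C.N_le
  have hroot := C.root.2
  by_cases hx : 4 ≤ x
  · simp [hr x hx]
  · have h3 : s.reg 3 < 2 * n - 1 := by
      cases T <;> exact hT.1
    have h0 := hC.1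
    have h1 := hC.2.1
    interval_cases x <;> omega

/-- The results of the analysis of a circuit. -/
structure Circuit.Analysed {n : ℕ} (C : Circuit n) (T : VTree n) (pos lo hi : ℕ → ℕ) (s : RamState) :
    Prop where
  stored : C.StoredIn s
  r2 : s.reg 2 = n
  r4 : s.reg 4 = 4 * n + 8
  pos_eq : s.mem 7 = pos
  positions : T.Positions pos
  topo : C.TopoOrder (s.mem 10)
  hull : ∀ p : Fin C.N, HullOf pos (C.vars p) (lo p) (hi p)
  gaps : ∀ e < C.size, C.EdgeGaps pos (s.mem 2) (s.mem 3) lo hi e (s.mem 13 (2 * e + 1))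
    (s.mem 14 (2 * e + 1)) (s.mem 13 (2 * e + 2)) (s.mem 14 (2 * e + 2))

theorem analyse_spec {n : ℕ} {C : Circuit n} {T : VTree n} (hT : T.IsVTree) (hR : C.Respects T)
    (hm : n ≤ C.size) {s : RamState} (hs : IsInputState C T s) {V : ℕ} (hV : 4 * C.size + 8 ≤ V) :
    Runs V analyse s (3000 * C.size) fun s' => ∃ pos lo hi, C.Analysed T pos lo hi s' := by
  obtain ⟨hC, h2, hst, hr, hb⟩ := hs
  have hn := hT.pos
  refine (Runs.seq (traverse_spec hT hst (by omega)) fun s₁ a₁ hpos => Runs.seq (setBig_spec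
    ((a₁.1 2 (by decide)).trans h2)) fun s₂ a₂ h4 => ?_).mono (T := 100 * n + (20 * n + 30 +
      (250 * (C.size + 1) + (150 * (C.size + 1) + 300 * (C.size + 1))))) (by omega) fun s' _ h => h
  have hC₂ := (hC.of_agree a₁ (by decide) (by decide)).of_agree a₂ (by decide) (by decide)
  have f2 : s₂.reg 2 = n := (a₂.1 2 (by decide)).trans ((a₁.1 2 (by decide)).trans h2)
  have f9 : s₂.mem 9 = s.mem 9 := (a₂.2 9 (by decide)).trans (a₁.2 9 (by decide))
  have f7 : s₂.mem 7 = s₁.mem 7 := a₂.2 7 (by decide)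
  generalize s₁.mem 7 = pos at hpos f7
  refine Runs.seq (topoSort_spec hC₂ (fun i => by rw [f9, hb 9 (by omega)]) (by omega))
    fun s₃ a₃ hord => ?_
  have hC₃ := hC₂.of_agree a₃ (by decide) (by decide)
  refine Runs.seq (hulls_spec (fun x => (hpos.pos_le hT x).2) hord hC₃ (by omega) (by omega)
    ((a₃.2 7 (by decide)).trans f7) rfl ((a₃.1 2 (by decide)).trans f2)) fun s₄ a₄ hhull => ?_
  have hC₄ := hC₃.of_agree a₄ (by decide) (by decide)
  refine (gaps_spec (hpos.pos_le hT) (hR.separated hpos) hC₄ (by omega) rfl rfl hhull).mono le_rfl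
    fun s₅ a₅ hgaps => ⟨pos, s₄.mem 11, s₄.mem 12, ?_⟩
  refine ⟨hC₄.of_agree a₅ (by decide) (by decide), ?_, ?_, ?_, hpos, ?_, hhull, ?_⟩
  · exact (a₅.1 2 (by decide)).trans ((a₄.1 2 (by decide)).trans ((a₃.1 2 (by decide)).trans f2))
  · exact (a₅.1 4 (by decide)).trans ((a₄.1 4 (by decide)).trans ((a₃.1 4 (by decide)).trans h4))
  · exact (a₅.2 7 (by decide)).trans ((a₄.2 7 (by decide)).trans ((a₃.2 7 (by decide)).trans f7))
  · rw [a₅.2 10 (by decide), a₄.2 10 (by decide)]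
    exact hord
  · rw [a₅.2 2 (by decide), a₅.2 3 (by decide)]
    exact hgaps

theorem exists_edge_of_query {m g : ℕ} (h1 : 1 ≤ g) (h2 : g ≤ 2 * m) :
    ∃ e < m, g = 2 * e + 1 ∨ g = 2 * e + 2 :=
  ⟨(g - 1) / 2, by omega, by omega⟩

/-- A bound of the time in terms of the inverse Ackermann function. -/
theorem prepare_time_le {m n h α F : ℕ} (hn : 1 ≤ n) (hm : n ≤ m) (hα : 1 ≤ α)
    (hh : 2 ^ h ≤ 2 * (n + 1))
    (hF : F ≤ (α + 1 + 2) * (2 ^ (h + 1) * (4 * ((m + n - 1) / n) + 2))) :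
    30 * n + 150 + (100 * n + 150 + (100 * 2 ^ h + (100 * 2 ^ (h + 1) +
      (70 * (2 ^ ((h + 1) / 2) * 2 ^ ((h + 1) / 2)) + 70 + (3 + (250 * (m + 1) +
      (200 * F + 2 * m * (400 * (α + 1 + 4)) + 30 * h + 100))))))) ≤ 100000 * (m * α) := by
  have h1 : 2 ^ ((h + 1) / 2) * 2 ^ ((h + 1) / 2) ≤ 2 * 2 ^ h := by
    rw [← pow_add, ← pow_succ']
    exact Nat.pow_le_pow_right (by norm_num) (by omega)
  have h2 : h < 2 ^ h := Nat.lt_two_pow_self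
  have h3 : n * ((m + n - 1) / n) ≤ m + n - 1 := Nat.mul_div_le _ _
  -- The tree has O(n) nodes, and n⌈m/n⌉ is at most m + n - 1. So q = 4⌈m/n⌉ keeps the potential per
  -- level at O(m).
  have h4 : 2 ^ (h + 1) * (4 * ((m + n - 1) / n) + 2) ≤ 80 * m := by
    rw [pow_succ]
    calc _ ≤ (8 * n) * (4 * ((m + n - 1) / n) + 2) := Nat.mul_le_mul_right _ (by omega)
      _ = 32 * (n * ((m + n - 1) / n)) + 16 * n := by ring
      _ ≤ 80 * m := by omega
  have h5 : (α + 1 + 2) * (2 ^ (h + 1) * (4 * ((m + n - 1) / n) + 2)) ≤ 80 * (m * α) + 240 * m :=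
    (Nat.mul_le_mul_left _ h4).trans (by ring_nf; omega)
  have h6 : m ≤ m * α := Nat.le_mul_of_pos_right _ hα
  have h7 : 2 * m * (400 * (α + 1 + 4)) = 800 * (m * α) + 4000 * m := by ring
  rw [pow_succ]
  omega

theorem prepare_spec {n : ℕ} {C : Circuit n} {T : VTree n} (hT : T.IsVTree) (hm : n ≤ C.size)
    {pos lo hi : ℕ → ℕ} {s : RamState} (hs : C.Analysed T pos lo hi s) (h17 : ∀ i, s.mem 17 i = 0)
    (h21 : ∀ i, s.mem 21 i = 0) (h32 : s.mem 32 0 = 0) {V : ℕ} (hV : 4 * C.size + 8 ≤ V) :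
    Runs V prepare s (100000 * (C.size * invAckermann C.size n)) fun s' =>
      C.Analysed T pos lo hi s' ∧ ∃ L : List (PGate n), s'.Holds C.Deterministic L ∧ ∀ g, 1 ≤ g → g ≤ 2 * C.size →
        IsProduct L (s'.mem 23 g) (posGap pos (s'.mem 13 g) (s'.mem 14 g)) := by
  have hn := hT.pos
  have hN := C.N_le
  have hlay := hs.stored.layout
  obtain ⟨hα, -, -⟩ := invAckermann_spec hn hm
  refine Runs.mono (T := 100000 * (C.size * invAckermann C.size n)) (Q := fun s' =>
    ∃ L : List (PGate n), s'.Holds C.Deterministic L ∧ ∀ g, 1 ≤ g → g ≤ 2 * C.size →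
        IsProduct L (s'.mem 23 g) (posGap pos (s.mem 13 g) (s.mem 14 g))) ?_ le_rfl ?_
  swap
  · rintro s' ha h
    refine ⟨⟨hs.stored.of_agree ha (by decide) (by decide), (ha.1 2 (by decide)).trans hs.r2,
      (ha.1 4 (by decide)).trans hs.r4, (ha.2 7 (by decide)).trans hs.pos_eq, hs.positions, ?_,
      hs.hull, ?_⟩, ?_⟩
    · rw [ha.2 10 (by decide)]
      exact hs.topo
    · rw [ha.2 2 (by decide), ha.2 3 (by decide), ha.2 13 (by decide), ha.2 14 (by decide)]
      exact hs.gaps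
    · rw [ha.2 13 (by decide), ha.2 14 (by decide)]
      exact h
  have hab : ∀ {h : ℕ}, n + 2 ≤ 2 ^ h → ∀ g, 1 ≤ g → g ≤ 2 * C.size →
      s.mem 13 g < s.mem 14 g ∧ s.mem 14 g < 2 ^ h := by
    intro h hh g h1 h2
    obtain ⟨e, he, rfl | rfl⟩ := exists_edge_of_query h1 h2
    · have := hs.gaps e he
      exact ⟨this.lt, by have := this.le; omega⟩
    · have := hs.gaps e he
      exact ⟨this.lt', by have := this.le'; omega⟩
  -- The height h is known only after `powers` has run, while the time for the rest must be fixed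
  -- before. So the rest is granted all the time that remains of the final bound.
  obtain ⟨f, hf⟩ : ∃ f, f = 100000 * (C.size * invAckermann C.size n) - (30 * n + 150) := ⟨_, rfl⟩
  have htime := fun (h F : ℕ) => prepare_time_le (h := h) (F := F) hn hm hα
  refine (Runs.seq (T' := f) (powers_spec hs.r2 hs.r4) fun s₁ a₁ ⟨h, hP⟩ => ?_).mono ?_ fun s' _ h => h
  swap
  · have := htime 0 0 (by omega) (by omega)
    omega
  refine Runs.mono (Runs.seq (leafGates_spec (pos := pos) (D := C.Deterministic) (fun x y => hs.positions.injective hT)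
    ((a₁.2 7 (by decide)).trans hs.pos_eq) ((a₁.1 2 (by decide)).trans hs.r2) hP.r19
    ((congrFun (a₁.2 32 (by decide)) 0).trans h32)
    fun i => (congrFun (a₁.2 17 (by decide)) i).trans (h17 i)) fun s₂ a₂ ⟨L₂, hL₂, _, hleaf⟩ => ?_)
    (T := 100 * n + 150 + (100 * 2 ^ h + (100 * 2 ^ (h + 1) +
      (70 * (2 ^ ((h + 1) / 2) * 2 ^ ((h + 1) / 2)) + 70 + (3 + (250 * (C.size + 1) +
      (200 * ((invAckermann C.size n + 1 + 2) *
        (2 ^ (h + 1) * (4 * ((C.size + n - 1) / n) + 2))) +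
        2 * C.size * (400 * (invAckermann C.size n + 1 + 4)) + 30 * h + 100))))))) ?_ fun s' _ h => h
  swap
  · have := htime h _ hP.lt le_rfl
    omega
  have hP₂ := hP.of_agree a₂ (by decide) (by decide)
  refine Runs.seq (heapGates_spec hP₂.r19 hL₂ hleaf) fun s₃ a₃ ⟨L₃, _, hL₃, hfull⟩ => ?_
  have hP₃ := hP₂.of_agree a₃ (by decide) (by decide)
  refine Runs.seq (forest_spec hP₃.r19 hfull) fun s₄ a₄ hF => ?_
  have hP₄ := hP₃.of_agree a₄ (by decide) (by decide)
  refine Runs.seq (meetTable_spec Nat.one_le_two_pow hP₄.r29) fun s₅ a₅ h16 => ?_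
  have hP₅ := hP₄.of_agree a₅ (by decide) (by decide)
  have a₀ : (powers ;; leafGates ;; heapGates ;; forest ;; meetTable).Agree s s₅ :=
    ((((a₁.of_subset (by decide) (by decide)).trans (a₂.of_subset (by decide) (by decide))).trans
      (a₃.of_subset (by decide) (by decide))).trans (a₄.of_subset (by decide) (by decide))).trans
      (a₅.of_subset (by decide) (by decide))
  have hC₅ : C.StoredIn s₅ := hs.stored.of_agree a₀ (by decide) (by decide)
  have hL₅ : s₅.Holds C.Deterministic L₃ := a₅.holds (a₄.holds hL₃ (by decide) (by decide)) (by decide)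
    (by decide)
  have hF₅ : ForestInv L₃ pos h 0 (s₅.mem 18) (s₅.mem 19) (s₅.mem 20) := by
    rw [a₅.2 18 (by decide), a₅.2 19 (by decide), a₅.2 20 (by decide)]
    exact hF
  have hoff : s₅.mem 2 C.N = C.size := hC₅.layout.off_last
  refine Runs.step_seq (T := 3) rfl (by decide) (by simp [hC₅.1, hoff]; omega) ?_
  refine Runs.seq (buckets_spec (n := n) (h := h) (M := C.size) (qa := s.mem 13) (qb := s.mem 14)
    ⟨hP₅.r19, hP₅.r28, hP₅.r45, hP₅.r29, hP₅.m15, hP₅.le, hP₅.lt⟩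
    ((a₀.1 4 (by decide)).trans hs.r4) (by simp [hC₅.1, hoff]) h16 (a₀.2 13 (by decide))
    (a₀.2 14 (by decide)) (fun q h1 h2 => ?_) fun i => (congrFun (a₀.2 21 (by decide)) i).trans (h21 i))
    fun s₆ a₆ hB => ?_
  · have := hab hP.le q h1 h2
    omega
  have hP₆ : PowersOK n h s₆ := PowersOK.of_agree (s := RamProg.step (.assign 8 (.load 2 (.reg 0))) s₅)
    ⟨hP₅.r19, hP₅.r28, hP₅.r45, hP₅.r29, hP₅.m15, hP₅.le, hP₅.lt⟩ a₆ (by decide) (by decide)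
  refine (fillGaps_spec (pos := pos) (D := C.Deterministic) (L := L₃) (qa := s.mem 13) (qb := s.mem 14)
    hP₆ (a₆.holds (hL₅.congr rfl rfl rfl rfl rfl rfl) (by decide) (by decide))
    ((a₆.1 4 (by decide)).trans ((a₀.1 4 (by decide)).trans hs.r4))
    ((a₆.2 13 (by decide)).trans (a₀.2 13 (by decide)))
    ((a₆.2 14 (by decide)).trans (a₀.2 14 (by decide))) (hab hP.le) (four_le_quotient hn hm)
    (lt_tarjanA_invAckermann hn hm (by have := hP.lt; omega)) hB ?_).mono ?_ ?_
  · rw [a₆.2 18 (by decide), a₆.2 19 (by decide), a₆.2 20 (by decide)]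
    exact hF₅
  · have := forestPot_le (invAckermann C.size n + 1) (4 * ((C.size + n - 1) / n)) h (s₆.mem 18)
    omega
  · rintro s₇ _ ⟨L', _, h1, h2⟩
    exact ⟨L', h1, h2⟩

theorem smoothen_spec {n : ℕ} {C : Circuit n} {T : VTree n} (hT : T.IsVTree) (hR : C.Respects T)
    (hm : n ≤ C.size) {s : RamState} (hs : IsInputState C T s) {V : ℕ} (hV : 4 * C.size + 8 ≤ V) :
    Runs V smoothen s (105000 * (C.size * invAckermann C.size n)) fun s' => ∃ pos lo hi L,
      T.Positions pos ∧ (∀ p : Fin C.N, HullOf pos (C.vars p) (lo p) (hi p)) ∧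
        s'.Holds C.Deterministic L ∧ C.IsCopy pos lo hi L (s'.mem 25 C.root) C.root := by
  have hn := hT.pos
  have hα : C.size ≤ C.size * invAckermann C.size n :=
    Nat.le_mul_of_pos_right _ (invAckermann_spec hn hm).1
  refine (Runs.seq (analyse_spec hT hR hm hs hV) fun s₁ a₁ ⟨pos, lo, hi, h₁⟩ => Runs.seq
    (prepare_spec hT hm h₁ (fun i => ?_) (fun i => ?_) ?_ hV) fun s₂ a₂ ⟨h₂, L, hL, hfill⟩ =>
    (build_spec (fun x y => h₂.positions.injective hT) (hR.separated h₂.positions) h₂.hull h₂.topo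
      h₂.stored (by omega) (by omega) hL rfl h₂.gaps hfill).mono le_rfl
      fun s₃ a₃ ⟨L', _, h3, h4⟩ => ⟨pos, lo, hi, L', h₂.positions, h₂.hull, h3, h4⟩).mono
      (by omega) fun s' _ h => h
  · rw [a₁.2 17 (by decide), hs.2.2.2.2 17 (by omega)]
  · rw [a₁.2 21 (by decide), hs.2.2.2.2 21 (by omega)]
  · rw [a₁.2 32 (by decide), hs.2.2.2.2 32 (by omega)]

theorem prune_spec {n : ℕ} {C : Circuit n} {pos lo hi : ℕ → ℕ} {L : List (PGate n)} {s : RamState}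
    {V : ℕ} (hs : s.Holds C.Deterministic L) (h1 : s.reg 1 = C.root)
    (hroot : C.IsCopy pos lo hi L (s.mem 25 C.root) C.root) (h2 : s.mem 2 0 = 0)
    (h26 : ∀ i, s.mem 26 i = 0) :
    Runs V prune s (70 * s.reg 25 + 160 * s.reg 24 + 100) fun s' => ∃ D : Circuit n, D.StoredIn s' ∧
      D.Equivalent C ∧ D.Smooth ∧ D.Decomposable ∧ (C.Deterministic → D.Deterministic) := by
  refine (Runs.seq (markGates_spec hs (by rw [h1]) hroot.1 h26) fun s₁ a₁ ⟨h63, hM⟩ =>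
    (renumber_spec (a₁.holds hs (by decide) (by decide)) hroot.1 h63 hM
      ((congrFun (a₁.2 2 (by decide)) 0).trans h2)).mono (le_of_eq ?_) ?_).mono
      (T := 30 * s.reg 25 + 62 * s.reg 24 + 50 + (40 * s.reg 25 + 90 * s.reg 24 + 50)) (by omega)
      fun s' _ h => h
  · rw [a₁.1 24 (by decide), a₁.1 25 (by decide)]
  · rintro s₂ _ ⟨L₂, id, hB, hren, hlast⟩
    have hid := hren.id_root hM hroot.1
    obtain ⟨D, hD⟩ := exists_ofList hren.valid (List.length_pos_iff.1 (by omega))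
      (hren.exists_parent hM hroot.1)
    have hr := hD.root_eq
    refine ⟨D, hD.storedIn hB hlast, fun a => ?_, hD.smooth hren.valid, hD.decomposable hren.valid,
      hD.deterministic hren.valid⟩
    rw [hD.sat_iff hren.valid, ← hroot.2.2 a,
      ← (hren.eqs hroot.1 (Nat.lt_succ_self _) hM.root).2.2,
      show (D.root : ℕ) = id (s.mem 25 C.root) by omega]

theorem pow_lt_pow_mul_succ {x b e c : ℕ} (hb : 2 ≤ b) (hx : x ≤ b ^ e) : x ^ c < b ^ (e * c + 1) :=
  calc x ^ c ≤ (b ^ e) ^ c := Nat.pow_le_pow_left hx _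
    _ = b ^ (e * c) := (pow_mul _ _ _).symm
    _ < b ^ (e * c + 1) := Nat.pow_lt_pow_right hb (Nat.lt_succ_self _)

/-- The increment 8 is due to the constant assigned at the start of `setBig`, and 20 bounds the cost
of every expression in the program. -/
theorem safe_smoothen_prune : (smoothen ;; prune).Safe 8 20 = true := by decide

theorem theorem2 :
    ∃ (P : RamProg) (K d : ℕ), ∀ (n : ℕ) (C : Circuit n) (T : VTree n),
      T.IsVTree → C.Respects T → n ≤ C.size →
      ∀ s : RamState, IsInputState C T s →
        ∃ (t : ℕ) (s' : RamState) (D : Circuit n),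
          RamRun ((C.size + 2) ^ d) P s t s' ∧
          t ≤ K * (C.size * invAckermann C.size n) ∧
          D.StoredIn s' ∧
          D.Equivalent C ∧ D.Smooth ∧ D.Decomposable ∧
          (C.Deterministic → D.Deterministic) := by
  -- All values stay below the 20th power of a number that is at most (m+2)^34, and one more factor
  -- makes the inequality strict. The constant 2^28 exceeds 105000 + 200000000.
  refine ⟨smoothen ;; prune, 2 ^ 28, 34 * 20 + 1, fun n C T hT hR hm s hs => ?_⟩
  have hb := hs.bdd hm
  obtain ⟨hα, -, hαn⟩ := invAckermann_spec hT.pos hm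
  have hα' : C.size ≤ C.size * invAckermann C.size n := Nat.le_mul_of_pos_right _ hα
  have hn := hT.pos
  obtain ⟨t, s', hx, ht, D, hD, h1, h2, h3, h4⟩ : Runs (4 * C.size + 8) (smoothen ;; prune) s
      (2 ^ 28 * (C.size * invAckermann C.size n)) fun s' => ∃ D : Circuit n, D.StoredIn s' ∧
      D.Equivalent C ∧ D.Smooth ∧ D.Decomposable ∧ (C.Deterministic → D.Deterministic) := by
    refine (Runs.seq ((smoothen_spec hT hR hm hs le_rfl).bdd (κ := 8) (c := 20) (by decide) hb)
      (T' := 200000000 * (C.size * invAckermann C.size n)) ?_).mono (by omega) fun s' _ h => h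
    rintro s₁ a₁ ⟨⟨pos, lo, hi, L, -, -, hL, hcopy⟩, hb₁⟩
    have hC₁ := hs.1.of_agree a₁ (by decide) (by decide)
    refine (prune_spec hL hC₁.2.1 hcopy hC₁.layout.off_zero fun i => by
      rw [a₁.2 26 (by decide), hs.2.2.2.2 26 (by omega)]).mono ?_ fun s' _ h => h
    -- Registers 24 and 25 hold the numbers of gates and edges to be pruned. They are O(m α) because
    -- values grow by at most 8 per unit of time.
    have := hb₁.1 24
    have := hb₁.1 25
    omega
  refine ⟨t, s', D, (hx.ramRun safe_smoothen_prune _ le_rfl hb ?_).1, ht, hD, h1, h2, h3, h4⟩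
  have h5 : C.size * invAckermann C.size n ≤ C.size * C.size := Nat.mul_le_mul_left _ (hαn.trans hm)
  -- As α(m,n) ≤ n ≤ m, the time is at most 2^28 m². The factor 2^32 is absorbed by (m+2)^32.
  have h6 : 4 * C.size + 8 + 8 * t + 8 + 2 ≤ (C.size + 2) ^ 34 := by
    calc _ ≤ 2 ^ 32 * (C.size + 2) ^ 2 := by nlinarith
      _ ≤ (C.size + 2) ^ 32 * (C.size + 2) ^ 2 :=
        Nat.mul_le_mul_right _ (Nat.pow_le_pow_left (by omega) _)
      _ = (C.size + 2) ^ 34 := by rw [← pow_add]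
  exact pow_lt_pow_mul_succ (by omega) h6
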